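/- Let $d\ge 4$ and consider $d$-dimensional Minkowski spacetime with inertial coordinates $(t,x)\in\mathbb R\times\mathbb R^{d-1}$, metric $\eta=-dt^2+\sum_i (dx^i)^2$, $r=|x|$, $u=t-r$ and $\omega=x/r\in S^{d-2}$. A neighbourhood of null infinity is an open set $U$ such that for each $T$ there is an $R$ for which all points with $|u|\le T$, $r\ge R$ lie in $U$. An expansion $f\sim\sum_n r^{-n}f^{(n)}(u,\omega)$ is understood as an asymptotic one as $r\to\infty$: the coefficients $f^{(n)}$ are smooth on $\mathbb R\times S^{d-2}$ and, for each $s\in\frac12\mathbb N$, the remainder $f-\sum_{n<s}r^{-n}f^{(n)}$ and all its derivatives in $u$ and along the sphere are $O(r^{-s})$, and $k$ further derivatives in $r$ (at fixed $u,\omega$) improve this to $O(r^{-s-k})$, uniformly for $\omega\in S^{d-2}$ and $u$ in bounded intervals. Covector fields are expanded through their components in the inertial frame (equivalently, in the normalized frame adapted to $(u,r,\omega)$). Let $A_a$ be a smooth vector potential on a neighbourhood $U$ of null infinity that satisfies there Maxwell's equations $$\Box A_a-\partial_a\partial^bA_b=-4\pi j_a,\qquad \partial^a j_a=0 .$$ A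 covector field satisfies the *ansatz* if it has an expansion $$A_a\sim\sum_{n\in d/2-1+\mathbb N}\frac{1}{r^n}A_a^{(n)}(u,\omega)\quad(d\text{ even}),\qquad A_a\sim\sum_{n\in d/2-1+\mathbb N}\frac{1}{r^n}A_a^{(n)}(u,\omega)+\sum_{p\in d-3+\mathbb N}\frac{1}{r^p}\tilde A_a^{(p)}(u,\omega)\quad(d\text{ odd}),$$ with $\mathbb N=\{0,1,2,\dots\}$. Suppose that in some gauge $A_a$ satisfies the ansatz, i.e. $A_a-\partial_a\chi$ satisfies it for some smooth function $\chi$ on $U$; that $j_a\sim\sum_{n\in d-2+\mathbb N}r^{-n}j_a^{(n)}(u,\omega)$; and that $j_a^{(d-2)}(u,\omega)\to0$ as $u\to-\infty$ for each $\omega$. We say that the Lorenz gauge can be imposed within the ansatz if there are a neighbourhood $V\subseteq U$ of null infinity and a smooth function $\varphi$ on $V$ such that $A'_a=A_a-\partial_a\varphi$ satisfies $\partial^aA'_a=0$ on $V$ as well as the ansatz. 1. If $d>4$, the Lorenz gauge can be imposed within the ansatz. 2. If $d=4$, the Lorenz gauge can be imposed within the ansatz if and only if $j_u^{(2)}(u,\omega)=0$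 for all $u\in\mathbb R$, $\omega\in S^2$ (there is no flux of charge to null infinity), where $j_u=j(\partial/\partial u)$ is the $u$-component of $j_a$ in the coordinates $(u,r,\omega)$. -/

import Mathlib

open scoped ContDiff

noncomputable section

namespace Lorenz

/-- Physical space `ℝ^(d-1)` with its Euclidean norm. -/
abbrev Space (d : ℕ) : Type := EuclideanSpace ℝ (Fin (d - 1))

/-- `d`-dimensional Minkowski spacetime in global inertial coordinates `(t, x)`; the metric
`-dt² + ∑ dxᵢ²` enters through `divergence` and `box` below. -/
abbrev Spacetime (d : ℕ) : Type := ℝ × Space d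

/-- Covectors. Their components in the inertial (constant) frame have the same orders in `1/r`
as the components in the normalized frame of the coordinates `(u, r, x^A)`, because the change
of frame only involves smooth functions of the direction. -/
abbrev Covector (d : ℕ) : Type := Spacetime d →L[ℝ] ℝ

/-- The coordinate vector `∂/∂t`. It is also the vector `∂/∂u` of the coordinates `(u, r, x^A)`,
`u = t - r`. -/
def timeVec (d : ℕ) : Spacetime d := (1, 0)

/-- The coordinate vector `∂/∂xᵢ`. -/
def spaceVec (d : ℕ) (i : Fin (d - 1)) : Spacetime d := (0, EuclideanSpace.single i 1)

/-- Derivative of `f` along the constant vector `v`. -/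
def pderiv {d : ℕ} {F : Type*} [NormedAddCommGroup F] [NormedSpace ℝ F]
    (v : Spacetime d) (f : Spacetime d → F) : Spacetime d → F :=
  fun x => fderiv ℝ f x v

/-- The wave operator `□ = η^{ab} ∂_a ∂_b`; on covector fields it acts on inertial components. -/
def box {d : ℕ} {F : Type*} [NormedAddCommGroup F] [NormedSpace ℝ F]
    (f : Spacetime d → F) (x : Spacetime d) : F :=
  -pderiv (timeVec d) (pderiv (timeVec d) f) x
    + ∑ i, pderiv (spaceVec d i) (pderiv (spaceVec d i) f) x

/-- The divergence `∂^a A_a = η^{ab} ∂_a A_b` of a covector field. -/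
def divergence {d : ℕ} (A : Spacetime d → Covector d) (x : Spacetime d) : ℝ :=
  -(pderiv (timeVec d) A x (timeVec d)) + ∑ i, pderiv (spaceVec d i) A x (spaceVec d i)

/-- Maxwell's equations `□ A_a - ∂_a ∂^b A_b = -4π j_a` with conserved current `∂^a j_a = 0`
on the set `U`. -/
def IsMaxwellOn {d : ℕ} (U : Set (Spacetime d)) (A j : Spacetime d → Covector d) : Prop :=
  (∀ x ∈ U, box A x - fderiv ℝ (divergence A) x = -(4 * Real.pi) • j x) ∧
    ∀ x ∈ U, divergence j x = 0

/-- The direction `y / |y|`. -/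
def dir {d : ℕ} (y : Space d) : Space d := ‖y‖⁻¹ • y

/-- The spacetime point with retarded time `u = t - r`, radius `r` (for `0 < r`) and
direction `y / |y|`. -/
def point {d : ℕ} (u r : ℝ) (y : Space d) : Spacetime d := (u + r, r • dir y)

/-- `U` is an open neighbourhood of future null infinity: `r → ∞` at retarded time in a bounded
interval ends up in `U`, uniformly in the direction. -/
def IsNhdScri {d : ℕ} (U : Set (Spacetime d)) : Prop :=
  IsOpen U ∧ ∀ T : ℝ, ∃ R : ℝ, ∀ u r : ℝ, ∀ θ : Space d,
    |u| ≤ T → R ≤ r → ‖θ‖ = 1 → point u r θ ∈ U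

/-- The asymptotic expansion `f ∼ ∑ k, r^(-k/2) c_k(u, θ)` near null infinity (`θ` a unit vector;
only the values of `c k u` on the unit sphere matter). The powers are indexed by twice their
exponent, so `c k` is the coefficient usually called `f^(k/2)`.

The coefficients are smooth on `ℝ × sphere`, and for every `K` the remainder after the terms with
exponent `< K/2` is `O(r^(-K/2))`, as are all its derivatives in `u` and along the sphere, while
each `r`-derivative (at fixed `u` and direction) gains a factor `1/r`. Estimates are uniform for `u`
in bounded intervals and over the sphere. Functions of the direction are extended to nonzero vectors
`y` by homogeneity of degree `0`, so that the total derivatives in `(u, y)` at unit vectors carry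
exactly the derivatives in `u` and along the sphere. -/
def HasExpansion {d : ℕ} {F : Type*} [NormedAddCommGroup F] [NormedSpace ℝ F]
    (f : Spacetime d → F) (c : ℕ → ℝ → Space d → F) : Prop :=
  (∀ k, ContDiffOn ℝ ∞ (fun p : ℝ × Space d => c k p.1 (dir p.2)) {p | p.2 ≠ 0}) ∧
  ∀ (K m l : ℕ) (T : ℝ), ∃ C R : ℝ, 0 < R ∧ ∀ (u r : ℝ) (θ : Space d),
    |u| ≤ T → R ≤ r → ‖θ‖ = 1 →
      ‖iteratedFDeriv ℝ m (fun p : ℝ × Space d =>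
          iteratedDeriv l (fun s : ℝ => f (point p.1 s p.2)
            - ∑ k ∈ Finset.range K, s ^ (-((k : ℝ) / 2)) • c k p.1 (dir p.2)) r) (u, θ)‖
        ≤ C * r ^ (-((K : ℝ) / 2) - (l : ℝ))

/-- The only nonzero coefficients are those whose (doubled) index lies in `I`. -/
def SupportedOn {d : ℕ} {F : Type*} [NormedAddCommGroup F]
    (c : ℕ → ℝ → Space d → F) (I : Set ℕ) : Prop :=
  ∀ k, k ∉ I → ∀ (u : ℝ) (θ : Space d), ‖θ‖ = 1 → c k u θ = 0

/-- Doubled exponents allowed for the potential: `n = d/2 - 1, d/2, d/2 + 1, …` in every dimension,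
and in odd dimensions also the integers `p = d - 3, d - 2, …`. -/
def potentialOrders (d : ℕ) : Set ℕ :=
  {k | ∃ i : ℕ, k = (d - 2) + 2 * i} ∪ {k | Odd d ∧ ∃ i : ℕ, k = 2 * (d - 3 + i)}

/-- Doubled exponents allowed for the current: the integers `n = d - 2, d - 1, …`. -/
def currentOrders (d : ℕ) : Set ℕ :=
  {k | ∃ i : ℕ, k = 2 * (d - 2 + i)}

/-- The `1/r` expansion ansatz for the vector potential. -/
def SatisfiesAnsatz {d : ℕ} (A : Spacetime d → Covector d) : Prop :=
  ∃ c : ℕ → ℝ → Space d → Covector d, HasExpansion A c ∧ SupportedOn c (potentialOrders d)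

/-- The gauge transform `A_a - ∂_a φ`. -/
def gaugeTransform {d : ℕ} (A : Spacetime d → Covector d) (φ : Spacetime d → ℝ) :
    Spacetime d → Covector d :=
  fun x => A x - fderiv ℝ φ x

/-- The potential `A`, given on `U`, can be put in the Lorenz gauge within the ansatz: after a
smooth gauge transformation on a neighbourhood of null infinity it is divergence free there and
satisfies the ansatz. -/
def LorenzWithinAnsatz {d : ℕ} (U : Set (Spacetime d)) (A : Spacetime d → Covector d) : Prop :=
  ∃ V : Set (Spacetime d), IsNhdScri V ∧ V ⊆ U ∧ ∃ φ : Spacetime d → ℝ,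
    ContDiffOn ℝ ∞ φ V ∧ (∀ x ∈ V, divergence (gaugeTransform A φ) x = 0) ∧
      SatisfiesAnsatz (gaugeTransform A φ)

end Lorenz

end

/-! Let `B = A - dχ` be the potential that satisfies the ansatz and `S` its divergence. A further
gauge function `ψ` gives the Lorenz gauge within the ansatz as soon as `□ψ = S` near null infinity
and `dψ` satisfies the ansatz (`lorenzWithinAnsatz_of_box_eq`). The whole problem is one scalar wave
equation with control of the expansion of the solution.

Coefficients are written as functions of `(u, y)` that are homogeneous of degree `-k/2` in `y`, with
`k` the doubled exponent. On such a term the wave operator acts as `(k - (d-2)) |y|⁻¹ ∂_u + Δ_y`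
(`etaTrace_liftD_liftD`), so formally `(k - (d-2)) |y|⁻¹ ∂_u ψ_k + Δψ_{k-2} = s_{k+2}`. This is
integrated in `u` order by order, apart from three conditions. The coefficient `ψ_{d-4}` must not
depend on `u`, since otherwise `dψ` starts too early; this needs `s_{d-2} = 0`. For odd `d` the
second series needs `s_{2(d-3)} = 0` for the same reason. At `k = d-2` the factor of `∂_u` vanishes
and a constraint `Δψ_{d-4} = s_d` remains.

Maxwell's equations provide all of this. Conservation and the decay at early times kill the
component of `j^{(d-2)}` along `∂_t + ∂_r` (`Exp.null_current_eq_zero`); contracting Maxwell's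
equations with this vector gives the two vanishing statements (`s_first`, `s_second`). For `d > 4`
the function `|y| b_{d-2}(∂_t + ∂_r)` is independent of `u` and has Laplacian `(2 - d/2) s_d`
(`lapY_radial`), so a multiple of it solves the constraint. For `d = 4` this factor is zero, and the
`∂_t` component of Maxwell's equations reads `∂_u s_4 = 4π j_4(∂_t)`. Hence the flux is the exact
obstruction: in the Lorenz gauge `s_4 = 0`, so there is no flux; without flux `s_4` does not depend
on `u` and the constraint is a Poisson equation on the two-sphere (`exists_poisson`). Its
solvability condition, zero mean, is met after adding a multiple of `log r` to `ψ`, whose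
differential is an allowed `1/r` term.

A formal solution becomes a true one as follows. Borel summation (`exists_exp`) produces a function
with the computed expansion; the error in the wave equation decreases rapidly near null infinity,
hence agrees there with a Schwartz function (`exists_schwartz`). The wave equation with a Schwartz
source is solved backwards from the far future by spatial Fourier transform (`wave`), and this
solution decays rapidly in time, so it does not alter the expansion.

The estimates are organised by `Sym`: after rescaling the radius by `L`, all derivatives at unit
radius are `O(L^{-κ})`. This is equivalent to the mixed bounds of `HasExpansion`, and it is stable
under products and differentiation. -/

open scoped ContDiff

noncomputable section

namespace Lorenz

open Filter Topology Set Asymptotics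

section

/-! ### Pointwise Leibniz and chain rule estimates -/

section Calculus

variable {E F G H : Type*} [NormedAddCommGroup E] [NormedSpace ℝ E] [NormedAddCommGroup F]
  [NormedSpace ℝ F] [NormedAddCommGroup G] [NormedSpace ℝ G] [NormedAddCommGroup H]
  [NormedSpace ℝ H]

/-- Pointwise Leibniz bound for a bilinear expression. -/
theorem norm_iteratedFDeriv_bilinear_le (B : F →L[ℝ] G →L[ℝ] H) {f : E → F} {g : E → G} {x : E}
    {n : ℕ} (hf : ContDiffAt ℝ n f x) (hg : ContDiffAt ℝ n g x) :
    ‖iteratedFDeriv ℝ n (fun y => B (f y) (g y)) x‖ ≤ ‖B‖ * ∑ i ∈ Finset.range (n + 1),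
      (n.choose i : ℝ) * ‖iteratedFDeriv ℝ i f x‖ * ‖iteratedFDeriv ℝ (n - i) g x‖ := by
  obtain ⟨u, hu, hfu⟩ := hf.contDiffOn le_rfl (by simp)
  obtain ⟨v, hv, hgv⟩ := hg.contDiffOn le_rfl (by simp)
  obtain ⟨w, hw, hwo, hxw⟩ := mem_nhds_iff.1 (inter_mem hu hv)
  have key := B.norm_iteratedFDerivWithin_le_of_bilinear (hfu.mono fun y hy => (hw hy).1)
    (hgv.mono fun y hy => (hw hy).2) hwo.uniqueDiffOn hxw (n := n) le_rfl
  simpa only [iteratedFDerivWithin_of_isOpen _ hwo hxw] using key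

/-- Pointwise form of the Faà di Bruno bound: smoothness of finite order at a point spreads to an
open neighbourhood, where the derivatives within the set are the full ones. -/
theorem norm_iteratedFDeriv_comp_at_le {g : F → G} {f : E → F} {n : ℕ} {x : E}
    (hg : ContDiffAt ℝ n g (f x)) (hf : ContDiffAt ℝ n f x) {C D : ℝ}
    (hC : ∀ i, i ≤ n → ‖iteratedFDeriv ℝ i g (f x)‖ ≤ C)
    (hD : ∀ i, 1 ≤ i → i ≤ n → ‖iteratedFDeriv ℝ i f x‖ ≤ D ^ i) :
    ‖iteratedFDeriv ℝ n (g ∘ f) x‖ ≤ n.factorial * C * D ^ n := by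
  obtain ⟨u, hu, hfu⟩ := hf.contDiffOn le_rfl (by simp)
  obtain ⟨v, hv, hgv⟩ := hg.contDiffOn le_rfl (by simp)
  obtain ⟨v', hv', hvo, hxv⟩ := mem_nhds_iff.1 hv
  have h1 : f ⁻¹' v' ∈ 𝓝 x := hf.continuousAt.preimage_mem_nhds (hvo.mem_nhds hxv)
  obtain ⟨w, hw, hwo, hxw⟩ := mem_nhds_iff.1 (inter_mem hu h1)
  have key := norm_iteratedFDerivWithin_comp_le (𝕜 := ℝ) (g := g) (f := f) (n := n) (s := w) (t := v')
    (hgv.mono hv') (hfu.mono fun y hy => (hw hy).1) le_rfl hvo.uniqueDiffOn hwo.uniqueDiffOn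
    (fun y hy => (hw hy).2) hxw (C := C) (D := D)
  simp only [iteratedFDerivWithin_of_isOpen _ hwo hxw,
    iteratedFDerivWithin_of_isOpen _ hvo hxv] at key
  exact key hC hD

theorem contDiffAt_top_fderiv {f : E → F} {x : E} (hf : ContDiffAt ℝ ∞ f x) :
    ContDiffAt ℝ ∞ (fderiv ℝ f) x := hf.fderiv_right (by simp)

theorem _root_.ContDiffAt.top_to_nat {f : E → F} {x : E} (hf : ContDiffAt ℝ ∞ f x) (n : ℕ) :
    ContDiffAt ℝ n f x := hf.of_le (by exact_mod_cast le_top)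

end Calculus

/-! ### Retarded coordinates and neighbourhoods of null infinity -/

section Geometry

variable {d : ℕ}

theorem norm_dir {y : Space d} (hy : y ≠ 0) : ‖dir y‖ = 1 := by
  rw [dir, norm_smul, norm_inv, norm_norm, inv_mul_cancel₀ (norm_ne_zero_iff.2 hy)]

theorem dir_smul {s : ℝ} (hs : 0 < s) (y : Space d) : dir (s • y) = dir y := by
  rw [dir, dir, norm_smul, Real.norm_of_nonneg hs.le, smul_smul, mul_inv, mul_comm s⁻¹,
    mul_assoc, inv_mul_cancel₀ hs.ne', mul_one]

theorem dir_eq_self {y : Space d} (hy : ‖y‖ = 1) : dir y = y := by simp [dir, hy]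

theorem norm_smul_dir (y : Space d) : ‖y‖ • dir y = y := by
  rcases eq_or_ne y 0 with rfl | hy
  · simp
  · rw [dir, smul_smul, mul_inv_cancel₀ (norm_ne_zero_iff.2 hy), one_smul]

theorem dir_dir (y : Space d) : dir (dir y) = dir y := by
  rcases eq_or_ne y 0 with rfl | hy
  · simp [dir]
  · exact dir_eq_self (norm_dir hy)

theorem ne_zero_of_norm_eq_one {y : Space d} (hy : ‖y‖ = 1) : y ≠ 0 := by
  rintro rfl; simp at hy

theorem contDiffAt_dir {y : Space d} (hy : y ≠ 0) : ContDiffAt ℝ ∞ (dir : Space d → Space d) y :=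
  ((contDiffAt_norm ℝ hy).inv (norm_ne_zero_iff.2 hy)).smul contDiffAt_id

theorem point_eq {t : ℝ} {x : Space d} : point (t - ‖x‖) ‖x‖ (dir x) = (t, x) := by
  simp [point, dir_dir, norm_smul_dir]

theorem point_snd_norm {u r : ℝ} {θ : Space d} (hr : 0 ≤ r) (hθ : θ ≠ 0) :
    ‖(point u r θ).2‖ = r := by
  simp [point, norm_smul, norm_dir hθ, abs_of_nonneg hr]

theorem point_dir {u r : ℝ} {θ : Space d} (hr : 0 < r) :
    dir (point u r θ).2 = dir θ := by
  simp [point, dir_smul hr, dir_dir]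

theorem point_retarded {u r : ℝ} {θ : Space d} (hr : 0 ≤ r) (hθ : θ ≠ 0) :
    (point u r θ).1 - ‖(point u r θ).2‖ = u := by
  rw [point_snd_norm hr hθ]; simp [point]

theorem IsNhdScri.inter {U V : Set (Spacetime d)} (hU : IsNhdScri U) (hV : IsNhdScri V) :
    IsNhdScri (U ∩ V) := by
  refine ⟨hU.1.inter hV.1, fun T => ?_⟩
  obtain ⟨R, hR⟩ := hU.2 T
  obtain ⟨R', hR'⟩ := hV.2 T
  exact ⟨max R R', fun u r θ hu hr hθ => ⟨hR u r θ hu ((le_max_left _ _).trans hr) hθ,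
    hR' u r θ hu ((le_max_right _ _).trans hr) hθ⟩⟩

/-- A set that contains, for each `T`, all far points with `|u| ≤ T` has an interior that is
a neighbourhood of null infinity. -/
theorem isNhdScri_interior {s : Set (Spacetime d)}
    (h : ∀ T : ℝ, ∃ R : ℝ, ∀ x : Spacetime d, |x.1 - ‖x.2‖| ≤ T → R ≤ ‖x.2‖ → x ∈ s) :
    IsNhdScri (interior s) := by
  refine ⟨isOpen_interior, fun T => ?_⟩
  obtain ⟨R, hR⟩ := h (T + 1)
  refine ⟨max R 0 + 1, fun u r θ hu hr hθ => ?_⟩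
  have h0 : 0 ≤ r := by linarith [le_max_right R 0]
  have hθ0 := ne_zero_of_norm_eq_one hθ
  rw [mem_interior_iff_mem_nhds]
  have ho : IsOpen {x : Spacetime d | |x.1 - ‖x.2‖| < T + 1 ∧ R < ‖x.2‖} :=
    IsOpen.and (isOpen_lt (by fun_prop) (by fun_prop)) (isOpen_lt (by fun_prop) (by fun_prop))
  refine mem_of_superset (ho.mem_nhds ⟨?_, ?_⟩) fun x hx => hR x hx.1.le hx.2.le
  · rw [point_retarded h0 hθ0]; linarith
  · rw [point_snd_norm h0 hθ0]; linarith [le_max_left R 0]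

theorem IsNhdScri.far {U : Set (Spacetime d)} (hU : IsNhdScri U) (T : ℝ) :
    ∃ R : ℝ, 0 < R ∧ ∀ x : Spacetime d, |x.1 - ‖x.2‖| ≤ T → R ≤ ‖x.2‖ → x ∈ U := by
  obtain ⟨R, hR⟩ := hU.2 T
  refine ⟨max R 1, by positivity, fun x hx hr => ?_⟩
  have h1 : 1 ≤ ‖x.2‖ := (le_max_right _ _).trans hr
  have h0 : x.2 ≠ 0 := norm_pos_iff.1 (by linarith)
  have := hR (x.1 - ‖x.2‖) ‖x.2‖ (dir x.2) hx ((le_max_left _ _).trans hr) (norm_dir h0)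
  rwa [point_eq] at this

theorem isNhdScri_lt_norm (R : ℝ) : IsNhdScri {x : Spacetime d | R < ‖x.2‖} := by
  refine ⟨isOpen_lt (by fun_prop) (by fun_prop), fun T => ⟨max R 0 + 1, fun u r θ _ hr hθ => ?_⟩⟩
  rw [mem_ofPred_eq, point_snd_norm (by linarith [le_max_right R 0]) (ne_zero_of_norm_eq_one hθ)]
  linarith [le_max_left R 0]

end Geometry

/-! ### Families of functions at unit radius, indexed by the scale `L` -/

section Families

variable {d : ℕ} {F G H : Type} [NormedAddCommGroup F] [NormedSpace ℝ F]
  [NormedAddCommGroup G] [NormedSpace ℝ G] [NormedAddCommGroup H] [NormedSpace ℝ H]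

/-- Parameters `((u, y), σ)`. -/
abbrev Par (d : ℕ) : Type := (ℝ × Space d) × ℝ

/-- The map `((u, y), σ) ↦ point u (L σ) y`. -/
def rescale {d : ℕ} (L : ℝ) (q : Par d) : Spacetime d := point q.1.1 (L * q.2) q.1.2

/-- `(L, (u, θ))` with `L → ∞`, `|u| ≤ T` and `‖θ‖ = 1`. -/
def scri (d : ℕ) (T : ℝ) : Filter (ℝ × (ℝ × Space d)) :=
  atTop ×ˢ 𝓟 {p | |p.1| ≤ T ∧ ‖p.2‖ = 1}

theorem eventually_scri {T : ℝ} {P : ℝ × (ℝ × Space d) → Prop} :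
    (∀ᶠ z in scri d T, P z) ↔
      ∃ R, ∀ L, R ≤ L → ∀ u θ, |u| ≤ T → ‖θ‖ = 1 → P (L, (u, θ)) := by
  rw [scri, eventually_prod_principal_iff, eventually_atTop]
  exact ⟨fun ⟨R, h⟩ => ⟨R, fun L hL u θ hu hθ => h L hL (u, θ) ⟨hu, hθ⟩⟩,
    fun ⟨R, h⟩ => ⟨R, fun L hL p hp => h L hL p.1 p.2 hp.1 hp.2⟩⟩

theorem eventually_scri_ge (T R : ℝ) : ∀ᶠ z in scri d T, R ≤ z.1 :=
  eventually_scri.2 ⟨R, fun _ hL _ _ _ _ => hL⟩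

theorem eventually_scri_norm (T : ℝ) : ∀ᶠ z in scri d T, |z.2.1| ≤ T ∧ ‖z.2.2‖ = 1 :=
  eventually_scri.2 ⟨0, fun _ _ _ _ hu hθ => ⟨hu, hθ⟩⟩

theorem rescale_continuousAt (L : ℝ) {p : ℝ × Space d} (hp : p.2 ≠ 0) (σ : ℝ) :
    ContinuousAt (rescale L) (p, σ) := by
  have h1 : ContinuousAt (fun q : Par d => dir q.1.2) (p, σ) :=
    ContinuousAt.comp (g := dir) (f := fun q : Par d => q.1.2) (contDiffAt_dir hp).continuousAt
      (by fun_prop)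
  unfold rescale point
  exact ContinuousAt.prodMk (by fun_prop)
    (ContinuousAt.smul (f := fun q : Par d => L * q.2) (by fun_prop) h1)

/-- Turns an identity on a neighbourhood of null infinity into an identity of germs at `σ = 1`, so
that all derivatives of the rescaled functions agree there. -/
theorem IsNhdScri.eventually_rescale {V : Set (Spacetime d)} (hV : IsNhdScri V) (T : ℝ) :
    ∀ᶠ z in scri d T, ∀ᶠ q in 𝓝 ((z.2, 1) : Par d), rescale z.1 q ∈ V := by
  obtain ⟨R, hR⟩ := hV.2 T
  refine eventually_scri.2 ⟨R, fun L hL u θ hu hθ => ?_⟩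
  refine (rescale_continuousAt L (p := (u, θ)) (ne_zero_of_norm_eq_one hθ) 1).eventually ?_
  refine hV.1.mem_nhds ?_
  simpa [rescale] using hR u L θ hu hL hθ

/-- A family of functions of `((u, y), σ)` all of whose derivatives at `σ = 1`, `‖y‖ = 1` are
`O(L^(-κ))`, uniformly for bounded `u`. -/
structure FamO (κ : ℝ) (f : ℝ → Par d → F) : Prop where
  smooth : ∀ T, ∀ᶠ z in scri d T, ContDiffAt ℝ ∞ (f z.1) (z.2, 1)
  bound : ∀ T n, (fun z : ℝ × (ℝ × Space d) => iteratedFDeriv ℝ n (f z.1) (z.2, 1))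
    =O[scri d T] fun z => z.1 ^ (-κ)

namespace FamO

variable {κ κ' a : ℝ} {f g : ℝ → Par d → F}

theorem congr (hf : FamO κ f)
    (h : ∀ T, ∀ᶠ z in scri d T, f z.1 =ᶠ[𝓝 ((z.2, 1) : Par d)] g z.1) : FamO κ g := by
  refine ⟨fun T => ?_, fun T n => ?_⟩
  · filter_upwards [hf.smooth T, h T] with z h1 h2
    exact h1.congr_of_eventuallyEq h2.symm
  · refine (hf.bound T n).congr' ?_ EventuallyEq.rfl
    filter_upwards [h T] with z h2
    exact (h2.iteratedFDeriv ℝ n).eq_of_nhds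

theorem mono (hf : FamO κ f) (h : κ' ≤ κ) : FamO κ' f := by
  refine ⟨hf.smooth, fun T n => (hf.bound T n).trans ?_⟩
  refine IsBigO.of_bound 1 ?_
  filter_upwards [eventually_scri_ge T 1] with z hz
  rw [one_mul, Real.norm_of_nonneg (by positivity), Real.norm_of_nonneg (by positivity)]
  exact Real.rpow_le_rpow_of_exponent_le hz (by linarith)

theorem clm (hf : FamO κ f) (A : F →L[ℝ] G) : FamO κ fun L q => A (f L q) := by
  refine ⟨fun T => ?_, fun T n => IsBigO.trans ?_ (hf.bound T n)⟩
  · filter_upwards [hf.smooth T] with z hz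
    exact A.contDiff.contDiffAt.comp _ hz
  · refine IsBigO.of_bound ‖A‖ ?_
    filter_upwards [hf.smooth T] with z hz
    exact A.norm_iteratedFDeriv_comp_left hz (by exact_mod_cast le_top)

theorem add (hf : FamO κ f) (hg : FamO κ g) : FamO κ fun L q => f L q + g L q := by
  refine ⟨fun T => ?_, fun T n => ?_⟩
  · filter_upwards [hf.smooth T, hg.smooth T] with z h1 h2 using h1.add h2
  · refine ((hf.bound T n).add (hg.bound T n)).congr' ?_ EventuallyEq.rfl
    filter_upwards [hf.smooth T, hg.smooth T] with z h1 h2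
    exact (iteratedFDeriv_add_apply (h1.top_to_nat n) (h2.top_to_nat n)).symm

theorem zero (κ : ℝ) : FamO κ (fun _ _ => 0 : ℝ → Par d → F) := by
  refine ⟨fun T => Eventually.of_forall fun z => contDiffAt_const, fun T n => ?_⟩
  have : (fun z : ℝ × (ℝ × Space d) => iteratedFDeriv ℝ n (fun _ : Par d => (0 : F)) (z.2, 1))
      = fun _ => 0 := by
    funext z; exact congrFun (iteratedFDeriv_fun_zero (𝕜 := ℝ) (n := n)) _
  rw [this]; exact isBigO_zero _ _

theorem fderiv (hf : FamO κ f) : FamO κ fun L => fderiv ℝ (f L) := by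
  refine ⟨fun T => ?_, fun T n => IsBigO.trans ?_ (hf.bound T (n + 1))⟩
  · filter_upwards [hf.smooth T] with z hz using contDiffAt_top_fderiv hz
  · refine IsBigO.of_bound 1 (Eventually.of_forall fun z => ?_)
    rw [norm_iteratedFDeriv_fderiv, one_mul]

theorem bilinear {g : ℝ → Par d → G} (B : F →L[ℝ] G →L[ℝ] H) (hf : FamO κ f) (hg : FamO κ' g) :
    FamO (κ + κ') fun L q => B (f L q) (g L q) := by
  refine ⟨fun T => ?_, fun T n => ?_⟩
  · filter_upwards [hf.smooth T, hg.smooth T] with z h1 h2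
    exact (B.contDiff.contDiffAt.comp _ h1).clm_apply h2
  · have h1 : (fun z : ℝ × (ℝ × Space d) => iteratedFDeriv ℝ n
        (fun q => B (f z.1 q) (g z.1 q)) (z.2, 1)) =O[scri d T]
        fun z => ‖B‖ * ∑ i ∈ Finset.range (n + 1), (n.choose i : ℝ) *
          ‖iteratedFDeriv ℝ i (f z.1) (z.2, 1)‖ * ‖iteratedFDeriv ℝ (n - i) (g z.1) (z.2, 1)‖ := by
      refine IsBigO.of_bound 1 ?_
      filter_upwards [hf.smooth T, hg.smooth T] with z h1 h2
      rw [one_mul]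
      exact (norm_iteratedFDeriv_bilinear_le B (h1.top_to_nat n) (h2.top_to_nat n)).trans
        (le_abs_self _)
    refine h1.trans (IsBigO.const_mul_left (IsBigO.fun_sum fun i _ => ?_) _)
    have h2 := ((hf.bound T i).norm_left.mul (hg.bound T (n - i)).norm_left).const_mul_left
      (n.choose i : ℝ)
    simp only [← mul_assoc] at h2
    refine h2.congr' EventuallyEq.rfl ?_
    filter_upwards [eventually_scri_ge T 1] with z hz
    rw [← Real.rpow_add (by linarith)]
    ring_nf

theorem rpow_smul (hf : FamO κ f) (a : ℝ) : FamO (κ + a) fun L q => L ^ (-a) • f L q := by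
  refine ⟨fun T => ?_, fun T n => ?_⟩
  · filter_upwards [hf.smooth T] with z hz using hz.const_smul _
  · have h1 : (fun z : ℝ × (ℝ × Space d) => z.1 ^ (-a) • iteratedFDeriv ℝ n (f z.1) (z.2, 1))
        =O[scri d T] fun z => z.1 ^ (-a) • z.1 ^ (-κ) :=
      (isBigO_refl _ _).smul (hf.bound T n)
    refine h1.congr' ?_ ?_
    · filter_upwards [hf.smooth T] with z hz
      exact (iteratedFDeriv_const_smul_apply' (hz.top_to_nat n)).symm
    · filter_upwards [eventually_scri_ge T 1] with z hz
      rw [smul_eq_mul, ← Real.rpow_add (by linarith)]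
      ring_nf

/-- The points with `|u| ≤ T`, `‖y‖ = 1`, `σ = 1` form a compact set, which bounds each derivative
of a fixed smooth function. -/
theorem const {f : Par d → F} (hf : ContDiffOn ℝ ∞ f {q | q.1.2 ≠ 0 ∧ 0 < q.2}) :
    FamO 0 fun _ => f := by
  have ho : IsOpen {q : Par d | q.1.2 ≠ 0 ∧ 0 < q.2} :=
    IsOpen.and (isOpen_ne_fun (by fun_prop) (by fun_prop)) (isOpen_lt (by fun_prop) (by fun_prop))
  have hsm : ∀ q : Par d, q.1.2 ≠ 0 → 0 < q.2 → ContDiffAt ℝ ∞ f q := fun q h1 h2 =>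
    hf.contDiffAt (ho.mem_nhds ⟨h1, h2⟩)
  refine ⟨fun T => ?_, fun T n => ?_⟩
  · filter_upwards [eventually_scri_norm T] with z hz
    exact hsm _ (ne_zero_of_norm_eq_one hz.2) one_pos
  · have hK : IsCompact ((Icc (-T) T ×ˢ Metric.sphere (0 : Space d) 1) ×ˢ ({1} : Set ℝ)) :=
      (isCompact_Icc.prod (isCompact_sphere _ _)).prod isCompact_singleton
    have hc : ContinuousOn (iteratedFDeriv ℝ n f)
        ((Icc (-T) T ×ˢ Metric.sphere (0 : Space d) 1) ×ˢ ({1} : Set ℝ)) := by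
      rintro ⟨⟨u, y⟩, σ⟩ ⟨⟨_, hy⟩, hσ⟩
      obtain rfl : σ = 1 := hσ
      exact ((hsm _ (ne_zero_of_norm_eq_one (by simpa using hy)) one_pos).iteratedFDeriv_right
        (m := 0) (by norm_cast; exact le_top)).continuousAt.continuousWithinAt
    obtain ⟨C, hC⟩ := hK.exists_bound_of_continuousOn hc
    refine IsBigO.of_bound C ?_
    filter_upwards [eventually_scri_norm T] with z hz
    simpa using hC (z.2, 1) ⟨⟨abs_le.1 hz.1, by simpa using hz.2⟩, rfl⟩

end FamO

end Families

end

section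

/-! ### Mixed partial derivatives against total derivatives -/

section Mixed

variable {P F : Type} [NormedAddCommGroup P] [NormedSpace ℝ P] [NormedAddCommGroup F]
  [NormedSpace ℝ F]

/-- Partial derivative in the last, real, variable. -/
def lastDeriv (f : P × ℝ → F) : P × ℝ → F := fun q => fderiv ℝ f q (0, 1)

/-- Partial derivative in the first variable. -/
def firstDeriv (f : P × ℝ → F) : P × ℝ → P →L[ℝ] F :=
  fun q => (fderiv ℝ f q).comp (ContinuousLinearMap.inl ℝ P ℝ)

theorem ContDiffOn.lastDeriv {f : P × ℝ → F} {N : Set (P × ℝ)} (hN : IsOpen N)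
    (hf : ContDiffOn ℝ ∞ f N) : ContDiffOn ℝ ∞ (lastDeriv f) N :=
  (hf.fderiv_of_isOpen hN (by simp)).clm_apply contDiffOn_const

theorem ContDiffOn.lastDeriv_iterate {f : P × ℝ → F} {N : Set (P × ℝ)} (hN : IsOpen N)
    (hf : ContDiffOn ℝ ∞ f N) (l : ℕ) : ContDiffOn ℝ ∞ (Lorenz.lastDeriv^[l] f) N := by
  induction l with
  | zero => exact hf
  | succ l ih => rw [Function.iterate_succ_apply']; exact ContDiffOn.lastDeriv hN ih

theorem ContDiffOn.firstDeriv {f : P × ℝ → F} {N : Set (P × ℝ)} (hN : IsOpen N)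
    (hf : ContDiffOn ℝ ∞ f N) : ContDiffOn ℝ ∞ (firstDeriv f) N :=
  (hf.fderiv_of_isOpen hN (by simp)).clm_comp contDiffOn_const

theorem hasDerivAt_slice {f : P × ℝ → F} {p : P} {s : ℝ} (hf : DifferentiableAt ℝ f (p, s)) :
    HasDerivAt (fun t => f (p, t)) (lastDeriv f (p, s)) s := by
  have h1 : HasDerivAt (fun t : ℝ => (p, t)) ((0, 1) : P × ℝ) s :=
    (hasDerivAt_const s p).prodMk (hasDerivAt_id s)
  exact hf.hasFDerivAt.comp_hasDerivAt s h1

theorem hasFDerivAt_slice {f : P × ℝ → F} {p : P} {s : ℝ} (hf : DifferentiableAt ℝ f (p, s)) :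
    HasFDerivAt (fun t => f (t, s)) (firstDeriv f (p, s)) p := by
  have h1 : HasFDerivAt (fun t : P => (t, s)) (ContinuousLinearMap.inl ℝ P ℝ) p :=
    (hasFDerivAt_id p).prodMk (hasFDerivAt_const s p)
  exact hf.hasFDerivAt.comp p h1

theorem ContDiffOn.differentiableAt_top {E : Type} [NormedAddCommGroup E] [NormedSpace ℝ E]
    {f : E → F} {N : Set E} (hN : IsOpen N)
    (hf : ContDiffOn ℝ ∞ f N) {q : E} (hq : q ∈ N) : DifferentiableAt ℝ f q :=
  (hf.contDiffAt (hN.mem_nhds hq)).differentiableAt (by simp)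

theorem iteratedDeriv_slice {f : P × ℝ → F} {N : Set (P × ℝ)} (hN : IsOpen N)
    (hf : ContDiffOn ℝ ∞ f N) (l : ℕ) : ∀ {p : P} {s : ℝ}, (p, s) ∈ N →
    iteratedDeriv l (fun t => f (p, t)) s = lastDeriv^[l] f (p, s) := by
  induction l with
  | zero => intro p s _; simp
  | succ l ih =>
    intro p s hs
    have hc : Continuous fun t : ℝ => (p, t) := by fun_prop
    have h1 : iteratedDeriv l (fun t => f (p, t)) =ᶠ[𝓝 s] fun t => lastDeriv^[l] f (p, t) := by
      filter_upwards [hc.continuousAt.eventually (hN.mem_nhds hs)] with t ht using ih ht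
    rw [iteratedDeriv_succ, h1.deriv_eq, Function.iterate_succ_apply']
    exact (hasDerivAt_slice (ContDiffOn.differentiableAt_top hN
      (ContDiffOn.lastDeriv_iterate hN hf l) hs)).deriv

/-- Symmetry of the second derivative. -/
theorem lastDeriv_firstDeriv {f : P × ℝ → F} {q : P × ℝ} (hf : ContDiffAt ℝ ∞ f q) :
    lastDeriv (firstDeriv f) q = firstDeriv (lastDeriv f) q := by
  have hd : DifferentiableAt ℝ (fderiv ℝ f) q :=
    (contDiffAt_top_fderiv hf).differentiableAt (by simp)
  have hs : IsSymmSndFDerivAt ℝ f q := hf.isSymmSndFDerivAt (by simpa using ENat.LEInfty.out)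
  ext v
  simp only [lastDeriv, firstDeriv, ContinuousLinearMap.comp_apply]
  have h1 : fderiv ℝ (fun q => fderiv ℝ f q (0, 1)) q
      = (fderiv ℝ (fderiv ℝ f) q).flip (0, 1) := by
    rw [fderiv_clm_apply hd (by fun_prop)]
    simp
  rw [show (lastDeriv f) = fun q => fderiv ℝ f q (0, 1) from rfl, h1]
  have : fderiv ℝ (fun q => (fderiv ℝ f q).comp (ContinuousLinearMap.inl ℝ P ℝ)) q (0, 1)
      = (fderiv ℝ (fderiv ℝ f) q (0, 1)).comp (ContinuousLinearMap.inl ℝ P ℝ) := by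
    rw [fderiv_clm_comp hd (by fun_prop)]
    simp
  rw [show (firstDeriv f) = fun q => (fderiv ℝ f q).comp (ContinuousLinearMap.inl ℝ P ℝ) from rfl,
    this]
  simpa using hs (0, 1) (v, 0)

theorem lastDeriv_iterate_firstDeriv {f : P × ℝ → F} {N : Set (P × ℝ)} (hN : IsOpen N)
    (hf : ContDiffOn ℝ ∞ f N) (l : ℕ) :
    ∀ q ∈ N, lastDeriv^[l] (firstDeriv f) q = firstDeriv (lastDeriv^[l] f) q := by
  induction l with
  | zero => intro q _; rfl
  | succ l ih =>
    intro q hq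
    rw [Function.iterate_succ_apply', Function.iterate_succ_apply',
      ← lastDeriv_firstDeriv ((ContDiffOn.lastDeriv_iterate hN hf l).contDiffAt (hN.mem_nhds hq))]
    have : lastDeriv^[l] (firstDeriv f) =ᶠ[𝓝 q] firstDeriv (lastDeriv^[l] f) := by
      filter_upwards [hN.mem_nhds hq] with q' hq' using ih q' hq'
    simp [lastDeriv, this.fderiv_eq]

/-- Restriction to a slice composes each derivative with the inclusion, of norm at most one. The
target space is quantified inside because the induction passes from `f` to its partial derivative.
-/
theorem norm_iteratedFDeriv_slice_le (m : ℕ) : ∀ {F : Type} [NormedAddCommGroup F]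
    [NormedSpace ℝ F] {f : P × ℝ → F} {N : Set (P × ℝ)} (_ : IsOpen N)
    (_ : ContDiffOn ℝ ∞ f N) {p : P} {s : ℝ} (_ : (p, s) ∈ N),
    ‖iteratedFDeriv ℝ m (fun p => f (p, s)) p‖ ≤ ‖iteratedFDeriv ℝ m f (p, s)‖ := by
  induction m with
  | zero => intros; simp
  | succ m ih =>
    intro F _ _ f N hN hf p s hp
    have hc : Continuous fun t : P => (t, s) := by fun_prop
    have h1 : fderiv ℝ (fun p => f (p, s)) =ᶠ[𝓝 p] fun t => firstDeriv f (t, s) := by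
      filter_upwards [hc.continuousAt.eventually (hN.mem_nhds hp)] with t ht
      exact (hasFDerivAt_slice (ContDiffOn.differentiableAt_top hN hf ht)).fderiv
    rw [← norm_iteratedFDeriv_fderiv, ← norm_iteratedFDeriv_fderiv,
      (h1.iteratedFDeriv ℝ m).eq_of_nhds]
    have hf' := hf.fderiv_of_isOpen hN (m := ∞) (by simp)
    have hA : ‖(ContinuousLinearMap.compL ℝ P (P × ℝ) F).flip (ContinuousLinearMap.inl ℝ P ℝ)‖
        ≤ 1 := by
      refine ContinuousLinearMap.opNorm_le_bound _ zero_le_one fun B => ?_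
      rw [one_mul]
      refine (B.opNorm_comp_le _).trans ?_
      exact mul_le_of_le_one_right (norm_nonneg _) (ContinuousLinearMap.norm_inl_le_one ℝ P ℝ)
    refine le_trans (le_trans (ih hN (ContDiffOn.firstDeriv hN hf) hp) ?_) (le_refl _)
    refine (((ContinuousLinearMap.compL ℝ P (P × ℝ) F).flip
      (ContinuousLinearMap.inl ℝ P ℝ)).norm_iteratedFDeriv_comp_left
      ((hf'.contDiffAt (hN.mem_nhds hp)).top_to_nat m) le_rfl).trans ?_
    exact mul_le_of_le_one_left (norm_nonneg _) hA

theorem norm_iteratedFDeriv_lastDeriv_le {f : P × ℝ → F} {q : P × ℝ} (m : ℕ)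
    (hf : ContDiffAt ℝ ∞ f q) :
    ‖iteratedFDeriv ℝ m (lastDeriv f) q‖ ≤ ‖iteratedFDeriv ℝ (m + 1) f q‖ := by
  rw [← norm_iteratedFDeriv_fderiv]
  refine (norm_iteratedFDeriv_clm_apply_const
    ((contDiffAt_top_fderiv hf).top_to_nat m) le_rfl).trans ?_
  exact mul_le_of_le_one_left (norm_nonneg _) (by simp [Prod.norm_def])

theorem norm_iteratedFDeriv_lastDeriv_iterate_le {f : P × ℝ → F} {N : Set (P × ℝ)}
    (hN : IsOpen N) (hf : ContDiffOn ℝ ∞ f N) {q : P × ℝ} (hq : q ∈ N) (m l : ℕ) :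
    ‖iteratedFDeriv ℝ m (lastDeriv^[l] f) q‖ ≤ ‖iteratedFDeriv ℝ (m + l) f q‖ := by
  induction l generalizing m with
  | zero => simp
  | succ l ih =>
    rw [Function.iterate_succ_apply']
    refine (norm_iteratedFDeriv_lastDeriv_le m
      ((ContDiffOn.lastDeriv_iterate hN hf l).contDiffAt (hN.mem_nhds hq))).trans ?_
    refine (ih (m + 1)).trans (le_of_eq ?_)
    rw [add_right_comm, add_assoc]

/-- Mixed derivatives control the total derivative. -/
theorem norm_iteratedFDeriv_le_of_mixed (n : ℕ) : ∀ {F : Type} [NormedAddCommGroup F]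
    [NormedSpace ℝ F] {f : P × ℝ → F} {N : Set (P × ℝ)} (_ : IsOpen N)
    (_ : ContDiffOn ℝ ∞ f N) {p : P} {s : ℝ} (_ : (p, s) ∈ N) {C : ℝ}
    (_ : ∀ m l, m ≤ n → l ≤ n →
      ‖iteratedFDeriv ℝ m (fun p => lastDeriv^[l] f (p, s)) p‖ ≤ C),
    ‖iteratedFDeriv ℝ n f (p, s)‖ ≤ 2 ^ n * C := by
  induction n with
  | zero =>
    intro F _ _ f N hN hf p s hp C h
    simpa using h 0 0 le_rfl le_rfl
  | succ n ih =>
    intro F _ _ f N hN hf p s hp C h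
    -- The total derivative is the sum of its two partial parts, each embedded with norm at most
    -- one; each differentiation therefore at most doubles the constant, whence `2 ^ n`.
    have hsplit : fderiv ℝ f = fun q =>
        ((ContinuousLinearMap.compL ℝ (P × ℝ) P F).flip (ContinuousLinearMap.fst ℝ P ℝ))
          (firstDeriv f q)
        + ((ContinuousLinearMap.smulRightL ℝ (P × ℝ) F) (ContinuousLinearMap.snd ℝ P ℝ))
          (lastDeriv f q) := by
      funext q
      ext v
      · simp [firstDeriv]
      · simp [firstDeriv, lastDeriv, ← Prod.zero_eq_mk]
    have h1 : ‖iteratedFDeriv ℝ n (lastDeriv f) (p, s)‖ ≤ 2 ^ n * C := by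
      refine ih hN (ContDiffOn.lastDeriv hN hf) hp fun m l hm hl => ?_
      simpa only [← Function.iterate_succ_apply] using h m (l + 1) (by omega) (by omega)
    have h2 : ‖iteratedFDeriv ℝ n (firstDeriv f) (p, s)‖ ≤ 2 ^ n * C := by
      refine ih hN (ContDiffOn.firstDeriv hN hf) hp fun m l hm hl => ?_
      have hc : Continuous fun t : P => (t, s) := by fun_prop
      have h3 : (fun p => lastDeriv^[l] (firstDeriv f) (p, s)) =ᶠ[𝓝 p]
          fderiv ℝ fun p => lastDeriv^[l] f (p, s) := by
        filter_upwards [hc.continuousAt.eventually (hN.mem_nhds hp)] with t ht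
        rw [lastDeriv_iterate_firstDeriv hN hf l _ ht]
        exact (hasFDerivAt_slice (ContDiffOn.differentiableAt_top hN
          (ContDiffOn.lastDeriv_iterate hN hf l) ht)).fderiv.symm
      rw [(h3.iteratedFDeriv ℝ m).eq_of_nhds, norm_iteratedFDeriv_fderiv]
      exact h (m + 1) l (by omega) (by omega)
    have c1 := ((ContDiffOn.firstDeriv hN hf).contDiffAt (hN.mem_nhds hp)).top_to_nat n
    have c2 := ((ContDiffOn.lastDeriv hN hf).contDiffAt (hN.mem_nhds hp)).top_to_nat n
    rw [← norm_iteratedFDeriv_fderiv, hsplit]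
    refine (congrArg norm (iteratedFDeriv_add_apply
        ((ContinuousLinearMap.contDiff _).contDiffAt.comp (p, s) c1)
        ((ContinuousLinearMap.contDiff _).contDiffAt.comp (p, s) c2))).trans_le ?_
    have n1 : ‖(ContinuousLinearMap.compL ℝ (P × ℝ) P F).flip (ContinuousLinearMap.fst ℝ P ℝ)‖
        ≤ 1 := by
      refine ContinuousLinearMap.opNorm_le_bound _ zero_le_one fun B => ?_
      rw [one_mul]
      exact (B.opNorm_comp_le _).trans
        (mul_le_of_le_one_right (norm_nonneg _) (ContinuousLinearMap.norm_fst_le ℝ P ℝ))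
    have n2 : ‖(ContinuousLinearMap.smulRightL ℝ (P × ℝ) F) (ContinuousLinearMap.snd ℝ P ℝ)‖
        ≤ 1 := by
      refine ContinuousLinearMap.opNorm_le_bound _ zero_le_one fun B => ?_
      rw [one_mul, ContinuousLinearMap.smulRightL_apply_apply,
        ContinuousLinearMap.norm_smulRight_apply]
      exact mul_le_of_le_one_left (norm_nonneg _) (ContinuousLinearMap.norm_snd_le ℝ P ℝ)
    refine (norm_add_le _ _).trans ?_
    have e1 := (ContinuousLinearMap.norm_iteratedFDeriv_comp_left
      ((ContinuousLinearMap.compL ℝ (P × ℝ) P F).flip (ContinuousLinearMap.fst ℝ P ℝ)) c1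
      le_rfl).trans (mul_le_of_le_one_left (norm_nonneg _) n1)
    have e2 := (ContinuousLinearMap.norm_iteratedFDeriv_comp_left
      ((ContinuousLinearMap.smulRightL ℝ (P × ℝ) F) (ContinuousLinearMap.snd ℝ P ℝ)) c2
      le_rfl).trans (mul_le_of_le_one_left (norm_nonneg _) n2)
    calc _ ≤ 2 ^ n * C + 2 ^ n * C := add_le_add (e1.trans h2) (e2.trans h1)
      _ = 2 ^ (n + 1) * C := by ring

theorem iteratedDeriv_comp_mul (l : ℕ) (c : ℝ) (f : ℝ → F) :
    iteratedDeriv l (fun s => f (c * s)) = fun s => c ^ l • iteratedDeriv l f (c * s) := by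
  induction l with
  | zero => simp
  | succ l ih =>
    funext s
    have h := deriv_comp_mul_left c (iteratedDeriv l f) s
    rw [iteratedDeriv_succ, ih, deriv_fun_const_smul_field, h, iteratedDeriv_succ, smul_smul,
      ← pow_succ]

end Mixed

/-! ### Symbol classes near null infinity -/

section Symbols

variable {d : ℕ} {F G H : Type} [NormedAddCommGroup F] [NormedSpace ℝ F]
  [NormedAddCommGroup G] [NormedSpace ℝ G] [NormedAddCommGroup H] [NormedSpace ℝ H]

def SmoothNear (f : Spacetime d → F) : Prop :=
  ∃ V, IsNhdScri V ∧ ContDiffOn ℝ ∞ f V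

theorem SmoothNear.congr {f g : Spacetime d → F} (hf : SmoothNear f) {V : Set (Spacetime d)}
    (hV : IsNhdScri V) (h : EqOn f g V) : SmoothNear g := by
  obtain ⟨W, hW, hfW⟩ := hf
  exact ⟨W ∩ V, hW.inter hV, (hfW.mono inter_subset_left).congr fun x hx => (h hx.2).symm⟩

theorem SmoothNear.add {f g : Spacetime d → F} (hf : SmoothNear f) (hg : SmoothNear g) :
    SmoothNear fun x => f x + g x := by
  obtain ⟨V, hV, hf⟩ := hf
  obtain ⟨W, hW, hg⟩ := hg
  exact ⟨V ∩ W, hV.inter hW, (hf.mono inter_subset_left).add (hg.mono inter_subset_right)⟩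

theorem SmoothNear.clm {f : Spacetime d → F} (hf : SmoothNear f) (A : F →L[ℝ] G) :
    SmoothNear fun x => A (f x) := by
  obtain ⟨V, hV, hf⟩ := hf
  exact ⟨V, hV, A.contDiff.comp_contDiffOn hf⟩

theorem SmoothNear.bilinear {f : Spacetime d → F} {g : Spacetime d → G} (hf : SmoothNear f)
    (hg : SmoothNear g) (B : F →L[ℝ] G →L[ℝ] H) : SmoothNear fun x => B (f x) (g x) := by
  obtain ⟨V, hV, hf⟩ := hf
  obtain ⟨W, hW, hg⟩ := hg
  exact ⟨V ∩ W, hV.inter hW, (B.contDiff.comp_contDiffOn (hf.mono inter_subset_left)).clm_apply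
    (hg.mono inter_subset_right)⟩

theorem SmoothNear.fderiv {f : Spacetime d → F} (hf : SmoothNear f) : SmoothNear (fderiv ℝ f) := by
  obtain ⟨V, hV, hf⟩ := hf
  exact ⟨V, hV, hf.fderiv_of_isOpen hV.1 (by simp)⟩

theorem contDiffAt_rescale {L : ℝ} {q : Par d} (hq : q.1.2 ≠ 0) :
    ContDiffAt ℝ ∞ (rescale L) q := by
  have h1 : ContDiffAt ℝ ∞ (fun q : Par d => dir q.1.2) q :=
    ContDiffAt.comp (g := dir) (f := fun q : Par d => q.1.2) q (contDiffAt_dir hq)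
      (by fun_prop)
  unfold rescale point
  exact ContDiffAt.prodMk (by fun_prop) (ContDiffAt.smul (f := fun q : Par d => L * q.2)
    (by fun_prop) h1)

/-- `f` is smooth near null infinity, and `f` and its derivatives there are `O(r^(-κ))`. -/
structure Sym (κ : ℝ) (f : Spacetime d → F) : Prop where
  smooth : SmoothNear f
  fam : FamO κ fun L q => f (rescale L q)

namespace Sym

variable {κ κ' : ℝ} {f g : Spacetime d → F}

theorem congr (hf : Sym κ f) {V : Set (Spacetime d)} (hV : IsNhdScri V) (h : EqOn f g V) :
    Sym κ g := by
  refine ⟨hf.smooth.congr hV h, hf.fam.congr fun T => ?_⟩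
  filter_upwards [hV.eventually_rescale T] with z hz
  filter_upwards [hz] with q hq using h hq

theorem mono (hf : Sym κ f) (h : κ' ≤ κ) : Sym κ' f := ⟨hf.smooth, hf.fam.mono h⟩

theorem clm (hf : Sym κ f) (A : F →L[ℝ] G) : Sym κ fun x => A (f x) :=
  ⟨hf.smooth.clm A, hf.fam.clm A⟩

theorem add (hf : Sym κ f) (hg : Sym κ g) : Sym κ fun x => f x + g x :=
  ⟨hf.smooth.add hg.smooth, hf.fam.add hg.fam⟩

theorem const_smul (hf : Sym κ f) (c : ℝ) : Sym κ fun x => c • f x :=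
  hf.clm (c • ContinuousLinearMap.id ℝ F)

theorem neg (hf : Sym κ f) : Sym κ fun x => -f x := by
  simpa using hf.const_smul (-1)

theorem sub (hf : Sym κ f) (hg : Sym κ g) : Sym κ fun x => f x - g x := by
  simpa only [sub_eq_add_neg] using hf.add hg.neg

theorem zero (κ : ℝ) : Sym κ (fun _ => 0 : Spacetime d → F) :=
  ⟨⟨_, isNhdScri_lt_norm 0, contDiffOn_const⟩, FamO.zero κ⟩

theorem sum {ι : Type*} (s : Finset ι) {f : ι → Spacetime d → F} (hf : ∀ i ∈ s, Sym κ (f i)) :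
    Sym κ fun x => ∑ i ∈ s, f i x := by
  classical
  induction s using Finset.induction_on with
  | empty => simpa using zero κ
  | insert i s hi ih =>
    simp only [Finset.sum_insert hi]
    exact (hf i (by simp)).add (ih fun j hj => hf j (by simp [hj]))

theorem bilinear {g : Spacetime d → G} (hf : Sym κ f) (hg : Sym κ' g) (B : F →L[ℝ] G →L[ℝ] H) :
    Sym (κ + κ') fun x => B (f x) (g x) :=
  ⟨hf.smooth.bilinear hg.smooth B, hf.fam.bilinear B hg.fam⟩

end Sym

theorem hasFDerivAt_norm {y : Space d} (hy : y ≠ 0) :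
    HasFDerivAt (fun y : Space d => ‖y‖) (innerSL ℝ (dir y)) y := by
  have h1 : HasFDerivAt (fun y : Space d => ‖y‖ ^ 2) (2 • innerSL ℝ y) y :=
    (hasStrictFDerivAt_norm_sq y).hasFDerivAt
  have h2 := h1.sqrt (pow_ne_zero 2 (norm_ne_zero_iff.2 hy))
  simp only [Real.sqrt_sq (norm_nonneg _)] at h2
  convert! h2 using 1
  ext v
  simp only [dir, innerSL_apply_apply, inner_smul_left, RCLike.conj_to_real,
    smul_apply, smul_eq_mul, nsmul_eq_mul, Nat.cast_ofNat]
  field_simp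

/-- A lift of a constant vector of spacetime through `rescale L`, split as
`liftVec0 + L⁻¹ liftVec1`. -/
def liftVec0 (q : Par d) : Spacetime d →L[ℝ] Par d :=
  ((ContinuousLinearMap.inl ℝ (ℝ × Space d) ℝ).comp (ContinuousLinearMap.inl ℝ ℝ (Space d))).comp
    (ContinuousLinearMap.fst ℝ ℝ (Space d)
      - (innerSL ℝ (dir q.1.2)).comp (ContinuousLinearMap.snd ℝ ℝ (Space d)))

def liftVec1 (q : Par d) : Spacetime d →L[ℝ] Par d :=
  (‖q.1.2‖ / q.2) • ((ContinuousLinearMap.inl ℝ (ℝ × Space d) ℝ).comp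
      (ContinuousLinearMap.inr ℝ ℝ (Space d))).comp (ContinuousLinearMap.snd ℝ ℝ (Space d))
    + (ContinuousLinearMap.inr ℝ (ℝ × Space d) ℝ).comp
      ((innerSL ℝ (dir q.1.2)).comp (ContinuousLinearMap.snd ℝ ℝ (Space d)))

/-- Expresses inertial derivatives through derivatives in the rescaled parameters. Only the
derivative of retarded time survives at leading order; directions along the sphere and along `r`
carry a factor `L⁻¹`. -/
theorem fderiv_rescale {f : Spacetime d → F} {L : ℝ} {q : Par d} (hL : 0 < L) (hσ : 0 < q.2)
    (hy : q.1.2 ≠ 0) (hf : DifferentiableAt ℝ f (rescale L q)) :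
    fderiv ℝ f (rescale L q) =
      (fderiv ℝ (fun q => f (rescale L q)) q).comp (liftVec0 q + L⁻¹ • liftVec1 q) := by
  obtain ⟨⟨u, y⟩, σ⟩ := q
  simp only at hσ hy
  set x0 := rescale L ((u, y), σ) with hx0
  have hx2 : x0.2 = (L * σ) • dir y := rfl
  have hLσ : 0 < L * σ := mul_pos hL hσ
  have hn : ‖x0.2‖ = L * σ := point_snd_norm hLσ.le hy
  have hd : dir x0.2 = dir y := point_dir hLσ
  have hx2n : x0.2 ≠ 0 := norm_pos_iff.1 (by rw [hn]; exact hLσ)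
  -- `rescale L` only sees the direction of `y`, so it is not injective. `Ξ` is a right inverse
  -- normalised to pass through the given point, and the chain rule is applied to `f` as the
  -- composite of its rescaling with `Ξ`.
  let Ξ : Spacetime d → Par d := fun x => ((x.1 - ‖x.2‖, (‖y‖ / (L * σ)) • x.2), ‖x.2‖ / L)
  have hyp : 0 < ‖y‖ / (L * σ) := div_pos (norm_pos_iff.2 hy) hLσ
  have hΞ0 : Ξ x0 = ((u, y), σ) := by
    simp only [Ξ, hn]
    refine Prod.ext (Prod.ext ?_ ?_) ?_
    · simp [hx0, rescale, point]
    · simp only [hx2, smul_smul]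
      rw [div_mul_cancel₀ _ hLσ.ne', norm_smul_dir]
    · simp only; field_simp
  have hsec : ∀ x : Spacetime d, rescale L (Ξ x) = x := by
    intro x
    simp only [Ξ, rescale, mul_div_cancel₀ _ hL.ne', point, dir_smul hyp, norm_smul_dir,
      sub_add_cancel]
  have hnorm : HasFDerivAt (fun x : Spacetime d => ‖x.2‖)
      ((innerSL ℝ (dir y)).comp (ContinuousLinearMap.snd ℝ ℝ (Space d))) x0 := by
    have := (hasFDerivAt_norm hx2n).comp x0 (hasFDerivAt_snd (𝕜 := ℝ) (p := x0))
    rwa [hd] at this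
  have hΞ : HasFDerivAt Ξ (liftVec0 ((u, y), σ) + L⁻¹ • liftVec1 ((u, y), σ)) x0 := by
    have h1 := ((hasFDerivAt_fst (𝕜 := ℝ) (p := x0)).sub hnorm).prodMk
      ((hasFDerivAt_snd (𝕜 := ℝ) (p := x0)).const_smul (‖y‖ / (L * σ)))
    have h2 := h1.prodMk (hnorm.mul_const L⁻¹)
    refine (h2.congr_fderiv ?_).congr_of_eventuallyEq ?_
    · refine ContinuousLinearMap.ext fun v => Prod.ext (Prod.ext ?_ ?_) ?_
      · simp [liftVec0, liftVec1]
      · simp only [liftVec0, liftVec1, add_apply,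
          smul_apply, ContinuousLinearMap.comp_apply,
          ContinuousLinearMap.prod_apply, ContinuousLinearMap.inl_apply,
          ContinuousLinearMap.inr_apply, Prod.snd_add, Prod.fst_add, Prod.smul_fst, Prod.smul_snd,
          zero_add, add_zero, smul_smul, ContinuousLinearMap.coe_snd']
        congr 1
        field_simp
      · simp [liftVec0, liftVec1]
    · exact Eventually.of_forall fun x => by simp [Ξ, div_eq_mul_inv]
  have hcomp : f = (fun q => f (rescale L q)) ∘ Ξ := by
    funext x; simp [hsec]
  have hg : DifferentiableAt ℝ (fun q => f (rescale L q)) (Ξ x0) := by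
    rw [hΞ0]
    exact DifferentiableAt.comp (g := f) _ hf ((contDiffAt_rescale hy).differentiableAt (by simp))
  have := (hg.hasFDerivAt.comp x0 hΞ).fderiv
  rw [← hcomp, hΞ0] at this
  exact this

theorem contDiffOn_dir_par :
    ContDiffOn ℝ ∞ (fun q : Par d => dir q.1.2) {q : Par d | q.1.2 ≠ 0 ∧ 0 < q.2} :=
  fun q hq => (ContDiffAt.comp (g := dir) (f := fun q : Par d => q.1.2) q (contDiffAt_dir hq.1)
      (by fun_prop)).contDiffWithinAt

theorem famO_liftVec0 : FamO 0 fun _ => (liftVec0 : Par d → Spacetime d →L[ℝ] Par d) := by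
  refine FamO.const ?_
  unfold liftVec0
  refine contDiffOn_const.clm_comp (contDiffOn_const.sub (ContDiffOn.clm_comp ?_ contDiffOn_const))
  exact (innerSL ℝ).contDiff.comp_contDiffOn contDiffOn_dir_par

theorem famO_liftVec1 : FamO 0 fun _ => (liftVec1 : Par d → Spacetime d →L[ℝ] Par d) := by
  refine FamO.const ?_
  unfold liftVec1
  refine ContDiffOn.add (ContDiffOn.smul (f := fun q : Par d => ‖q.1.2‖ / q.2) ?_
    contDiffOn_const) (contDiffOn_const.clm_comp (ContDiffOn.clm_comp ?_ contDiffOn_const))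
  · intro q hq
    refine ContDiffAt.contDiffWithinAt (ContDiffAt.div ?_ (by fun_prop) hq.2.ne')
    exact ContDiffAt.comp (g := norm) (f := fun q : Par d => q.1.2) q (contDiffAt_norm ℝ hq.1)
      (by fun_prop)
  · exact (innerSL ℝ).contDiff.comp_contDiffOn contDiffOn_dir_par

/-- No power is gained, since a `u`-derivative does not improve decay; none is lost, since the lifts
of constant vectors are bounded families. -/
theorem Sym.fderiv {κ : ℝ} {f : Spacetime d → F} (hf : Sym κ f) : Sym κ (fderiv ℝ f) := by
  refine ⟨hf.smooth.fderiv, ?_⟩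
  have h0 := hf.fam.fderiv.bilinear (ContinuousLinearMap.compL ℝ (Spacetime d) (Par d) F)
    famO_liftVec0
  have h1 := (hf.fam.fderiv.bilinear (ContinuousLinearMap.compL ℝ (Spacetime d) (Par d) F)
    famO_liftVec1).rpow_smul 1
  rw [add_zero] at h0 h1
  refine (h0.add (h1.mono (by linarith))).congr fun T => ?_
  obtain ⟨V, hV, hfV⟩ := hf.smooth
  filter_upwards [hV.eventually_rescale T, eventually_scri_norm T, eventually_scri_ge T 1]
    with z hz1 hz2 hz3
  have hy : ∀ᶠ q in 𝓝 ((z.2, 1) : Par d), q.1.2 ≠ 0 :=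
    (isOpen_ne_fun (by fun_prop) (by fun_prop)).mem_nhds (ne_zero_of_norm_eq_one hz2.2)
  have hσ : ∀ᶠ q in 𝓝 ((z.2, 1) : Par d), 0 < q.2 :=
    continuous_snd.continuousAt.eventually (lt_mem_nhds one_pos)
  filter_upwards [hz1, hy, hσ] with q h1 h2 h3
  rw [fderiv_rescale (by linarith) h3 h2 (ContDiffOn.differentiableAt_top hV.1 hfV h1)]
  simp [Real.rpow_neg_one, ContinuousLinearMap.comp_add]

/-- All the mixed derivative bounds of the expansion in the definition of `HasExpansion`. -/
def MixedO (κ : ℝ) (h : Spacetime d → F) : Prop :=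
  ∀ (m l : ℕ) (T : ℝ), (fun z : ℝ × (ℝ × Space d) => iteratedFDeriv ℝ m (fun p : ℝ × Space d =>
      iteratedDeriv l (fun s : ℝ => h (point p.1 s p.2)) z.1) z.2) =O[scri d T]
    fun z => z.1 ^ (-κ - (l : ℝ))

theorem SmoothNear.eventually_contDiffOn {h : Spacetime d → F} (hs : SmoothNear h) (T : ℝ) :
    ∀ᶠ z in scri d T, ∃ N : Set (Par d), IsOpen N ∧ (z.2, 1) ∈ N ∧
      ContDiffOn ℝ ∞ (fun q => h (rescale z.1 q)) N := by
  obtain ⟨V, hV, hh⟩ := hs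
  filter_upwards [hV.eventually_rescale T, eventually_scri_norm T] with z hz hz2
  have hy : ∀ᶠ q in 𝓝 ((z.2, 1) : Par d), q.1.2 ≠ 0 :=
    (isOpen_ne_fun (by fun_prop) (by fun_prop)).mem_nhds (ne_zero_of_norm_eq_one hz2.2)
  obtain ⟨N, hN, hNo, hzN⟩ := mem_nhds_iff.1 (hz.and hy)
  refine ⟨N, hNo, hzN, fun q hq => ?_⟩
  exact ((hh.contDiffAt (hV.1.mem_nhds (hN hq).1)).comp q
    (contDiffAt_rescale (hN hq).2)).contDiffWithinAt

/-- With `r = Lσ` one has `∂_r = L⁻¹ ∂_σ`: the gain of `1/r` per radial derivative is built into the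
rescaling. -/
theorem mixed_eq {h : Spacetime d → F} {L : ℝ} (hL : 0 < L) {p : ℝ × Space d} {N : Set (Par d)}
    (hN : IsOpen N) (hp : (p, 1) ∈ N) (hh : ContDiffOn ℝ ∞ (fun q => h (rescale L q)) N)
    (m l : ℕ) :
    iteratedFDeriv ℝ m (fun p : ℝ × Space d =>
      iteratedDeriv l (fun s : ℝ => h (point p.1 s p.2)) L) p
    = (L ^ l)⁻¹ • iteratedFDeriv ℝ m
      (fun p => lastDeriv^[l] (fun q => h (rescale L q)) (p, 1)) p := by
  have hc : Continuous fun t : ℝ × Space d => (t, (1 : ℝ)) := by fun_prop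
  have hev := hc.continuousAt.eventually (hN.mem_nhds hp)
  have h1 : (fun p : ℝ × Space d => iteratedDeriv l (fun s : ℝ => h (point p.1 s p.2)) L) =ᶠ[𝓝 p]
      fun p => (L ^ l)⁻¹ • lastDeriv^[l] (fun q => h (rescale L q)) (p, 1) := by
    filter_upwards [hev] with t ht
    rw [← iteratedDeriv_slice hN hh l ht]
    have := congrFun (iteratedDeriv_comp_mul l L fun s : ℝ => h (point t.1 s t.2)) 1
    simp only [mul_one] at this
    simp only [rescale]
    rw [this, smul_smul, inv_mul_cancel₀ (pow_ne_zero _ hL.ne'), one_smul]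
  rw [(h1.iteratedFDeriv ℝ m).eq_of_nhds]
  refine iteratedFDeriv_const_smul_apply' ?_
  exact (((ContDiffOn.lastDeriv_iterate hN hh l).contDiffAt (hN.mem_nhds hp)).comp p
    (by fun_prop : ContDiffAt ℝ ∞ (fun t : ℝ × Space d => (t, (1 : ℝ))) p)).top_to_nat m

/-- The powers `L ^ l` produced by rescaling cancel the gain of the `l` radial derivatives; mixed
derivatives then control the total ones. -/
theorem MixedO.sym {κ : ℝ} {h : Spacetime d → F} (hs : SmoothNear h) (hm : MixedO κ h) :
    Sym κ h := by
  refine ⟨hs, fun T => ?_, fun T n => ?_⟩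
  · filter_upwards [hs.eventually_contDiffOn T] with z ⟨N, hN, hz, hc⟩
    exact hc.contDiffAt (hN.mem_nhds hz)
  · have h1 : ∀ m l : ℕ, ∃ C : ℝ, ∀ᶠ z in scri d T, ‖iteratedFDeriv ℝ m
        (fun p => lastDeriv^[l] (fun q => h (rescale z.1 q)) (p, 1)) z.2‖ ≤ C * z.1 ^ (-κ) := by
      intro m l
      obtain ⟨C, hC⟩ := (hm m l T).bound
      refine ⟨C, ?_⟩
      filter_upwards [hC, hs.eventually_contDiffOn T, eventually_scri_ge T 1]
        with z hz ⟨N, hN, hzN, hc⟩ hz1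
      have hz0 : 0 < z.1 := by linarith
      rw [mixed_eq hz0 hN hzN hc, norm_smul, norm_inv, Real.norm_of_nonneg (by positivity),
        Real.norm_of_nonneg (by positivity), Real.rpow_sub hz0, Real.rpow_natCast,
        inv_mul_le_iff₀ (by positivity)] at hz
      refine hz.trans (le_of_eq ?_)
      field_simp
    choose C hC using h1
    -- A single constant that dominates all the finitely many `C m l`.
    let C' := ∑ m ∈ Finset.range (n + 1), ∑ l ∈ Finset.range (n + 1), |C m l|
    refine IsBigO.of_bound (2 ^ n * C') ?_
    have hall : ∀ᶠ z in scri d T, ∀ m ∈ Finset.range (n + 1), ∀ l ∈ Finset.range (n + 1),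
        ‖iteratedFDeriv ℝ m (fun p => lastDeriv^[l] (fun q => h (rescale z.1 q)) (p, 1)) z.2‖
          ≤ C m l * z.1 ^ (-κ) := by
      rw [eventually_all_finset]; intro m _
      rw [eventually_all_finset]; exact fun l _ => hC m l
    filter_upwards [hall, hs.eventually_contDiffOn T, eventually_scri_ge T 1]
      with z hz ⟨N, hN, hzN, hc⟩ hz1
    have hz0 : 0 < z.1 := by linarith
    rw [mul_assoc, Real.norm_of_nonneg (by positivity)]
    refine norm_iteratedFDeriv_le_of_mixed n hN hc hzN fun m l hm hl => ?_
    have hm' : m ∈ Finset.range (n + 1) := by simp; omega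
    have hl' : l ∈ Finset.range (n + 1) := by simp; omega
    refine (hz m hm' l hl').trans ?_
    refine mul_le_mul_of_nonneg_right ?_ (by positivity)
    refine (le_abs_self _).trans ?_
    refine (Finset.single_le_sum (f := fun l => |C m l|) (fun _ _ => abs_nonneg _) hl').trans ?_
    exact Finset.single_le_sum (f := fun m => ∑ l ∈ Finset.range (n + 1), |C m l|)
      (fun _ _ => Finset.sum_nonneg fun _ _ => abs_nonneg _) hm'

/-- The converse passage: a mixed derivative is a component of the total derivative of order `m +
l`. -/
theorem Sym.mixedO {κ : ℝ} {h : Spacetime d → F} (hs : Sym κ h) : MixedO κ h := by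
  intro m l T
  obtain ⟨C, hC⟩ := (hs.fam.bound T (m + l)).bound
  refine IsBigO.of_bound C ?_
  filter_upwards [hC, hs.smooth.eventually_contDiffOn T, eventually_scri_ge T 1]
    with z hz ⟨N, hN, hzN, hc⟩ hz1
  have hz0 : 0 < z.1 := by linarith
  rw [mixed_eq hz0 hN hzN hc, norm_smul, norm_inv, Real.norm_of_nonneg (by positivity),
    Real.norm_of_nonneg (by positivity), Real.rpow_sub hz0, Real.rpow_natCast,
    inv_mul_le_iff₀ (by positivity)]
  rw [Real.norm_of_nonneg (by positivity)] at hz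
  have h1 := (norm_iteratedFDeriv_slice_le m hN (ContDiffOn.lastDeriv_iterate hN hc l) hzN).trans
    (norm_iteratedFDeriv_lastDeriv_iterate_le hN hc hzN m l)
  refine (h1.trans hz).trans (le_of_eq ?_)
  field_simp

end Symbols

end

/-! ### Homogeneous coefficients and the wave operator on their lifts -/

section

variable {d : ℕ} {F G H : Type} [NormedAddCommGroup F] [NormedSpace ℝ F]
  [NormedAddCommGroup G] [NormedSpace ℝ G] [NormedAddCommGroup H] [NormedSpace ℝ H]

theorem isOpen_snd_ne_zero : IsOpen {p : ℝ × Space d | p.2 ≠ 0} :=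
  isOpen_ne_fun (by fun_prop) (by fun_prop)

/-- Smooth functions of `(u, y)`, `y ≠ 0`, homogeneous of degree `-a` in `y`. -/
structure Hom (a : ℝ) (f : ℝ × Space d → F) : Prop where
  smooth : ContDiffOn ℝ ∞ f {p | p.2 ≠ 0}
  hom : ∀ (u : ℝ) (y : Space d) (s : ℝ), 0 < s → y ≠ 0 → f (u, s • y) = s ^ (-a) • f (u, y)

/-- The function `x ↦ f (u, x)`, `u = t - |x|`, on spacetime. -/
def lift (f : ℝ × Space d → F) (x : Spacetime d) : F := f (x.1 - ‖x.2‖, x.2)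

/-- Derivative with respect to `u`. -/
def uD (f : ℝ × Space d → F) (p : ℝ × Space d) : F := fderiv ℝ f p (1, 0)

/-- Derivative with respect to `y` in the direction `v`. -/
def yD (v : Space d) (f : ℝ × Space d → F) (p : ℝ × Space d) : F := fderiv ℝ f p (0, v)

/-- The Laplacian in the variable `y`. -/
def lapY (f : ℝ × Space d → F) (p : ℝ × Space d) : F :=
  ∑ i, yD (EuclideanSpace.single i 1) (yD (EuclideanSpace.single i 1) f) p

/-- The vector `∂_t + ∂_r`. -/
def nullVec (p : ℝ × Space d) : Spacetime d := (1, dir p.2)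

namespace Hom

variable {a b : ℝ} {f g : ℝ × Space d → F}

theorem contDiffAt (hf : Hom a f) {p : ℝ × Space d} (hp : p.2 ≠ 0) : ContDiffAt ℝ ∞ f p :=
  hf.smooth.contDiffAt (isOpen_snd_ne_zero.mem_nhds hp)

theorem differentiableAt (hf : Hom a f) {p : ℝ × Space d} (hp : p.2 ≠ 0) :
    DifferentiableAt ℝ f p := (hf.contDiffAt hp).differentiableAt (by simp)

theorem congr (hf : Hom a f) (h : ∀ p : ℝ × Space d, p.2 ≠ 0 → f p = g p) : Hom a g :=
  ⟨hf.smooth.congr fun p hp => (h p hp).symm, fun u y s hs hy => by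
    rw [← h (u, s • y) (smul_ne_zero hs.ne' hy), ← h (u, y) hy, hf.hom u y s hs hy]⟩

theorem clm (hf : Hom a f) (A : F →L[ℝ] G) : Hom a fun p => A (f p) :=
  ⟨A.contDiff.comp_contDiffOn hf.smooth, fun u y s hs hy => by
    rw [hf.hom u y s hs hy, map_smul]⟩

theorem add (hf : Hom a f) (hg : Hom a g) : Hom a fun p => f p + g p :=
  ⟨hf.smooth.add hg.smooth, fun u y s hs hy => by
    rw [hf.hom u y s hs hy, hg.hom u y s hs hy, smul_add]⟩

theorem const_smul (hf : Hom a f) (c : ℝ) : Hom a fun p => c • f p :=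
  hf.clm (c • ContinuousLinearMap.id ℝ F)

theorem neg (hf : Hom a f) : Hom a fun p => -f p := by
  simpa using hf.const_smul (-1)

theorem sub (hf : Hom a f) (hg : Hom a g) : Hom a fun p => f p - g p := by
  simpa only [sub_eq_add_neg] using hf.add hg.neg

theorem zero (a : ℝ) : Hom a (fun _ => 0 : ℝ × Space d → F) :=
  ⟨contDiffOn_const, fun _ _ _ _ _ => by simp⟩

theorem sum {ι : Type*} (s : Finset ι) {f : ι → ℝ × Space d → F} (hf : ∀ i ∈ s, Hom a (f i)) :
    Hom a fun p => ∑ i ∈ s, f i p := by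
  classical
  induction s using Finset.induction_on with
  | empty => simpa using zero a
  | insert i s hi ih =>
    simp only [Finset.sum_insert hi]
    exact (hf i (by simp)).add (ih fun j hj => hf j (by simp [hj]))

theorem bilinear {g : ℝ × Space d → G} (hf : Hom a f) (hg : Hom b g) (B : F →L[ℝ] G →L[ℝ] H) :
    Hom (a + b) fun p => B (f p) (g p) :=
  ⟨(B.contDiff.comp_contDiffOn hf.smooth).clm_apply hg.smooth, fun u y s hs hy => by
    rw [hf.hom u y s hs hy, hg.hom u y s hs hy, map_smul, map_smul, smul_apply, smul_smul,
      ← Real.rpow_add hs]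
    ring_nf⟩

theorem norm : Hom (-1) fun p : ℝ × Space d => ‖p.2‖ :=
  ⟨fun _ hp => ((contDiffAt_norm ℝ hp).comp _ contDiffAt_snd).contDiffWithinAt,
    fun u y s hs hy => by simp [norm_smul, abs_of_pos hs]⟩

theorem norm_inv : Hom 1 fun p : ℝ × Space d => ‖p.2‖⁻¹ :=
  ⟨fun _ hp => (((contDiffAt_norm ℝ hp).comp _ contDiffAt_snd).inv
      (norm_ne_zero_iff.2 hp)).contDiffWithinAt,
    fun u y s hs hy => by
      simp [norm_smul, abs_of_pos hs, mul_comm, Real.rpow_neg_one]⟩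

theorem dir : Hom 0 fun p : ℝ × Space d => Lorenz.dir p.2 :=
  ⟨fun _ hp => ((contDiffAt_dir hp).comp _ contDiffAt_snd).contDiffWithinAt,
    fun u y s hs hy => by simp [dir_smul hs]⟩

theorem const (c : F) : Hom 0 fun _ : ℝ × Space d => c :=
  ⟨contDiffOn_const, fun _ _ _ _ _ => by simp⟩

theorem nullVec : Hom 0 (nullVec : ℝ × Space d → Spacetime d) :=
  ((const (timeVec d)).add (dir.clm (ContinuousLinearMap.inr ℝ ℝ (Space d)))).congr fun p _ => by
    simp [Lorenz.nullVec, timeVec]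

theorem smul {g : ℝ × Space d → ℝ} (hg : Hom b g) (hf : Hom a f) : Hom (b + a) fun p => g p • f p :=
  hg.bilinear hf (ContinuousLinearMap.lsmul ℝ ℝ)

/-- Differentiates the homogeneity relation along the linear map `(u, y) ↦ (u, s y)`. A
`u`-derivative keeps the degree and a `y`-derivative lowers it by one. -/
theorem fderiv_scale (hf : Hom a f) {u s : ℝ} {y : Space d} (hs : 0 < s) (hy : y ≠ 0)
    (b : ℝ) (v : Space d) :
    fderiv ℝ f (u, s • y) (b, s • v) = s ^ (-a) • fderiv ℝ f (u, y) (b, v) := by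
  let A : ℝ × Space d →L[ℝ] ℝ × Space d :=
    (ContinuousLinearMap.id ℝ ℝ).prodMap (s • ContinuousLinearMap.id ℝ (Space d))
  have hA : ∀ p : ℝ × Space d, A p = (p.1, s • p.2) := fun p => rfl
  have h1 : (fun p => f (A p)) =ᶠ[𝓝 (u, y)] fun p => s ^ (-a) • f p := by
    filter_upwards [isOpen_snd_ne_zero.mem_nhds (show ((u, y) : ℝ × Space d).2 ≠ 0 from hy)]
      with p hp
    rw [hA, hf.hom _ _ _ hs hp]
  have hd : DifferentiableAt ℝ f (A (u, y)) := by
    rw [hA]; exact hf.differentiableAt (smul_ne_zero hs.ne' hy)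
  have h2 := (hd.hasFDerivAt.comp (u, y) A.hasFDerivAt).fderiv
  have h3 : fderiv ℝ (f ∘ A) (u, y) = s ^ (-a) • fderiv ℝ f (u, y) := by
    rw [show f ∘ A = fun p => f (A p) from rfl, h1.fderiv_eq]
    exact fderiv_const_smul (hf.differentiableAt hy) _
  rw [h3] at h2
  have := congrArg (fun B => B (b, v)) h2
  simpa [hA] using this.symm

theorem uD (hf : Hom a f) : Hom a (uD f) :=
  ⟨(hf.smooth.fderiv_of_isOpen isOpen_snd_ne_zero (by simp)).clm_apply contDiffOn_const,
    fun u y s hs hy => by simpa [Lorenz.uD] using hf.fderiv_scale hs hy (u := u) 1 0⟩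

theorem yD (hf : Hom a f) (v : Space d) : Hom (a + 1) (yD v f) :=
  ⟨(hf.smooth.fderiv_of_isOpen isOpen_snd_ne_zero (by simp)).clm_apply contDiffOn_const,
    fun u y s hs hy => by
      have := hf.fderiv_scale hs hy (u := u) 0 (s⁻¹ • v)
      rw [smul_inv_smul₀ hs.ne'] at this
      rw [Lorenz.yD, this, Lorenz.yD, show ((0 : ℝ), s⁻¹ • v) = s⁻¹ • ((0 : ℝ), v) by simp,
        map_smul, smul_smul, neg_add, Real.rpow_add hs, Real.rpow_neg_one]⟩

theorem lapY (hf : Hom a f) : Hom (a + 2) (lapY f) := by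
  have : Hom (a + 2) fun p => ∑ i : Fin (d - 1), Lorenz.yD (EuclideanSpace.single i 1)
      (Lorenz.yD (EuclideanSpace.single i 1) f) p := Hom.sum _ fun i _ => by
    have := (hf.yD (EuclideanSpace.single i 1)).yD (EuclideanSpace.single i 1)
    rwa [add_assoc, one_add_one_eq_two] at this
  exact this

/-- Euler's identity. -/
theorem euler (hf : Hom a f) {p : ℝ × Space d} (hp : p.2 ≠ 0) :
    fderiv ℝ f p (0, p.2) = -a • f p := by
  obtain ⟨u, y⟩ := p
  have h1 : HasDerivAt (fun s : ℝ => ((u, s • y) : ℝ × Space d)) (0, y) 1 := by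
    simpa using (hasDerivAt_const (1 : ℝ) u).prodMk ((hasDerivAt_id (1 : ℝ)).smul_const y)
  have hd : DifferentiableAt ℝ f (u, (1 : ℝ) • y) := by
    rw [one_smul]; exact hf.differentiableAt hp
  have h2 := hd.hasFDerivAt.comp_hasDerivAt (1 : ℝ) h1
  have h3 : HasDerivAt (fun s : ℝ => s ^ (-a) • f (u, y)) (-a • f (u, y)) 1 := by
    simpa using (Real.hasDerivAt_rpow_const (x := 1) (p := -a) (by simp)).smul_const (f (u, y))
  have h4 : (fun s : ℝ => s ^ (-a) • f (u, y)) =ᶠ[𝓝 1] (f ∘ fun s : ℝ => (u, s • y)) := by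
    filter_upwards [lt_mem_nhds (one_pos : (0 : ℝ) < 1)] with s hs
    simp [hf.hom u y s hs hp]
  have := (h2.congr_of_eventuallyEq h4).unique h3
  simpa using this

theorem euler_dir (hf : Hom a f) {p : ℝ × Space d} (hp : p.2 ≠ 0) :
    fderiv ℝ f p (0, Lorenz.dir p.2) = (-a * ‖p.2‖⁻¹) • f p := by
  have := hf.euler hp
  rw [Lorenz.dir, show ((0 : ℝ), ‖p.2‖⁻¹ • p.2) = ‖p.2‖⁻¹ • ((0 : ℝ), p.2) by simp, map_smul, this,
    smul_smul, mul_comm]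

theorem lift_rescale (hf : Hom a f) {L : ℝ} {q : Par d} (hL : 0 < L) (hσ : 0 < q.2)
    (hq : q.1.2 ≠ 0) : lift f (rescale L q) = L ^ (-a) • f (q.1.1, q.2 • Lorenz.dir q.1.2) := by
  have hd0 : Lorenz.dir q.1.2 ≠ 0 := ne_zero_of_norm_eq_one (norm_dir hq)
  rw [lift, rescale, point_retarded (mul_pos hL hσ).le hq]
  simp only [point]
  rw [mul_smul, hf.hom _ _ _ hL (smul_ne_zero hσ.ne' hd0)]

theorem contDiffOn_lift (hf : Hom a f) : ContDiffOn ℝ ∞ (lift f) {x : Spacetime d | x.2 ≠ 0} := by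
  intro x hx
  refine ContDiffAt.contDiffWithinAt ?_
  refine ContDiffAt.comp x (hf.contDiffAt (p := (x.1 - ‖x.2‖, x.2)) hx)
    (ContDiffAt.prodMk (contDiffAt_fst.sub ?_) contDiffAt_snd)
  exact (contDiffAt_norm ℝ hx).comp x contDiffAt_snd

theorem smoothNear_lift (hf : Hom a f) : SmoothNear (lift f) :=
  ⟨_, isNhdScri_lt_norm 0, hf.contDiffOn_lift.mono fun x (hx : 0 < ‖x.2‖) => norm_pos_iff.1 hx⟩

theorem sym (hf : Hom a f) : Sym a (lift f) := by
  refine ⟨hf.smoothNear_lift, ?_⟩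
  have h1 : FamO 0 fun _ (q : Par d) => f (q.1.1, q.2 • Lorenz.dir q.1.2) := by
    refine FamO.const fun q hq => ContDiffAt.contDiffWithinAt ?_
    refine ContDiffAt.comp q (hf.contDiffAt (p := (q.1.1, q.2 • Lorenz.dir q.1.2)) ?_) ?_
    · exact smul_ne_zero hq.2.ne' (ne_zero_of_norm_eq_one (norm_dir hq.1))
    · refine ContDiffAt.prodMk (by fun_prop) (ContDiffAt.smul (f := fun q : Par d => q.2)
        (by fun_prop) ?_)
      exact ContDiffAt.comp (g := Lorenz.dir) (f := fun q : Par d => q.1.2) q (contDiffAt_dir hq.1)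
        (by fun_prop)
  have h2 := h1.rpow_smul a
  rw [zero_add] at h2
  refine h2.congr fun T => ?_
  filter_upwards [eventually_scri_norm T, eventually_scri_ge T 1] with z hz2 hz3
  have hy : ∀ᶠ q in 𝓝 ((z.2, 1) : Par d), q.1.2 ≠ 0 :=
    (isOpen_ne_fun (by fun_prop) (by fun_prop)).mem_nhds (ne_zero_of_norm_eq_one hz2.2)
  have hσ : ∀ᶠ q in 𝓝 ((z.2, 1) : Par d), 0 < q.2 :=
    continuous_snd.continuousAt.eventually (lt_mem_nhds one_pos)
  filter_upwards [hy, hσ] with q h2 h3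
  rw [hf.lift_rescale (by linarith) h3 h2]

/-- Along a ray the lift is exactly `L^{-a}` times a fixed value; a bound by a higher negative power
forces this value to be zero. This is what makes expansion coefficients unique. -/
theorem eq_zero_of_sym (hf : Hom a f) {κ : ℝ} (hs : Sym κ (lift f)) (hκ : a < κ)
    {p : ℝ × Space d} (hp : p.2 ≠ 0) : f p = 0 := by
  have hθ := norm_dir hp
  suffices h0 : f (p.1, Lorenz.dir p.2) = 0 by
    have := hf.hom p.1 (Lorenz.dir p.2) ‖p.2‖ (norm_pos_iff.2 hp) (ne_zero_of_norm_eq_one hθ)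
    rwa [norm_smul_dir, h0, smul_zero] at this
  obtain ⟨C, hC⟩ := (hs.fam.bound |p.1| 0).bound
  obtain ⟨R, hR⟩ := eventually_scri.1 hC
  have h1 : ∀ᶠ L : ℝ in atTop, ‖f (p.1, Lorenz.dir p.2)‖ ≤ C * L ^ (-(κ - a)) := by
    filter_upwards [eventually_ge_atTop R, eventually_ge_atTop 1] with L hL hL1
    have hL0 : 0 < L := by linarith
    have := hR L hL p.1 (Lorenz.dir p.2) le_rfl hθ
    have hl := hf.lift_rescale (q := ((p.1, Lorenz.dir p.2), 1)) hL0 one_pos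
      (ne_zero_of_norm_eq_one hθ)
    simp only [one_smul, dir_dir] at hl
    rw [norm_iteratedFDeriv_zero] at this
    replace this : ‖lift f (rescale L ((p.1, Lorenz.dir p.2), 1))‖ ≤ C * ‖L ^ (-κ)‖ := this
    rw [hl, norm_smul] at this
    rw [Real.norm_of_nonneg (by positivity), Real.norm_of_nonneg (by positivity)] at this
    have h2 : L ^ (-(κ - a)) = L ^ a * L ^ (-κ) := by
      rw [← Real.rpow_add hL0]; ring_nf
    have h3 : L ^ a * L ^ (-a) = 1 := by rw [← Real.rpow_add hL0]; simp
    calc ‖f (p.1, Lorenz.dir p.2)‖ = L ^ a * (L ^ (-a) * ‖f (p.1, Lorenz.dir p.2)‖) := by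
          rw [← mul_assoc, h3, one_mul]
      _ ≤ L ^ a * (C * L ^ (-κ)) := mul_le_mul_of_nonneg_left this (by positivity)
      _ = C * L ^ (-(κ - a)) := by rw [h2]; ring
  have h2 : Tendsto (fun L : ℝ => C * L ^ (-(κ - a))) atTop (𝓝 0) := by
    simpa using (tendsto_rpow_neg_atTop (by linarith : 0 < κ - a)).const_mul C
  exact norm_le_zero_iff.1 (ge_of_tendsto h2 h1)

end Hom

/-- Horizontal lift of a constant vector of spacetime to the coordinates `(u, y)`. -/
def toUY (p : ℝ × Space d) : Spacetime d →L[ℝ] ℝ × Space d :=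
  (ContinuousLinearMap.fst ℝ ℝ (Space d)
    - (innerSL ℝ (dir p.2)).comp (ContinuousLinearMap.snd ℝ ℝ (Space d))).prod
    (ContinuousLinearMap.snd ℝ ℝ (Space d))

theorem toUY_apply (p : ℝ × Space d) (v : Spacetime d) :
    toUY p v = (v.1 - inner ℝ (dir p.2) v.2, v.2) := rfl

/-- The derivative of a lift, as a function of `(u, y)`. -/
def liftD (f : ℝ × Space d → F) (p : ℝ × Space d) : Spacetime d →L[ℝ] F :=
  (fderiv ℝ f p).comp (toUY p)

theorem hasFDerivAt_lift {f : ℝ × Space d → F} {x : Spacetime d} (hx : x.2 ≠ 0)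
    (hf : DifferentiableAt ℝ f (x.1 - ‖x.2‖, x.2)) :
    HasFDerivAt (lift f) (lift (liftD f) x) x := by
  have h1 : HasFDerivAt (fun x : Spacetime d => ((x.1 - ‖x.2‖, x.2) : ℝ × Space d))
      (toUY (x.1 - ‖x.2‖, x.2)) x :=
    ((hasFDerivAt_fst (𝕜 := ℝ) (p := x)).sub
      ((hasFDerivAt_norm hx).comp x (hasFDerivAt_snd (𝕜 := ℝ) (p := x)))).prodMk
      (hasFDerivAt_snd (𝕜 := ℝ) (p := x))
  exact hf.hasFDerivAt.comp x h1

theorem contDiffOn_dir_snd :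
    ContDiffOn ℝ ∞ (fun p : ℝ × Space d => dir p.2) {p | p.2 ≠ 0} := Hom.dir.smooth

theorem contDiffOn_toUY :
    ContDiffOn ℝ ∞ (toUY : ℝ × Space d → Spacetime d →L[ℝ] ℝ × Space d) {p | p.2 ≠ 0} := by
  have h : (toUY : ℝ × Space d → Spacetime d →L[ℝ] ℝ × Space d) = fun p =>
      (ContinuousLinearMap.inl ℝ ℝ (Space d)).comp (ContinuousLinearMap.fst ℝ ℝ (Space d)
      - (innerSL ℝ (dir p.2)).comp (ContinuousLinearMap.snd ℝ ℝ (Space d)))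
      + (ContinuousLinearMap.inr ℝ ℝ (Space d)).comp (ContinuousLinearMap.snd ℝ ℝ (Space d)) := by
    funext p
    refine ContinuousLinearMap.ext fun v => ?_
    simp [toUY]
  rw [h]
  refine ContDiffOn.add (contDiffOn_const.clm_comp (contDiffOn_const.sub
    (ContDiffOn.clm_comp ?_ contDiffOn_const))) contDiffOn_const
  exact (innerSL ℝ).contDiff.comp_contDiffOn contDiffOn_dir_snd

theorem Hom.contDiffOn_liftD {a : ℝ} {f : ℝ × Space d → F} (hf : Hom a f) :
    ContDiffOn ℝ ∞ (liftD f) {p | p.2 ≠ 0} :=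
  (hf.smooth.fderiv_of_isOpen isOpen_snd_ne_zero (by simp)).clm_comp contDiffOn_toUY

/-- The trace with respect to the Minkowski metric. -/
def etaTrace (d : ℕ) (F : Type) [NormedAddCommGroup F] [NormedSpace ℝ F] :
    (Spacetime d →L[ℝ] Spacetime d →L[ℝ] F) →L[ℝ] F :=
  -((ContinuousLinearMap.apply ℝ F (timeVec d)).comp
      (ContinuousLinearMap.apply ℝ (Spacetime d →L[ℝ] F) (timeVec d)))
    + ∑ i, (ContinuousLinearMap.apply ℝ F (spaceVec d i)).comp
      (ContinuousLinearMap.apply ℝ (Spacetime d →L[ℝ] F) (spaceVec d i))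

theorem etaTrace_apply (B : Spacetime d →L[ℝ] Spacetime d →L[ℝ] F) :
    etaTrace d F B = -(B (timeVec d) (timeVec d)) + ∑ i, B (spaceVec d i) (spaceVec d i) := by
  simp [etaTrace, sum_apply]
  rfl

theorem divergence_eq (A : Spacetime d → Covector d) :
    divergence A = fun x => etaTrace d ℝ (fderiv ℝ A x) := by
  funext x; rw [etaTrace_apply]; rfl

theorem box_eq {f : Spacetime d → F} {x : Spacetime d} (hf : ContDiffAt ℝ ∞ f x) :
    box f x = etaTrace d F (fderiv ℝ (fderiv ℝ f) x) := by
  have hd : DifferentiableAt ℝ (fderiv ℝ f) x :=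
    (contDiffAt_top_fderiv hf).differentiableAt (by simp)
  have h : ∀ v : Spacetime d, pderiv v (pderiv v f) x = fderiv ℝ (fderiv ℝ f) x v v := by
    intro v
    show fderiv ℝ (fun x => fderiv ℝ f x v) x v = _
    rw [fderiv_clm_apply hd (by fun_prop)]
    simp
  rw [etaTrace_apply, box]
  simp [h]

theorem fderiv_dir_apply {y : Space d} (hy : y ≠ 0) (v : Space d) :
    fderiv ℝ (dir : Space d → Space d) y v = ‖y‖⁻¹ • (v - inner ℝ (dir y) v • dir y) := by
  have hn := norm_ne_zero_iff.2 hy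
  have h1 : HasFDerivAt (fun y : Space d => ‖y‖⁻¹) (-(‖y‖ ^ 2)⁻¹ • innerSL ℝ (dir y)) y :=
    (hasDerivAt_inv hn).comp_hasFDerivAt y (hasFDerivAt_norm hy)
  have h2 : HasFDerivAt (dir : Space d → Space d) _ y := h1.smul (hasFDerivAt_id y)
  rw [h2.fderiv]
  show ‖y‖⁻¹ • v + (-(‖y‖ ^ 2)⁻¹ * inner ℝ (dir y) v) • y = _
  have h3 : ∀ c : ℝ, c • y = (c * ‖y‖) • dir y := fun c => by rw [mul_smul, norm_smul_dir]
  rw [h3, smul_sub, smul_smul, sub_eq_add_neg, ← neg_smul]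
  congr 2
  field_simp

theorem inner_single (v : Space d) (i : Fin (d - 1)) :
    inner ℝ v (EuclideanSpace.single i (1 : ℝ)) = v i := by
  rw [EuclideanSpace.inner_single_right]; simp

theorem sum_apply_single {G' : Type*} [NormedAddCommGroup G'] [NormedSpace ℝ G']
    (A : Space d →L[ℝ] G') (v : Space d) :
    ∑ i, v i • A (EuclideanSpace.single i 1) = A v := by
  have : v = ∑ i, v i • EuclideanSpace.single i (1 : ℝ) := by
    ext j; simp [Pi.single_apply]
  conv_rhs => rw [this, map_sum]
  simp

theorem sum_dir_sq {y : Space d} (hy : y ≠ 0) : ∑ i, dir y i * dir y i = 1 := by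
  have := norm_dir hy
  rw [EuclideanSpace.norm_eq, Real.sqrt_eq_one] at this
  rw [← this]
  exact Finset.sum_congr rfl fun i _ => by rw [Real.norm_eq_abs, sq_abs, sq]

/-- The divergence of a lift. -/
theorem etaTrace_liftD {f : ℝ × Space d → Covector d} (p : ℝ × Space d) :
    etaTrace d ℝ (liftD f p) = -(uD f p (nullVec p))
      + ∑ i, yD (EuclideanSpace.single i 1) f p (spaceVec d i) := by
  have h1 : ∀ i : Fin (d - 1), liftD f p (spaceVec d i) (spaceVec d i)
      = -(dir p.2 i • uD f p (spaceVec d i))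
        + yD (EuclideanSpace.single i 1) f p (spaceVec d i) := by
    intro i
    have : toUY p (spaceVec d i) = -(dir p.2 i • ((1 : ℝ), (0 : Space d)))
        + ((0 : ℝ), EuclideanSpace.single i (1 : ℝ)) := by
      simp [toUY_apply, spaceVec, inner_single]
    simp only [liftD, ContinuousLinearMap.comp_apply, this, map_add, map_neg, map_smul]
    rfl
  have h2 : liftD f p (timeVec d) (timeVec d) = uD f p (timeVec d) := by
    simp [liftD, toUY_apply, timeVec, uD]
  have h3 : nullVec p = timeVec d + ∑ i, dir p.2 i • spaceVec d i := by
    refine Prod.ext ?_ ?_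
    · simp [nullVec, timeVec, spaceVec, Prod.fst_sum]
    · ext j
      simp [nullVec, timeVec, spaceVec, Prod.snd_sum, Pi.single_apply]
  rw [etaTrace_apply, h2, h3]
  simp only [h1, map_add, map_sum, map_smul, Finset.sum_add_distrib, Finset.sum_neg_distrib]
  ring

theorem card_space (hd : 1 ≤ d) : ((Fintype.card (Fin (d - 1)) : ℕ) : ℝ) = (d : ℝ) - 1 := by
  simp [Nat.cast_sub hd]

/-- The wave operator on a homogeneous lift. -/
theorem etaTrace_liftD_liftD {a : ℝ} {f : ℝ × Space d → F} (hd : 1 ≤ d) (hf : Hom a f)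
    {p : ℝ × Space d} (hp : p.2 ≠ 0) :
    etaTrace d F (liftD (liftD f) p)
      = ((2 * a - (d - 2)) * ‖p.2‖⁻¹) • uD f p + lapY f p := by
  have hD : DifferentiableAt ℝ (fderiv ℝ f) p :=
    (contDiffAt_top_fderiv (hf.contDiffAt hp)).differentiableAt (by simp)
  have hsymm : IsSymmSndFDerivAt ℝ f p :=
    (hf.contDiffAt hp).isSymmSndFDerivAt (by simpa using ENat.LEInfty.out)
  have hT : DifferentiableAt ℝ (toUY : ℝ × Space d → _) p :=
    (contDiffOn_toUY.contDiffAt (isOpen_snd_ne_zero.mem_nhds hp)).differentiableAt (by simp)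
  have hdir : DifferentiableAt ℝ (dir : Space d → Space d) p.2 :=
    (contDiffAt_dir hp).differentiableAt (by simp)
  -- The extra term is the Hessian of retarded time `t - |x|` multiplied by `∂_u f`.
  have key : ∀ v : Spacetime d, liftD (liftD f) p v v =
      fderiv ℝ (fderiv ℝ f) p (toUY p v) (toUY p v)
        - (inner ℝ (fderiv ℝ dir p.2 v.2) v.2) • uD f p := by
    intro v
    have e1 : fderiv ℝ (fun q => fderiv ℝ f q (toUY q v)) p =
        (fderiv ℝ f p).comp (fderiv ℝ (fun q => toUY q v) p)
          + (fderiv ℝ (fderiv ℝ f) p).flip (toUY p v) := by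
      exact fderiv_clm_apply hD (hT.clm_apply (by fun_prop))
    have e2 : fderiv ℝ (liftD f) p (toUY p v) v
        = fderiv ℝ (fun q => fderiv ℝ f q (toUY q v)) p (toUY p v) := by
      have hl : DifferentiableAt ℝ (liftD f) p :=
        (hf.contDiffOn_liftD.contDiffAt (isOpen_snd_ne_zero.mem_nhds hp)).differentiableAt (by simp)
      have := fderiv_clm_apply hl (differentiableAt_const v)
      rw [show (fun q => fderiv ℝ f q (toUY q v)) = fun q => (liftD f q) v from rfl, this]
      simp
    have e3 : HasFDerivAt (fun q : ℝ × Space d => toUY q v)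
        ((-((innerSL ℝ v.2).comp ((fderiv ℝ dir p.2).comp
          (ContinuousLinearMap.snd ℝ ℝ (Space d))))).prod 0) p := by
      have h1 : HasFDerivAt (fun q : ℝ × Space d => dir q.2)
          ((fderiv ℝ dir p.2).comp (ContinuousLinearMap.snd ℝ ℝ (Space d))) p :=
        hdir.hasFDerivAt.comp p (hasFDerivAt_snd (𝕜 := ℝ) (p := p))
      have h2 := ((innerSL ℝ v.2).hasFDerivAt.comp p h1).const_sub v.1
      have h3 := h2.prodMk (hasFDerivAt_const v.2 p)
      refine h3.congr_of_eventuallyEq (Eventually.of_forall fun q => ?_)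
      simp [toUY_apply, real_inner_comm]
    show fderiv ℝ (liftD f) p (toUY p v) v = _
    rw [e2, e1, e3.fderiv]
    simp only [add_apply, ContinuousLinearMap.comp_apply, ContinuousLinearMap.flip_apply]
    rw [add_comm, sub_eq_add_neg]
    congr 1
    rw [show ((-((innerSL ℝ v.2).comp ((fderiv ℝ dir p.2).comp
          (ContinuousLinearMap.snd ℝ ℝ (Space d))))).prod (0 : ℝ × Space d →L[ℝ] Space d))
          (toUY p v) = -(inner ℝ (fderiv ℝ dir p.2 v.2) v.2) • ((1 : ℝ), (0 : Space d)) by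
      simp [toUY_apply, real_inner_comm], map_smul, neg_smul]
    rfl
  have hsum : ∑ i, (inner ℝ (fderiv ℝ dir p.2 (EuclideanSpace.single i 1))
      (EuclideanSpace.single i (1 : ℝ)) : ℝ) = (d - 2) * ‖p.2‖⁻¹ := by
    have : ∀ i : Fin (d - 1), (inner ℝ (fderiv ℝ dir p.2 (EuclideanSpace.single i 1))
        (EuclideanSpace.single i (1 : ℝ)) : ℝ) = ‖p.2‖⁻¹ * (1 - dir p.2 i * dir p.2 i) := by
      intro i
      rw [fderiv_dir_apply hp, inner_smul_left, inner_sub_left, inner_smul_left, inner_single,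
        inner_single]
      simp
    simp only [this, ← Finset.mul_sum, Finset.sum_sub_distrib, sum_dir_sq hp]
    simp only [Finset.sum_const, Finset.card_univ, nsmul_eq_mul, mul_one, card_space hd]
    ring
  have hlap : lapY f p = ∑ i : Fin (d - 1), fderiv ℝ (fderiv ℝ f) p
      (0, EuclideanSpace.single i 1) (0, EuclideanSpace.single i 1) := by
    refine Finset.sum_congr rfl fun i _ => ?_
    show fderiv ℝ (fun q => fderiv ℝ f q (0, EuclideanSpace.single i 1)) p _ = _
    rw [fderiv_clm_apply hD (by fun_prop)]
    simp
  -- The trace contains the cross term `-2 ∂_r ∂_u f`, and Euler's identity turns it into `2a |y|⁻¹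
  -- ∂_u f`. The Hessian term contributes `-(d-2) |y|⁻¹ ∂_u f`, and the two `∂_u²` terms cancel
  -- because the direction has length one.
  have heul : fderiv ℝ (fderiv ℝ f) p (0, dir p.2) (1, 0) = (-a * ‖p.2‖⁻¹) • uD f p := by
    rw [← hf.uD.euler_dir hp]
    show _ = fderiv ℝ (fun q => fderiv ℝ f q (1, 0)) p _
    rw [fderiv_clm_apply hD (by fun_prop)]
    simp
  have ht : toUY p (timeVec d) = (1, 0) := by simp [toUY_apply, timeVec]
  have hi : ∀ i, toUY p (spaceVec d i) = -(dir p.2 i • ((1 : ℝ), (0 : Space d)))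
        + ((0 : ℝ), EuclideanSpace.single i (1 : ℝ)) := by
    intro i; simp [toUY_apply, spaceVec, inner_single]
  set B := fderiv ℝ (fderiv ℝ f) p with hB
  have hBi : ∀ i, B (toUY p (spaceVec d i)) (toUY p (spaceVec d i)) =
      (dir p.2 i * dir p.2 i) • B (1, 0) (1, 0)
      - (2 : ℝ) • (dir p.2 i • B (0, EuclideanSpace.single i 1) (1, 0))
      + B (0, EuclideanSpace.single i 1) (0, EuclideanSpace.single i 1) := by
    intro i
    rw [hi]
    simp only [map_add, map_neg, map_smul, add_apply, neg_apply, smul_apply]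
    rw [hsymm (1, 0) (0, EuclideanSpace.single i 1)]
    module
  have hcross : ∑ i, dir p.2 i • B (0, EuclideanSpace.single i 1) (1, 0)
      = B (0, dir p.2) (1, 0) := by
    exact sum_apply_single ((B.flip (1, 0)).comp (ContinuousLinearMap.inr ℝ ℝ (Space d))) (dir p.2)
  rw [etaTrace_apply, key]
  simp only [key, Finset.sum_sub_distrib, ← Finset.sum_smul]
  rw [show ∑ i, (inner ℝ (fderiv ℝ dir p.2 (spaceVec d i).2) (spaceVec d i).2 : ℝ)
      = (d - 2) * ‖p.2‖⁻¹ from hsum]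
  simp only [hBi, Finset.sum_add_distrib, Finset.sum_sub_distrib, ← Finset.sum_smul,
    ← Finset.smul_sum, hcross, sum_dir_sq hp, ht, heul, ← hlap]
  simp only [timeVec, map_zero, inner_zero_left, zero_smul, one_smul]
  module

end

/-! ### Calculus of asymptotic expansions -/

section

variable {d : ℕ} {F G H : Type} [NormedAddCommGroup F] [NormedSpace ℝ F]
  [NormedAddCommGroup G] [NormedSpace ℝ G] [NormedAddCommGroup H] [NormedSpace ℝ H]

/-- The asymptotic expansion `f ∼ ∑ k, c k` near null infinity, with coefficients written as
homogeneous functions of degree `-k/2`. -/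
structure Exp (f : Spacetime d → F) (c : ℕ → ℝ × Space d → F) : Prop where
  smooth : SmoothNear f
  hom : ∀ k : ℕ, Hom ((k : ℝ) / 2) (c k)
  rem : ∀ K : ℕ, Sym ((K : ℝ) / 2) fun x => f x - ∑ k ∈ Finset.range K, lift (c k) x

theorem point_retarded_norm {u r : ℝ} {y : Space d} (hr : 0 < r) (hy : y ≠ 0)
    (f : ℝ × Space d → F) : lift f (point u r y) = f (u, r • dir y) := by
  rw [lift, point_retarded hr.le hy]; rfl

theorem Hom.lift_point {a : ℝ} {f : ℝ × Space d → F} (hf : Hom a f) {u r : ℝ} {y : Space d}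
    (hr : 0 < r) (hy : y ≠ 0) : lift f (point u r y) = r ^ (-a) • f (u, Lorenz.dir y) := by
  rw [point_retarded_norm hr hy, hf.hom u _ r hr (ne_zero_of_norm_eq_one (norm_dir hy))]

/-- Near null infinity the two ways to write the remainder agree as germs. -/
theorem mixed_rem_eq {h : Spacetime d → F} {c : ℕ → ℝ × Space d → F}
    (hc : ∀ k : ℕ, Hom ((k : ℝ) / 2) (c k)) (K m l : ℕ) {u r : ℝ} {θ : Space d} (hr : 0 < r)
    (hθ : ‖θ‖ = 1) :
    iteratedFDeriv ℝ m (fun p : ℝ × Space d => iteratedDeriv l (fun s : ℝ =>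
      h (point p.1 s p.2) - ∑ k ∈ Finset.range K, lift (c k) (point p.1 s p.2)) r) (u, θ)
    = iteratedFDeriv ℝ m (fun p : ℝ × Space d => iteratedDeriv l (fun s : ℝ =>
      h (point p.1 s p.2) - ∑ k ∈ Finset.range K,
        s ^ (-((k : ℝ) / 2)) • c k (p.1, dir p.2)) r) (u, θ) := by
  have hθ0 := ne_zero_of_norm_eq_one hθ
  refine (Filter.EventuallyEq.iteratedFDeriv ℝ ?_ m).eq_of_nhds
  filter_upwards [isOpen_snd_ne_zero.mem_nhds (show ((u, θ) : ℝ × Space d).2 ≠ 0 from hθ0)]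
    with p hp
  refine Filter.EventuallyEq.iteratedDeriv_eq l ?_
  filter_upwards [lt_mem_nhds hr] with s hs
  congr 1
  exact Finset.sum_congr rfl fun k _ => (hc k).lift_point hs hp

theorem HasExpansion.exp {f : Spacetime d → F} {c : ℕ → ℝ → Space d → F} (hf : HasExpansion f c)
    (hs : SmoothNear f) :
    Exp f fun k p => ‖p.2‖ ^ (-((k : ℝ) / 2)) • c k p.1 (dir p.2) := by
  have hh : ∀ k : ℕ, Hom ((k : ℝ) / 2)
      fun p : ℝ × Space d => ‖p.2‖ ^ (-((k : ℝ) / 2)) • c k p.1 (dir p.2) := by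
    intro k
    refine ⟨ContDiffOn.smul (f := fun p : ℝ × Space d => ‖p.2‖ ^ (-((k : ℝ) / 2)))
      (fun p hp => ?_) (hf.1 k), fun u y s hs hy => ?_⟩
    · exact (((contDiffAt_norm ℝ hp).comp p contDiffAt_snd).rpow_const_of_ne
        (norm_ne_zero_iff.2 hp)).contDiffWithinAt
    · simp only [dir_smul hs, norm_smul, Real.norm_of_nonneg hs.le]
      rw [Real.mul_rpow hs.le (norm_nonneg _), mul_smul]
  refine ⟨hs, hh, fun K => ?_⟩
  have hsum : Sym 0 fun x => ∑ k ∈ Finset.range K,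
      lift (fun p : ℝ × Space d => ‖p.2‖ ^ (-((k : ℝ) / 2)) • c k p.1 (dir p.2)) x :=
    Sym.sum _ fun k _ => (hh k).sym.mono (by positivity)
  refine MixedO.sym ?_ fun m l T => ?_
  · simpa only [sub_eq_add_neg] using hs.add hsum.neg.smooth
  · obtain ⟨C, R, hR, h⟩ := hf.2 K m l T
    refine IsBigO.of_bound C ?_
    refine eventually_scri.2 ⟨R, fun L hL u θ hu hθ => ?_⟩
    have hL0 : 0 < L := by linarith
    rw [mixed_rem_eq hh K m l hL0 hθ, Real.norm_of_nonneg (by positivity)]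
    refine le_trans (le_of_eq ?_) (h u L θ hu hL hθ)
    congr 1
    refine (Filter.EventuallyEq.iteratedFDeriv ℝ ?_ m).eq_of_nhds
    filter_upwards [isOpen_snd_ne_zero.mem_nhds
      (show ((u, θ) : ℝ × Space d).2 ≠ 0 from ne_zero_of_norm_eq_one hθ)] with p hp
    simp only [dir_dir, norm_dir hp, Real.one_rpow, one_smul]

theorem Exp.hasExpansion {f : Spacetime d → F} {c : ℕ → ℝ × Space d → F} (hf : Exp f c) :
    HasExpansion f fun k u y => c k (u, y) := by
  refine ⟨fun k p hp => ?_, fun K m l T => ?_⟩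
  · refine ContDiffAt.contDiffWithinAt (ContDiffAt.comp p (((hf.hom k).contDiffAt
      (p := (p.1, dir p.2)) (ne_zero_of_norm_eq_one (norm_dir hp)))) ?_)
    exact contDiffAt_fst.prodMk ((contDiffAt_dir hp).comp p contDiffAt_snd)
  · obtain ⟨C, hC⟩ := ((hf.rem K).mixedO m l T).bound
    obtain ⟨R, hR⟩ := eventually_scri.1 hC
    refine ⟨C, max R 1, by positivity, fun u r θ hu hr hθ => ?_⟩
    have hr0 : 0 < r := lt_of_lt_of_le (by positivity) ((le_max_right R 1).trans hr)
    have := hR r ((le_max_left _ _).trans hr) u θ hu hθ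
    rwa [mixed_rem_eq hf.hom K m l hr0 hθ, Real.norm_of_nonneg (by positivity)] at this

/-- The family `M` moved up by `j`. -/
def shiftCoef {F : Type} [Zero F] (j : ℕ) (M : ℕ → ℝ × Space d → F) (k : ℕ) : ℝ × Space d → F :=
  if j ≤ k then M (k - j) else fun _ => 0

theorem shiftCoef_add (j : ℕ) (M : ℕ → ℝ × Space d → F) (k : ℕ) :
    shiftCoef j M (k + j) = M k := by simp [shiftCoef]

theorem shiftCoef_of_lt {j k : ℕ} (h : k < j) (M : ℕ → ℝ × Space d → F) :
    shiftCoef j M k = fun _ => 0 := by simp [shiftCoef, h]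

theorem Hom.shiftCoef {j : ℕ} {M : ℕ → ℝ × Space d → F} {e : ℝ} (he : e = (j : ℝ) / 2)
    (hM : ∀ k : ℕ, Hom ((k : ℝ) / 2 + e) (M k)) (k : ℕ) :
    Hom ((k : ℝ) / 2) (shiftCoef j M k) := by
  unfold Lorenz.shiftCoef
  split_ifs with h
  · have := hM (k - j)
    rwa [he, Nat.cast_sub h, ← add_div, sub_add_cancel] at this
  · exact Hom.zero _

theorem sum_shiftCoef (j : ℕ) (M : ℕ → ℝ × Space d → F) (K : ℕ) (x : Spacetime d) :
    ∑ k ∈ Finset.range K, lift (shiftCoef j M k) x = ∑ k ∈ Finset.range (K - j), lift (M k) x := by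
  induction K with
  | zero => simp
  | succ K ih =>
    rw [Finset.sum_range_succ, ih]
    by_cases h : j ≤ K
    · rw [Nat.succ_sub h, Finset.sum_range_succ]
      simp [shiftCoef, h]
    · rw [Nat.sub_eq_zero_of_le (by omega), Nat.sub_eq_zero_of_le (by omega)]
      simp [shiftCoef, h, lift]

/-- The two truncations differ only by the terms with `K - j ≤ k < K`, and each of these already has
order `K/2`. -/
theorem sym_sum_sub_shift {j : ℕ} {M : ℕ → ℝ × Space d → F} {e : ℝ} (he : e = (j : ℝ) / 2)
    (hM : ∀ k : ℕ, Hom ((k : ℝ) / 2 + e) (M k)) (K : ℕ) :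
    Sym ((K : ℝ) / 2) fun x => ∑ k ∈ Finset.range K, lift (M k) x
      - ∑ k ∈ Finset.range K, lift (shiftCoef j M k) x := by
  have h : (fun x : Spacetime d => ∑ k ∈ Finset.range K, lift (M k) x
      - ∑ k ∈ Finset.range K, lift (shiftCoef j M k) x)
      = fun x => ∑ k ∈ Finset.Ico (K - j) K, lift (M k) x := by
    funext x
    rw [sum_shiftCoef, Finset.sum_Ico_eq_sub _ (Nat.sub_le K j)]
  rw [h]
  refine Sym.sum _ fun k hk => (hM k).sym.mono ?_
  rw [Finset.mem_Ico] at hk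
  have : (K : ℝ) ≤ k + j := by exact_mod_cast (by omega : K ≤ k + j)
  rw [he]; linarith

theorem SmoothNear.sub {f g : Spacetime d → F} (hf : SmoothNear f) (hg : SmoothNear g) :
    SmoothNear fun x => f x - g x := by
  have := hf.add (hg.clm (-ContinuousLinearMap.id ℝ F))
  simpa [sub_eq_add_neg] using this

theorem SmoothNear.sum {ι : Type*} (s : Finset ι) {f : ι → Spacetime d → F}
    (hf : ∀ i ∈ s, SmoothNear (f i)) : SmoothNear fun x => ∑ i ∈ s, f i x := by
  classical
  induction s using Finset.induction_on with
  | empty => simpa using (Sym.zero (d := d) (F := F) 0).smooth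
  | insert i s hi ih =>
    simp only [Finset.sum_insert hi]
    exact (hf i (by simp)).add (ih fun j hj => hf j (by simp [hj]))

/-- Expansion of `D f` for a linear differential operator `D` that maps homogeneous lifts of
degree `-a` to sums of lifts of degrees `-a`, `-a - 1` and `-a - 2`. -/
theorem Exp.operator {D : (Spacetime d → F) → Spacetime d → G}
    (hsym : ∀ {κ : ℝ} {h : Spacetime d → F}, Sym κ h → Sym κ (D h))
    (hsmooth : ∀ {h : Spacetime d → F}, SmoothNear h → SmoothNear (D h))
    (hsub : ∀ {f g : Spacetime d → F}, SmoothNear f → SmoothNear g →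
      ∃ V, IsNhdScri V ∧ EqOn (D fun x => f x - g x) (fun x => D f x - D g x) V)
    {f : Spacetime d → F} {c : ℕ → ℝ × Space d → F} (hf : Exp f c)
    {M0 M1 M2 : ℕ → ℝ × Space d → G} (h0 : ∀ k : ℕ, Hom ((k : ℝ) / 2) (M0 k))
    (h1 : ∀ k : ℕ, Hom ((k : ℝ) / 2 + 1) (M1 k)) (h2 : ∀ k : ℕ, Hom ((k : ℝ) / 2 + 2) (M2 k))
    (hD : ∀ k (x : Spacetime d), x.2 ≠ 0 →
      D (lift (c k)) x = lift (M0 k) x + lift (M1 k) x + lift (M2 k) x) :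
    Exp (D f) fun k p => M0 k p + shiftCoef 2 M1 k p + shiftCoef 4 M2 k p := by
  have hs1 := Hom.shiftCoef (j := 2) (e := 1) (by norm_num) h1
  have hs2 := Hom.shiftCoef (j := 4) (e := 2) (by norm_num) h2
  have hcs : ∀ K, SmoothNear fun x => ∑ k ∈ Finset.range K, lift (c k) x := fun K =>
    SmoothNear.sum _ fun k _ => (hf.hom k).smoothNear_lift
  refine ⟨hsmooth hf.smooth, fun k : ℕ => ((h0 k).add (hs1 k)).add (hs2 k), fun K => ?_⟩
  -- Additivity of `D` is only available on a neighbourhood that depends on the functions, so the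
  -- neighbourhoods are intersected one term at a time.
  have hind : ∀ K : ℕ, ∃ V, IsNhdScri V ∧
      EqOn (D fun x => f x - ∑ k ∈ Finset.range K, lift (c k) x)
        (fun x => D f x - ∑ k ∈ Finset.range K, D (lift (c k)) x) V := by
    intro K
    induction K with
    | zero => exact ⟨_, isNhdScri_lt_norm 0, fun x _ => by simp⟩
    | succ K ih =>
      obtain ⟨V, hV, hE⟩ := ih
      obtain ⟨W, hW, hE'⟩ := hsub (hf.smooth.sub (hcs K)) (hf.hom K).smoothNear_lift
      refine ⟨V ∩ W, hV.inter hW, fun x hx => ?_⟩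
      have e1 := hE' hx.2
      simp only [Finset.sum_range_succ, ← sub_sub]
      rw [e1]
      simp only []
      rw [hE hx.1]
  obtain ⟨V, hV, hE⟩ := hind K
  have key := ((hsym (hf.rem K)).add (sym_sum_sub_shift (j := 2) (by norm_num) h1 K)).add
    (sym_sum_sub_shift (j := 4) (by norm_num) h2 K)
  refine key.congr (hV.inter (isNhdScri_lt_norm 0)) fun x hx => ?_
  have hx0 : x.2 ≠ 0 := norm_pos_iff.1 hx.2
  simp only []
  rw [hE hx.1]
  simp only [hD _ x hx0, Finset.sum_add_distrib, lift]
  abel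

/-- If all earlier coefficients agree, comparing the remainders after the index `k` shows that the
lift of `c k - c' k` has order `(k+1)/2`, more than its degree permits unless it is zero. -/
theorem Exp.unique {f : Spacetime d → F} {c c' : ℕ → ℝ × Space d → F} (h : Exp f c)
    (h' : Exp f c') (k : ℕ) {p : ℝ × Space d} (hp : p.2 ≠ 0) : c k p = c' k p := by
  induction k using Nat.strong_induction_on generalizing p with
  | _ k ih =>
    have h1 : Sym (((k + 1 : ℕ) : ℝ) / 2) (lift fun p => c k p - c' k p) := by
      refine ((h'.rem (k + 1)).sub (h.rem (k + 1))).congr (isNhdScri_lt_norm 0) fun x hx => ?_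
      have hx0 : x.2 ≠ 0 := norm_pos_iff.1 hx
      have h2 : ∑ j ∈ Finset.range k, lift (c j) x = ∑ j ∈ Finset.range k, lift (c' j) x :=
        Finset.sum_congr rfl fun j hj => ih j (Finset.mem_range.1 hj) hx0
      simp only [Finset.sum_range_succ, h2]
      simp only [lift]
      abel
    have := ((h.hom k).sub (h'.hom k)).eq_zero_of_sym h1 (by push_cast; linarith) hp
    exact sub_eq_zero.1 this

theorem Exp.congr {f g : Spacetime d → F} {c : ℕ → ℝ × Space d → F} (h : Exp f c)
    {V : Set (Spacetime d)} (hV : IsNhdScri V) (hfg : EqOn f g V) : Exp g c :=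
  ⟨h.smooth.congr hV hfg, h.hom, fun K => (h.rem K).congr hV fun x hx => by simp only [hfg hx]⟩

theorem Exp.congr_coef {f : Spacetime d → F} {c c' : ℕ → ℝ × Space d → F} (h : Exp f c)
    (hc : ∀ k (p : ℝ × Space d), p.2 ≠ 0 → c k p = c' k p) : Exp f c' :=
  ⟨h.smooth, fun k : ℕ => (h.hom k).congr (hc k), fun K =>
    (h.rem K).congr (isNhdScri_lt_norm 0) fun x hx => by
      have : ∑ k ∈ Finset.range K, lift (c k) x = ∑ k ∈ Finset.range K, lift (c' k) x :=
        Finset.sum_congr rfl fun k _ => hc k (x.1 - ‖x.2‖, x.2) (norm_pos_iff.1 hx)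
      simp only [this]⟩

theorem Exp.clm {f : Spacetime d → F} {c : ℕ → ℝ × Space d → F} (h : Exp f c) (A : F →L[ℝ] G) :
    Exp (fun x => A (f x)) fun k p => A (c k p) :=
  ⟨h.smooth.clm A, fun k : ℕ => (h.hom k).clm A, fun K => by
    refine ((h.rem K).clm A).congr (isNhdScri_lt_norm 0) fun x _ => ?_
    simp [lift]⟩

theorem Exp.add {f g : Spacetime d → F} {c c' : ℕ → ℝ × Space d → F} (h : Exp f c)
    (h' : Exp g c') : Exp (fun x => f x + g x) fun k p => c k p + c' k p :=
  ⟨h.smooth.add h'.smooth, fun k : ℕ => (h.hom k).add (h'.hom k), fun K => by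
    refine ((h.rem K).add (h'.rem K)).congr (isNhdScri_lt_norm 0) fun x _ => ?_
    simp only [lift, Finset.sum_add_distrib]
    abel⟩

theorem Exp.const_smul {f : Spacetime d → F} {c : ℕ → ℝ × Space d → F} (h : Exp f c) (a : ℝ) :
    Exp (fun x => a • f x) fun k p => a • c k p :=
  h.clm (a • ContinuousLinearMap.id ℝ F)

theorem Exp.sub {f g : Spacetime d → F} {c c' : ℕ → ℝ × Space d → F} (h : Exp f c)
    (h' : Exp g c') : Exp (fun x => f x - g x) fun k p => c k p - c' k p := by
  simpa [sub_eq_add_neg] using h.add (h'.const_smul (-1))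

/-- The part of `liftD` of the same degree. -/
def liftD0 (f : ℝ × Space d → F) (p : ℝ × Space d) : Spacetime d →L[ℝ] F :=
  (ContinuousLinearMap.fst ℝ ℝ (Space d)
    - (innerSL ℝ (dir p.2)).comp (ContinuousLinearMap.snd ℝ ℝ (Space d))).smulRight (uD f p)

/-- The part of `liftD` of degree one less. -/
def liftD1 (f : ℝ × Space d → F) (p : ℝ × Space d) : Spacetime d →L[ℝ] F :=
  ((fderiv ℝ f p).comp (ContinuousLinearMap.inr ℝ ℝ (Space d))).comp
    (ContinuousLinearMap.snd ℝ ℝ (Space d))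

theorem liftD_eq (f : ℝ × Space d → F) (p : ℝ × Space d) : liftD f p = liftD0 f p + liftD1 f p := by
  refine ContinuousLinearMap.ext fun v => ?_
  have : toUY p v = (v.1 - inner ℝ (dir p.2) v.2) • ((1 : ℝ), (0 : Space d)) + ((0 : ℝ), v.2) := by
    simp [toUY_apply]
  show fderiv ℝ f p (toUY p v) = (v.1 - inner ℝ (dir p.2) v.2) • uD f p + fderiv ℝ f p (0, v.2)
  rw [this, map_add, map_smul]
  rfl

theorem Hom.liftD0 {a : ℝ} {f : ℝ × Space d → F} (hf : Hom a f) : Hom a (liftD0 f) := by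
  have h1 : Hom 0 fun p : ℝ × Space d => (ContinuousLinearMap.fst ℝ ℝ (Space d)
      - (innerSL ℝ (Lorenz.dir p.2)).comp (ContinuousLinearMap.snd ℝ ℝ (Space d))) :=
    (Hom.const _).sub (Hom.dir.clm (((ContinuousLinearMap.compL ℝ (Spacetime d) (Space d) ℝ).flip
      (ContinuousLinearMap.snd ℝ ℝ (Space d))).comp (innerSL ℝ : Space d →L[ℝ] Space d →L[ℝ] ℝ)))
  have h2 := h1.bilinear hf.uD (ContinuousLinearMap.smulRightL ℝ (Spacetime d) F)
  rw [zero_add] at h2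
  exact h2

theorem Hom.liftD1 {a : ℝ} {f : ℝ × Space d → F} (hf : Hom a f) : Hom (a + 1) (liftD1 f) := by
  refine ⟨((hf.smooth.fderiv_of_isOpen isOpen_snd_ne_zero (by simp)).clm_comp
    contDiffOn_const).clm_comp contDiffOn_const, fun u y s hs hy => ?_⟩
  refine ContinuousLinearMap.ext fun v => ?_
  exact (hf.yD v.2).hom u y s hs hy

theorem fderiv_sub_near {f g : Spacetime d → F} (hf : SmoothNear f) (hg : SmoothNear g) :
    ∃ V, IsNhdScri V ∧ EqOn (fderiv ℝ fun x => f x - g x)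
      (fun x => fderiv ℝ f x - fderiv ℝ g x) V := by
  obtain ⟨V, hV, hf⟩ := hf
  obtain ⟨W, hW, hg⟩ := hg
  refine ⟨V ∩ W, hV.inter hW, fun x hx => ?_⟩
  exact fderiv_fun_sub (ContDiffOn.differentiableAt_top hV.1 hf hx.1)
    (ContDiffOn.differentiableAt_top hW.1 hg hx.2)

theorem Hom.fderiv_lift {a : ℝ} {f : ℝ × Space d → F} (hf : Hom a f) {x : Spacetime d}
    (hx : x.2 ≠ 0) : fderiv ℝ (lift f) x = lift (liftD f) x :=
  (hasFDerivAt_lift hx (hf.differentiableAt (p := (x.1 - ‖x.2‖, x.2)) hx)).fderiv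

theorem Exp.fderiv {f : Spacetime d → F} {c : ℕ → ℝ × Space d → F} (h : Exp f c) :
    Exp (fderiv ℝ f) fun k p => liftD0 (c k) p + shiftCoef 2 (fun j => liftD1 (c j)) k p := by
  refine (h.operator (D := _root_.fderiv ℝ) (M0 := fun k => Lorenz.liftD0 (c k))
    (M1 := fun k => Lorenz.liftD1 (c k))
    (M2 := fun _ _ => 0) (fun h => h.fderiv) (fun h => h.fderiv) fderiv_sub_near
    (fun k => (h.hom k).liftD0) (fun k => (h.hom k).liftD1) (fun k => Hom.zero _)
    fun k x hx => ?_).congr_coef fun k p _ => ?_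
  · rw [(h.hom k).fderiv_lift hx]
    simp [lift, liftD_eq]
  · simp [shiftCoef]

/-- The gradient of `u` is minus the covector dual to `∂_t + ∂_r`; hence only this component of the
potential is differentiated in `u`, and the spatial divergence enters one order later. -/
theorem Exp.divergence {f : Spacetime d → Covector d} {c : ℕ → ℝ × Space d → Covector d}
    (h : Exp f c) : Exp (divergence f) fun k p => -(uD (c k) p (nullVec p))
      + shiftCoef 2 (fun j p => ∑ i, yD (EuclideanSpace.single i 1) (c j) p (spaceVec d i)) k p := by
  rw [divergence_eq]
  refine (h.fderiv.clm (etaTrace d ℝ)).congr_coef fun k p _ => ?_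
  by_cases hk : 2 ≤ k
  · have h1 : ∀ f : ℝ × Space d → Covector d, etaTrace d ℝ (liftD0 f p)
        = -(uD f p (nullVec p)) := by
      intro f
      have : ∀ i : Fin (d - 1), inner ℝ (dir p.2) (EuclideanSpace.single i (1 : ℝ)) = dir p.2 i :=
        fun i => inner_single _ i
      have h3 : nullVec p = timeVec d + ∑ i, dir p.2 i • spaceVec d i := by
        refine Prod.ext ?_ ?_
        · simp [nullVec, timeVec, spaceVec, Prod.fst_sum]
        · ext j
          simp [nullVec, timeVec, spaceVec, Prod.snd_sum, Pi.single_apply]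
      rw [etaTrace_apply, h3, map_add, map_sum]
      simp only [map_smul]
      simp [liftD0, timeVec, spaceVec, this, add_comm]
    have h2 : ∀ f : ℝ × Space d → Covector d, etaTrace d ℝ (liftD1 f p)
        = ∑ i, yD (EuclideanSpace.single i 1) f p (spaceVec d i) := by
      intro f
      have h4 := etaTrace_liftD (f := f) p
      rw [liftD_eq, map_add, h1] at h4
      linarith
    simp only [shiftCoef, hk, if_true, map_add, h1, h2]
  · have h4 := etaTrace_liftD (f := c k) p
    simp only [shiftCoef, hk, if_false, add_zero]
    rw [liftD_eq, map_add] at h4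
    have h2 : etaTrace d ℝ (liftD1 (c k) p)
        = ∑ i, yD (EuclideanSpace.single i 1) (c k) p (spaceVec d i) := by
      rw [etaTrace_apply]
      simp [liftD1, timeVec, spaceVec, yD, ← Prod.zero_eq_mk]
    rw [h2] at h4
    linarith

theorem SmoothNear.box_eq {f : Spacetime d → F} (hf : SmoothNear f) :
    ∃ V, IsNhdScri V ∧ EqOn (box f) (fun x => etaTrace d F (_root_.fderiv ℝ (_root_.fderiv ℝ f) x)) V := by
  obtain ⟨V, hV, hf⟩ := hf
  exact ⟨V, hV, fun x hx => Lorenz.box_eq (hf.contDiffAt (hV.1.mem_nhds hx))⟩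

/-- There is no term at the order of the coefficient itself because retarded time has a null
gradient. -/
theorem Exp.box (hd : 1 ≤ d) {f : Spacetime d → F} {c : ℕ → ℝ × Space d → F} (h : Exp f c) :
    Exp (box f) fun k p => shiftCoef 2 (fun j p => (((j : ℝ) - (d - 2)) * ‖p.2‖⁻¹) • uD (c j) p) k p
      + shiftCoef 4 (fun j => lapY (c j)) k p := by
  have hcs : ∀ {κ : ℝ} {h : Spacetime d → F}, Sym κ h →
      Sym κ fun x => etaTrace d F (_root_.fderiv ℝ (_root_.fderiv ℝ h) x) :=
    fun h => h.fderiv.fderiv.clm _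
  obtain ⟨V, hV, hE⟩ := h.smooth.box_eq
  refine Exp.congr ?_ hV hE.symm
  refine (h.operator (D := fun f x => etaTrace d F (_root_.fderiv ℝ (_root_.fderiv ℝ f) x))
    (M0 := fun _ _ => 0)
    (M1 := fun j p => (((j : ℝ) - (d - 2)) * ‖p.2‖⁻¹) • uD (c j) p) (M2 := fun j => lapY (c j))
    hcs (fun h => h.fderiv.fderiv.clm _) ?_ (fun k => Hom.zero _) (fun k : ℕ => ?_)
    (fun k => (h.hom k).lapY) fun k x hx => ?_).congr_coef fun k p _ => ?_
  · intro f g hf hg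
    obtain ⟨W, hW, h1⟩ := fderiv_sub_near hf hg
    obtain ⟨W', hW', h2⟩ := fderiv_sub_near hf.fderiv hg.fderiv
    refine ⟨W ∩ W', hW.inter hW', fun x hx => ?_⟩
    have h3 : _root_.fderiv ℝ (fun x => f x - g x) =ᶠ[𝓝 x]
        fun x => _root_.fderiv ℝ f x - _root_.fderiv ℝ g x := by
      filter_upwards [hW.1.mem_nhds hx.1] with y hy using h1 hy
    simp only [h3.fderiv_eq, h2 hx.2]
    rw [eq_sub_iff_add_eq, ← map_add]
    exact congrArg _ (ContinuousLinearMap.ext fun v => ContinuousLinearMap.ext fun w =>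
      sub_add_cancel (_ : F) _)
  · have := (Hom.norm_inv.smul (h.hom k).uD).const_smul ((k : ℝ) - (d - 2))
    simp only [smul_smul] at this
    rwa [add_comm] at this
  · have h1 : _root_.fderiv ℝ (lift (c k)) =ᶠ[𝓝 x] lift (liftD (c k)) := by
      filter_upwards [(isOpen_ne_fun (by fun_prop) (by fun_prop) :
        IsOpen {x : Spacetime d | x.2 ≠ 0}).mem_nhds hx] with y hy using (h.hom k).fderiv_lift hy
    have h2 : DifferentiableAt ℝ (liftD (c k)) (x.1 - ‖x.2‖, x.2) :=
      ((h.hom k).contDiffOn_liftD.contDiffAt (x := (x.1 - ‖x.2‖, x.2))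
        (isOpen_snd_ne_zero.mem_nhds hx)).differentiableAt (by simp)
    simp only [h1.fderiv_eq, (hasFDerivAt_lift hx h2).fderiv]
    have := etaTrace_liftD_liftD (p := (x.1 - ‖x.2‖, x.2)) hd (h.hom k) hx
    rw [show lift (liftD (liftD (c k))) x = liftD (liftD (c k)) (x.1 - ‖x.2‖, x.2) from rfl, this]
    simp only [lift, zero_add]
    congr 3
    ring
  · simp

end

/-! ### Leibniz rules for homogeneous coefficients -/

section

variable {d : ℕ} {F G H : Type} [NormedAddCommGroup F] [NormedSpace ℝ F]
  [NormedAddCommGroup G] [NormedSpace ℝ G] [NormedAddCommGroup H] [NormedSpace ℝ H]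

theorem eventuallyEq_of_eq {f g : ℝ × Space d → F} (h : ∀ p : ℝ × Space d, p.2 ≠ 0 → f p = g p)
    {p : ℝ × Space d} (hp : p.2 ≠ 0) : f =ᶠ[𝓝 p] g := by
  filter_upwards [isOpen_snd_ne_zero.mem_nhds hp] with q hq using h q hq

theorem uD_congr {f g : ℝ × Space d → F} (h : ∀ p : ℝ × Space d, p.2 ≠ 0 → f p = g p)
    {p : ℝ × Space d} (hp : p.2 ≠ 0) : uD f p = uD g p := by
  simp only [uD, (eventuallyEq_of_eq h hp).fderiv_eq]

theorem yD_congr {f g : ℝ × Space d → F} (h : ∀ p : ℝ × Space d, p.2 ≠ 0 → f p = g p)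
    (v : Space d) {p : ℝ × Space d} (hp : p.2 ≠ 0) : yD v f p = yD v g p := by
  simp only [yD, (eventuallyEq_of_eq h hp).fderiv_eq]

theorem lapY_congr {f g : ℝ × Space d → F} (h : ∀ p : ℝ × Space d, p.2 ≠ 0 → f p = g p)
    {p : ℝ × Space d} (hp : p.2 ≠ 0) : lapY f p = lapY g p :=
  Finset.sum_congr rfl fun _ _ => yD_congr (fun _ hq => yD_congr h _ hq) _ hp

theorem uD_zero (p : ℝ × Space d) : uD (fun _ => (0 : F)) p = 0 := by simp [uD]

theorem yD_zero (v : Space d) (p : ℝ × Space d) : yD v (fun _ => (0 : F)) p = 0 := by simp [yD]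

theorem lapY_zero (p : ℝ × Space d) : lapY (fun _ => (0 : F)) p = 0 := by
  have : ∀ v : Space d, yD v (fun _ : ℝ × Space d => (0 : F)) = fun _ => 0 :=
    fun v => funext (yD_zero v)
  simp [lapY, this]

theorem uD_clm {f : ℝ × Space d → F} {p : ℝ × Space d} (hf : DifferentiableAt ℝ f p)
    (A : F →L[ℝ] G) : uD (fun q => A (f q)) p = A (uD f p) := by
  have := (A.hasFDerivAt.comp p hf.hasFDerivAt).fderiv
  rw [uD, show (fun q => A (f q)) = A ∘ f from rfl, this]; rfl

theorem yD_clm {f : ℝ × Space d → F} {p : ℝ × Space d} (hf : DifferentiableAt ℝ f p)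
    (A : F →L[ℝ] G) (v : Space d) : yD v (fun q => A (f q)) p = A (yD v f p) := by
  have := (A.hasFDerivAt.comp p hf.hasFDerivAt).fderiv
  rw [yD, show (fun q => A (f q)) = A ∘ f from rfl, this]; rfl

theorem Hom.lapY_clm {a : ℝ} {f : ℝ × Space d → F} (hf : Hom a f) (A : F →L[ℝ] G)
    {p : ℝ × Space d} (hp : p.2 ≠ 0) : Lorenz.lapY (fun q => A (f q)) p = A (Lorenz.lapY f p) := by
  rw [Lorenz.lapY, Lorenz.lapY, map_sum]
  refine Finset.sum_congr rfl fun i _ => ?_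
  rw [yD_congr (fun q hq => yD_clm (hf.differentiableAt hq) A _) _ hp,
    yD_clm ((hf.yD _).differentiableAt hp)]

theorem Hom.lapY_add {a b : ℝ} {f g : ℝ × Space d → F} (hf : Hom a f) (hg : Hom b g)
    {p : ℝ × Space d} (hp : p.2 ≠ 0) :
    Lorenz.lapY (fun q => f q + g q) p = Lorenz.lapY f p + Lorenz.lapY g p := by
  have h1 : ∀ {a b : ℝ} {f g : ℝ × Space d → F} (_ : Hom a f) (_ : Hom b g) (v : Space d)
      (q : ℝ × Space d), q.2 ≠ 0 →
      Lorenz.yD v (fun q => f q + g q) q = Lorenz.yD v f q + Lorenz.yD v g q := by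
    intro a b f g hf hg v q hq
    simp only [Lorenz.yD]
    rw [fderiv_fun_add (hf.differentiableAt hq) (hg.differentiableAt hq)]; rfl
  rw [Lorenz.lapY, Lorenz.lapY, Lorenz.lapY, ← Finset.sum_add_distrib]
  refine Finset.sum_congr rfl fun i _ => ?_
  rw [yD_congr (h1 hf hg _) _ hp, h1 (hf.yD _) (hg.yD _) _ _ hp]

theorem Hom.lapY_sum {ι : Type*} (s : Finset ι) {a : ℝ} {f : ι → ℝ × Space d → F}
    (hf : ∀ i ∈ s, Hom a (f i)) {p : ℝ × Space d} (hp : p.2 ≠ 0) :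
    Lorenz.lapY (fun q => ∑ i ∈ s, f i q) p = ∑ i ∈ s, Lorenz.lapY (f i) p := by
  classical
  induction s using Finset.induction_on with
  | empty => simpa using lapY_zero p
  | insert i s hi ih =>
    simp only [Finset.sum_insert hi]
    rw [(hf i (by simp)).lapY_add (Hom.sum s fun j hj => hf j (by simp [hj])) hp,
      ih fun j hj => hf j (by simp [hj])]

theorem Hom.yD_mul {a b : ℝ} {f g : ℝ × Space d → ℝ} (hf : Hom a f) (hg : Hom b g) (v : Space d)
    {p : ℝ × Space d} (hp : p.2 ≠ 0) :
    Lorenz.yD v (fun q => f q * g q) p = f p * Lorenz.yD v g p + g p * Lorenz.yD v f p := by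
  simp only [Lorenz.yD]
  rw [fderiv_fun_mul (hf.differentiableAt hp) (hg.differentiableAt hp)]; rfl

theorem Hom.mul {a b : ℝ} {f g : ℝ × Space d → ℝ} (hf : Hom a f) (hg : Hom b g) :
    Hom (a + b) fun p => f p * g p := hf.smul hg

theorem Hom.lapY_mul {a b : ℝ} {f g : ℝ × Space d → ℝ} (hf : Hom a f) (hg : Hom b g)
    {p : ℝ × Space d} (hp : p.2 ≠ 0) :
    Lorenz.lapY (fun q => f q * g q) p = f p * Lorenz.lapY g p + g p * Lorenz.lapY f p
      + 2 * ∑ i, Lorenz.yD (EuclideanSpace.single i 1) f p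
        * Lorenz.yD (EuclideanSpace.single i 1) g p := by
  simp only [Lorenz.lapY, Finset.mul_sum, ← Finset.sum_add_distrib]
  refine Finset.sum_congr rfl fun i _ => ?_
  set v : Space d := EuclideanSpace.single i 1
  rw [yD_congr (fun q hq => hf.yD_mul hg v hq) v hp]
  have h1 := hf.mul (hg.yD v)
  have h2 := hg.mul (hf.yD v)
  have h3 : Lorenz.yD v (fun q => f q * Lorenz.yD v g q + g q * Lorenz.yD v f q) p
      = Lorenz.yD v (fun q => f q * Lorenz.yD v g q) p
        + Lorenz.yD v (fun q => g q * Lorenz.yD v f q) p := by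
    change fderiv ℝ (fun q => f q * Lorenz.yD v g q + g q * Lorenz.yD v f q) p (0, v) = _
    rw [fderiv_fun_add (h1.differentiableAt hp) (h2.differentiableAt hp)]; rfl
  rw [h3, hf.yD_mul (hg.yD v) v hp, hg.yD_mul (hf.yD v) v hp]
  ring

theorem yD_norm (v : Space d) {p : ℝ × Space d} (hp : p.2 ≠ 0) :
    yD v (fun q => ‖q.2‖) p = inner ℝ (dir p.2) v := by
  have := ((hasFDerivAt_norm hp).comp p (hasFDerivAt_snd (𝕜 := ℝ) (p := p))).fderiv
  rw [yD, show (fun q : ℝ × Space d => ‖q.2‖) = (fun y : Space d => ‖y‖) ∘ Prod.snd from rfl, this]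
  rfl

theorem lapY_norm (hd : 1 ≤ d) {p : ℝ × Space d} (hp : p.2 ≠ 0) :
    lapY (fun q => ‖q.2‖) p = (d - 2) * ‖p.2‖⁻¹ := by
  have h1 : ∀ i : Fin (d - 1), yD (EuclideanSpace.single i 1)
      (yD (EuclideanSpace.single i 1) fun q : ℝ × Space d => ‖q.2‖) p
      = ‖p.2‖⁻¹ * (1 - dir p.2 i * dir p.2 i) := by
    intro i
    rw [yD_congr (fun q hq => yD_norm _ hq) _ hp]
    have hd1 : HasFDerivAt (fun q : ℝ × Space d => dir q.2)
        ((fderiv ℝ dir p.2).comp (ContinuousLinearMap.snd ℝ ℝ (Space d))) p :=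
      ((contDiffAt_dir hp).differentiableAt (by simp)).hasFDerivAt.comp p
        (hasFDerivAt_snd (𝕜 := ℝ) (p := p))
    have hd2 := ((innerSL ℝ (EuclideanSpace.single i (1 : ℝ))).hasFDerivAt.comp p hd1).fderiv
    have hd3 : (fun q : ℝ × Space d => inner ℝ (dir q.2) (EuclideanSpace.single i (1 : ℝ)))
        = (innerSL ℝ (EuclideanSpace.single i (1 : ℝ))) ∘ fun q : ℝ × Space d => dir q.2 := by
      funext q
      rw [real_inner_comm]; rfl
    rw [yD, hd3, hd2]
    simp only [ContinuousLinearMap.comp_apply, ContinuousLinearMap.coe_snd', innerSL_apply_apply]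
    rw [fderiv_dir_apply hp, inner_smul_right, inner_sub_right, inner_smul_right, inner_single,
      inner_single, real_inner_comm, inner_single]
    simp
  simp only [lapY, h1, ← Finset.mul_sum, Finset.sum_sub_distrib, sum_dir_sq hp]
  simp only [Finset.sum_const, Finset.card_univ, nsmul_eq_mul, mul_one, card_space hd]
  ring

theorem Hom.coord (i : Fin (d - 1)) : Hom (-1) fun p : ℝ × Space d => p.2 i :=
  ⟨by fun_prop, fun u y s hs hy => by simp⟩

theorem yD_coord (v : Space d) (i : Fin (d - 1)) (p : ℝ × Space d) :
    yD v (fun q => q.2 i) p = v i := by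
  have h : HasFDerivAt (fun q : ℝ × Space d => q.2 i)
      ((EuclideanSpace.proj i : Space d →L[ℝ] ℝ).comp (ContinuousLinearMap.snd ℝ ℝ (Space d))) p :=
    ((EuclideanSpace.proj i : Space d →L[ℝ] ℝ).comp
      (ContinuousLinearMap.snd ℝ ℝ (Space d))).hasFDerivAt
  rw [yD, h.fderiv]; rfl

theorem lapY_coord (i : Fin (d - 1)) (p : ℝ × Space d) : lapY (fun q => q.2 i) p = 0 := by
  have : ∀ v : Space d, yD v (fun q : ℝ × Space d => q.2 i) = fun _ => v i :=
    fun v => funext (yD_coord v i)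
  simp [lapY, this, yD]

theorem norm_smul_nullVec (p : ℝ × Space d) :
    ‖p.2‖ • nullVec p = ‖p.2‖ • timeVec d + ∑ i, p.2 i • spaceVec d i := by
  refine Prod.ext ?_ ?_
  · simp [nullVec, timeVec, spaceVec, Prod.fst_sum]
  · ext j
    simp [nullVec, timeVec, spaceVec, Prod.snd_sum, Pi.single_apply, dir]
    rcases eq_or_ne p.2 0 with h | h
    · simp [h]
    · field_simp [norm_ne_zero_iff.2 h]

theorem Hom.hasDerivAt_u {a : ℝ} {f : ℝ × Space d → F} (hf : Hom a f) (u : ℝ) {y : Space d}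
    (hy : y ≠ 0) : HasDerivAt (fun u => f (u, y)) (Lorenz.uD f (u, y)) u :=
  (hf.differentiableAt (p := (u, y)) hy).hasFDerivAt.comp_hasDerivAt u
    ((hasDerivAt_id u).prodMk (hasDerivAt_const u y))

theorem uD_apply_nullVec {a : ℝ} {f : ℝ × Space d → Covector d} (hf : Hom a f) (u : ℝ) {y : Space d}
    (hy : y ≠ 0) : HasDerivAt (fun u => f (u, y) (nullVec (u, y)))
      (uD f (u, y) (nullVec (u, y))) u :=
  (hf.hasDerivAt_u u hy).clm_apply (hasDerivAt_const u (nullVec (u, y))) |>.congr_deriv (by simp)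

/-! ### Consequences of current conservation and Maxwell's equations, order by order -/

/-- The radial null component of the leading coefficient of a conserved current that decays at
early retarded times vanishes. -/
theorem Exp.null_current_eq_zero {j : Spacetime d → Covector d}
    {c : ℕ → ℝ × Space d → Covector d} (hj : Exp j c) {V : Set (Spacetime d)} (hV : IsNhdScri V)
    (hdiv : ∀ x ∈ V, Lorenz.divergence j x = 0) {n : ℕ}
    (hlow : ∀ k < n, ∀ p : ℝ × Space d, p.2 ≠ 0 → c k p = 0)
    (hearly : ∀ y : Space d, y ≠ 0 → Tendsto (fun u => c n (u, y)) atBot (𝓝 0))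
    {p : ℝ × Space d} (hp : p.2 ≠ 0) : c n p (nullVec p) = 0 := by
  have hz : Exp (Lorenz.divergence j) fun _ (_ : ℝ × Space d) => (0 : ℝ) := by
    refine Exp.congr (f := fun _ => 0) ?_ hV fun x hx => (hdiv x hx).symm
    exact ⟨(Sym.zero 0).smooth, fun k => Hom.zero _, fun K => by simpa [lift] using Sym.zero _⟩
  -- At the leading order the divergence consists of the `u`-derivative alone, because the spatial
  -- divergence comes from the vanishing coefficient `c (n - 2)`.
  have h0 : ∀ q : ℝ × Space d, q.2 ≠ 0 → uD (c n) q (nullVec q) = 0 := by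
    intro q hq
    have h1 := hj.divergence.unique hz n hq
    have h2 : shiftCoef 2 (fun j (p : ℝ × Space d) =>
        ∑ i, yD (EuclideanSpace.single i 1) (c j) p (spaceVec d i)) n q = 0 := by
      unfold shiftCoef
      split_ifs with h
      · refine Finset.sum_eq_zero fun i _ => ?_
        rw [yD_congr (g := fun _ => 0) (hlow (n - 2) (by omega)) _ hq, yD_zero]; rfl
      · rfl
    rw [h2] at h1
    linarith
  obtain ⟨u, y⟩ := p
  have hconst : ∀ v : ℝ, c n (v, y) (nullVec (v, y)) = c n (u, y) (nullVec (u, y)) := by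
    intro v
    have hd : ∀ v, HasDerivAt (fun u => c n (u, y) (nullVec (u, y))) 0 v := fun v => by
      have := uD_apply_nullVec (hj.hom n) v hp
      rwa [h0 (v, y) hp] at this
    exact is_const_of_deriv_eq_zero (fun v => (hd v).differentiableAt) (fun v => (hd v).deriv) v u
  have hlim : Tendsto (fun v => c n (v, y) (nullVec (u, y))) atBot (𝓝 0) := by
    have := ((ContinuousLinearMap.apply ℝ ℝ (nullVec (u, y))).continuous.tendsto 0).comp
      (hearly y hp)
    rw [map_zero] at this
    exact this
  have hlim' : Tendsto (fun _ : ℝ => c n (u, y) (nullVec (u, y))) atBot (𝓝 0) :=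
    hlim.congr hconst
  exact tendsto_nhds_unique tendsto_const_nhds hlim'

/-- The divergence in `y` of the spatial components. -/
def divY (f : ℝ × Space d → Covector d) (p : ℝ × Space d) : ℝ :=
  ∑ i, yD (EuclideanSpace.single i 1) f p (spaceVec d i)

/-- The relations between the coefficients of a potential `b`, its divergence `s` and its current
`c` implied by Maxwell's equations. -/
structure MaxwellCoef (b c : ℕ → ℝ × Space d → Covector d) (s : ℕ → ℝ × Space d → ℝ) : Prop where
  hom : ∀ k : ℕ, Hom ((k : ℝ) / 2) (b k)
  homS : ∀ k : ℕ, Hom ((k : ℝ) / 2) (s k)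
  div : ∀ k (p : ℝ × Space d), p.2 ≠ 0 →
    s k p = -(uD (b k) p (nullVec p)) + shiftCoef 2 (fun j => divY (b j)) k p
  maxwell : ∀ k (p : ℝ × Space d), p.2 ≠ 0 →
    shiftCoef 2 (fun j p => (((j : ℝ) - (d - 2)) * ‖p.2‖⁻¹) • uD (b j) p) k p
      + shiftCoef 4 (fun j => lapY (b j)) k p
      - (liftD0 (s k) p + shiftCoef 2 (fun j => liftD1 (s j)) k p) = -(4 * Real.pi) • c k p
  supp : ∀ k ∉ potentialOrders d, ∀ p : ℝ × Space d, p.2 ≠ 0 → b k p = 0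
  suppJ : ∀ k ∉ currentOrders d, ∀ p : ℝ × Space d, p.2 ≠ 0 → c k p = 0
  null : ∀ p : ℝ × Space d, p.2 ≠ 0 → c (2 * (d - 2)) p (nullVec p) = 0

theorem Exp.divergence' {f : Spacetime d → Covector d} {c : ℕ → ℝ × Space d → Covector d}
    (h : Exp f c) : Exp (Lorenz.divergence f) fun k p => -(uD (c k) p (nullVec p))
      + shiftCoef 2 (fun j => divY (c j)) k p := h.divergence

theorem Exp.maxwell (hd : 1 ≤ d) {B j : Spacetime d → Covector d}
    {b c : ℕ → ℝ × Space d → Covector d} {s : ℕ → ℝ × Space d → ℝ} (hB : Exp B b) (hj : Exp j c)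
    (hs : Exp (Lorenz.divergence B) s) {V : Set (Spacetime d)} (hV : IsNhdScri V)
    (hM : ∀ x ∈ V, Lorenz.box B x - _root_.fderiv ℝ (Lorenz.divergence B) x = -(4 * Real.pi) • j x)
    (k : ℕ) {p : ℝ × Space d} (hp : p.2 ≠ 0) :
    shiftCoef 2 (fun j p => (((j : ℝ) - (d - 2)) * ‖p.2‖⁻¹) • uD (b j) p) k p
      + shiftCoef 4 (fun j => lapY (b j)) k p
      - (Lorenz.liftD0 (s k) p + shiftCoef 2 (fun j => Lorenz.liftD1 (s j)) k p)
      = -(4 * Real.pi) • c k p :=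
  (((hB.box hd).sub hs.fderiv).congr hV hM).unique (hj.const_smul _) k hp

theorem liftD0_timeVec (f : ℝ × Space d → F) (p : ℝ × Space d) :
    liftD0 f p (timeVec d) = uD f p := by simp [liftD0, timeVec]

theorem liftD1_timeVec (f : ℝ × Space d → F) (p : ℝ × Space d) :
    liftD1 f p (timeVec d) = 0 := by simp [liftD1, timeVec, ← Prod.zero_eq_mk]

theorem liftD0_nullVec (f : ℝ × Space d → F) {p : ℝ × Space d} (hp : p.2 ≠ 0) :
    liftD0 f p (nullVec p) = 0 := by
  simp [liftD0, nullVec, norm_dir hp]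

theorem Hom.liftD1_nullVec {a : ℝ} {f : ℝ × Space d → F} (hf : Hom a f) {p : ℝ × Space d}
    (hp : p.2 ≠ 0) : Lorenz.liftD1 f p (Lorenz.nullVec p) = (-a * ‖p.2‖⁻¹) • f p :=
  hf.euler_dir hp

theorem not_mem_potentialOrders_of_lt {k : ℕ} (hd : 4 ≤ d) (h : k < d - 2) :
    k ∉ potentialOrders d := by
  rintro (⟨i, hi⟩ | ⟨_, i, hi⟩) <;> omega

theorem sub_two_not_mem_potentialOrders {k : ℕ} (h2 : 2 ≤ k) (h : k ∉ potentialOrders d) :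
    k - 2 ∉ potentialOrders d := by
  rintro (⟨i, hi⟩ | ⟨ho, i, hi⟩)
  · exact h (Or.inl ⟨i + 1, by omega⟩)
  · exact h (Or.inr ⟨ho, i + 1, by omega⟩)

theorem divY_eq_zero {f : ℝ × Space d → Covector d} (h : ∀ p : ℝ × Space d, p.2 ≠ 0 → f p = 0)
    {p : ℝ × Space d} (hp : p.2 ≠ 0) : divY f p = 0 := by
  refine Finset.sum_eq_zero fun i _ => ?_
  rw [yD_congr (g := fun _ => 0) h _ hp, yD_zero]; rfl

namespace MaxwellCoef

variable {b c : ℕ → ℝ × Space d → Covector d} {s : ℕ → ℝ × Space d → ℝ}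

/-- The allowed orders are stable under adding two to the doubled exponent, so neither the
coefficient `k` nor the coefficient `k - 2` contributes. -/
theorem s_eq_zero (h : MaxwellCoef b c s) {k : ℕ} (hk : k ∉ potentialOrders d)
    {p : ℝ × Space d} (hp : p.2 ≠ 0) : s k p = 0 := by
  rw [h.div k p hp, uD_congr (g := fun _ => 0) (h.supp k hk) hp, uD_zero]
  unfold shiftCoef
  split_ifs with h2
  · beta_reduce
    rw [divY_eq_zero (h.supp _ (sub_two_not_mem_potentialOrders h2 hk)) hp]; simp
  · simp

theorem lapY_eq_zero (h : MaxwellCoef b c s) {k : ℕ} (hk : k ∉ potentialOrders d)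
    {p : ℝ × Space d} (hp : p.2 ≠ 0) (v : Spacetime d) : lapY (b k) p v = 0 := by
  rw [lapY_congr (g := fun _ => 0) (h.supp k hk) hp, lapY_zero]; rfl

/-- Contraction with `∂_t + ∂_r` annihilates `du`, which removes the `u`-derivative of the
divergence; Euler's identity evaluates the remaining radial derivative. -/
theorem maxwell_null (h : MaxwellCoef b c s) (k : ℕ) {p : ℝ × Space d} (hp : p.2 ≠ 0) :
    ((k + 2 : ℝ) - d) * ‖p.2‖⁻¹ * uD (b (k + 2)) p (nullVec p) + lapY (b k) p (nullVec p)
      + ((k + 2 : ℝ) / 2) * ‖p.2‖⁻¹ * s (k + 2) p + 2 * ‖p.2‖⁻¹ * uD (b (k + 2)) p (nullVec p)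
      = -(4 * Real.pi) * c (k + 4) p (nullVec p) := by
  have h1 := congrArg (fun A => A (nullVec p)) (h.maxwell (k + 4) p hp)
  rw [shiftCoef_add 4, show k + 4 = k + 2 + 2 from rfl, shiftCoef_add 2, shiftCoef_add 2] at h1
  simp only [add_apply, sub_apply, smul_apply, liftD0_nullVec _ hp,
    (h.homS (k + 2)).liftD1_nullVec hp, smul_eq_mul] at h1
  push_cast at h1
  rw [← h1]
  ring

/-- Contraction with `∂_t` keeps exactly the `u`-derivative of the divergence. This is the component
that sees the charge flux. -/
theorem maxwell_time (h : MaxwellCoef b c s) (k : ℕ) {p : ℝ × Space d} (hp : p.2 ≠ 0) :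
    ((k + 2 : ℝ) - (d - 2)) * ‖p.2‖⁻¹ * uD (b (k + 2)) p (timeVec d) + lapY (b k) p (timeVec d)
      - uD (s (k + 4)) p = -(4 * Real.pi) * c (k + 4) p (timeVec d) := by
  have h1 := congrArg (fun A => A (timeVec d)) (h.maxwell (k + 4) p hp)
  rw [shiftCoef_add 4, show k + 4 = k + 2 + 2 from rfl, shiftCoef_add 2, shiftCoef_add 2] at h1
  simp only [add_apply, sub_apply, smul_apply, liftD0_timeVec, liftD1_timeVec, smul_eq_mul,
    add_zero] at h1
  push_cast at h1
  exact h1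

theorem null_current (h : MaxwellCoef b c s) {k : ℕ}
    (hk : k ∉ currentOrders d ∨ k = 2 * (d - 2)) {p : ℝ × Space d} (hp : p.2 ≠ 0) :
    c k p (nullVec p) = 0 := by
  rcases hk with hk | rfl
  · rw [h.suppJ k hk p hp]; rfl
  · exact h.null p hp

/-- The divergence starts one order later than generic. -/
theorem s_first (h : MaxwellCoef b c s) (hd : 4 ≤ d) {p : ℝ × Space d} (hp : p.2 ≠ 0) :
    s (d - 2) p = 0 := by
  obtain ⟨n, rfl⟩ := Nat.exists_eq_add_of_le hd
  have h1 := h.maxwell_null n hp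
  have hn : n ∉ potentialOrders (4 + n) := not_mem_potentialOrders_of_lt hd (by omega)
  -- The index `d` is a current order only for `d = 4`, where it is the leading one. At this order
  -- the two terms with `∂_u b` cancel, so that a nonzero multiple of `s (d - 2)` remains.
  rw [h.lapY_eq_zero hn hp, h.null_current (k := n + 4) (by
    by_cases h0 : n = 0
    · right; omega
    · left; rintro ⟨i, hi⟩; omega) hp] at h1
  have hp' : ‖p.2‖⁻¹ ≠ 0 := inv_ne_zero (norm_ne_zero_iff.2 hp)
  have h2 : ((n + 2 : ℝ) / 2 * ‖p.2‖⁻¹) * s (n + 2) p = 0 := by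
    push_cast at h1
    linear_combination h1
  rw [show 4 + n - 2 = n + 2 by omega]
  refine (mul_eq_zero.1 h2).resolve_left (mul_ne_zero ?_ hp')
  positivity

/-- At this order the factor `k - (d-2)` in front of `∂_u b` is zero, so the time derivative of `s
d` is the current component by itself. -/
theorem uD_s (h : MaxwellCoef b c s) (hd : 4 ≤ d) {p : ℝ × Space d} (hp : p.2 ≠ 0)
    (hc : c d p (timeVec d) = 0) : uD (s d) p = 0 := by
  obtain ⟨n, rfl⟩ := Nat.exists_eq_add_of_le hd
  have h1 := h.maxwell_time n hp
  have hn : n ∉ potentialOrders (4 + n) := not_mem_potentialOrders_of_lt hd (by omega)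
  have ec : c (n + 4) = c (4 + n) := congrArg c (add_comm n 4)
  have es : s (n + 4) = s (4 + n) := congrArg s (add_comm n 4)
  rw [h.lapY_eq_zero hn hp, ec, es, hc] at h1
  push_cast at h1
  linear_combination -h1

/-- First order of the integer series. The order before it is absent, hence the divergence there is
`-∂_u b(∂_t + ∂_r)`; inserting this in the null component leaves `(d-3) - (d-4) = 1` times the
divergence. -/
theorem s_second (h : MaxwellCoef b c s) (hd : 4 ≤ d) (hodd : Odd d) {p : ℝ × Space d}
    (hp : p.2 ≠ 0) : s (2 * (d - 3)) p = 0 := by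
  obtain ⟨m, hm⟩ := hodd
  have hn : 2 * (d - 4) ∉ potentialOrders d := by
    rintro (⟨i, hi⟩ | ⟨_, i, hi⟩) <;> omega
  have h1 := h.maxwell_null (2 * (d - 4)) hp
  -- The current index here is `2(d-2)`, the leading order, where conservation applies.
  rw [h.lapY_eq_zero hn hp, h.null_current (k := 2 * (d - 4) + 4) (Or.inr (by omega)) hp] at h1
  have h2 := h.div (2 * (d - 4) + 2) p hp
  rw [shiftCoef_add, divY_eq_zero (h.supp _ hn) hp] at h2
  have hp' : ‖p.2‖⁻¹ ≠ 0 := inv_ne_zero (norm_ne_zero_iff.2 hp)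
  have h3 : ‖p.2‖⁻¹ * s (2 * (d - 4) + 2) p = 0 := by
    push_cast [Nat.cast_sub hd] at h1
    rw [h2] at h1 ⊢
    linear_combination h1
  rw [show 2 * (d - 3) = 2 * (d - 4) + 2 by omega]
  exact (mul_eq_zero.1 h3).resolve_left hp'

/-- `|y| b(∂_t + ∂_r)` for the leading coefficient `b`. -/
def radial (b : ℕ → ℝ × Space d → Covector d) (p : ℝ × Space d) : ℝ :=
  ‖p.2‖ * b (d - 2) p (nullVec p)

theorem hom_radial (h : MaxwellCoef b c s) (hd : 4 ≤ d) :
    Hom (((d - 4 : ℕ) : ℝ) / 2) (radial b) := by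
  have h1 := (h.hom (d - 2)).bilinear Hom.nullVec (ContinuousLinearMap.id ℝ (Covector d))
  have h2 := Hom.norm.mul h1
  convert h2 using 1
  swap
  · rfl
  rw [Nat.cast_sub hd, Nat.cast_sub (by omega : 2 ≤ d)]
  push_cast
  ring

/-- The divergence at order `d - 2` vanishes and receives nothing from the spatial divergence, so
the null component of the leading coefficient is constant in `u`. -/
theorem uD_radial (h : MaxwellCoef b c s) (hd : 4 ≤ d) {p : ℝ × Space d} (hp : p.2 ≠ 0) :
    uD (radial b) p = 0 := by
  have h1 := ((h.hom_radial hd).hasDerivAt_u p.1 hp)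
  have h2 := (uD_apply_nullVec (h.hom (d - 2)) p.1 hp).const_mul ‖p.2‖
  have h3 := h.div (d - 2) p hp
  have hn : d - 2 - 2 ∉ potentialOrders d := not_mem_potentialOrders_of_lt hd (by omega)
  rw [h.s_first hd hp, shiftCoef, if_pos (by omega : 2 ≤ d - 2),
    divY_eq_zero (h.supp _ hn) hp] at h3
  have h4 : uD (b (d - 2)) p (nullVec p) = 0 := by linarith
  rw [show uD (b (d - 2)) (p.1, p.2) (nullVec (p.1, p.2)) = 0 from h4, mul_zero] at h2
  exact h1.unique h2

/-- Since `|y|(∂_t + ∂_r) = |y| ∂_t + y^i ∂_i`, the product rule gives `|y| Δb(∂_t + ∂_r) + 2 div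
b`. Maxwell's null component replaces the first term by `-2 ∂_u b_d(∂_t + ∂_r) - (d/2) s_d`, and the
definition of `s_d` combines the rest to `2 s_d`. -/
theorem lapY_radial (h : MaxwellCoef b c s) (hd : 4 < d) {p : ℝ × Space d} (hp : p.2 ≠ 0) :
    lapY (radial b) p = (2 - (d : ℝ) / 2) * s d p := by
  obtain ⟨n, rfl⟩ := Nat.exists_eq_add_of_le hd.le
  have e2 : 4 + n - 2 = n + 2 := by omega
  have hb : Hom (((n + 2 : ℕ) : ℝ) / 2) (b (n + 2)) := h.hom (n + 2)
  have happ : ∀ v : Spacetime (4 + n), Hom (((n + 2 : ℕ) : ℝ) / 2) fun q => b (n + 2) q v :=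
    fun v => hb.clm (ContinuousLinearMap.apply ℝ ℝ v)
  have hlapv : ∀ v, lapY (fun q => b (n + 2) q v) p = lapY (b (n + 2)) p v :=
    fun v => hb.lapY_clm (ContinuousLinearMap.apply ℝ ℝ v) hp
  have hyDv : ∀ v w, yD w (fun q => b (n + 2) q v) p = yD w (b (n + 2)) p v :=
    fun v w => yD_clm (hb.differentiableAt hp) (ContinuousLinearMap.apply ℝ ℝ v) w
  have hrad : ∀ q : ℝ × Space (4 + n), q.2 ≠ 0 → radial b q = ‖q.2‖ * b (n + 2) q (timeVec (4 + n))
      + ∑ i, q.2 i * b (n + 2) q (spaceVec (4 + n) i) := by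
    intro q _
    have := congrArg (b (n + 2) q) (norm_smul_nullVec q)
    simp only [map_smul, map_add, map_sum, smul_eq_mul] at this
    rw [radial, e2, this]
  have h1 := Hom.norm.mul (happ (timeVec (4 + n)))
  have h2 : ∀ i, Hom (-1 + ((n + 2 : ℕ) : ℝ) / 2)
      fun q : ℝ × Space (4 + n) => q.2 i * b (n + 2) q (spaceVec (4 + n) i) :=
    fun i => (Hom.coord i).mul (happ _)
  rw [lapY_congr hrad hp, h1.lapY_add (Hom.sum _ fun i _ => h2 i) hp,
    Hom.lapY_sum _ (fun i _ => h2 i) hp, Hom.norm.lapY_mul (happ _) hp, lapY_norm (by omega) hp]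
  have h3 : ∀ i, lapY (fun q : ℝ × Space (4 + n) => q.2 i * b (n + 2) q (spaceVec (4 + n) i)) p
      = p.2 i * lapY (b (n + 2)) p (spaceVec (4 + n) i)
        + 2 * yD (EuclideanSpace.single i 1) (b (n + 2)) p (spaceVec (4 + n) i) := by
    intro i
    rw [(Hom.coord i).lapY_mul (happ _) hp, lapY_coord, hlapv]
    simp only [yD_coord, hyDv]
    rw [Finset.sum_eq_single i]
    · simp
    · intro j _ hj; simp [hj.symm]
    · simp
  simp only [h3, hlapv, hyDv, yD_norm _ hp, inner_single, Finset.sum_add_distrib, ← Finset.mul_sum]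
  -- Euler's identity for degree `-(d-2)/2`: twice this cross term cancels the contribution of `Δ|y|
  -- = (d-2)/|y|` exactly.
  have h4 : ∑ i, dir p.2 i * yD (EuclideanSpace.single i 1) (b (n + 2)) p (timeVec (4 + n))
      = -((n + 2 : ℕ) : ℝ) / 2 * ‖p.2‖⁻¹ * b (n + 2) p (timeVec (4 + n)) := by
    have e1 := sum_apply_single ((fderiv ℝ (fun q => b (n + 2) q (timeVec (4 + n))) p).comp
      (ContinuousLinearMap.inr ℝ ℝ (Space (4 + n)))) (dir p.2)
    have e3 := (happ (timeVec (4 + n))).euler_dir hp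
    simp only [ContinuousLinearMap.comp_apply, ContinuousLinearMap.inr_apply] at e1
    rw [e3] at e1
    simp only [← hyDv, smul_eq_mul] at e1 ⊢
    rw [neg_div]
    exact e1
  have h5 : ‖p.2‖ * lapY (b (n + 2)) p (nullVec p) = ‖p.2‖ * lapY (b (n + 2)) p (timeVec (4 + n))
      + ∑ i, p.2 i * lapY (b (n + 2)) p (spaceVec (4 + n) i) := by
    have := congrArg (fun v => lapY (b (n + 2)) p v) (norm_smul_nullVec p)
    simpa only [map_smul, map_add, map_sum, smul_eq_mul] using this
  have h6 := h.maxwell_null (n + 2) hp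
  -- For `d > 4` the index `d + 2` is a current order only if `d = 6`, and then it is the leading
  -- one. In dimension four it would be a subleading order, where the null component need not
  -- vanish.
  rw [h.null_current (k := n + 2 + 4) (by
    by_cases h0 : n = 2
    · right; omega
    · left; rintro ⟨i, hi⟩; omega) hp] at h6
  have h7 := h.div (n + 2 + 2) p hp
  rw [shiftCoef_add] at h7
  have hp' : ‖p.2‖ ≠ 0 := norm_ne_zero_iff.2 hp
  have e4 : s (4 + n) p = s (n + 2 + 2) p := by rw [show 4 + n = n + 2 + 2 by omega]
  rw [h4, e4]
  rw [show ∑ i, yD (EuclideanSpace.single i 1) (b (n + 2)) p (spaceVec (4 + n) i)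
    = divY (b (n + 2)) p from rfl]
  push_cast at h6 ⊢
  have h8 : ‖p.2‖ * lapY (b (n + 2)) p (nullVec p)
      = -2 * uD (b (n + 2 + 2)) p (nullVec p) - ((n + 4 : ℝ) / 2) * s (n + 2 + 2) p := by
    have h9 := congrArg (fun t => ‖p.2‖ * t) h6
    simp only [mul_zero] at h9
    have h10 : ‖p.2‖ * ‖p.2‖⁻¹ = 1 := mul_inv_cancel₀ hp'
    linear_combination h9 - (2 * uD (b (n + 2 + 2)) p (nullVec p)
      + ((n + 4 : ℝ) / 2) * s (n + 2 + 2) p) * h10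
  linear_combination -h5 + h8 - 2 * h7

end MaxwellCoef

end

section

/-! ### The wave equation with Schwartz source, by spatial Fourier transform -/

section WaveSolver

open MeasureTheory SchwartzMap FourierTransform

variable {d : ℕ} {F : Type} [NormedAddCommGroup F] [NormedSpace ℂ F]

/-- The decay weight `(1 + |t|)^(-a)`. -/
def wt {E : Type*} [NormedAddCommGroup E] (a : ℝ) (t : E) : ℝ := (1 + ‖t‖) ^ (-a)

theorem wt_pos {E : Type*} [NormedAddCommGroup E] (a : ℝ) (t : E) : 0 < wt a t := by
  unfold wt; positivity

/-- Peetre's inequality: translating a weight costs a factor that depends only on the translation.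
-/
theorem wt_add_le {E : Type*} [NormedAddCommGroup E] {a : ℝ} (ha : 0 ≤ a) (s t : E) :
    wt a (s + t) ≤ (1 + ‖s‖) ^ a * wt a t := by
  unfold wt
  have h1 : 1 + ‖t‖ ≤ (1 + ‖s‖) * (1 + ‖s + t‖) := by
    have : ‖t‖ ≤ ‖s + t‖ + ‖s‖ := by
      simpa using norm_sub_le (s + t) s
    nlinarith [mul_nonneg (norm_nonneg s) (norm_nonneg (s + t))]
  have h2 : (1 + ‖t‖) ^ a ≤ (1 + ‖s‖) ^ a * (1 + ‖s + t‖) ^ a := by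
    rw [← Real.mul_rpow (by positivity) (by positivity)]
    exact Real.rpow_le_rpow (by positivity) h1 ha
  rw [Real.rpow_neg (by positivity), Real.rpow_neg (by positivity)]
  have h3 : 0 < (1 + ‖t‖) ^ a := by positivity
  have h4 : 0 < (1 + ‖s + t‖) ^ a := by positivity
  rw [inv_le_iff_one_le_mul₀ h4, mul_assoc, mul_comm _⁻¹, ← mul_assoc,
    ← div_eq_mul_inv, le_div_iff₀ h3, one_mul]
  exact h2

theorem wt_add {E : Type*} [NormedAddCommGroup E] (a b : ℝ) (t : E) :
    wt (a + b) t = wt a t * wt b t := by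
  unfold wt
  rw [← Real.rpow_add (by positivity)]; ring_nf

theorem integrable_wt_space (hd : 1 ≤ d) : Integrable (fun y : Space d => wt d y) := by
  unfold wt
  refine integrable_one_add_norm ?_
  rw [finrank_euclideanSpace, Fintype.card_fin]
  exact_mod_cast (by omega : d - 1 < d)

theorem schwartz_bound (g : 𝓢(Spacetime d, F)) (N M : ℕ) :
    ∃ C : ℝ, 0 ≤ C ∧ ∀ x : Spacetime d, ‖g x‖ ≤ C * wt N x.1 * wt M x.2 := by
  refine ⟨2 ^ (N + M) * ((Finset.Iic (N + M, 0)).sup fun m => SchwartzMap.seminorm ℝ m.1 m.2) g,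
    by positivity, fun x => ?_⟩
  have h := one_add_le_sup_seminorm_apply (𝕜 := ℝ) (m := (N + M, 0)) (k := N + M) (n := 0) le_rfl
    le_rfl g x
  rw [norm_iteratedFDeriv_zero] at h
  set C := 2 ^ (N + M) * ((Finset.Iic (N + M, 0)).sup fun m => SchwartzMap.seminorm ℝ m.1 m.2) g
  have h1 : ‖x.1‖ ≤ ‖x‖ := norm_fst_le x
  have h2 : ‖x.2‖ ≤ ‖x‖ := norm_snd_le x
  unfold wt
  rw [Real.rpow_neg (by positivity), Real.rpow_neg (by positivity), Real.rpow_natCast,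
    Real.rpow_natCast, mul_assoc, ← mul_inv, ← div_eq_mul_inv, le_div_iff₀ (by positivity), mul_comm]
  refine le_trans (mul_le_mul_of_nonneg_right ?_ (norm_nonneg _)) h
  rw [pow_add]
  gcongr

/-- The spatial Fourier transform of `y ↦ g (p + (τ, y))`, as a function of `z = (τ, ξ)`. -/
def slab (g : Spacetime d → F) (p z : Spacetime d) : F :=
  𝓕 (fun y : Space d => g (p + (z.1, y))) z.2

theorem slab_eq (g : Spacetime d → F) (p z : Spacetime d) :
    slab g p z = ∫ y : Space d, Real.fourierChar (-inner ℝ y z.2) • g (p + (z.1, y)) := rfl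

/-- A bound uniform over a unit ball of translations, as domination for differentiating and taking
limits under the integral. -/
theorem schwartz_translate_bound (hd : 1 ≤ d) (g : 𝓢(Spacetime d, F)) (p : Spacetime d) (N : ℕ) :
    ∃ C : ℝ, 0 ≤ C ∧ ∀ q : Spacetime d, ‖q - p‖ ≤ 1 → ∀ z : Spacetime d,
      ‖g (q + z)‖ ≤ C * wt N z.1 * wt d z.2 := by
  obtain ⟨C, hC, h⟩ := schwartz_bound g N d
  refine ⟨C * (2 + ‖p‖) ^ (N : ℝ) * (2 + ‖p‖) ^ (d : ℝ), by positivity, fun q hq z => ?_⟩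
  have hqn : ‖q‖ ≤ 1 + ‖p‖ := by
    have := norm_add_le (q - p) p
    rw [sub_add_cancel] at this; linarith
  have h1 : wt N (q + z).1 ≤ (2 + ‖p‖) ^ (N : ℝ) * wt N z.1 := by
    refine (wt_add_le (by positivity) q.1 z.1).trans
      (mul_le_mul_of_nonneg_right (Real.rpow_le_rpow (by positivity) ?_ (by positivity))
        (wt_pos _ _).le)
    linarith [norm_fst_le q]
  have h2 : wt d (q + z).2 ≤ (2 + ‖p‖) ^ (d : ℝ) * wt d z.2 := by
    refine (wt_add_le (by positivity) q.2 z.2).trans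
      (mul_le_mul_of_nonneg_right (Real.rpow_le_rpow (by positivity) ?_ (by positivity))
        (wt_pos _ _).le)
    linarith [norm_snd_le q]
  refine (h (q + z)).trans ?_
  have h3 := mul_le_mul h1 h2 (wt_pos _ _).le (mul_nonneg (by positivity) (wt_pos _ _).le)
  calc C * wt N (q + z).1 * wt d (q + z).2 = C * (wt N (q + z).1 * wt d (q + z).2) := by ring
    _ ≤ C * ((2 + ‖p‖) ^ (N : ℝ) * wt N z.1 * ((2 + ‖p‖) ^ (d : ℝ) * wt d z.2)) := by gcongr
    _ = _ := by ring

theorem integrable_slice (hd : 1 ≤ d) (g : 𝓢(Spacetime d, F)) (p : Spacetime d) (τ : ℝ) :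
    Integrable fun y : Space d => g (p + (τ, y)) := by
  obtain ⟨C, hC, h⟩ := schwartz_translate_bound hd g p 0
  refine Integrable.mono' ((integrable_wt_space hd).const_mul (C * wt ((0 : ℕ) : ℝ) τ)) ?_
    (ae_of_all _ fun y => h p (by simp) (τ, y))
  exact (g.continuous.comp (by fun_prop)).aestronglyMeasurable

theorem continuous_slab (hd : 1 ≤ d) (g : 𝓢(Spacetime d, F)) (p : Spacetime d) :
    Continuous (slab g p) := by
  refine continuous_iff_continuousAt.2 fun z => ?_
  obtain ⟨C, hC, h⟩ := schwartz_translate_bound hd g (p + (z.1, 0)) 0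
  suffices ContinuousAt (fun w : Spacetime d => ∫ y : Space d,
      Real.fourierChar (-inner ℝ y w.2) • g (p + (w.1, y))) z from this
  refine continuousAt_of_dominated (bound := fun y : Space d => C * wt ((0 : ℕ) : ℝ) (0 : ℝ) * wt d y)
    ?_ ?_ ((integrable_wt_space hd).const_mul _) ?_
  · refine Eventually.of_forall fun w => Continuous.aestronglyMeasurable ?_
    exact (Real.continuous_fourierChar.comp (by fun_prop)).smul (g.continuous.comp (by fun_prop))
  · filter_upwards [Metric.closedBall_mem_nhds z one_pos] with w hw
    refine ae_of_all _ fun y => ?_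
    have h1 : ‖(p + (w.1, 0)) - (p + (z.1, (0 : Space d)))‖ ≤ 1 := by
      have := norm_fst_le (w - z)
      rw [mem_closedBall_iff_norm] at hw
      simpa [Prod.norm_def] using this.trans hw
    have h2 := h _ h1 (0, y)
    rw [Circle.norm_smul]
    simpa [add_assoc] using h2
  · refine ae_of_all _ fun y => Continuous.continuousAt ?_
    exact (Real.continuous_fourierChar.comp (by fun_prop)).smul (g.continuous.comp (by fun_prop))

variable (d F) in
/-- The total derivative of a Schwartz function. -/
abbrev Dg : 𝓢(Spacetime d, F) → 𝓢(Spacetime d, Spacetime d →L[ℝ] F) :=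
  SchwartzMap.fderivCLM ℝ (Spacetime d) F

/-- The point `p` enters only as a translation of `g`, so a derivative in `p` falls on `g`. -/
theorem hasFDerivAt_slab (hd : 1 ≤ d) (g : 𝓢(Spacetime d, F)) (p z : Spacetime d) :
    HasFDerivAt (fun q => slab g q z) (slab (Dg d F g) p z) p := by
  obtain ⟨C, hC, h⟩ := schwartz_translate_bound hd (Dg d F g) p 0
  refine hasFDerivAt_integral_of_dominated_of_fderiv_le (s := Metric.closedBall p 1)
    (bound := fun y : Space d => C * wt ((0 : ℕ) : ℝ) z.1 * wt d y)
    (F := fun q y => Real.fourierChar (-inner ℝ y z.2) • g (q + (z.1, y)))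
    (F' := fun q y => Real.fourierChar (-inner ℝ y z.2) • Dg d F g (q + (z.1, y)))
    (Metric.closedBall_mem_nhds p one_pos) ?_ ?_ ?_ ?_
    ((integrable_wt_space hd).const_mul _) ?_
  · refine Eventually.of_forall fun w => Continuous.aestronglyMeasurable ?_
    exact (Real.continuous_fourierChar.comp (by fun_prop)).smul (g.continuous.comp (by fun_prop))
  · exact (Real.fourierIntegral_convergent_iff z.2).2 (integrable_slice hd g p z.1)
  · refine Continuous.aestronglyMeasurable ?_
    exact (Real.continuous_fourierChar.comp (by fun_prop)).smul
      ((Dg d F g).continuous.comp (by fun_prop))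
  · refine ae_of_all _ fun y q hq => ?_
    refine (Circle.norm_smul (Real.fourierChar (-inner ℝ y z.2))
      (Dg d F g (q + (z.1, y)))).le.trans ?_
    exact h q (by rwa [← mem_closedBall_iff_norm]) (z.1, y)
  · refine ae_of_all _ fun y q _ => ?_
    have h1 : HasFDerivAt g (Dg d F g (q + (z.1, y))) (q + (z.1, y)) :=
      (g.differentiableAt).hasFDerivAt
    have h2 : HasFDerivAt (fun q => g (q + (z.1, y))) (Dg d F g (q + (z.1, y))) q :=
      h1.comp q ((hasFDerivAt_id q).add_const _)
    exact h2.const_smul (Real.fourierChar (-inner ℝ y z.2))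

/-- The Fourier transform turns a spatial derivative into multiplication by `2πi ξ`. -/
theorem slab_fderiv_snd (hd : 1 ≤ d) (g : 𝓢(Spacetime d, F)) (p z : Spacetime d) (v : Space d) :
    slab (Dg d F g) p z (0, v)
      = (2 * Real.pi * Complex.I * (inner ℝ z.2 v : ℝ)) • slab g p z := by
  have hi := integrable_slice hd (Dg d F g) p z.1
  have hder : ∀ y : Space d, HasFDerivAt (fun y => g (p + (z.1, y)))
      ((Dg d F g (p + (z.1, y))).comp (ContinuousLinearMap.inr ℝ ℝ (Space d))) y := by
    intro y
    have h1 : HasFDerivAt g (Dg d F g (p + (z.1, y))) (p + (z.1, y)) :=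
      (g.differentiableAt).hasFDerivAt
    exact h1.comp y ((hasFDerivAt_prodMk_right z.1 y).const_add p)
  have hfd : fderiv ℝ (fun y => g (p + (z.1, y))) = fun y =>
      (Dg d F g (p + (z.1, y))).comp (ContinuousLinearMap.inr ℝ ℝ (Space d)) :=
    funext fun y => (hder y).fderiv
  have hi' : Integrable (fderiv ℝ fun y : Space d => g (p + (z.1, y))) := by
    rw [hfd]
    let R : (Spacetime d →L[ℝ] F) →L[ℝ] Space d →L[ℝ] F := (ContinuousLinearMap.compL ℝ (Space d)
      (Spacetime d) F).flip (ContinuousLinearMap.inr ℝ ℝ (Space d))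
    exact R.integrable_comp hi
  have key := congrFun (Real.fourier_fderiv (integrable_slice hd g p z.1)
    (fun y => (hder y).differentiableAt) hi') z.2
  have key' := congrArg (fun A => A v) key
  rw [hfd] at key'
  simp only [VectorFourier.fourierSMulRight_apply] at key'
  have h3 : (𝓕 (fun y => (Dg d F g (p + (z.1, y))).comp (ContinuousLinearMap.inr ℝ ℝ (Space d))) :
      Space d → Space d →L[ℝ] F) z.2 v
      = slab (Dg d F g) p z (0, v) := by
    rw [slab_eq, Real.fourier_eq]
    rw [ContinuousLinearMap.integral_apply, ContinuousLinearMap.integral_apply]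
    · rfl
    · exact (Real.fourierIntegral_convergent_iff z.2).2 hi
    · rw [hfd] at hi'
      exact (Real.fourierIntegral_convergent_iff z.2).2 hi'
  rw [← h3, key']
  change -(2 * Real.pi * Complex.I) • (-inner ℝ z.2 v) • slab g p z = _
  rw [neg_smul, neg_smul, smul_neg, neg_neg,
    mul_smul (2 * (Real.pi : ℂ) * Complex.I) ((inner ℝ z.2 v : ℝ) : ℂ), Complex.coe_smul]

/-- A shift in `τ` is a shift of `p` in time, which reduces this to the derivative in `p`. -/
theorem slab_fderiv_fst (g : 𝓢(Spacetime d, F)) (p : Spacetime d) (τ : ℝ) (ξ : Space d)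
    (hd : 1 ≤ d) :
    HasDerivAt (fun τ => slab g p (τ, ξ)) (slab (Dg d F g) p (τ, ξ) (timeVec d)) τ := by
  have h0 : ∀ s : ℝ, slab g p (s, ξ) = slab g (p + (s, 0)) (0, ξ) := by
    intro s
    rw [slab_eq, slab_eq]
    refine integral_congr_ae (ae_of_all _ fun y => ?_)
    simp [add_assoc]
  have h1 := hasFDerivAt_slab hd g (p + (τ, 0)) (0, ξ)
  have h2 : HasDerivAt (fun s : ℝ => p + (s, (0 : Space d))) (timeVec d) τ :=
    ((hasDerivAt_id τ).prodMk (hasDerivAt_const τ (0 : Space d))).const_add p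
  have h3 := h1.comp_hasDerivAt τ h2
  have h4 : slab (Dg d F g) (p + (τ, 0)) (0, ξ) = slab (Dg d F g) p (τ, ξ) := by
    rw [slab_eq, slab_eq]
    refine integral_congr_ae (ae_of_all _ fun y => ?_)
    simp [add_assoc]
  rw [h4] at h3
  exact h3.congr_of_eventuallyEq (Eventually.of_forall fun s => h0 s)

theorem slab_bound_zero (hd : 1 ≤ d) (g : 𝓢(Spacetime d, F)) (N : ℕ) :
    ∃ C : ℝ, 0 ≤ C ∧ ∀ p z : Spacetime d, ‖slab g p z‖ ≤ C * wt N (p.1 + z.1) := by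
  obtain ⟨C, hC, h⟩ := schwartz_bound g N d
  refine ⟨C * ∫ y : Space d, wt d y, mul_nonneg hC (integral_nonneg fun y => (wt_pos _ _).le),
    fun p z => ?_⟩
  have h1 : Integrable fun y : Space d => C * wt N (p.1 + z.1) * wt d (p.2 + y) :=
    ((integrable_wt_space hd).comp_add_left p.2).const_mul _
  have h2 := norm_integral_le_of_norm_le (f := fun y : Space d =>
    Real.fourierChar (-inner ℝ y z.2) • g (p + (z.1, y))) h1
    (ae_of_all _ fun y => by rw [Circle.norm_smul]; exact h (p + (z.1, y)))
  rw [integral_const_mul, integral_add_left_eq_self (fun y : Space d => wt d y) p.2] at h2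
  rw [slab_eq]
  linarith

/-- Each power of `|ξ|` is paid for by one derivative of `g`; time decay is inherited directly. The
induction replaces `g` by its derivative, so the target space has to vary. -/
theorem slab_bound (hd : 1 ≤ d) (N M : ℕ) : ∀ {F : Type} [NormedAddCommGroup F] [NormedSpace ℂ F]
    (g : 𝓢(Spacetime d, F)), ∃ C : ℝ, 0 ≤ C ∧ ∀ p z : Spacetime d,
      ‖slab g p z‖ ≤ C * wt N (p.1 + z.1) * wt M z.2 := by
  induction M with
  | zero =>
    intro F _ _ g
    obtain ⟨C, hC, h⟩ := slab_bound_zero hd g N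
    exact ⟨C, hC, fun p z => by simpa [wt] using h p z⟩
  | succ M ih =>
    intro F _ _ g
    obtain ⟨C, hC, h⟩ := ih g
    obtain ⟨C', hC', h'⟩ := ih (Dg d F g)
    refine ⟨C + C', by positivity, fun p z => ?_⟩
    have h1 : ‖z.2‖ * ‖slab g p z‖ ≤ ‖slab (Dg d F g) p z‖ := by
      rcases eq_or_ne z.2 0 with h0 | h0
      · rw [h0]; simp
      have h2 := (slab (Dg d F g) p z).le_opNorm (0, z.2)
      rw [slab_fderiv_snd hd g p z z.2, norm_smul, real_inner_self_eq_norm_sq] at h2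
      have h3 : 0 < ‖z.2‖ := norm_pos_iff.2 h0
      have h4 : ‖((0 : ℝ), z.2)‖ = ‖z.2‖ := by simp [Prod.norm_def]
      have h5 : ‖2 * (Real.pi : ℂ) * Complex.I * ((‖z.2‖ ^ 2 : ℝ) : ℂ)‖
          = 2 * Real.pi * ‖z.2‖ ^ 2 := by
        simp [abs_of_pos Real.pi_pos]
      rw [h4, h5] at h2
      have h6 : 2 * Real.pi * (‖z.2‖ * ‖slab g p z‖) ≤ ‖slab (Dg d F g) p z‖ := by
        refine le_of_mul_le_mul_right ?_ h3
        linarith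
      refine le_trans ?_ h6
      have : 0 ≤ ‖z.2‖ * ‖slab g p z‖ := by positivity
      nlinarith [Real.pi_gt_three]
    have h7 : (1 + ‖z.2‖) * ‖slab g p z‖ ≤ (C + C') * wt N (p.1 + z.1) * wt M z.2 := by
      have := h p z
      have := h' p z
      linarith
    have h8 : wt ((M + 1 : ℕ) : ℝ) z.2 = wt M z.2 / (1 + ‖z.2‖) := by
      unfold wt
      rw [Real.rpow_neg (by positivity), Real.rpow_neg (by positivity), Real.rpow_natCast,
        Real.rpow_natCast, pow_succ, mul_inv]; rfl
    rw [h8, ← mul_div_assoc, le_div_iff₀ (by positivity)]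
    linarith

/-- The propagator `sin (2π|ξ|τ) / (2π|ξ|)`. -/
def propagator (z : Spacetime d) : ℝ := z.1 * Real.sinc (2 * Real.pi * ‖z.2‖ * z.1)

theorem continuous_propagator : Continuous (propagator : Spacetime d → ℝ) :=
  continuous_fst.mul (Real.continuous_sinc.comp (by fun_prop))

theorem abs_propagator_le (z : Spacetime d) : |propagator z| ≤ |z.1| := by
  rw [propagator, abs_mul]
  exact mul_le_of_le_one_right (abs_nonneg _) (Real.abs_sinc_le_one _)

theorem hasDerivAt_propagator (ξ : Space d) (τ : ℝ) :
    HasDerivAt (fun τ => propagator (τ, ξ)) (Real.cos (2 * Real.pi * ‖ξ‖ * τ)) τ := by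
  rcases eq_or_ne (2 * Real.pi * ‖ξ‖) 0 with h | h
  · simpa [propagator, h] using hasDerivAt_id' τ
  · have h1 : (fun τ => propagator (τ, ξ))
        = fun τ => (2 * Real.pi * ‖ξ‖)⁻¹ * Real.sin (2 * Real.pi * ‖ξ‖ * τ) := by
      funext τ
      rcases eq_or_ne τ 0 with rfl | hτ
      · simp [propagator]
      · rw [propagator, Real.sinc_of_ne_zero (mul_ne_zero h hτ)]
        field_simp
    rw [h1]
    have h2 := ((hasDerivAt_id τ).const_mul (2 * Real.pi * ‖ξ‖)).sin.const_mul
      (2 * Real.pi * ‖ξ‖)⁻¹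
    refine h2.congr_deriv ?_
    simp only [id, mul_one]
    rw [mul_comm (Real.cos _), ← mul_assoc, inv_mul_cancel₀ h, one_mul]

theorem hasDerivAt_cos_propagator (ξ : Space d) (τ : ℝ) :
    HasDerivAt (fun τ => Real.cos (2 * Real.pi * ‖ξ‖ * τ))
      (-(2 * Real.pi * ‖ξ‖) ^ 2 * propagator (τ, ξ)) τ := by
  have h2 := ((hasDerivAt_id τ).const_mul (2 * Real.pi * ‖ξ‖)).cos
  refine h2.congr_deriv ?_
  simp only [id, mul_one, propagator]
  rcases eq_or_ne (2 * Real.pi * ‖ξ‖ * τ) 0 with h | h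
  · rw [h]
    simp only [Real.sin_zero, Real.sinc_zero]
    linear_combination (2 * Real.pi * ‖ξ‖) * h
  · rw [Real.sinc_of_ne_zero h]
    have h3 : 2 * Real.pi * ‖ξ‖ ≠ 0 := left_ne_zero_of_mul h
    have h4 : τ ≠ 0 := right_ne_zero_of_mul h
    field_simp

/-- The measure on `(τ, ξ)` with `τ > 0`. -/
def futureMeasure (d : ℕ) : Measure (Spacetime d) :=
  (volume.restrict (Ioi (0 : ℝ))).prod volume

/-- The solution of the wave equation with source `-g` and no data in the far future. -/
def wave (g : Spacetime d → F) (p : Spacetime d) : F :=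
  ∫ z, propagator z • slab g p z ∂futureMeasure d

theorem integrable_wt_time (a : ℝ) (ha : 1 < a) :
    Integrable (fun τ : ℝ => wt a τ) (volume.restrict (Ioi (0 : ℝ))) := by
  unfold wt
  exact (integrable_one_add_norm (by simpa using ha)).restrict

theorem integrable_wt_wt (hd : 1 ≤ d) (C : ℝ) :
    Integrable (fun z : Spacetime d => C * wt 2 z.1 * wt d z.2) (futureMeasure d) :=
  ((integrable_wt_time 2 (by norm_num)).const_mul C).mul_prod (integrable_wt_space hd)

/-- Of the `N + 3` available powers in time, `N` give decay in `p.1`, two give integrability in `τ`,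
and one absorbs the linear growth of the propagator. For nonnegative times `1 + p.1 + τ` dominates
both `1 + p.1` and `1 + τ`. -/
theorem propagator_slab_bound (hd : 1 ≤ d) (g : 𝓢(Spacetime d, F)) (N : ℕ) :
    ∃ C : ℝ, 0 ≤ C ∧ ∀ p z : Spacetime d, 0 ≤ p.1 → 0 ≤ z.1 →
      ‖propagator z • slab g p z‖ ≤ C * wt N p.1 * wt 2 z.1 * wt d z.2 := by
  obtain ⟨C, hC, h⟩ := slab_bound hd (N + 3) d g
  refine ⟨C, hC, fun p z hp hz => ?_⟩
  rw [norm_smul, Real.norm_eq_abs]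
  have h1 : wt ((N + 3 : ℕ) : ℝ) (p.1 + z.1) ≤ wt N p.1 * (wt 2 z.1 * wt 1 z.1) := by
    push_cast
    rw [← wt_add, wt_add, show (2 : ℝ) + 1 = 3 by norm_num]
    refine mul_le_mul ?_ ?_ (wt_pos _ _).le (wt_pos _ _).le
    all_goals
      unfold wt
      refine Real.rpow_le_rpow_of_nonpos (by positivity) ?_ (by simp)
      rw [Real.norm_of_nonneg (add_nonneg hp hz)]
      simp only [Real.norm_of_nonneg hp, Real.norm_of_nonneg hz]
      linarith
  have h2 : |propagator z| * wt 1 z.1 ≤ 1 := by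
    have h3 : |z.1| * wt 1 z.1 ≤ 1 := by
      rw [wt, Real.rpow_neg_one, ← div_eq_mul_inv, div_le_one (by positivity), Real.norm_eq_abs]
      linarith
    exact (mul_le_mul_of_nonneg_right (abs_propagator_le z) (wt_pos _ _).le).trans h3
  have e1 := (wt_pos N p.1).le
  have e2 := (wt_pos 2 z.1).le
  have e3 := (wt_pos d z.2).le
  calc |propagator z| * ‖slab g p z‖
      ≤ |propagator z| * (C * (wt N p.1 * (wt 2 z.1 * wt 1 z.1)) * wt d z.2) := by
        refine mul_le_mul_of_nonneg_left ((h p z).trans ?_) (abs_nonneg _)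
        gcongr
    _ = (C * wt N p.1 * wt 2 z.1 * wt d z.2) * (|propagator z| * wt 1 z.1) := by ring
    _ ≤ (C * wt N p.1 * wt 2 z.1 * wt d z.2) * 1 :=
        mul_le_mul_of_nonneg_left h2 (by positivity)
    _ = _ := mul_one _

/-- Domination that is locally uniform in `p`, without decay in `p` and without sign conditions on
the times. -/
theorem propagator_slab_bound_near (hd : 1 ≤ d) (g : 𝓢(Spacetime d, F)) (T : ℝ) :
    ∃ C : ℝ, 0 ≤ C ∧ ∀ p z : Spacetime d, |p.1| ≤ T → 
      ‖propagator z • slab g p z‖ ≤ C * wt 2 z.1 * wt d z.2 := by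
  obtain ⟨C, hC, h⟩ := slab_bound hd 3 d g
  refine ⟨C * (1 + |T|) ^ (3 : ℝ), by positivity, fun p z hp => ?_⟩
  rw [norm_smul, Real.norm_eq_abs]
  have h1 : wt ((3 : ℕ) : ℝ) (p.1 + z.1) ≤ (1 + |T|) ^ (3 : ℝ) * (wt 2 z.1 * wt 1 z.1) := by
    push_cast
    rw [← wt_add, show (2 : ℝ) + 1 = 3 by norm_num]
    refine (wt_add_le (by norm_num) _ _).trans (mul_le_mul_of_nonneg_right
      (Real.rpow_le_rpow (by positivity) ?_ (by norm_num)) (wt_pos _ _).le)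
    rw [Real.norm_eq_abs]
    linarith [le_abs_self T]
  have h2 : |propagator z| * wt 1 z.1 ≤ 1 := by
    have h3 : |z.1| * wt 1 z.1 ≤ 1 := by
      rw [wt, Real.rpow_neg_one, ← div_eq_mul_inv, div_le_one (by positivity), Real.norm_eq_abs]
      linarith
    exact (mul_le_mul_of_nonneg_right (abs_propagator_le z) (wt_pos _ _).le).trans h3
  have e2 := (wt_pos 2 z.1).le
  have e3 := (wt_pos d z.2).le
  calc |propagator z| * ‖slab g p z‖
      ≤ |propagator z| * (C * ((1 + |T|) ^ (3 : ℝ) * (wt 2 z.1 * wt 1 z.1)) * wt d z.2) := by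
        refine mul_le_mul_of_nonneg_left ((h p z).trans ?_) (abs_nonneg _)
        gcongr
    _ = (C * (1 + |T|) ^ (3 : ℝ) * wt 2 z.1 * wt d z.2) * (|propagator z| * wt 1 z.1) := by ring
    _ ≤ (C * (1 + |T|) ^ (3 : ℝ) * wt 2 z.1 * wt d z.2) * 1 :=
        mul_le_mul_of_nonneg_left h2 (by positivity)
    _ = _ := mul_one _

theorem continuous_propagator_slab (hd : 1 ≤ d) (g : 𝓢(Spacetime d, F)) (p : Spacetime d) :
    Continuous fun z => propagator z • slab g p z :=
  continuous_propagator.smul (continuous_slab hd g p)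

theorem integrable_propagator_slab (hd : 1 ≤ d) (g : 𝓢(Spacetime d, F)) (p : Spacetime d) :
    Integrable (fun z => propagator z • slab g p z) (futureMeasure d) := by
  obtain ⟨C, hC, h⟩ := propagator_slab_bound_near hd g |p.1|
  exact Integrable.mono' (integrable_wt_wt hd C)
    (continuous_propagator_slab hd g p).aestronglyMeasurable
    (ae_of_all _ fun z => h p z le_rfl)

theorem hasFDerivAt_wave (hd : 1 ≤ d) (g : 𝓢(Spacetime d, F)) (p : Spacetime d) :
    HasFDerivAt (wave g) (wave (Dg d F g) p) p := by
  obtain ⟨C, hC, h⟩ := propagator_slab_bound_near hd (Dg d F g) (|p.1| + 1)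
  refine hasFDerivAt_integral_of_dominated_of_fderiv_le (s := Metric.closedBall p 1)
    (bound := fun z : Spacetime d => C * wt 2 z.1 * wt d z.2)
    (F := fun q z => propagator z • slab g q z)
    (F' := fun q z => propagator z • slab (Dg d F g) q z)
    (Metric.closedBall_mem_nhds p one_pos) ?_ (integrable_propagator_slab hd g p)
    (continuous_propagator_slab hd _ p).aestronglyMeasurable ?_ (integrable_wt_wt hd C) ?_
  · exact Eventually.of_forall fun q => (continuous_propagator_slab hd g q).aestronglyMeasurable
  · refine ae_of_all _ fun z q hq => h q z ?_
    rw [mem_closedBall_iff_norm] at hq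
    have h1 : |q.1 - p.1| ≤ 1 := (norm_fst_le (q - p)).trans hq
    linarith [abs_sub_abs_le_abs_sub q.1 p.1]
  · exact ae_of_all _ fun z q _ => (hasFDerivAt_slab hd g q z).const_smul (propagator z)

theorem fderiv_wave (hd : 1 ≤ d) (g : 𝓢(Spacetime d, F)) :
    fderiv ℝ (wave g) = wave (Dg d F g) :=
  funext fun p => (hasFDerivAt_wave hd g p).fderiv

theorem contDiff_wave_nat (hd : 1 ≤ d) (n : ℕ) : ∀ {F : Type} [NormedAddCommGroup F]
    [NormedSpace ℂ F] (g : 𝓢(Spacetime d, F)), ContDiff ℝ n (wave g) := by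
  induction n with
  | zero =>
    intro F _ _ g
    exact contDiff_zero.2 (continuous_iff_continuousAt.2 fun p =>
      (hasFDerivAt_wave hd g p).continuousAt)
  | succ n ih =>
    intro F _ _ g
    rw [show ((n + 1 : ℕ) : ℕ∞ω) = (n : ℕ∞ω) + 1 by norm_cast, contDiff_succ_iff_fderiv]
    refine ⟨fun p => (hasFDerivAt_wave hd g p).differentiableAt, by simp, ?_⟩
    rw [fderiv_wave hd g]
    exact ih (Dg d F g)

theorem contDiff_wave (hd : 1 ≤ d) (g : 𝓢(Spacetime d, F)) : ContDiff ℝ ∞ (wave g) :=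
  contDiff_infty.2 fun n => contDiff_wave_nat hd n g

/-- Derivatives of the solution are solutions for the differentiated source, so only the
undifferentiated case needs an estimate. -/
theorem wave_bound (hd : 1 ≤ d) (N n : ℕ) : ∀ {F : Type} [NormedAddCommGroup F]
    [NormedSpace ℂ F] (g : 𝓢(Spacetime d, F)), ∃ C : ℝ, ∀ p : Spacetime d, 0 ≤ p.1 →
      ‖iteratedFDeriv ℝ n (wave g) p‖ ≤ C * wt N p.1 := by
  induction n with
  | zero =>
    intro F _ _ g
    obtain ⟨C, hC, h⟩ := propagator_slab_bound hd g N
    refine ⟨C * ∫ z : Spacetime d, 1 * wt 2 z.1 * wt d z.2 ∂futureMeasure d, fun p hp => ?_⟩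
    rw [norm_iteratedFDeriv_zero]
    have h1 := norm_integral_le_of_norm_le (μ := futureMeasure d)
      (f := fun z => propagator z • slab g p z)
      ((integrable_wt_wt hd 1).const_mul (C * wt N p.1)) (by
        have : ∀ᵐ z ∂futureMeasure d, 0 ≤ z.1 := by
          have h0 : ∀ᵐ τ : ℝ ∂volume.restrict (Ioi (0 : ℝ)), 0 ≤ τ :=
            (ae_restrict_mem measurableSet_Ioi).mono fun τ hτ => le_of_lt hτ
          exact Measure.quasiMeasurePreserving_fst.ae h0
        filter_upwards [this] with z hz
        refine (h p z hp hz).trans_eq (by ring))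
    rw [integral_const_mul] at h1
    exact h1.trans_eq (by ring)
  | succ n ih =>
    intro F _ _ g
    obtain ⟨C, h⟩ := ih (Dg d F g)
    refine ⟨C, fun p hp => ?_⟩
    rw [← norm_iteratedFDeriv_fderiv, fderiv_wave hd g]
    exact h p hp

/-- Fourier inversion at the origin. -/
theorem integral_slab_zero [CompleteSpace F] (hd : 1 ≤ d) (g : 𝓢(Spacetime d, F))
    (p : Spacetime d) : ∫ ξ : Space d, slab g p (0, ξ) = g p := by
  obtain ⟨C, hC, h⟩ := slab_bound hd 0 d g
  have hc : Continuous fun ξ : Space d => slab g p (0, ξ) :=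
    (continuous_slab hd g p).comp (by fun_prop)
  have h1 : Integrable (𝓕 fun y : Space d => g (p + (0, y))) :=
    Integrable.mono' ((integrable_wt_space hd).const_mul (C * wt ((0 : ℕ) : ℝ) (p.1 + 0)))
      hc.aestronglyMeasurable (ae_of_all _ fun ξ => h p (0, ξ))
  have h2 := (integrable_slice hd g p 0).fourierInv_fourier_eq h1 (v := 0)
    (g.continuous.comp (by fun_prop)).continuousAt
  rw [Real.fourierInv_eq, show p + (0, (0 : Space d)) = p by
    rw [Prod.mk_zero_zero, add_zero]] at h2
  simpa [slab] using h2

theorem tendsto_wt_atTop {a : ℝ} (ha : 0 < a) (s : ℝ) :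
    Tendsto (fun τ : ℝ => wt a (s + τ)) atTop (𝓝 0) := by
  refine (tendsto_rpow_neg_atTop ha).comp (tendsto_atTop_add_const_left _ 1 ?_)
  exact tendsto_norm_atTop_atTop.comp (tendsto_atTop_add_const_left _ s tendsto_id)

theorem integrableOn_propagator_slab (hd : 1 ≤ d) (g : 𝓢(Spacetime d, F)) (p : Spacetime d)
    (ξ : Space d) : IntegrableOn (fun τ => propagator (τ, ξ) • slab g p (τ, ξ)) (Ioi 0) := by
  obtain ⟨C, hC, hb⟩ := propagator_slab_bound_near hd g |p.1|
  exact Integrable.mono' (((integrable_wt_time 2 (by norm_num)).const_mul C).mul_const (wt d ξ))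
    ((continuous_propagator_slab hd g p).comp (by fun_prop)).aestronglyMeasurable
    (ae_of_all _ fun τ => hb p (τ, ξ) le_rfl)

/-- With `P` the propagator and `ω = 2π|ξ|`, one has `P' = cos ωτ` and `(cos ωτ)' = -ω² P`, so `P ĝ'
- cos(ωτ) ĝ` is an antiderivative of the integrand. It vanishes at infinity and equals `-ĝ` at `τ =
0`. -/
theorem integral_propagator_slab (hd : 1 ≤ d) [CompleteSpace F] (g : 𝓢(Spacetime d, F))
    (p : Spacetime d) (ξ : Space d) :
    ∫ τ in Ioi (0 : ℝ), propagator (τ, ξ) • (slab (Dg d _ (Dg d F g)) p (τ, ξ) (timeVec d) (timeVec d)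
      + (2 * Real.pi * ‖ξ‖) ^ 2 • slab g p (τ, ξ)) = slab g p (0, ξ) := by
  have h1 := fun τ => slab_fderiv_fst g p τ ξ hd
  have h2 : ∀ τ, HasDerivAt (fun τ => slab (Dg d F g) p (τ, ξ) (timeVec d))
      (slab (Dg d _ (Dg d F g)) p (τ, ξ) (timeVec d) (timeVec d)) τ := fun τ =>
    ((slab_fderiv_fst (Dg d F g) p τ ξ hd).clm_apply (hasDerivAt_const τ (timeVec d))).congr_deriv
      (by simp)
  have h3 : ∀ τ, HasDerivAt (fun τ => propagator (τ, ξ) • slab (Dg d F g) p (τ, ξ) (timeVec d)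
      - Real.cos (2 * Real.pi * ‖ξ‖ * τ) • slab g p (τ, ξ))
      (propagator (τ, ξ) • (slab (Dg d _ (Dg d F g)) p (τ, ξ) (timeVec d) (timeVec d)
      + (2 * Real.pi * ‖ξ‖) ^ 2 • slab g p (τ, ξ))) τ := by
    intro τ
    refine (((hasDerivAt_propagator ξ τ).smul (h2 τ)).sub
      ((hasDerivAt_cos_propagator ξ τ).smul (h1 τ))).congr_deriv ?_
    module
  obtain ⟨C1, hC1, hb1⟩ := propagator_slab_bound_near hd (Dg d F g) |p.1|
  obtain ⟨C0, hC0, hb0⟩ := slab_bound hd 1 0 g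
  set D2 := Dg d _ (Dg d F g) with hD2
  have hlim : Tendsto (fun τ => propagator (τ, ξ) • slab (Dg d F g) p (τ, ξ) (timeVec d)
      - Real.cos (2 * Real.pi * ‖ξ‖ * τ) • slab g p (τ, ξ)) atTop (𝓝 0) := by
    have e1 : Tendsto (fun τ => propagator (τ, ξ) • slab (Dg d F g) p (τ, ξ)) atTop (𝓝 0) := by
      refine squeeze_zero_norm (fun τ => hb1 p (τ, ξ) le_rfl) ?_
      have := ((tendsto_wt_atTop (a := 2) (by norm_num) 0).const_mul C1).mul_const (wt d ξ)
      simpa using this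
    have e2 := ((ContinuousLinearMap.apply ℝ F (timeVec d)).continuous.tendsto 0).comp e1
    rw [map_zero] at e2
    have e3 : Tendsto (fun τ => Real.cos (2 * Real.pi * ‖ξ‖ * τ) • slab g p (τ, ξ)) atTop (𝓝 0) := by
      refine squeeze_zero_norm (a := fun τ => C0 * wt ((1 : ℕ) : ℝ) (p.1 + τ) * wt ((0 : ℕ) : ℝ) ξ)
        (fun τ => ?_) ?_
      · rw [norm_smul]
        refine (mul_le_of_le_one_left (norm_nonneg _) (Real.abs_cos_le_one _)).trans (hb0 p (τ, ξ))
      · have := ((tendsto_wt_atTop (a := ((1 : ℕ) : ℝ)) (by norm_num) p.1).const_mul C0).mul_const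
          (wt ((0 : ℕ) : ℝ) ξ)
        simpa using this
    have e4 := e2.sub e3
    rw [sub_zero] at e4
    exact e4
  have hint : IntegrableOn (fun τ => propagator (τ, ξ) •
      (slab D2 p (τ, ξ) (timeVec d) (timeVec d) + (2 * Real.pi * ‖ξ‖) ^ 2 • slab g p (τ, ξ)))
      (Ioi 0) := by
    have i1 := integrableOn_propagator_slab hd D2 p ξ
    have i2 := integrableOn_propagator_slab hd g p ξ
    let ev : (Spacetime d →L[ℝ] Spacetime d →L[ℝ] F) →L[ℝ] F :=
      (ContinuousLinearMap.apply ℝ F (timeVec d)).comp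
        (ContinuousLinearMap.apply ℝ (Spacetime d →L[ℝ] F) (timeVec d))
    refine ((ev.integrable_comp i1).add (i2.smul ((2 * Real.pi * ‖ξ‖) ^ 2))).congr
      (ae_of_all _ fun τ => ?_)
    simp only [ev, Pi.add_apply, Pi.smul_apply, ContinuousLinearMap.comp_apply,
      ContinuousLinearMap.apply_apply, smul_apply, smul_add]
    rw [smul_comm]
  rw [integral_Ioi_of_hasDerivAt_of_tendsto' (fun τ _ => h3 τ) hint hlim]
  simp [propagator]

/-- On the Fourier side the wave operator is `-(∂_τ² + (2π|ξ|)²)`. -/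
theorem etaTrace_slab (hd : 1 ≤ d) (g : 𝓢(Spacetime d, F)) (p z : Spacetime d) :
    etaTrace d F (slab (Dg d _ (Dg d F g)) p z)
      = -(slab (Dg d _ (Dg d F g)) p z (timeVec d) (timeVec d)
        + (2 * Real.pi * ‖z.2‖) ^ 2 • slab g p z) := by
  have h1 : ∀ i, slab (Dg d _ (Dg d F g)) p z (spaceVec d i) (spaceVec d i)
      = (-(2 * Real.pi) ^ 2 * (z.2 i * z.2 i)) • slab g p z := by
    intro i
    rw [spaceVec, slab_fderiv_snd hd (Dg d F g), smul_apply, slab_fderiv_snd hd g, smul_smul,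
      ← Complex.coe_smul, inner_single]
    congr 1
    push_cast
    linear_combination (4 * Real.pi ^ 2 * z.2 i * z.2 i : ℂ) * Complex.I_sq
  rw [etaTrace_apply]
  simp only [h1]
  rw [← Finset.sum_smul, ← Finset.mul_sum]
  have h2 : ∑ i, z.2 i * z.2 i = ‖z.2‖ ^ 2 := by
    rw [EuclideanSpace.real_norm_sq_eq]
    exact Finset.sum_congr rfl fun i _ => (sq _).symm
  rw [h2, neg_add, ← neg_smul]
  congr 2
  ring

theorem box_wave [CompleteSpace F] (hd : 1 ≤ d) (g : 𝓢(Spacetime d, F)) (p : Spacetime d) :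
    box (wave g) p = -g p := by
  have hint := integrable_propagator_slab hd (Dg d _ (Dg d F g)) p
  rw [box_eq (contDiff_wave hd g).contDiffAt, fderiv_wave hd, fderiv_wave hd, wave,
    ← ContinuousLinearMap.integral_comp_comm _ hint]
  have h1 : ∀ z, etaTrace d F (propagator z • slab (Dg d _ (Dg d F g)) p z)
      = -(propagator z • (slab (Dg d _ (Dg d F g)) p z (timeVec d) (timeVec d)
        + (2 * Real.pi * ‖z.2‖) ^ 2 • slab g p z)) := by
    intro z
    rw [map_smul, etaTrace_slab hd, smul_neg]
  have hint' := (etaTrace d F).integrable_comp hint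
  simp only [h1] at hint' ⊢
  rw [futureMeasure, integral_prod_symm _ hint']
  simp only [integral_neg]
  have h2 := fun ξ => integral_propagator_slab hd g p ξ
  simp only [h2]
  rw [integral_slab_zero hd]

end WaveSolver

end

section

/-! ### Wave solutions for real sources, and inertial derivative bounds -/

section Borel

variable {d : ℕ} {F G : Type} [NormedAddCommGroup F] [NormedSpace ℝ F]
  [NormedAddCommGroup G] [NormedSpace ℝ G]

open SchwartzMap in
/-- The wave equation with a Schwartz source has a solution that decays rapidly in the future. -/
theorem exists_wave (hd : 1 ≤ d) (g : 𝓢(Spacetime d, ℝ)) : ∃ w : Spacetime d → ℝ,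
    ContDiff ℝ ∞ w ∧ (∀ x, box w x = g x) ∧ ∀ N n : ℕ, ∃ C : ℝ, ∀ p : Spacetime d, 0 ≤ p.1 →
      ‖iteratedFDeriv ℝ n w p‖ ≤ C * wt N p.1 := by
  let gc : 𝓢(Spacetime d, ℂ) := g.postcompCLM Complex.ofRealCLM
  have hw := contDiff_wave hd gc
  -- The Fourier solution is complex and has source `-g`; minus its real part is the desired real
  -- solution.
  let w : Spacetime d → ℝ := fun x => (-Complex.reCLM) (wave gc x)
  have hcd : ContDiff ℝ ∞ w := (-Complex.reCLM).contDiff.comp hw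
  have h1 : fderiv ℝ w = fun x => (ContinuousLinearMap.compL ℝ (Spacetime d) ℂ ℝ (-Complex.reCLM))
      (fderiv ℝ (wave gc) x) := by
    funext x
    exact ((-Complex.reCLM).hasFDerivAt.comp x
      ((hw.differentiable (by simp)) x).hasFDerivAt).fderiv
  refine ⟨w, hcd, fun x => ?_, fun N n => ?_⟩
  · have h2 := box_wave hd gc x
    rw [box_eq hw.contDiffAt] at h2
    have h3 : fderiv ℝ (fderiv ℝ w) x
        = (ContinuousLinearMap.compL ℝ (Spacetime d) ℂ ℝ (-Complex.reCLM)).comp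
          (fderiv ℝ (fderiv ℝ (wave gc)) x) := by
      rw [h1]
      exact ((ContinuousLinearMap.compL ℝ (Spacetime d) ℂ ℝ (-Complex.reCLM)).hasFDerivAt.comp x
        (((hw.fderiv_right (m := ∞) (by simp)).differentiable (by simp)) x).hasFDerivAt).fderiv
    rw [box_eq hcd.contDiffAt, h3, etaTrace_apply]
    have h4 := congrArg (fun z => (-Complex.reCLM) z) h2
    rw [etaTrace_apply, map_add, map_neg, map_sum] at h4
    refine h4.trans ?_
    simp [gc]
  · obtain ⟨C, hC⟩ := wave_bound hd N n gc
    refine ⟨‖-Complex.reCLM‖ * C, fun p hp => ?_⟩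
    refine ((-Complex.reCLM).norm_iteratedFDeriv_comp_left (f := wave gc) hw.contDiffAt
      (by exact_mod_cast le_top)).trans ?_
    rw [mul_assoc]
    exact mul_le_mul_of_nonneg_left (hC p hp) (norm_nonneg _)

theorem rescale_self {x : Spacetime d} : rescale ‖x.2‖ ((x.1 - ‖x.2‖, dir x.2), 1) = x := by
  rw [rescale, mul_one, point_eq]

theorem Sym.norm_le {κ : ℝ} {f : Spacetime d → F} (hf : Sym κ f) (T : ℝ) :
    ∃ C R : ℝ, 0 < R ∧ ∀ x : Spacetime d, |x.1 - ‖x.2‖| ≤ T → R ≤ ‖x.2‖ →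
      ‖f x‖ ≤ C * ‖x.2‖ ^ (-κ) := by
  obtain ⟨C, hC⟩ := (hf.fam.bound T 0).bound
  obtain ⟨R, hR⟩ := eventually_scri.1 hC
  refine ⟨C, max R 1, by positivity, fun x hx hr => ?_⟩
  have h1 : 1 ≤ ‖x.2‖ := (le_max_right _ _).trans hr
  have h0 : x.2 ≠ 0 := norm_pos_iff.1 (by linarith)
  have := hR ‖x.2‖ ((le_max_left _ _).trans hr) (x.1 - ‖x.2‖) (dir x.2) hx (norm_dir h0)
  simp only [norm_iteratedFDeriv_zero] at this
  rwa [rescale_self, Real.norm_of_nonneg (by positivity)] at this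

/-- Bounds on derivatives in inertial coordinates. -/
theorem Sym.inertial (n : ℕ) : ∀ {F : Type} [NormedAddCommGroup F] [NormedSpace ℝ F] {κ : ℝ}
    {f : Spacetime d → F} (_ : Sym κ f) (T : ℝ),
    ∃ C R : ℝ, 0 < R ∧ ∀ x : Spacetime d, |x.1 - ‖x.2‖| ≤ T → R ≤ ‖x.2‖ →
      ‖iteratedFDeriv ℝ n f x‖ ≤ C * ‖x.2‖ ^ (-κ) := by
  induction n with
  | zero => intro F _ _ κ f hf T; simpa only [norm_iteratedFDeriv_zero] using hf.norm_le T
  | succ n ih =>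
    intro F _ _ κ f hf T
    simpa only [norm_iteratedFDeriv_fderiv] using ih hf.fderiv T

theorem Sym.inertial_le {κ : ℝ} {f : Spacetime d → F} (hf : Sym κ f) (n : ℕ) (T : ℝ) :
    ∃ C R : ℝ, 0 ≤ C ∧ 1 ≤ R ∧ ∀ x : Spacetime d, |x.1 - ‖x.2‖| ≤ T → R ≤ ‖x.2‖ → ∀ j ≤ n,
      ‖iteratedFDeriv ℝ j f x‖ ≤ C * ‖x.2‖ ^ (-κ) := by
  choose C R hR h using fun j => Sym.inertial j hf T
  refine ⟨∑ j ∈ Finset.range (n + 1), |C j|, 1 + ∑ j ∈ Finset.range (n + 1), R j,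
    Finset.sum_nonneg fun _ _ => abs_nonneg _,
    le_add_of_nonneg_right (Finset.sum_nonneg fun j _ => (hR j).le), fun x hx hr j hj => ?_⟩
  have hmem : j ∈ Finset.range (n + 1) := Finset.mem_range.2 (by omega)
  have h1 : R j ≤ ∑ j ∈ Finset.range (n + 1), R j :=
    Finset.single_le_sum (fun j _ => (hR j).le) hmem
  refine (h j x hx (by linarith)).trans ?_
  refine mul_le_mul_of_nonneg_right ((le_abs_self _).trans ?_) (by positivity)
  exact Finset.single_le_sum (f := fun j => |C j|) (fun j _ => abs_nonneg _) hmem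

theorem eventually_scri_of_far {T : ℝ} {P : Spacetime d → Prop}
    (h : ∃ R : ℝ, ∀ x : Spacetime d, |x.1 - ‖x.2‖| ≤ T → R ≤ ‖x.2‖ → P x) :
    ∀ᶠ z in scri d T, P (rescale z.1 (z.2, 1)) := by
  obtain ⟨R, hR⟩ := h
  refine eventually_scri.2 ⟨max R 0, fun L hL u θ hu hθ => ?_⟩
  have h0 : 0 ≤ L := (le_max_right _ _).trans hL
  have hθ0 := ne_zero_of_norm_eq_one hθ
  simp only [rescale, mul_one]
  refine hR _ ?_ ?_
  · rwa [point_retarded h0 hθ0]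
  · rw [point_snd_norm h0 hθ0]; exact (le_max_left _ _).trans hL

/-- `rescale L` is affine in `L` with smooth coefficients, so each derivative is `O(L)`. The bound
is weakened to `(C L) ^ i`, the form required by the chain rule estimate. -/
theorem rescale_bound (n : ℕ) (T : ℝ) : ∃ C : ℝ, 1 ≤ C ∧ ∀ᶠ z in scri d T, ∀ i, 1 ≤ i → i ≤ n →
    ‖iteratedFDeriv ℝ i (rescale (d := d) z.1) (z.2, 1)‖ ≤ (C * z.1) ^ i := by
  let c0 : Par d → Spacetime d := fun q => (q.1.1, 0)
  let c1 : Par d → Spacetime d := fun q => (q.2, q.2 • dir q.1.2)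
  have hc0 : FamO 0 fun _ => c0 := FamO.const (by fun_prop)
  have hc1 : FamO 0 fun _ => c1 := FamO.const (by
    refine ContDiffOn.prodMk (by fun_prop) (ContDiffOn.smul (f := fun q : Par d => q.2) (by fun_prop) ?_)
    intro q hq
    exact ((contDiffAt_dir hq.1).comp (f := fun q : Par d => q.1.2) q
      (by fun_prop)).contDiffWithinAt)
  have hf : FamO (-1) fun L => (rescale (d := d) L) := by
    refine ((hc0.mono (κ' := -1) (by norm_num)).add
      ((hc1.rpow_smul (-1)).mono (κ' := -1) (by norm_num))).congr fun T => ?_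
    refine Eventually.of_forall fun z => Eventually.of_forall fun q => ?_
    simp [c0, c1, rescale, point, mul_smul]
  choose C hC using fun i => (hf.bound T i).bound
  have hC0 : ∀ i, C i ≤ 1 + ∑ j ∈ Finset.range (n + 1), |C j| ∨ n < i := by
    intro i
    by_cases hi : n < i
    · exact Or.inr hi
    · left
      have := Finset.single_le_sum (f := fun j => |C j|) (s := Finset.range (n + 1))
        (fun j _ => abs_nonneg _) (Finset.mem_range.2 (by omega : i < n + 1))
      linarith [le_abs_self (C i)]
  have hD : 1 ≤ 1 + ∑ j ∈ Finset.range (n + 1), |C j| :=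
    le_add_of_nonneg_right (Finset.sum_nonneg fun j _ => abs_nonneg _)
  refine ⟨1 + ∑ j ∈ Finset.range (n + 1), |C j|, hD, ?_⟩
  have hall : ∀ᶠ z in scri d T, ∀ i ∈ Finset.range (n + 1),
      ‖iteratedFDeriv ℝ i (rescale (d := d) z.1) (z.2, 1)‖ ≤ C i * ‖z.1 ^ (-(-1 : ℝ))‖ :=
    (Filter.eventually_all_finset _).2 fun i _ => hC i
  filter_upwards [hall, eventually_scri_ge T 1] with z hz h1 i hi1 hin
  have h2 := hz i (Finset.mem_range.2 (by omega))
  rw [neg_neg, Real.rpow_one, Real.norm_of_nonneg (by linarith)] at h2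
  have h3 : C i * z.1 ≤ (1 + ∑ j ∈ Finset.range (n + 1), |C j|) * z.1 :=
    mul_le_mul_of_nonneg_right ((hC0 i).resolve_right (by omega)) (by linarith)
  refine (h2.trans h3).trans (le_self_pow₀ ?_ (by omega))
  nlinarith

/-- A function whose inertial derivatives decay fast is small, up to functions known to be. -/
theorem Sym.of_approx {κ : ℝ} {f : Spacetime d → F} (hs : SmoothNear f)
    (h : ∀ (n : ℕ) (T : ℝ), ∃ g : Spacetime d → F, Sym κ g ∧ ∃ C R : ℝ, ∀ x : Spacetime d,
      |x.1 - ‖x.2‖| ≤ T → R ≤ ‖x.2‖ → ∀ j ≤ n,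
        ‖iteratedFDeriv ℝ j (fun x => f x - g x) x‖ ≤ C * ‖x.2‖ ^ (-(κ + n))) : Sym κ f := by
  refine ⟨hs, fun T => ?_, fun T n => ?_⟩
  · obtain ⟨V, hV, hf⟩ := hs
    filter_upwards [hV.eventually_rescale T, eventually_scri_norm T] with z hz h1
    exact (hf.contDiffAt (hV.1.mem_nhds hz.self_of_nhds)).comp _
      (contDiffAt_rescale (ne_zero_of_norm_eq_one h1.2))
  · obtain ⟨g, hg, C, R, hb⟩ := h n T
    have hsub := hs.sub hg.smooth
    obtain ⟨V, hV, hfV⟩ := hsub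
    obtain ⟨D, hD, hDb⟩ := rescale_bound (d := d) n T
    have key : (fun z : ℝ × (ℝ × Space d) => iteratedFDeriv ℝ n
        (fun q => f (rescale z.1 q) - g (rescale z.1 q)) (z.2, 1)) =O[scri d T]
        fun z => z.1 ^ (-κ) := by
      refine IsBigO.of_bound (n.factorial * |C| * D ^ n) ?_
      filter_upwards [hV.eventually_rescale T, eventually_scri_norm T, eventually_scri_ge T 1, hDb,
        eventually_scri_of_far (T := T) ⟨R, hb⟩] with z hz h1 h2 h3 h4
      have h0 : 0 < z.1 := by linarith
      have hθ0 := ne_zero_of_norm_eq_one h1.2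
      have hnorm : ‖(rescale z.1 ((z.2, 1) : Par d)).2‖ = z.1 := by
        rw [rescale, mul_one, point_snd_norm h0.le hθ0]
      rw [hnorm] at h4
      -- Composition with `rescale L` costs a factor `L ^ n`; this is why the approximation is
      -- required to have the extra decay `n`.
      have h5 := norm_iteratedFDeriv_comp_at_le (g := fun x => f x - g x) (f := rescale z.1)
        (x := ((z.2, 1) : Par d)) (n := n)
        ((hfV.contDiffAt (hV.1.mem_nhds hz.self_of_nhds)).top_to_nat n)
        ((contDiffAt_rescale hθ0).top_to_nat n)
        (C := |C| * z.1 ^ (-(κ + n))) (D := D * z.1)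
        (fun i hi => (h4 i hi).trans (mul_le_mul_of_nonneg_right (le_abs_self C) (by positivity))) h3
      refine h5.trans_eq ?_
      rw [Real.norm_of_nonneg (by positivity), mul_pow, neg_add, Real.rpow_add h0,
        Real.rpow_neg h0.le (n : ℝ), Real.rpow_natCast]
      field_simp
    refine (key.add (hg.fam.bound T n)).congr' ?_ EventuallyEq.rfl
    filter_upwards [hV.eventually_rescale T, eventually_scri_norm T, hg.fam.smooth T] with z hz h1 h2
    have hθ0 := ne_zero_of_norm_eq_one h1.2
    have h3 : ContDiffAt ℝ ∞ (fun q => f (rescale z.1 q) - g (rescale z.1 q)) ((z.2, 1) : Par d) :=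
      (hfV.contDiffAt (hV.1.mem_nhds hz.self_of_nhds)).comp ((z.2, 1) : Par d)
        (contDiffAt_rescale hθ0)
    have h4 := iteratedFDeriv_add_apply (h3.top_to_nat n) (h2.top_to_nat n)
    rw [← h4]
    congr 1
    funext q
    simp

/-! ### Cutoffs and Borel summation -/

/-- The bump function underlying all cutoffs. -/
def unitBump (d : ℕ) : ContDiffBump (0 : Space d) where
  rIn := 1
  rOut := 2
  rIn_pos := one_pos
  rIn_lt_rOut := one_lt_two

/-- A smooth cutoff that vanishes for `r ≤ R` and is one for `2 R ≤ r`. -/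
def farCutoff (R : ℝ) (x : Spacetime d) : ℝ := 1 - unitBump d (R⁻¹ • x.2)

theorem contDiff_farCutoff (R : ℝ) : ContDiff ℝ ∞ (farCutoff R : Spacetime d → ℝ) :=
  contDiff_const.sub ((unitBump d).contDiff.comp (by fun_prop))

theorem farCutoff_eq_zero {R : ℝ} (hR : 0 < R) {x : Spacetime d} (hx : ‖x.2‖ ≤ R) :
    farCutoff R x = 0 := by
  rw [farCutoff, (unitBump d).one_of_mem_closedBall, sub_self]
  rw [mem_closedBall_zero_iff, norm_smul, norm_inv, Real.norm_of_nonneg hR.le]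
  exact (inv_mul_le_one₀ hR).2 hx

theorem farCutoff_eq_one {R : ℝ} (hR : 0 < R) {x : Spacetime d} (hx : 2 * R ≤ ‖x.2‖) :
    farCutoff R x = 1 := by
  rw [farCutoff, (unitBump d).zero_of_le_dist, sub_zero]
  rw [dist_zero_right, norm_smul, norm_inv, Real.norm_of_nonneg hR.le, ← div_eq_inv_mul,
    le_div_iff₀ hR]
  exact hx

/-- The cutoff is a fixed function composed with `x ↦ R⁻¹ x`, a contraction for `R ≥ 1`; the bounds
are thus uniform in `R`. -/
theorem norm_iteratedFDeriv_farCutoff_le (n : ℕ) : ∃ C : ℝ, 0 ≤ C ∧ ∀ R : ℝ, 1 ≤ R →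
    ∀ x : Spacetime d, ∀ j ≤ n, ‖iteratedFDeriv ℝ j (farCutoff R) x‖ ≤ C := by
  let f : Space d → ℝ := fun y => 1 - unitBump d y
  have hf : ContDiff ℝ ∞ f := contDiff_const.sub (unitBump d).contDiff
  have hb : ∀ j : ℕ, ∃ C : ℝ, ∀ y, ‖iteratedFDeriv ℝ j f y‖ ≤ C := by
    intro j
    have hc : Continuous (iteratedFDeriv ℝ j f) :=
      hf.continuous_iteratedFDeriv (by exact_mod_cast le_top)
    obtain ⟨C, hC⟩ := (isCompact_closedBall (0 : Space d) 2).exists_bound_of_continuousOn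
      hc.continuousOn
    obtain ⟨C', hC'⟩ : ∃ C' : ℝ, ∀ y, ‖iteratedFDeriv ℝ j (fun _ : Space d => (1 : ℝ)) y‖ ≤ C' := by
      rcases Nat.eq_zero_or_pos j with rfl | hj
      · exact ⟨1, fun y => by simp⟩
      · exact ⟨0, fun y => by
          rw [iteratedFDeriv_const_of_ne (by omega)]; simp⟩
    refine ⟨max C C', fun y => ?_⟩
    by_cases hy : y ∈ Metric.closedBall (0 : Space d) 2
    · exact (hC y hy).trans (le_max_left _ _)
    · have : f =ᶠ[𝓝 y] fun _ => 1 := by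
        filter_upwards [Metric.isClosed_closedBall.isOpen_compl.mem_nhds hy] with z hz
        have : unitBump d z = 0 := by
          refine (unitBump d).zero_of_le_dist ?_
          have : ¬ dist z 0 ≤ 2 := hz
          exact (not_le.1 this).le
        simp [f, this]
      rw [(this.iteratedFDeriv ℝ j).eq_of_nhds]
      exact (hC' y).trans (le_max_right _ _)
  choose C hC using hb
  refine ⟨∑ j ∈ Finset.range (n + 1), |C j|, Finset.sum_nonneg fun _ _ => abs_nonneg _,
    fun R hR x j hj => ?_⟩
  let A : Spacetime d →L[ℝ] Space d := R⁻¹ • ContinuousLinearMap.snd ℝ ℝ (Space d)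
  have hA : ‖A‖ ≤ 1 := by
    rw [norm_smul, norm_inv, Real.norm_of_nonneg (by linarith)]
    exact mul_le_one₀ (inv_le_one_of_one_le₀ hR) (norm_nonneg _)
      (ContinuousLinearMap.norm_snd_le ℝ ℝ (Space d))
  have h1 : farCutoff R = f ∘ A := rfl
  rw [h1, A.iteratedFDeriv_comp_right hf x (by exact_mod_cast le_top)]
  refine ((iteratedFDeriv ℝ j f (A x)).norm_compContinuousLinearMap_le _).trans ?_
  rw [Finset.prod_const]
  refine (mul_le_of_le_one_right (norm_nonneg _) (pow_le_one₀ (norm_nonneg _) hA)).trans ?_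
  refine (hC j _).trans ((le_abs_self _).trans ?_)
  exact Finset.single_le_sum (f := fun j => |C j|) (fun j _ => abs_nonneg _)
    (Finset.mem_range.2 (by omega))

theorem iteratedFDeriv_eq_zero_of_eventually {f : Spacetime d → F} {x : Spacetime d}
    (h : f =ᶠ[𝓝 x] fun _ => 0) (j : ℕ) : iteratedFDeriv ℝ j f x = 0 := by
  rw [(h.iteratedFDeriv ℝ j).eq_of_nhds]
  exact congrFun (iteratedFDeriv_fun_zero (𝕜 := ℝ) (n := j)) _

theorem farCutoff_smul_eventually_zero {R : ℝ} (hR : 0 < R) {x : Spacetime d} (hx : ‖x.2‖ < R)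
    (h : Spacetime d → F) : (fun x => farCutoff R x • h x) =ᶠ[𝓝 x] fun _ => 0 := by
  filter_upwards [(isOpen_lt (f := fun x : Spacetime d => ‖x.2‖) (g := fun _ => R) (by fun_prop)
    (by fun_prop)).mem_nhds hx] with y hy
  rw [farCutoff_eq_zero hR (le_of_lt hy), zero_smul]

/-- Cutting off far out makes a symbol small, at the price of one power of `r`. -/
theorem Sym.farCutoff_small {κ : ℝ} {h : Spacetime d → F} (hh : Sym κ h) (n : ℕ) (T : ℝ) {ε : ℝ}
    (hε : 0 < ε) : ∃ R₀ : ℝ, 1 ≤ R₀ ∧ ∀ R, R₀ ≤ R → ∀ x : Spacetime d, |x.1 - ‖x.2‖| ≤ T → ∀ j ≤ n,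
      ‖iteratedFDeriv ℝ j (fun x => farCutoff R x • h x) x‖ ≤ ε * ‖x.2‖ ^ (-κ + 1) := by
  obtain ⟨C, R1, hC, hR1, hb⟩ := hh.inertial_le n T
  obtain ⟨C', hC', hb'⟩ := norm_iteratedFDeriv_farCutoff_le (d := d) n
  obtain ⟨V, hV, hsm⟩ := hh.smooth
  obtain ⟨R2, hR2, hV2⟩ := hV.far T
  let B : ℝ →L[ℝ] F →L[ℝ] F := ContinuousLinearMap.lsmul ℝ ℝ
  let M : ℝ := ‖B‖ * ∑ j ∈ Finset.range (n + 1), ∑ i ∈ Finset.range (j + 1), (j.choose i : ℝ) * C' * C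
  have hM : 0 ≤ M := mul_nonneg (norm_nonneg B) (Finset.sum_nonneg fun j _ =>
    Finset.sum_nonneg fun i _ => by positivity)
  -- Beyond `R1` the derivative bounds hold and beyond `R2` the function is smooth. The part `M / ε`
  -- converts the constant `M` into `ε r` on the support of the cutoff.
  refine ⟨R1 + R2 + M / ε, by linarith [div_nonneg hM hε.le], fun R hR x hx j hj => ?_⟩
  have hd0 := div_nonneg hM hε.le
  have hR0 : 0 < R := by linarith
  rcases lt_or_ge ‖x.2‖ R with hr | hr
  · rw [iteratedFDeriv_eq_zero_of_eventually (farCutoff_smul_eventually_zero hR0 hr h), norm_zero]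
    positivity
  have hxV : x ∈ V := hV2 x hx (by linarith)
  have hr0 : 0 < ‖x.2‖ := by linarith
  have h1 := norm_iteratedFDeriv_bilinear_le B (f := farCutoff R) (g := h) (x := x) (n := j)
    ((contDiff_farCutoff R).contDiffAt.top_to_nat j)
    ((hsm.contDiffAt (hV.1.mem_nhds hxV)).top_to_nat j)
  refine (h1.trans ?_ : _ ≤ M * ‖x.2‖ ^ (-κ)).trans ?_
  · rw [mul_assoc]
    refine mul_le_mul_of_nonneg_left ?_ (norm_nonneg B)
    have h2 : ∑ i ∈ Finset.range (j + 1), (j.choose i : ℝ) * ‖iteratedFDeriv ℝ i (farCutoff R) x‖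
        * ‖iteratedFDeriv ℝ (j - i) h x‖
        ≤ (∑ i ∈ Finset.range (j + 1), (j.choose i : ℝ) * C' * C) * ‖x.2‖ ^ (-κ) := by
      rw [Finset.sum_mul]
      refine Finset.sum_le_sum fun i hi => ?_
      have hi' : i ≤ j := by simpa [Nat.lt_succ_iff] using hi
      have e1 := hb' R (by linarith) x i (by omega)
      have e2 := hb x hx (by linarith) (j - i) (by omega)
      calc _ ≤ (j.choose i : ℝ) * C' * (C * ‖x.2‖ ^ (-κ)) := by gcongr
        _ = _ := by ring
    refine h2.trans (mul_le_mul_of_nonneg_right ?_ (by positivity))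
    exact Finset.single_le_sum (f := fun j => ∑ i ∈ Finset.range (j + 1), (j.choose i : ℝ) * C' * C)
      (fun j _ => Finset.sum_nonneg fun i _ => by positivity) (Finset.mem_range.2 (by omega))
  · rw [Real.rpow_add hr0, Real.rpow_one]
    have h3 : M ≤ ε * ‖x.2‖ := by
      rw [← div_le_iff₀' hε]
      linarith
    have h4 : (0 : ℝ) ≤ ‖x.2‖ ^ (-κ) := by positivity
    nlinarith

/-- Locally finite sums. -/
theorem exists_locally_finite_sum (h : ℕ → Spacetime d → F) (hs : ∀ k, ContDiff ℝ ∞ (h k))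
    (h0 : ∀ (k : ℕ) (x : Spacetime d), ‖x.2‖ ≤ k → h k x = 0) : ∃ f : Spacetime d → F,
      ContDiff ℝ ∞ f ∧ (∀ (M : ℕ) x, ‖x.2‖ ≤ M → f x = ∑ k ∈ Finset.range M, h k x) ∧
      ∀ (K j : ℕ) (x : Spacetime d) (a B : ℝ), 0 ≤ a → 0 ≤ B →
        (∀ k, K ≤ k → a * ‖iteratedFDeriv ℝ j (h k) x‖ ≤ (1 / 2) ^ k * B) →
        a * ‖iteratedFDeriv ℝ j (fun x => f x - ∑ k ∈ Finset.range K, h k x) x‖ ≤ 2 * B := by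
  let f : Spacetime d → F := fun x => ∑ k ∈ Finset.range ⌈‖x.2‖⌉₊, h k x
  have hf : ∀ (M : ℕ) x, ‖x.2‖ ≤ M → f x = ∑ k ∈ Finset.range M, h k x := by
    intro M x hx
    refine Finset.sum_subset (Finset.range_mono (Nat.ceil_le.2 hx)) fun k _ hk => h0 k x ?_
    exact Nat.ceil_le.1 (by simpa using hk)
  have hloc : ∀ (M : ℕ) (x : Spacetime d), ‖x.2‖ < M → 
      f =ᶠ[𝓝 x] fun x => ∑ k ∈ Finset.range M, h k x := by
    intro M x hx
    filter_upwards [(isOpen_lt (f := fun x : Spacetime d => ‖x.2‖) (g := fun _ => (M : ℝ))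
      (by fun_prop) (by fun_prop)).mem_nhds hx] with y hy using hf M y (le_of_lt hy)
  refine ⟨f, contDiff_iff_contDiffAt.2 fun x => ?_, hf, fun K j x a B ha hB hb => ?_⟩
  · obtain ⟨M, hM⟩ := exists_nat_gt ‖x.2‖
    exact (ContDiff.sum fun k _ => hs k).contDiffAt.congr_of_eventuallyEq (hloc M x hM)
  · obtain ⟨M', hM'⟩ := exists_nat_gt ‖x.2‖
    have hM : ‖x.2‖ < ((max M' K : ℕ) : ℝ) := hM'.trans_le (by exact_mod_cast le_max_left _ _)
    set M := max M' K
    have hKM : K ≤ M := le_max_right _ _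
    have e1 : (fun x => f x - ∑ k ∈ Finset.range K, h k x)
        =ᶠ[𝓝 x] fun x => ∑ k ∈ Finset.Ico K M, h k x := by
      filter_upwards [hloc M x hM] with y hy
      rw [hy, Finset.sum_Ico_eq_sub _ hKM]
    rw [(e1.iteratedFDeriv ℝ j).eq_of_nhds, iteratedFDeriv_fun_sum_apply
      (fun k _ => (hs k).contDiffAt.top_to_nat j)]
    calc a * ‖∑ k ∈ Finset.Ico K M, iteratedFDeriv ℝ j (h k) x‖
        ≤ a * ∑ k ∈ Finset.Ico K M, ‖iteratedFDeriv ℝ j (h k) x‖ :=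
          mul_le_mul_of_nonneg_left (norm_sum_le _ _) ha
      _ ≤ ∑ k ∈ Finset.Ico K M, (1 / 2) ^ k * B := by
          rw [Finset.mul_sum]
          exact Finset.sum_le_sum fun k hk => hb k (Finset.mem_Ico.1 hk).1
      _ ≤ ∑ k ∈ Finset.range M, (1 / 2) ^ k * B := by
          refine Finset.sum_le_sum_of_subset_of_nonneg (fun k hk => ?_) fun k _ _ => by positivity
          exact Finset.mem_range.2 (Finset.mem_Ico.1 hk).2
      _ ≤ 2 * B := by
          rw [← Finset.sum_mul]
          exact mul_le_mul_of_nonneg_right (sum_geometric_two_le M) hB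

theorem contDiff_farCutoff_smul {R : ℝ} (hR : 0 < R) {h : Spacetime d → F}
    (hs : ∀ x : Spacetime d, R ≤ ‖x.2‖ → ContDiffAt ℝ ∞ h x) :
    ContDiff ℝ ∞ fun x => farCutoff R x • h x := by
  refine contDiff_iff_contDiffAt.2 fun x => ?_
  rcases lt_or_ge ‖x.2‖ R with hr | hr
  · exact contDiffAt_const.congr_of_eventuallyEq (farCutoff_smul_eventually_zero hR hr h)
  · exact (contDiff_farCutoff R).contDiffAt.smul (hs x hr)

theorem Sym.of_eq_zero_far {κ : ℝ} {h : Spacetime d → F} {R : ℝ}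
    (hh : ∀ x : Spacetime d, R < ‖x.2‖ → h x = 0) : Sym κ h :=
  (Sym.zero κ).congr (isNhdScri_lt_norm R) fun x hx => (hh x hx).symm

theorem Sym.farCutoff_smul {κ : ℝ} {h : Spacetime d → F} (hh : Sym κ h) {R : ℝ} (hR : 0 < R) :
    Sym κ fun x => farCutoff R x • h x := by
  refine hh.congr (isNhdScri_lt_norm (2 * R)) fun x hx => ?_
  rw [farCutoff_eq_one hR (le_of_lt hx), one_smul]

/-- Borel summation: every sequence of homogeneous coefficients is the expansion of a function. -/
theorem exists_exp {c : ℕ → ℝ × Space d → F} (hc : ∀ k : ℕ, Hom ((k : ℝ) / 2) (c k)) :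
    ∃ f : Spacetime d → F, ContDiff ℝ ∞ f ∧ Exp f c := by
  -- The `k`-th term is made smaller than `2^{-k}` together with `k` derivatives on `|u| ≤ k`; every
  -- fixed order and time interval is covered by all but finitely many terms.
  choose R₀ hR1 hR₀ using fun k : ℕ =>
    (hc k).sym.farCutoff_small k k (ε := (1 / 2) ^ k) (by positivity)
  -- The lower bound `k + 1` makes the `k`-th term vanish for `‖x.2‖ ≤ k`, so the sum is locally
  -- finite.
  let R : ℕ → ℝ := fun k => max (R₀ k) (k + 1)
  have hR0 : ∀ k, 0 < R k := fun k => lt_of_lt_of_le (by positivity) (le_max_right _ _)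
  obtain ⟨f, hf, -, hsum⟩ := exists_locally_finite_sum
    (fun k x => farCutoff (R k) x • lift (c k) x)
    (fun k => contDiff_farCutoff_smul (hR0 k) fun x hx => (hc k).contDiffOn_lift.contDiffAt
      ((isOpen_ne_fun (by fun_prop) (by fun_prop)).mem_nhds
        (norm_pos_iff.1 ((hR0 k).trans_le hx))))
    (fun k x hx => by
      rw [farCutoff_eq_zero (hR0 k) (hx.trans ((le_add_of_nonneg_right zero_le_one).trans
        (le_max_right _ _))), zero_smul])
  have hfs : SmoothNear f := ⟨_, isNhdScri_lt_norm 0, hf.contDiffOn⟩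
  have hls : ∀ K, SmoothNear fun x => ∑ k ∈ Finset.range K, lift (c k) x :=
    fun K => SmoothNear.sum _ fun k _ => (hc k).smoothNear_lift
  refine ⟨f, hf, hfs, hc, fun K => Sym.of_approx (hfs.sub (hls K)) fun n T => ?_⟩
  -- For `k ≥ K'` one has `-k/2 + 1 ≤ -(K/2 + n)`, the required decay after the loss of one power in
  -- the cutoff, as well as `k ≥ n` and `k ≥ T`.
  obtain ⟨K', hK'⟩ := exists_nat_ge ((K : ℝ) + 2 * n + 2 + |T|)
  have hT : T ≤ K' := by linarith [le_abs_self T, (Nat.cast_nonneg K : (0 : ℝ) ≤ K),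
    (Nat.cast_nonneg n : (0 : ℝ) ≤ n)]
  have hKK : K ≤ K' := by
    have : (K : ℝ) ≤ K' := by linarith [abs_nonneg T, (Nat.cast_nonneg n : (0 : ℝ) ≤ n)]
    exact_mod_cast this
  have hnK : n ≤ K' := by
    have : (n : ℝ) ≤ K' := by linarith [abs_nonneg T, (Nat.cast_nonneg K : (0 : ℝ) ≤ K),
      (Nat.cast_nonneg n : (0 : ℝ) ≤ n)]
    exact_mod_cast this
  -- The comparison function: the cutoff corrections vanish far out, and the terms from `K` to `K'`
  -- have order at least `K/2`. What is left is the tail of the series.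
  refine ⟨fun x => (∑ k ∈ Finset.range K', (farCutoff (R k) x • lift (c k) x - lift (c k) x))
    + ∑ k ∈ Finset.Ico K K', lift (c k) x, ?_, 2, 1, fun x hx hr j hj => ?_⟩
  · refine Sym.add (Sym.sum _ fun k _ => Sym.of_eq_zero_far (R := 2 * R k) fun x hx => ?_)
      (Sym.sum _ fun k hk => (hc k).sym.mono ?_)
    · rw [farCutoff_eq_one (hR0 k) hx.le, one_smul, sub_self]
    · have : (K : ℝ) ≤ k := by exact_mod_cast (Finset.mem_Ico.1 hk).1
      linarith
  · have e1 : (fun x => f x - ∑ k ∈ Finset.range K, lift (c k) x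
        - ((∑ k ∈ Finset.range K', (farCutoff (R k) x • lift (c k) x - lift (c k) x))
          + ∑ k ∈ Finset.Ico K K', lift (c k) x))
        = fun x => f x - ∑ k ∈ Finset.range K', farCutoff (R k) x • lift (c k) x := by
      funext y
      rw [Finset.sum_sub_distrib, Finset.sum_Ico_eq_sub _ hKK]
      abel
    rw [e1]
    have h1 := hsum K' j x 1 (‖x.2‖ ^ (-((K : ℝ) / 2 + n))) zero_le_one (by positivity) ?_
    · simpa only [one_mul] using h1
    · intro k hk
      rw [one_mul]
      have hk' : (K' : ℝ) ≤ k := by exact_mod_cast hk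
      refine (hR₀ k (R k) (le_max_left _ _) x (by linarith) j (by omega)).trans ?_
      refine mul_le_mul_of_nonneg_left (Real.rpow_le_rpow_of_exponent_le hr ?_) (by positivity)
      linarith [abs_nonneg T]

/-! ### Partition in retarded time and extension to Schwartz functions -/

/-- Bumps in retarded time. -/
def timeBump (k : ℕ) : ContDiffBump (0 : ℝ) where
  rIn := k + 1
  rOut := k + 2
  rIn_pos := by positivity
  rIn_lt_rOut := by linarith

/-- The pieces of a partition of unity in retarded time. -/
def timePiece : ℕ → ℝ → ℝ
  | 0, u => timeBump 0 u
  | k + 1, u => timeBump (k + 1) u - timeBump k u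

theorem contDiff_timePiece (k : ℕ) : ContDiff ℝ ∞ (timePiece k) := by
  cases k with
  | zero => exact (timeBump 0).contDiff
  | succ k => exact (timeBump (k + 1)).contDiff.sub (timeBump k).contDiff

theorem sum_timePiece (M : ℕ) (u : ℝ) :
    ∑ k ∈ Finset.range (M + 1), timePiece k u = timeBump M u := by
  induction M with
  | zero => simp [timePiece]
  | succ M ih => rw [Finset.sum_range_succ, ih, timePiece]; ring

theorem timeBump_eq_one {k : ℕ} {u : ℝ} (h : |u| ≤ k + 1) : timeBump k u = 1 :=
  (timeBump k).one_of_mem_closedBall (by simpa [timeBump] using h)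

theorem timeBump_eq_zero {k : ℕ} {u : ℝ} (h : (k : ℝ) + 2 ≤ |u|) : timeBump k u = 0 :=
  (timeBump k).zero_of_le_dist (by simpa [timeBump] using h)

theorem timePiece_eq_zero {k : ℕ} {u : ℝ} (h : (k : ℝ) + 2 ≤ |u|) : timePiece k u = 0 := by
  cases k with
  | zero => exact timeBump_eq_zero h
  | succ k =>
    push_cast at h
    rw [timePiece, timeBump_eq_zero (by push_cast; exact h), timeBump_eq_zero (by linarith),
      sub_zero]

theorem timePiece_eq_zero_of_le {k : ℕ} {u : ℝ} (h : |u| ≤ k) (hk : 0 < k) :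
    timePiece k u = 0 := by
  cases k with
  | zero => omega
  | succ k =>
    push_cast at h
    rw [timePiece, timeBump_eq_one (by push_cast; linarith), timeBump_eq_one h, sub_self]

theorem hom_timePiece (k : ℕ) : Hom 0 fun p : ℝ × Space d => timePiece k p.1 :=
  ⟨((contDiff_timePiece k).comp contDiff_fst).contDiffOn, fun u y s _ _ => by simp⟩

/-- A globally smooth function supported at bounded retarded time that is rapidly decreasing near
null infinity is rapidly decreasing. -/
theorem schwartz_decay_of_sym {h : Spacetime d → F} (hs : ContDiff ℝ ∞ h)
    (hh : ∀ κ : ℝ, Sym κ h) {T : ℝ} (hT : 0 ≤ T)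
    (h0 : ∀ x : Spacetime d, T < |x.1 - ‖x.2‖| → h =ᶠ[𝓝 x] fun _ => 0) (m n : ℕ) :
    ∃ C : ℝ, ∀ x, ‖x‖ ^ m * ‖iteratedFDeriv ℝ n h x‖ ≤ C := by
  obtain ⟨C, R, hR, hb⟩ := (hh m).inertial n T
  have hc : Continuous fun x => ‖x‖ ^ m * ‖iteratedFDeriv ℝ n h x‖ :=
    (continuous_norm.pow m).mul (hs.continuous_iteratedFDeriv (by exact_mod_cast le_top)).norm
  obtain ⟨C', hC'⟩ := (isCompact_closedBall (0 : Spacetime d) (R + 2 * T)).exists_bound_of_continuousOn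
    hc.continuousOn
  refine ⟨max C' (2 ^ m * |C|), fun x => ?_⟩
  -- A compact ball is handled by continuity; outside it, either `h` vanishes locally or `‖x‖ ≤ 2
  -- ‖x.2‖` and the decay in the radius applies.
  by_cases hx : x ∈ Metric.closedBall (0 : Spacetime d) (R + 2 * T)
  · exact (le_abs_self _).trans ((hC' x hx).trans (le_max_left _ _))
  by_cases hu : T < |x.1 - ‖x.2‖|
  · rw [iteratedFDeriv_eq_zero_of_eventually (h0 x hu), norm_zero, mul_zero]
    exact le_trans (by positivity) (le_max_right _ _)
  have hx' : R + 2 * T < ‖x‖ := by simpa using hx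
  have hu' := not_lt.1 hu
  have hn : ‖x‖ ≤ T + ‖x.2‖ := by
    rw [Prod.norm_def]
    refine max_le ?_ (by linarith)
    rw [Real.norm_eq_abs]
    have := abs_sub_abs_le_abs_sub x.1 ‖x.2‖
    rw [abs_of_nonneg (norm_nonneg x.2)] at this
    linarith
  have hr : R ≤ ‖x.2‖ := by linarith
  have hr0 : 0 < ‖x.2‖ := by linarith
  refine le_trans ?_ (le_max_right _ _)
  calc ‖x‖ ^ m * ‖iteratedFDeriv ℝ n h x‖ ≤ (2 * ‖x.2‖) ^ m * (|C| * ‖x.2‖ ^ (-(m : ℝ))) := by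
        refine mul_le_mul (pow_le_pow_left₀ (norm_nonneg _) (by linarith) m)
          ((hb x hu' hr).trans ?_) (norm_nonneg _) (by positivity)
        exact mul_le_mul_of_nonneg_right (le_abs_self C) (by positivity)
    _ = 2 ^ m * |C| := by
        rw [Real.rpow_neg hr0.le, Real.rpow_natCast, mul_pow]
        field_simp

theorem isOpen_retarded_gt (T : ℝ) : IsOpen {x : Spacetime d | T < |x.1 - ‖x.2‖|} :=
  isOpen_lt (by fun_prop) (by fun_prop)

open SchwartzMap in
/-- A function that decreases rapidly near null infinity agrees there with a Schwartz function. -/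
theorem exists_schwartz {g : Spacetime d → F} (hg : ∀ κ : ℝ, Sym κ g) :
    ∃ G : 𝓢(Spacetime d, F), ∃ V, IsNhdScri V ∧ ∀ x ∈ V, G x = g x := by
  obtain ⟨V, hV, hsm⟩ := (hg 0).smooth
  choose ρ hρ0 hρ using fun k : ℕ => hV.far ((k : ℝ) + 2)
  let q : ℕ → Spacetime d → F := fun k x => lift (fun p => timePiece k p.1) x • g x
  have hq : ∀ k κ, Sym κ (q k) := by
    intro k κ
    have := (hom_timePiece (d := d) k).sym.bilinear (hg κ) (ContinuousLinearMap.lsmul ℝ ℝ)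
    rw [zero_add] at this
    exact this
  choose R₀ hR1 hR₀ using fun k : ℕ =>
    (hq k (k + 1)).farCutoff_small k (k + 2) (ε := (1 / 2) ^ k) (by positivity)
  -- Beyond `ρ k` the source is smooth on the support of the `k`-th piece. With `R k ≥ k + 2` the
  -- radius dominates `|u|` there, so radial decay is decay in the full norm.
  let R : ℕ → ℝ := fun k => max (R₀ k) (max (k + 2) (ρ k))
  have hRk : ∀ k : ℕ, (k : ℝ) + 2 ≤ R k := fun k => (le_max_left _ _).trans (le_max_right _ _)
  have hR0 : ∀ k, 0 < R k := fun k => lt_of_lt_of_le (by positivity) (hRk k)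
  have hRρ : ∀ k, ρ k ≤ R k := fun k => (le_max_right _ _).trans (le_max_right _ _)
  let h : ℕ → Spacetime d → F := fun k x => farCutoff (R k) x • q k x
  have hz : ∀ (k : ℕ) (x : Spacetime d), (k : ℝ) + 2 < |x.1 - ‖x.2‖| →
      q k =ᶠ[𝓝 x] fun _ => 0 := by
    intro k x hx
    filter_upwards [(isOpen_retarded_gt ((k : ℝ) + 2)).mem_nhds hx] with y hy
    simp only [q, lift]
    rw [timePiece_eq_zero (le_of_lt hy), zero_smul]
  have hz' : ∀ (k : ℕ) (x : Spacetime d), (k : ℝ) + 2 < |x.1 - ‖x.2‖| →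
      h k =ᶠ[𝓝 x] fun _ => 0 := by
    intro k x hx
    filter_upwards [hz k x hx] with y hy
    simp only [h, hy, smul_zero]
  have hsmooth : ∀ k, ContDiff ℝ ∞ (h k) := fun k => contDiff_farCutoff_smul (hR0 k) fun x hx => by
    by_cases hu : (k : ℝ) + 2 < |x.1 - ‖x.2‖|
    · exact contDiffAt_const.congr_of_eventuallyEq (hz k x hu)
    · have hxV := hρ k x (not_lt.1 hu) ((hRρ k).trans hx)
      have hx0 : x.2 ≠ 0 := norm_pos_iff.1 ((hR0 k).trans_le hx)
      exact ((hom_timePiece k).contDiffOn_lift.contDiffAt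
        ((isOpen_ne_fun (by fun_prop) (by fun_prop)).mem_nhds hx0)).smul
          (hsm.contDiffAt (hV.1.mem_nhds hxV))
  obtain ⟨f, hf, hfM, hsum⟩ := exists_locally_finite_sum h hsmooth (fun k x hx => by
    simp only [h]
    rw [farCutoff_eq_zero (hR0 k) (by linarith [hRk k]), zero_smul])
  have hdecay : ∀ m n : ℕ, ∃ C : ℝ, ∀ x, ‖x‖ ^ m * ‖iteratedFDeriv ℝ n f x‖ ≤ C := by
    intro m n
    -- From this index on the pieces sum geometrically against `‖x‖ ^ m` with `n` derivatives; the
    -- finitely many earlier ones decrease rapidly one by one.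
    let K := m + n
    choose C hC using fun k : ℕ => schwartz_decay_of_sym (hsmooth k)
      (fun κ => (hq k κ).farCutoff_smul (hR0 k)) (T := (k : ℝ) + 2) (by positivity) (hz' k) m n
    refine ⟨2 * 2 ^ m + ∑ k ∈ Finset.range K, C k, fun x => ?_⟩
    have h1 := hsum K n x (‖x‖ ^ m) (2 ^ m) (by positivity) (by positivity) (fun k hk => by
      by_cases hu : (k : ℝ) + 2 < |x.1 - ‖x.2‖|
      · rw [iteratedFDeriv_eq_zero_of_eventually (hz' k x hu), norm_zero, mul_zero]; positivity
      rcases lt_or_ge ‖x.2‖ (R k) with hr | hr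
      · rw [iteratedFDeriv_eq_zero_of_eventually
          (farCutoff_smul_eventually_zero (hR0 k) hr (q k)), norm_zero, mul_zero]; positivity
      have hk2 : (k : ℝ) + 2 ≤ ‖x.2‖ := (hRk k).trans hr
      have hk0 : (0 : ℝ) ≤ k := Nat.cast_nonneg k
      have hn : ‖x‖ ≤ 2 * ‖x.2‖ := by
        rw [Prod.norm_def]
        refine max_le ?_ (by linarith)
        rw [Real.norm_eq_abs]
        have := abs_sub_abs_le_abs_sub x.1 ‖x.2‖
        rw [abs_of_nonneg (norm_nonneg x.2)] at this
        linarith [not_lt.1 hu]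
      have h2 := hR₀ k (R k) (le_max_left _ _) x (not_lt.1 hu) n (by omega)
      have hx1 : 1 ≤ ‖x.2‖ := by linarith
      calc ‖x‖ ^ m * ‖iteratedFDeriv ℝ n (h k) x‖
          ≤ (2 * ‖x.2‖) ^ m * ((1 / 2) ^ k * ‖x.2‖ ^ (-((k : ℝ) + 1) + 1)) := by gcongr
        _ ≤ (2 * ‖x.2‖) ^ m * ((1 / 2) ^ k * ‖x.2‖ ^ (-(m : ℝ))) := by
            have : (m : ℝ) ≤ k := by exact_mod_cast (by omega : m ≤ k)
            gcongr
            linarith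
        _ = (1 / 2) ^ k * 2 ^ m := by
            rw [Real.rpow_neg (by linarith), Real.rpow_natCast, mul_pow]
            field_simp)
    have h3 : iteratedFDeriv ℝ n f x
        = iteratedFDeriv ℝ n (fun x => f x - ∑ k ∈ Finset.range K, h k x) x
          + ∑ k ∈ Finset.range K, iteratedFDeriv ℝ n (h k) x := by
      rw [← iteratedFDeriv_fun_sum_apply (fun k _ => (hsmooth k).contDiffAt.top_to_nat n)]
      have hs2 : ContDiff ℝ ∞ fun x => ∑ k ∈ Finset.range K, h k x :=
        ContDiff.sum fun k _ => hsmooth k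
      rw [← iteratedFDeriv_add_apply ((hf.sub hs2).contDiffAt.top_to_nat n)
        (hs2.contDiffAt.top_to_nat n)]
      congr 1
      funext y
      simp
    rw [h3]
    refine (mul_le_mul_of_nonneg_left ((norm_add_le _ _).trans (add_le_add_right
      (norm_sum_le _ _) _)) (by positivity)).trans ?_
    rw [mul_add, Finset.mul_sum]
    exact add_le_add h1 (Finset.sum_le_sum fun k _ => hC k x)
  refine ⟨⟨f, hf, hdecay⟩, _, isNhdScri_interior (s := {x | f x = g x}) fun T => ?_,
    fun x hx => (interior_subset hx : _)⟩
  obtain ⟨M, hM⟩ := exists_nat_ge |T|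
  refine ⟨∑ k ∈ Finset.range (M + 1), 2 * R k, fun x hx hr => ?_⟩
  have hTM : |x.1 - ‖x.2‖| ≤ M := hx.trans ((le_abs_self T).trans hM)
  obtain ⟨N, hN⟩ := exists_nat_ge ‖x.2‖
  have e1 := hfM (max N (M + 1)) x (hN.trans (by exact_mod_cast le_max_left _ _))
  -- For `|u| ≤ M` only the first `M + 1` pieces can be nonzero. Far out all their cutoffs equal one
  -- and the pieces add up to `g`.
  have e2 : ∑ k ∈ Finset.range (max N (M + 1)), h k x = ∑ k ∈ Finset.range (M + 1), h k x := by
    symm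
    refine Finset.sum_subset (Finset.range_mono (le_max_right _ _)) fun k _ hk => ?_
    have hk' : M + 1 ≤ k := by simpa using hk
    have : (M : ℝ) ≤ k := by exact_mod_cast (by omega : M ≤ k)
    simp only [h, q, lift]
    rw [timePiece_eq_zero_of_le (by linarith) (by omega), zero_smul, smul_zero]
  have e3 : ∑ k ∈ Finset.range (M + 1), h k x = g x := by
    have : ∀ k ∈ Finset.range (M + 1), h k x = timePiece k (x.1 - ‖x.2‖) • g x := by
      intro k hk
      simp only [h, q, lift]
      rw [farCutoff_eq_one (hR0 k) ((Finset.single_le_sum (f := fun k => 2 * R k)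
        (fun k _ => by linarith [hR0 k]) hk).trans hr), one_smul]
    rw [Finset.sum_congr rfl this, ← Finset.sum_smul, sum_timePiece,
      timeBump_eq_one (by linarith), one_smul]
  rw [mem_ofPred_eq, e1, e2, e3]

/-- The wave equation with a source that decreases rapidly near null infinity has a solution that
decreases rapidly near null infinity. -/
theorem exists_wave_near (hd : 1 ≤ d) {g : Spacetime d → ℝ} (hg : ∀ κ : ℝ, Sym κ g) :
    ∃ w : Spacetime d → ℝ, ContDiff ℝ ∞ w ∧ (∀ κ : ℝ, Sym κ w) ∧
      ∃ V, IsNhdScri V ∧ ∀ x ∈ V, box w x = g x := by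
  obtain ⟨G, V, hV, hG⟩ := exists_schwartz hg
  obtain ⟨w, hw, hbox, hb⟩ := exists_wave hd G
  refine ⟨w, hw, fun κ => Sym.of_approx ⟨_, isNhdScri_lt_norm 0, hw.contDiffOn⟩ fun n T => ?_,
    V, hV, fun x hx => by rw [hbox, hG x hx]⟩
  obtain ⟨N, hN⟩ := exists_nat_ge (κ + n)
  choose C hC using hb N
  refine ⟨fun _ => 0, Sym.zero κ, (∑ j ∈ Finset.range (n + 1), |C j|) * 2 ^ N, 1 + 2 * |T|,
    fun x hx hr j hj => ?_⟩
  simp only [sub_zero]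
  have hT := le_abs_self T
  have hT0 := abs_nonneg T
  -- At bounded retarded time and large radius `t` is comparable to `r`, so decay in time is decay
  -- in `r`.
  have ht : ‖x.2‖ / 2 ≤ x.1 := by linarith [(abs_le.1 hx).1]
  have hr1 : 1 ≤ ‖x.2‖ := by linarith
  have h1 : wt N x.1 ≤ 2 ^ N * ‖x.2‖ ^ (-(κ + n)) := by
    have h2 : wt N x.1 ≤ (‖x.2‖ / 2) ^ (-(N : ℝ)) := by
      refine Real.rpow_le_rpow_of_nonpos (by linarith) ?_ (by simp)
      rw [Real.norm_of_nonneg (by linarith)]; linarith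
    refine h2.trans ?_
    rw [Real.rpow_neg (by linarith), Real.rpow_natCast, div_pow, inv_div, div_eq_mul_inv,
      ← Real.rpow_natCast ‖x.2‖, ← Real.rpow_neg (by linarith)]
    refine mul_le_mul_of_nonneg_left (Real.rpow_le_rpow_of_exponent_le hr1 ?_) (by positivity)
    linarith
  refine (hC j x (by linarith)).trans ?_
  rw [mul_assoc]
  refine mul_le_mul ((le_abs_self _).trans ?_) h1 (wt_pos _ _).le
    (Finset.sum_nonneg fun _ _ => abs_nonneg _)
  exact Finset.single_le_sum (f := fun j => |C j|) (fun j _ => abs_nonneg _)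
    (Finset.mem_range.2 (by omega))

end Borel

end

section

/-! ### Smoothness of integrals over compact sets -/

section ParametricIntegral

open MeasureTheory

variable {E X : Type} [NormedAddCommGroup E] [NormedSpace ℝ E] [NormedAddCommGroup X]
  [NormedSpace ℝ X] [MeasurableSpace X] [BorelSpace X]

/-- The partial derivative in the first argument. -/
def fstDeriv {F : Type} [NormedAddCommGroup F] [NormedSpace ℝ F] (f : E × X → F) :
    E × X → E →L[ℝ] F :=
  fun z => (fderiv ℝ f z).comp (ContinuousLinearMap.inl ℝ E X)

theorem _root_.ContDiffOn.fstDeriv {F : Type} [NormedAddCommGroup F] [NormedSpace ℝ F]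
    {f : E × X → F} {W : Set (E × X)} (hW : IsOpen W) (hf : ContDiffOn ℝ ∞ f W) :
    ContDiffOn ℝ ∞ (Lorenz.fstDeriv f) W :=
  (hf.fderiv_of_isOpen hW (by simp)).clm_comp contDiffOn_const

theorem continuousOn_slice {F : Type} [TopologicalSpace F]
    {f : E × X → F} {W : Set (E × X)} {K : Set X} (hf : ContinuousOn f W) {x : E}
    (hx : ∀ y ∈ K, (x, y) ∈ W) : ContinuousOn (fun y => f (x, y)) K :=
  hf.comp (by fun_prop) hx

/-- The weight `w` is only integrable, which admits the singular kernel `‖z‖⁻¹`. The tube lemma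
supplies a bound for the derivative of `f` that is uniform over `K` and over nearby parameters. -/
theorem hasFDerivAt_integral_param {F : Type} [NormedAddCommGroup F] [NormedSpace ℝ F]
    {μ : Measure X} {K : Set X} (hK : IsCompact K) {w : X → ℝ} (hw : IntegrableOn w K μ)
    {U : Set E} (hU : IsOpen U) {W : Set (E × X)} (hW : IsOpen W)
    (hUK : U ×ˢ K ⊆ W) {f : E × X → F} (hf : ContDiffOn ℝ ∞ f W) {x : E} (hx : x ∈ U) :
    HasFDerivAt (fun x => ∫ y in K, w y • f (x, y) ∂μ) (∫ y in K, w y • fstDeriv f (x, y) ∂μ) x := by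
  have hc' : ContinuousOn (fstDeriv f) W := (hf.fstDeriv hW).continuousOn
  have hxK : ∀ x ∈ U, ∀ y ∈ K, (x, y) ∈ W := fun x hx y hy => hUK ⟨hx, hy⟩
  obtain ⟨C, hC⟩ := hK.exists_bound_of_continuousOn (continuousOn_slice hc' (hxK x hx))
  obtain ⟨C₀, hC₀⟩ := hK.exists_bound_of_continuousOn (continuousOn_slice hf.continuousOn (hxK x hx))
  have ho : IsOpen (W ∩ {z | ‖fstDeriv f z‖ < C + 1}) :=
    hc'.norm.isOpen_inter_preimage hW isOpen_Iio
  obtain ⟨u, v, hu, -, hxu, hKv, huv⟩ := generalized_tube_lemma (s := {x}) (t := K)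
    isCompact_singleton hK ho (by
      rintro ⟨x', y⟩ ⟨hx', hy⟩
      obtain rfl : x' = x := hx'
      exact ⟨hxK _ hx y hy, by simpa using (hC y hy).trans_lt (lt_add_one C)⟩)
  have hnhds : u ∩ U ∈ 𝓝 x := (hu.inter hU).mem_nhds ⟨hxu rfl, hx⟩
  have hKm : MeasurableSet K := hK.measurableSet
  have hm : ∀ x' ∈ U, AEStronglyMeasurable (fun y => w y • f (x', y)) (μ.restrict K) :=
    fun x' hx' => hw.aestronglyMeasurable.smul
      ((continuousOn_slice hf.continuousOn (hxK x' hx')).aestronglyMeasurable_of_isCompact hK hKm)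
  refine hasFDerivAt_integral_of_dominated_of_fderiv_le (s := u ∩ U)
    (bound := fun y => ‖w y‖ * (C + 1))
    (F := fun x y => w y • f (x, y)) (F' := fun x y => w y • fstDeriv f (x, y)) hnhds ?_ ?_ ?_ ?_
    (hw.norm.mul_const _) ?_
  · filter_upwards [hnhds] with x' hx' using hm x' hx'.2
  · refine Integrable.mono' (hw.norm.mul_const C₀) (hm x hx) ?_
    filter_upwards [ae_restrict_mem hKm] with y hy
    rw [norm_smul]
    exact mul_le_mul_of_nonneg_left (hC₀ y hy) (norm_nonneg _)
  · exact hw.aestronglyMeasurable.smul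
      ((continuousOn_slice hc' (hxK x hx)).aestronglyMeasurable_of_isCompact hK hKm)
  · filter_upwards [ae_restrict_mem hKm] with y hy x' hx'
    rw [norm_smul]
    exact mul_le_mul_of_nonneg_left (le_of_lt (huv ⟨hx'.1, hKv hy⟩).2) (norm_nonneg _)
  · filter_upwards [ae_restrict_mem hKm] with y hy x' hx'
    have h1 : HasFDerivAt (fun x => f (x, y)) (fstDeriv f (x', y)) x' :=
      (ContDiffOn.differentiableAt_top hW hf (hxK x' hx'.2 y hy)).hasFDerivAt.comp x'
        (hasFDerivAt_prodMk_left x' y)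
    exact h1.const_smul (w y)

theorem contDiffOn_integral_param_nat {μ : Measure X} {K : Set X} (hK : IsCompact K) {w : X → ℝ}
    (hw : IntegrableOn w K μ) {U : Set E} (hU : IsOpen U) {W : Set (E × X)} (hW : IsOpen W)
    (hUK : U ×ˢ K ⊆ W) (n : ℕ) : ∀ {F : Type} [NormedAddCommGroup F] [NormedSpace ℝ F]
    {f : E × X → F} (_ : ContDiffOn ℝ ∞ f W),
    ContDiffOn ℝ n (fun x => ∫ y in K, w y • f (x, y) ∂μ) U := by
  induction n with
  | zero =>
    intro F _ _ f hf
    exact contDiffOn_zero.2 fun x hx =>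
      (hasFDerivAt_integral_param hK hw hU hW hUK hf hx).continuousAt.continuousWithinAt
  | succ n ih =>
    intro F _ _ f hf
    rw [show ((n + 1 : ℕ) : ℕ∞ω) = (n : ℕ∞ω) + 1 by norm_cast,
      contDiffOn_succ_iff_fderiv_of_isOpen hU]
    refine ⟨fun x hx => (hasFDerivAt_integral_param hK hw hU hW hUK hf
      hx).differentiableAt.differentiableWithinAt, by simp, ?_⟩
    exact (ih (hf.fstDeriv hW)).congr fun x hx =>
      (hasFDerivAt_integral_param hK hw hU hW hUK hf hx).fderiv

/-- Differentiation under the integral sign over a compact set. -/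
theorem contDiffOn_integral_param {F : Type} [NormedAddCommGroup F] [NormedSpace ℝ F]
    {μ : Measure X} {K : Set X} (hK : IsCompact K) {w : X → ℝ} (hw : IntegrableOn w K μ)
    {U : Set E} (hU : IsOpen U) {W : Set (E × X)} (hW : IsOpen W)
    (hUK : U ×ˢ K ⊆ W) {f : E × X → F} (hf : ContDiffOn ℝ ∞ f W) :
    ContDiffOn ℝ ∞ (fun x => ∫ y in K, w y • f (x, y) ∂μ) U :=
  contDiffOn_infty.2 fun n => contDiffOn_integral_param_nat hK hw hU hW hUK n hf

end ParametricIntegral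

/-! ### Formal and actual solution of the wave equation -/

section Recursion

variable {d : ℕ}

/-- Substituting `v = u t` fixes the interval of integration, so smoothness follows by
differentiating under the integral. -/
theorem Hom.integral_u {a : ℝ} {f : ℝ × Space d → ℝ} (hf : Hom a f) :
    Hom a fun p => ∫ v in (0 : ℝ)..p.1, f (v, p.2) := by
  have h1 : (fun p : ℝ × Space d => ∫ v in (0 : ℝ)..p.1, f (v, p.2))
      = fun p => p.1 * ∫ t in Icc (0 : ℝ) 1, f (p.1 * t, p.2) := by
    funext p
    have := intervalIntegral.smul_integral_comp_mul_left (a := 0) (b := 1)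
      (fun v => f (v, p.2)) p.1
    rw [mul_zero, mul_one, smul_eq_mul] at this
    rw [← this, intervalIntegral.integral_of_le zero_le_one,
      MeasureTheory.integral_Icc_eq_integral_Ioc]
  refine ⟨?_, fun u y s hs hy => ?_⟩
  · rw [h1]
    refine ContDiffOn.mul (by fun_prop) ?_
    have h2 := contDiffOn_integral_param (μ := MeasureTheory.volume) (w := fun _ => (1 : ℝ))
      (f := fun z : (ℝ × Space d) × ℝ => f (z.1.1 * z.2, z.1.2))
      (W := {z : (ℝ × Space d) × ℝ | z.1.2 ≠ 0}) (isCompact_Icc (a := 0) (b := 1)) (by simp) isOpen_snd_ne_zero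
      (isOpen_ne_fun (by fun_prop) (by fun_prop)) (fun z hz => hz.1)
      (hf.smooth.comp (by fun_prop) fun z hz => hz)
    simpa only [one_smul] using h2
  · simp only
    rw [← intervalIntegral.integral_smul]
    exact intervalIntegral.integral_congr fun v _ => hf.hom v y s hs hy

theorem Hom.uD_integral_u {a : ℝ} {f : ℝ × Space d → ℝ} (hf : Hom a f) {p : ℝ × Space d}
    (hp : p.2 ≠ 0) : Lorenz.uD (fun p => ∫ v in (0 : ℝ)..p.1, f (v, p.2)) p = f p := by
  have h1 := hf.integral_u.hasDerivAt_u p.1 hp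
  have hc : Continuous fun v => f (v, p.2) :=
    continuous_iff_continuousAt.2 fun v => (hf.hasDerivAt_u v hp).continuousAt
  exact h1.unique (hc.integral_hasStrictDerivAt 0 p.1).hasDerivAt

/-- One step of the recursion that solves the wave equation formally. -/
def waveStep (lam : ℝ × Space d → ℝ) (s : ℕ → ℝ × Space d → ℝ) (k : ℕ) (L : ℝ × Space d → ℝ)
    (p : ℝ × Space d) : ℝ :=
  if k = d - 4 then lam p else if k = d - 2 then 0 else
    ∫ v in (0 : ℝ)..p.1, ((k : ℝ) - (d - 2))⁻¹ * (‖p.2‖ * (s (k + 2) (v, p.2) - L (v, p.2)))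

/-- The coefficients of a formal solution of the wave equation with source `s`. -/
def waveCoef (lam : ℝ × Space d → ℝ) (s : ℕ → ℝ × Space d → ℝ) : ℕ → ℝ × Space d → ℝ
  | 0 => waveStep lam s 0 fun _ => 0
  | 1 => waveStep lam s 1 fun _ => 0
  | k + 2 => waveStep lam s (k + 2) (lapY (waveCoef lam s k))

theorem waveCoef_eq (lam : ℝ × Space d → ℝ) (s : ℕ → ℝ × Space d → ℝ) (k : ℕ) :
    waveCoef lam s k
      = waveStep lam s k (shiftCoef 2 (fun j => lapY (waveCoef lam s j)) k) := by
  match k with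
  | 0 => simp [waveCoef, shiftCoef]
  | 1 => simp [waveCoef, shiftCoef]
  | k + 2 => rw [waveCoef, shiftCoef_add]

variable {lam : ℝ × Space d → ℝ} {s : ℕ → ℝ × Space d → ℝ}

theorem hom_waveIntegrand {k : ℕ} {L : ℝ × Space d → ℝ} (hs : Hom (((k + 2 : ℕ) : ℝ) / 2) (s (k + 2)))
    (hL : Hom ((k : ℝ) / 2 + 1) L) :
    Hom ((k : ℝ) / 2) fun p => ((k : ℝ) - (d - 2))⁻¹ * (‖p.2‖ * (s (k + 2) p - L p)) := by
  have e : ((k + 2 : ℕ) : ℝ) / 2 = (k : ℝ) / 2 + 1 := by push_cast; ring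
  rw [e] at hs
  have := (Hom.norm.mul (hs.sub hL)).const_smul ((k : ℝ) - (d - 2))⁻¹
  rwa [show -1 + ((k : ℝ) / 2 + 1) = (k : ℝ) / 2 by ring] at this

theorem hom_waveStep (hlam : Hom (((d - 4 : ℕ) : ℝ) / 2) lam) {k : ℕ} {L : ℝ × Space d → ℝ}
    (hs : Hom (((k + 2 : ℕ) : ℝ) / 2) (s (k + 2))) (hL : Hom ((k : ℝ) / 2 + 1) L) :
    Hom ((k : ℝ) / 2) (waveStep lam s k L) := by
  unfold waveStep
  split_ifs with h1 h2
  · rwa [h1]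
  · exact Hom.zero _
  · exact (hom_waveIntegrand hs hL).integral_u

theorem hom_waveCoef (hlam : Hom (((d - 4 : ℕ) : ℝ) / 2) lam)
    (hs : ∀ k : ℕ, Hom ((k : ℝ) / 2) (s k)) (k : ℕ) : Hom ((k : ℝ) / 2) (waveCoef lam s k) := by
  induction k using Nat.strong_induction_on with
  | _ k ih =>
    rw [waveCoef_eq]
    refine hom_waveStep hlam (hs _) ?_
    unfold shiftCoef
    split_ifs with h
    · have := (ih (k - 2) (by omega)).lapY
      rwa [Nat.cast_sub h, show ((k : ℝ) - (2 : ℕ)) / 2 + 2 = (k : ℝ) / 2 + 1 by push_cast; ring] at this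
    · exact Hom.zero _

/-- The transport equation in `u`. Away from `k = d - 2` its factor is nonzero and can be divided
out. -/
theorem uD_waveCoef (hlam : Hom (((d - 4 : ℕ) : ℝ) / 2) lam)
    (hs : ∀ k : ℕ, Hom ((k : ℝ) / 2) (s k)) {k : ℕ} (h4 : k ≠ d - 4) (h2 : k ≠ d - 2) (hd : 4 ≤ d)
    {p : ℝ × Space d} (hp : p.2 ≠ 0) :
    (((k : ℝ) - (d - 2)) * ‖p.2‖⁻¹) * uD (waveCoef lam s k) p
      = s (k + 2) p - shiftCoef 2 (fun j => lapY (waveCoef lam s j)) k p := by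
  have hL : Hom ((k : ℝ) / 2 + 1) (shiftCoef 2 (fun j => lapY (waveCoef lam s j)) k) := by
    unfold shiftCoef
    split_ifs with h
    · have := (hom_waveCoef hlam hs (k - 2)).lapY
      rwa [Nat.cast_sub h, show ((k : ℝ) - (2 : ℕ)) / 2 + 2 = (k : ℝ) / 2 + 1 by push_cast; ring] at this
    · exact Hom.zero _
  have h1 : uD (waveCoef lam s k) p = _ := (congrArg (fun f => uD f p) (by
    rw [waveCoef_eq]; funext q; exact (if_neg h4).trans (if_neg h2))).trans
    ((hom_waveIntegrand (hs (k + 2)) hL).uD_integral_u hp)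
  rw [h1]
  have e1 : ‖p.2‖ ≠ 0 := norm_ne_zero_iff.2 hp
  have e2 : (k : ℝ) - (d - 2) ≠ 0 := by
    intro h
    have h3 : (k : ℝ) + 2 = d := by linarith
    have : k + 2 = d := by exact_mod_cast h3
    omega
  field_simp

/-- Outside the allowed orders a source term of index `k + 2` could only be the first member of one
of the two series: `d - 2`, excluded by `k ≠ d - 4`, or `2(d-3)`, where the source vanishes by
assumption. The Laplacian term vanishes by induction. -/
theorem waveCoef_eq_zero (hd : 4 ≤ d)
    (hs0 : ∀ k ∉ potentialOrders d, ∀ p : ℝ × Space d, p.2 ≠ 0 → s k p = 0)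
    (hs2 : Odd d → ∀ p : ℝ × Space d, p.2 ≠ 0 → s (2 * (d - 3)) p = 0) (k : ℕ)
    (hk : k ∉ potentialOrders d) (h4 : k ≠ d - 4) {p : ℝ × Space d} (hp : p.2 ≠ 0) :
    waveCoef lam s k p = 0 := by
  induction k using Nat.strong_induction_on generalizing p with
  | _ k ih =>
    rw [waveCoef_eq, waveStep, if_neg h4]
    split_ifs with h2
    · rfl
    · have h1 : ∀ v : ℝ, s (k + 2) (v, p.2) = 0 := by
        intro v
        by_cases hk2 : k + 2 ∈ potentialOrders d
        · rcases hk2 with ⟨i, hi⟩ | ⟨ho, i, hi⟩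
          · rcases Nat.eq_zero_or_pos i with rfl | hi0
            · exact absurd (by omega) h4
            · exact absurd (Or.inl ⟨i - 1, by omega⟩) hk
          · rcases Nat.eq_zero_or_pos i with rfl | hi0
            · rw [hi]; exact hs2 ho _ hp
            · exact absurd (Or.inr ⟨ho, i - 1, by omega⟩) hk
        · exact hs0 _ hk2 _ hp
      have h3 : ∀ v : ℝ, shiftCoef 2 (fun j => lapY (waveCoef lam s j)) k (v, p.2) = 0 := by
        intro v
        unfold shiftCoef
        split_ifs with h
        · have hk' := sub_two_not_mem_potentialOrders h hk
          have h4' : k - 2 ≠ d - 4 := fun h' => h2 (by omega)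
          exact (lapY_congr (f := waveCoef lam s (k - 2)) (g := fun _ => 0)
            (fun q hq => ih (k - 2) (by omega) hk' h4' hq) (p := (v, p.2)) hp).trans (lapY_zero _)
        · rfl
      simp [h1, h3]

/-- The transport equation holds at all generic orders. At `k = d - 4` it says `0 = s (d - 2)`
because `lam` does not depend on `u`; at `k = d - 2` it is the constraint `Δ lam = s d`. -/
theorem box_waveCoef (hd : 4 ≤ d) (hlam : Hom (((d - 4 : ℕ) : ℝ) / 2) lam)
    (hlamu : ∀ p : ℝ × Space d, p.2 ≠ 0 → uD lam p = 0)
    (hlap : ∀ p : ℝ × Space d, p.2 ≠ 0 → lapY lam p = s d p)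
    (hs : ∀ k : ℕ, Hom ((k : ℝ) / 2) (s k))
    (hs0 : ∀ k ∉ potentialOrders d, ∀ p : ℝ × Space d, p.2 ≠ 0 → s k p = 0)
    (hs1 : ∀ p : ℝ × Space d, p.2 ≠ 0 → s (d - 2) p = 0)
    (hs2 : Odd d → ∀ p : ℝ × Space d, p.2 ≠ 0 → s (2 * (d - 3)) p = 0) (k : ℕ)
    {p : ℝ × Space d} (hp : p.2 ≠ 0) :
    shiftCoef 2 (fun j p => (((j : ℝ) - (d - 2)) * ‖p.2‖⁻¹) • uD (waveCoef lam s j) p) k p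
      + shiftCoef 4 (fun j => lapY (waveCoef lam s j)) k p = s k p := by
  by_cases hk : k < 2
  · rw [shiftCoef_of_lt hk, shiftCoef_of_lt (by omega),
      hs0 k (not_mem_potentialOrders_of_lt hd (by omega)) p hp, add_zero]
  obtain ⟨k, rfl⟩ := Nat.exists_eq_add_of_le' (not_lt.1 hk)
  have e1 : shiftCoef 4 (fun j => lapY (waveCoef lam s j)) (k + 2)
      = shiftCoef 2 (fun j => lapY (waveCoef lam s j)) k := by
    unfold shiftCoef
    simp only [show 4 ≤ k + 2 ↔ 2 ≤ k by omega, show k + 2 - 4 = k - 2 by omega]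
  rw [e1, shiftCoef_add, smul_eq_mul]
  by_cases h4 : k = d - 4
  · have h5 : waveCoef lam s k = lam := by
      rw [waveCoef_eq]; funext q; exact if_pos h4
    have h6 : shiftCoef 2 (fun j => lapY (waveCoef lam s j)) k p = 0 := by
      unfold shiftCoef
      split_ifs with h
      · exact (lapY_congr (f := waveCoef lam s (k - 2)) (g := fun _ => 0)
          (fun q hq => waveCoef_eq_zero hd hs0 hs2 (k - 2)
          (not_mem_potentialOrders_of_lt hd (by omega)) (by omega) hq) hp).trans (lapY_zero _)
      · rfl
    rw [h5, hlamu p hp, h6, show k + 2 = d - 2 by omega, hs1 p hp]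
    ring
  by_cases h2 : k = d - 2
  · have h5 : waveCoef lam s k = fun _ => 0 := by
      rw [waveCoef_eq]; funext q; exact (if_neg h4).trans (if_pos h2)
    have h6 : waveCoef lam s (k - 2) = lam := by
      rw [waveCoef_eq]; funext q; exact if_pos (by omega)
    rw [h5, uD_zero, shiftCoef, if_pos (by omega), h6, hlap p hp, show k + 2 = d by omega]
    ring
  · rw [uD_waveCoef hlam hs h4 h2 hd hp]
    ring

theorem Exp.of_sym {F : Type} [NormedAddCommGroup F] [NormedSpace ℝ F] {f : Spacetime d → F}
    (h : ∀ κ : ℝ, Sym κ f) : Exp f fun _ _ => 0 :=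
  ⟨(h 0).smooth, fun _ => Hom.zero _, fun K => by simpa [lift] using h ((K : ℝ) / 2)⟩

/-- With all coefficients zero, every remainder is the function itself; so it decreases faster than
any power. -/
theorem Exp.sym_of_zero {F : Type} [NormedAddCommGroup F] [NormedSpace ℝ F] {f : Spacetime d → F}
    (h : Exp f fun _ _ => 0) (κ : ℝ) : Sym κ f := by
  obtain ⟨K, hK⟩ := exists_nat_ge (2 * κ)
  have := h.rem K
  simp only [lift, Finset.sum_const_zero, sub_zero] at this
  exact this.mono (by linarith)

theorem box_add_near {f g : Spacetime d → ℝ} (hf : SmoothNear f) (hg : SmoothNear g) :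
    ∃ V, IsNhdScri V ∧ ∀ x ∈ V, box (fun x => f x + g x) x = box f x + box g x := by
  obtain ⟨V, hV, hf⟩ := hf
  obtain ⟨W, hW, hg⟩ := hg
  refine ⟨V ∩ W, hV.inter hW, fun x hx => ?_⟩
  have hfx := hf.contDiffAt (hV.1.mem_nhds hx.1)
  have hgx := hg.contDiffAt (hW.1.mem_nhds hx.2)
  rw [box_eq hfx, box_eq hgx, box_eq (hfx.add hgx), ← map_add]
  have h1 : fderiv ℝ (fun x => f x + g x) =ᶠ[𝓝 x] fun x => fderiv ℝ f x + fderiv ℝ g x := by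
    filter_upwards [(hV.inter hW).1.mem_nhds hx] with y hy
    exact fderiv_fun_add (ContDiffOn.differentiableAt_top hV.1 hf hy.1)
      (ContDiffOn.differentiableAt_top hW.1 hg hy.2)
  rw [h1.fderiv_eq, fderiv_fun_add ((contDiffAt_top_fderiv hfx).differentiableAt (by simp))
    ((contDiffAt_top_fderiv hgx).differentiableAt (by simp))]

/-- The wave equation can be solved near null infinity with a gradient in the ansatz. -/
theorem exists_box_eq (hd : 4 ≤ d) {S : Spacetime d → ℝ} (hS : Exp S s)
    (hlam : Hom (((d - 4 : ℕ) : ℝ) / 2) lam)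
    (hlamu : ∀ p : ℝ × Space d, p.2 ≠ 0 → uD lam p = 0)
    (hlap : ∀ p : ℝ × Space d, p.2 ≠ 0 → lapY lam p = s d p)
    (hs0 : ∀ k ∉ potentialOrders d, ∀ p : ℝ × Space d, p.2 ≠ 0 → s k p = 0)
    (hs1 : ∀ p : ℝ × Space d, p.2 ≠ 0 → s (d - 2) p = 0)
    (hs2 : Odd d → ∀ p : ℝ × Space d, p.2 ≠ 0 → s (2 * (d - 3)) p = 0) :
    ∃ ψ : Spacetime d → ℝ, SmoothNear ψ ∧ (∃ V, IsNhdScri V ∧ ∀ x ∈ V, box ψ x = S x) ∧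
      ∃ c : ℕ → ℝ × Space d → Covector d, Exp (fderiv ℝ ψ) c ∧
        ∀ k ∉ potentialOrders d, ∀ p : ℝ × Space d, p.2 ≠ 0 → c k p = 0 := by
  obtain ⟨ψ₀, -, hψ₀⟩ := exists_exp (hom_waveCoef (s := s) hlam hS.hom)
  -- The formal solution makes every coefficient of the error vanish; the error is rapidly
  -- decreasing and can be removed by a rapidly decreasing correction.
  have hres : Exp (fun x => S x - box ψ₀ x) fun _ _ => 0 :=
    (hS.sub (hψ₀.box (by omega))).congr_coef fun k p hp => by
      rw [sub_eq_zero]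
      exact (box_waveCoef hd hlam hlamu hlap hS.hom hs0 hs1 hs2 k hp).symm
  obtain ⟨w, -, hw, V, hV, hbw⟩ := exists_wave_near (by omega : 1 ≤ d) hres.sym_of_zero
  have hψ : Exp (fun x => ψ₀ x + w x) (waveCoef lam s) :=
    (hψ₀.add (Exp.of_sym hw)).congr_coef fun k p _ => add_zero _
  obtain ⟨V', hV', hadd⟩ := box_add_near hψ₀.smooth (hw 0).smooth
  refine ⟨_, hψ.smooth, ⟨V ∩ V', hV.inter hV', fun x hx => ?_⟩, _, hψ.fderiv,
    fun k hk p hp => ?_⟩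
  · rw [hadd x hx.2, hbw x hx.1]; ring
  · have h0 : liftD0 (waveCoef lam s k) p = 0 := by
      have : uD (waveCoef lam s k) p = 0 := by
        -- The coefficient `lam` lies below the ansatz, but it has no `u`-derivative and contributes
        -- to the gradient only at the index `d - 2`.
        by_cases h4 : k = d - 4
        · rw [show waveCoef lam s k = lam by rw [waveCoef_eq]; funext q; exact if_pos h4]
          exact hlamu p hp
        · rw [uD_congr (g := fun _ => 0)
            (fun q hq => waveCoef_eq_zero hd hs0 hs2 k hk h4 hq) hp, uD_zero]
      rw [liftD0, this]
      ext v <;> simp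
    have h1 : shiftCoef 2 (fun j => liftD1 (waveCoef lam s j)) k p = 0 := by
      unfold shiftCoef
      split_ifs with h
      · have h4 : k - 2 ≠ d - 4 := fun h' => hk (Or.inl ⟨0, by omega⟩)
        have : fderiv ℝ (waveCoef lam s (k - 2)) p = 0 := by
          rw [(eventuallyEq_of_eq (g := fun _ => 0) (fun q hq => waveCoef_eq_zero hd hs0 hs2
            (k - 2) (sub_two_not_mem_potentialOrders h hk) h4 hq) hp).fderiv_eq]
          simp
        show liftD1 (waveCoef lam s (k - 2)) p = 0
        rw [liftD1, this]
        simp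
      · rfl
    rw [h0, h1, add_zero]

end Recursion

end

section

/-! ### The spatial Laplacian and Green's formula -/

section Laplacian

open MeasureTheory

variable {d : ℕ}

/-- The Laplacian on physical space. -/
def lapS (h : Space d → ℝ) (y : Space d) : ℝ :=
  ∑ i, fderiv ℝ (fderiv ℝ h) y (EuclideanSpace.single i 1) (EuclideanSpace.single i 1)

theorem fderiv_fderiv_apply {h : Space d → ℝ} {y : Space d}
    (hh : DifferentiableAt ℝ (fderiv ℝ h) y) (v w : Space d) :
    fderiv ℝ (fun x => fderiv ℝ h x v) y w = fderiv ℝ (fderiv ℝ h) y w v := by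
  rw [(hh.hasFDerivAt.clm_apply (hasFDerivAt_const v y)).fderiv]
  simp

theorem differentiableAt_fderiv {h : Space d → ℝ} {y : Space d} (hh : ContDiffAt ℝ ∞ h y) :
    DifferentiableAt ℝ (fderiv ℝ h) y :=
  (contDiffAt_top_fderiv hh).differentiableAt (by simp)

theorem eventually_differentiableAt {h : Space d → ℝ} {y : Space d} (hh : ContDiffAt ℝ ∞ h y) :
    ∀ᶠ x in 𝓝 y, DifferentiableAt ℝ h x := by
  filter_upwards [(hh.top_to_nat 1).eventually (by simp)] with x hx
  exact hx.differentiableAt (by simp)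

theorem lapY_comp_snd {h : Space d → ℝ} {p : ℝ × Space d} (hh : ContDiffAt ℝ ∞ h p.2) :
    lapY (fun q => h q.2) p = lapS h p.2 := by
  refine Finset.sum_congr rfl fun i _ => ?_
  have key : ∀ (g : Space d → ℝ) (q : ℝ × Space d) (v : Space d), DifferentiableAt ℝ g q.2 →
      yD v (fun q => g q.2) q = fderiv ℝ g q.2 v := fun g q v hg => by
    rw [yD, HasFDerivAt.fderiv (f := fun q : ℝ × Space d => g q.2)
      (hg.hasFDerivAt.comp q hasFDerivAt_snd)]
    simp
  have h1 : yD (EuclideanSpace.single i 1) (fun q => h q.2)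
      =ᶠ[𝓝 p] fun q => fderiv ℝ h q.2 (EuclideanSpace.single i 1) := by
    filter_upwards [continuous_snd.continuousAt.eventually (eventually_differentiableAt hh)]
      with q hq using key h q _ hq
  have hd := differentiableAt_fderiv hh
  rw [yD, h1.fderiv_eq, ← yD, key (fun y => fderiv ℝ h y (EuclideanSpace.single i 1)) p _
    (hd.clm_apply (differentiableAt_const _)), fderiv_fderiv_apply hd]

theorem lapS_congr {h g : Space d → ℝ} {y : Space d} (hg : h =ᶠ[𝓝 y] g) : lapS h y = lapS g y := by
  unfold lapS
  rw [hg.fderiv.fderiv_eq]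

theorem lapS_add {h g : Space d → ℝ} {y : Space d} (hh : ContDiffAt ℝ ∞ h y)
    (hg : ContDiffAt ℝ ∞ g y) : lapS (fun x => h x + g x) y = lapS h y + lapS g y := by
  have h1 : fderiv ℝ (fun x => h x + g x) =ᶠ[𝓝 y] fun x => fderiv ℝ h x + fderiv ℝ g x := by
    filter_upwards [eventually_differentiableAt hh, eventually_differentiableAt hg] with x h1 h2
    exact fderiv_fun_add h1 h2
  unfold lapS
  rw [h1.fderiv_eq, fderiv_fun_add (differentiableAt_fderiv hh) (differentiableAt_fderiv hg),
    ← Finset.sum_add_distrib]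
  rfl

theorem lapS_const_mul {h : Space d → ℝ} {y : Space d} (hh : ContDiffAt ℝ ∞ h y) (c : ℝ) :
    lapS (fun x => c * h x) y = c * lapS h y := by
  have h1 : fderiv ℝ (fun x => c * h x) =ᶠ[𝓝 y] fun x => c • fderiv ℝ h x := by
    filter_upwards [eventually_differentiableAt hh] with x h1
    exact fderiv_const_mul h1 c
  unfold lapS
  rw [h1.fderiv_eq, fderiv_fun_const_smul (differentiableAt_fderiv hh), Finset.mul_sum]
  rfl

theorem lapS_comp_add (h : Space d → ℝ) (a y : Space d) :
    lapS (fun x => h (x + a)) y = lapS h (y + a) := by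
  unfold lapS
  rw [show fderiv ℝ (fun x => h (x + a)) = fun x => fderiv ℝ h (x + a) from
    funext fun x => fderiv_comp_add_right a, fderiv_comp_add_right]

/-- The Laplacian of a function of the square of the radius. -/
theorem lapS_radial (hd : 1 ≤ d) {φ φ' : ℝ → ℝ} {φ₂ : ℝ} {y : Space d}
    (h1 : ∀ᶠ q in 𝓝 (‖y‖ ^ 2), HasDerivAt φ (φ' q) q) (h2 : HasDerivAt φ' φ₂ (‖y‖ ^ 2)) :
    lapS (fun z => φ (‖z‖ ^ 2)) y = 4 * φ₂ * ‖y‖ ^ 2 + 2 * (d - 1) * φ' (‖y‖ ^ 2) := by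
  have hn : ∀ z : Space d, HasFDerivAt (fun z : Space d => ‖z‖ ^ 2) (2 • innerSL ℝ z) z :=
    fun z => (hasStrictFDerivAt_norm_sq z).hasFDerivAt
  have e1 : fderiv ℝ (fun z : Space d => φ (‖z‖ ^ 2))
      =ᶠ[𝓝 y] fun z => φ' (‖z‖ ^ 2) • (2 • innerSL ℝ z) := by
    have hc : ContinuousAt (fun z : Space d => ‖z‖ ^ 2) y := by fun_prop
    filter_upwards [hc.eventually h1] with z hz
    exact (hz.comp_hasFDerivAt z (hn z)).fderiv
  have e2 : HasFDerivAt (fun z : Space d => (2 : ℕ) • innerSL ℝ z) ((2 : ℕ) • innerSL ℝ) y :=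
    ((innerSL ℝ : Space d →L[ℝ] Space d →L[ℝ] ℝ).hasFDerivAt).const_smul 2
  have e3 := (h2.comp_hasFDerivAt y (hn y)).smul e2
  unfold lapS
  rw [e1.fderiv_eq, HasFDerivAt.fderiv (f := fun z : Space d => φ' (‖z‖ ^ 2) • (2 • innerSL ℝ z)) e3]
  have e4 : ∑ i, y i * y i = ‖y‖ ^ 2 := by
    rw [EuclideanSpace.real_norm_sq_eq]; simp [sq]
  have e5 : ∀ i, inner ℝ y (EuclideanSpace.single i (1 : ℝ)) = y i := fun i => by
    rw [EuclideanSpace.inner_single_right]; simp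
  simp only [add_apply, smul_apply, ContinuousLinearMap.smulRight_apply, innerSL_apply_apply, e5]
  simp only [Function.comp_apply]
  simp only [nsmul_eq_mul, smul_eq_mul, Nat.cast_ofNat]
  have e6 : ∀ i, innerSL ℝ (EuclideanSpace.single i (1 : ℝ) : Space d) (EuclideanSpace.single i 1)
      = 1 := fun i => by rw [innerSL_apply_apply]; simp
  simp only [e6]
  rw [Finset.sum_add_distrib, Finset.sum_const, Finset.card_univ, nsmul_eq_mul, card_space hd, ← e4,
    Finset.mul_sum]
  rw [add_comm]
  congr 1
  · exact Finset.sum_congr rfl fun i _ => by ring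
  · ring

/-- Differentiation of a parametric integral, second order. -/
theorem lapS_integral_param {X : Type} [NormedAddCommGroup X] [NormedSpace ℝ X]
    [FiniteDimensional ℝ X]
    [MeasurableSpace X] [BorelSpace X] {μ : Measure X} {K : Set X} (hK : IsCompact K) {w : X → ℝ}
    (hw : IntegrableOn w K μ) {U : Set (Space d)} (hU : IsOpen U) {W : Set (Space d × X)}
    (hW : IsOpen W) (hUK : U ×ˢ K ⊆ W) {f : Space d × X → ℝ} (hf : ContDiffOn ℝ ∞ f W) {x : Space d}
    (hx : x ∈ U) :
    lapS (fun x => ∫ y in K, w y • f (x, y) ∂μ) x = ∫ y in K, w y * lapS (fun x => f (x, y)) x ∂μ := by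
  have h1 : fderiv ℝ (fun x => ∫ y in K, w y • f (x, y) ∂μ)
      =ᶠ[𝓝 x] fun x => ∫ y in K, w y • fstDeriv f (x, y) ∂μ := by
    filter_upwards [hU.mem_nhds hx] with z hz
    exact (hasFDerivAt_integral_param hK hw hU hW hUK hf hz).fderiv
  have hf' := hf.fstDeriv hW
  have hf'' := hf'.fstDeriv hW
  have hxK : ∀ y ∈ K, (x, y) ∈ W := fun y hy => hUK ⟨hx, hy⟩
  have hslice : ∀ {F : Type} [NormedAddCommGroup F] [NormedSpace ℝ F] {g : Space d × X → F}
      {z : Space d × X}, ContDiffOn ℝ ∞ g W → z ∈ W →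
      fderiv ℝ (fun x => g (x, z.2)) z.1 = fstDeriv g z := fun {F} _ _ {g} {z} hg hz =>
    ((ContDiffOn.differentiableAt_top hW hg hz).hasFDerivAt.comp z.1
        (hasFDerivAt_prodMk_left z.1 z.2)).fderiv
  have hint : IntegrableOn (fun y => w y • fstDeriv (fstDeriv f) (x, y)) K μ :=
    hw.smul_continuousOn (continuousOn_slice hf''.continuousOn hxK) hK
  have hpt : ∀ y ∈ K, fderiv ℝ (fderiv ℝ fun x => f (x, y)) x = fstDeriv (fstDeriv f) (x, y) := by
    intro y hy
    have : fderiv ℝ (fun x => f (x, y)) =ᶠ[𝓝 x] fun x => fstDeriv f (x, y) := by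
      have hc : ContinuousAt (fun x : Space d => (x, y)) x := by fun_prop
      filter_upwards [hc.eventually (hW.mem_nhds (hxK y hy))] with z hz
      exact hslice hf (z := (z, y)) hz
    rw [this.fderiv_eq, hslice hf' (z := (x, y)) (hxK y hy)]
  unfold lapS
  rw [h1.fderiv_eq, (hasFDerivAt_integral_param hK hw hU hW hUK hf' hx).fderiv]
  have e1 : ∀ v : Space d, (∫ y in K, w y • fstDeriv (fstDeriv f) (x, y) ∂μ) v v
      = ∫ y in K, (w y • fstDeriv (fstDeriv f) (x, y)) v v ∂μ := fun v => by
    rw [ContinuousLinearMap.integral_apply hint, ContinuousLinearMap.integral_apply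
      (hint.apply_continuousLinearMap v)]
  simp only [e1]
  rw [← integral_finsetSum _ fun i _ => (hint.apply_continuousLinearMap _).apply_continuousLinearMap _]
  refine setIntegral_congr_fun hK.measurableSet fun y hy => ?_
  simp only [hpt y hy, smul_apply, smul_eq_mul, Finset.mul_sum]

/-- Green's formula for a compactly supported function. -/
theorem integral_mul_lapS {N g : Space d → ℝ} (hN : ContDiff ℝ ∞ N) (hg : ContDiff ℝ ∞ g)
    (hc : HasCompactSupport g) : ∫ z, N z * lapS g z = ∫ z, lapS N z * g z := by
  have hN' : ∀ v, ContDiff ℝ ∞ fun z => fderiv ℝ N z v := fun v =>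
    (hN.fderiv_right (by simp)).clm_apply contDiff_const
  have hg' : ∀ v, ContDiff ℝ ∞ fun z => fderiv ℝ g z v := fun v =>
    (hg.fderiv_right (by simp)).clm_apply contDiff_const
  have hc' : ∀ v, HasCompactSupport fun z => fderiv ℝ g z v := fun v =>
    hc.fderiv_apply ℝ v
  have ibp : ∀ {M h : Space d → ℝ} (v : Space d), ContDiff ℝ ∞ M → ContDiff ℝ ∞ h →
      HasCompactSupport h → ∫ z, M z * fderiv ℝ h z v = -∫ z, fderiv ℝ M z v * h z := by
    intro M h v hM hh hch
    refine integral_mul_fderiv_eq_neg_fderiv_mul_of_integrable ?_ ?_ ?_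
      (fun z _ => hM.differentiable (by simp) z) (fun z _ => hh.differentiable (by simp) z)
    · exact (((hM.continuous_fderiv (by simp)).clm_apply
        continuous_const).mul hh.continuous).integrable_of_hasCompactSupport hch.mul_left
    · exact (hM.continuous.mul ((hh.continuous_fderiv (by simp)).clm_apply
        continuous_const)).integrable_of_hasCompactSupport (hch.fderiv_apply ℝ v).mul_left
    · exact (hM.continuous.mul hh.continuous).integrable_of_hasCompactSupport hch.mul_left
  have e1 : ∀ (h : Space d → ℝ), ContDiff ℝ ∞ h → ∀ z, lapS h z
      = ∑ i, fderiv ℝ (fun x => fderiv ℝ h x (EuclideanSpace.single i 1)) z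
          (EuclideanSpace.single i 1) := fun h hh z =>
    Finset.sum_congr rfl fun i _ =>
      (fderiv_fderiv_apply (differentiableAt_fderiv hh.contDiffAt) _ _).symm
  simp only [e1 N hN, e1 g hg, Finset.mul_sum, Finset.sum_mul]
  rw [integral_finsetSum _ fun i _ => ?_, integral_finsetSum _ fun i _ => ?_]
  · refine Finset.sum_congr rfl fun i _ => ?_
    rw [ibp _ hN (hg' _) (hc' _), ibp _ (hN' _) hg hc, neg_neg]
  · exact ((((hN' _).continuous_fderiv (by simp)).clm_apply continuous_const).mul
      hg.continuous).integrable_of_hasCompactSupport hc.mul_left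
  · exact (hN.continuous.mul (((hg' _).continuous_fderiv (by simp)).clm_apply
      continuous_const)).integrable_of_hasCompactSupport ((hc' _).fderiv_apply ℝ _).mul_left

end Laplacian

end

section

/-! ### The Newton kernel in three dimensions -/

section Newton

open MeasureTheory

theorem hasDerivAt_add_rpow {e q a : ℝ} (h : 0 < q + e) :
    HasDerivAt (fun q => (q + e) ^ a) (a * (q + e) ^ (a - 1)) q := by
  simpa using ((hasDerivAt_id q).add_const e).rpow_const (p := a) (Or.inl h.ne')

/-- The Laplacian of the regularized Newton kernel. -/
theorem lapS_newton {e : ℝ} {z : Space 4} (h : 0 < ‖z‖ ^ 2 + e) :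
    lapS (fun z : Space 4 => (‖z‖ ^ 2 + e) ^ (-(1 / 2) : ℝ)) z
      = -(3 * e * (‖z‖ ^ 2 + e) ^ (-(5 / 2) : ℝ)) := by
  have h1 : ∀ᶠ q in 𝓝 (‖z‖ ^ 2), HasDerivAt (fun q => (q + e) ^ (-(1 / 2) : ℝ))
      (-(1 / 2) * (q + e) ^ (-(3 / 2) : ℝ)) q := by
    have hc : ContinuousAt (fun q : ℝ => q + e) (‖z‖ ^ 2) := by fun_prop
    filter_upwards [hc.eventually (lt_mem_nhds h)] with q hq
    convert hasDerivAt_add_rpow hq (a := -(1 / 2)) using 3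
    norm_num
  have h2 : HasDerivAt (fun q => -(1 / 2) * (q + e) ^ (-(3 / 2) : ℝ))
      (-(1 / 2) * (-(3 / 2) * (‖z‖ ^ 2 + e) ^ (-(5 / 2) : ℝ))) (‖z‖ ^ 2) := by
    have := (hasDerivAt_add_rpow h (a := -(3 / 2))).const_mul (-(1 / 2) : ℝ)
    rwa [show (-(3 / 2) - 1 : ℝ) = -(5 / 2) by norm_num] at this
  rw [lapS_radial (by norm_num) h1 h2]
  have h3 : (‖z‖ ^ 2 + e) ^ (-(3 / 2) : ℝ) = (‖z‖ ^ 2 + e) ^ (-(5 / 2) : ℝ) * (‖z‖ ^ 2 + e) := by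
    rw [← Real.rpow_add_one h.ne']; norm_num
  rw [h3]
  push_cast
  ring

theorem norm_inv_eq_rpow {d : ℕ} (z : Space d) : ‖z‖⁻¹ = (‖z‖ ^ 2 + 0) ^ (-(1 / 2) : ℝ) := by
  rw [add_zero, Real.rpow_neg (by positivity), ← Real.sqrt_eq_rpow, Real.sqrt_sq (norm_nonneg z)]

theorem lapS_norm_inv {z : Space 4} (hz : z ≠ 0) : lapS (fun z : Space 4 => ‖z‖⁻¹) z = 0 := by
  have h : 0 < ‖z‖ ^ 2 + 0 := by have := norm_pos_iff.2 hz; positivity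
  simp only [norm_inv_eq_rpow]
  rw [lapS_newton h]
  ring

/-- `Space 4` is three-dimensional, so the logarithm is not harmonic; its Laplacian is what
compensates the mean of the source on the sphere. -/
theorem lapS_log_norm {z : Space 4} (hz : z ≠ 0) :
    lapS (fun z : Space 4 => Real.log ‖z‖) z = (‖z‖ ^ 2)⁻¹ := by
  have hz' := norm_pos_iff.2 hz
  have h : ‖z‖ ^ 2 ≠ 0 := by positivity
  have e : (fun z : Space 4 => Real.log ‖z‖) = fun z => (2 : ℝ)⁻¹ * Real.log (‖z‖ ^ 2) := by
    funext z; rw [Real.log_pow]; push_cast; ring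
  have h1 : ∀ᶠ q in 𝓝 (‖z‖ ^ 2), HasDerivAt (fun q => (2 : ℝ)⁻¹ * Real.log q) (2⁻¹ * q⁻¹) q := by
    filter_upwards [isOpen_ne.mem_nhds h] with q hq
    exact (Real.hasDerivAt_log hq).const_mul _
  have h2 := (hasDerivAt_inv h).const_mul (2⁻¹ : ℝ)
  rw [e, lapS_radial (by norm_num) h1 h2]
  field_simp
  push_cast
  ring

/-- In polar coordinates the density `r²` cancels the singularity. -/
theorem integrableOn_norm_inv (R : ℝ) :
    IntegrableOn (fun z : Space 4 => ‖z‖⁻¹) (Metric.closedBall 0 R) := by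
  have h : IntegrableOn (fun z : Space 4 => ‖z‖⁻¹) (Metric.ball 0 (R + 1)) := by
    rw [integrableOn_fun_norm_addHaar volume (f := fun r : ℝ => r⁻¹)]
    have : Module.finrank ℝ (Space 4) - 1 = 2 := by simp
    rw [this]
    have h1 : IntegrableOn (fun y : ℝ => y) (Ioo 0 (R + 1)) :=
      (continuous_id.integrableOn_Icc).mono_set Ioo_subset_Icc_self
    refine h1.congr_fun (fun y hy => ?_) measurableSet_Ioo
    have : y ≠ 0 := hy.1.ne'
    simp only [smul_eq_mul]
    field_simp
  exact h.mono_set (Metric.closedBall_subset_ball (by linarith))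

theorem integrable_norm_inv_mul {g : Space 4 → ℝ} (hg : Continuous g) (hc : HasCompactSupport g) :
    Integrable fun z => ‖z‖⁻¹ * g z := by
  obtain ⟨R, hR⟩ := hc.isCompact.isBounded.subset_closedBall (0 : Space 4)
  rw [← integrableOn_iff_integrable_of_support_subset (s := Metric.closedBall 0 R)]
  · exact (integrableOn_norm_inv R).mul_continuousOn hg.continuousOn (isCompact_closedBall 0 R)
  · exact (Function.support_mul_subset_right _ _).trans ((subset_tsupport g).trans hR)

/-- The total mass of the Laplacian of the Newton kernel, up to sign. -/
def newtonMass : ℝ := 3 * ∫ w : Space 4, (‖w‖ ^ 2 + 1) ^ (-(5 / 2) : ℝ)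

theorem integrable_japanese : Integrable fun w : Space 4 => (‖w‖ ^ 2 + 1) ^ (-(5 / 2) : ℝ) := by
  have := integrable_rpow_neg_one_add_norm_sq (E := Space 4) (μ := volume) (r := 5) (by simp; norm_num)
  refine this.congr (ae_of_all _ fun w => ?_)
  simp only [add_comm (1 : ℝ)]
  norm_num

theorem newtonMass_pos : 0 < newtonMass := by
  refine mul_pos (by norm_num) ?_
  rw [integral_pos_iff_support_of_nonneg (fun w => by positivity) integrable_japanese]
  have : Function.support (fun w : Space 4 => (‖w‖ ^ 2 + 1) ^ (-(5 / 2) : ℝ)) = univ :=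
    eq_univ_of_forall fun w => by
      have : 0 < (‖w‖ ^ 2 + 1) ^ (-(5 / 2) : ℝ) := by positivity
      exact this.ne'
  rw [this]
  exact isOpen_univ.measure_pos _ univ_nonempty

theorem continuous_lapS {d : ℕ} {g : Space d → ℝ} (hg : ContDiff ℝ ∞ g) : Continuous (lapS g) := by
  have h1 : ContDiff ℝ ∞ (fderiv ℝ (fderiv ℝ g)) :=
    (hg.fderiv_right (m := ∞) (by simp)).fderiv_right (by simp)
  have h2 := h1.continuous
  unfold lapS
  fun_prop

theorem hasCompactSupport_lapS {d : ℕ} {g : Space d → ℝ} (hc : HasCompactSupport g) :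
    HasCompactSupport (lapS g) := by
  refine (hc.fderiv ℝ).fderiv ℝ |>.mono fun y hy h => hy ?_
  simp [lapS, h]

/-- The Newton kernel is a fundamental solution of the Laplace equation. -/
theorem integral_norm_inv_mul_lapS {g : Space 4 → ℝ} (hg : ContDiff ℝ ∞ g)
    (hc : HasCompactSupport g) : ∫ z, ‖z‖⁻¹ * lapS g z = -newtonMass * g 0 := by
  have hpos : ∀ ε : ℝ, 0 < ε → ∀ z : Space 4, 0 < ‖z‖ ^ 2 + ε ^ 2 := fun ε h z => by positivity
  -- The kernel is regularised as `(|z|² + ε²)^{-1/2}`, for which Green's formula is available, and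
  -- dominated convergence lets `ε → 0` on both sides.
  have hN : ∀ ε : ℝ, 0 < ε →
      ContDiff ℝ ∞ fun z : Space 4 => (‖z‖ ^ 2 + ε ^ 2) ^ (-(1 / 2) : ℝ) := fun ε h =>
    ((contDiff_norm_sq ℝ).add contDiff_const).rpow_const_of_ne fun z => (hpos ε h z).ne'
  obtain ⟨C, hC⟩ := hg.continuous.bounded_above_of_compact_support hc
  have hL : Tendsto (fun ε : ℝ => ∫ z : Space 4, (‖z‖ ^ 2 + ε ^ 2) ^ (-(1 / 2) : ℝ) * lapS g z)
      (𝓝[>] 0) (𝓝 (∫ z, ‖z‖⁻¹ * lapS g z)) := by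
    refine tendsto_integral_filter_of_dominated_convergence (fun z => ‖‖z‖⁻¹ * lapS g z‖) ?_ ?_
      (integrable_norm_inv_mul (continuous_lapS hg) (hasCompactSupport_lapS hc)).norm ?_
    · filter_upwards [self_mem_nhdsWithin] with ε hε
      exact ((hN ε hε).continuous.mul (continuous_lapS hg)).aestronglyMeasurable
    · filter_upwards [self_mem_nhdsWithin] with ε hε
      filter_upwards [Measure.ae_ne volume (0 : Space 4)] with z hz
      rw [norm_mul, norm_mul]
      refine mul_le_mul_of_nonneg_right ?_ (norm_nonneg _)
      rw [Real.norm_of_nonneg (by positivity), Real.norm_of_nonneg (by positivity),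
        norm_inv_eq_rpow]
      have := norm_pos_iff.2 hz
      exact Real.rpow_le_rpow_of_nonpos (by positivity) (by gcongr; positivity) (by norm_num)
    · filter_upwards [Measure.ae_ne volume (0 : Space 4)] with z hz
      have h0 : ‖z‖ ^ 2 + (0 : ℝ) ^ 2 ≠ 0 := by have := norm_pos_iff.2 hz; positivity
      have hc : ContinuousAt (fun ε : ℝ => (‖z‖ ^ 2 + ε ^ 2) ^ (-(1 / 2) : ℝ) * lapS g z) 0 :=
        (ContinuousAt.rpow_const (f := fun ε : ℝ => ‖z‖ ^ 2 + ε ^ 2) (by fun_prop) (Or.inl h0)).mul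
          continuousAt_const
      have h2 := hc.tendsto.mono_left (nhdsWithin_le_nhds (s := Ioi 0))
      rwa [zero_pow two_ne_zero, ← norm_inv_eq_rpow] at h2
  have hR : Tendsto (fun ε : ℝ => -3 * ∫ w : Space 4, (‖w‖ ^ 2 + 1) ^ (-(5 / 2) : ℝ) * g (ε • w))
      (𝓝[>] 0) (𝓝 (-3 * ∫ w : Space 4, (‖w‖ ^ 2 + 1) ^ (-(5 / 2) : ℝ) * g 0)) := by
    refine (tendsto_integral_filter_of_dominated_convergence
      (fun w => (‖w‖ ^ 2 + 1) ^ (-(5 / 2) : ℝ) * C) ?_ ?_ (integrable_japanese.mul_const C)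
      ?_).const_mul _
    · refine Eventually.of_forall fun ε => integrable_japanese.aestronglyMeasurable.mul ?_
      exact (hg.continuous.comp (continuous_const_smul ε)).aestronglyMeasurable
    · refine Eventually.of_forall fun ε => ae_of_all _ fun w => ?_
      rw [norm_mul, Real.norm_of_nonneg (by positivity)]
      exact mul_le_mul_of_nonneg_left (hC _) (by positivity)
    · refine ae_of_all _ fun w => Tendsto.const_mul _ ?_
      have h1 : Continuous fun ε : ℝ => g (ε • w) := by
        have := hg.continuous
        fun_prop
      have h2 := (h1.tendsto 0).mono_left (nhdsWithin_le_nhds (s := Ioi 0))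
      rwa [zero_smul] at h2
  -- With `z = ε w` the powers combine as `ε² · ε³ · ε⁻⁵ = 1`, so a fixed mass concentrates at the
  -- origin.
  have heq : ∀ ε : ℝ, 0 < ε → ∫ z : Space 4, (‖z‖ ^ 2 + ε ^ 2) ^ (-(1 / 2) : ℝ) * lapS g z
      = -3 * ∫ w : Space 4, (‖w‖ ^ 2 + 1) ^ (-(5 / 2) : ℝ) * g (ε • w) := by
    intro ε hε
    rw [integral_mul_lapS (hN ε hε) hg hc]
    have h1 := Measure.integral_comp_smul_of_nonneg (volume : Measure (Space 4))
      (fun z : Space 4 => lapS (fun z : Space 4 => (‖z‖ ^ 2 + ε ^ 2) ^ (-(1 / 2) : ℝ)) z * g z)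
      ε (hR := hε.le)
    have h3 : Module.finrank ℝ (Space 4) = 3 := by simp
    rw [h3, smul_eq_mul] at h1
    have h4 : ∫ z, lapS (fun z : Space 4 => (‖z‖ ^ 2 + ε ^ 2) ^ (-(1 / 2) : ℝ)) z * g z
        = ε ^ 3 * ∫ z, lapS (fun z : Space 4 => (‖z‖ ^ 2 + ε ^ 2) ^ (-(1 / 2) : ℝ)) (ε • z)
          * g (ε • z) := by
      rw [h1, mul_inv_cancel_left₀ (by positivity)]
    rw [h4, ← integral_const_mul, ← integral_const_mul]
    refine integral_congr_ae (ae_of_all _ fun w => ?_)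
    simp only
    rw [lapS_newton (hpos ε hε _), norm_smul, Real.norm_of_nonneg hε.le,
      show (ε * ‖w‖) ^ 2 + ε ^ 2 = ε ^ 2 * (‖w‖ ^ 2 + 1) by ring,
      Real.mul_rpow (by positivity) (by positivity)]
    have h5 : (ε ^ 2) ^ (-(5 / 2) : ℝ) = (ε ^ 5)⁻¹ := by
      rw [← Real.rpow_natCast, ← Real.rpow_mul hε.le, ← Real.rpow_natCast, ← Real.rpow_neg hε.le]
      norm_num
    rw [h5]
    field_simp
  have hL' := hL.congr' (by filter_upwards [self_mem_nhdsWithin] with ε hε using heq ε hε)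
  rw [tendsto_nhds_unique hL' hR, integral_mul_const, newtonMass]
  ring

end Newton

end

section

/-! ### Newton potentials -/

section Potential

open MeasureTheory

/-- The Newton potential of a function supported in the ball of radius two, up to a constant; the
formula is the usual one within the ball of radius eight. -/
def newtonPot (F : Space 4 → ℝ) (x : Space 4) : ℝ :=
  ∫ z in Metric.closedBall 0 10, ‖z‖⁻¹ • F (x + z)

variable {F : Space 4 → ℝ}

theorem contDiff_newtonPot (hF : ContDiff ℝ ∞ F) : ContDiff ℝ ∞ (newtonPot F) := by
  rw [← contDiffOn_univ]
  exact contDiffOn_integral_param (isCompact_closedBall 0 10) (integrableOn_norm_inv 10) isOpen_univ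
    (f := fun z : Space 4 × Space 4 => F (z.1 + z.2)) isOpen_univ (subset_univ _)
    (hF.comp (contDiff_fst.add contDiff_snd)).contDiffOn

theorem two_lt_norm_add {x z : Space 4} (hx : ‖x‖ ≤ 8) (hz : z ∉ Metric.closedBall 0 10) :
    2 < ‖x + z‖ := by
  have h1 : 10 < ‖z‖ := by simpa using hz
  have h2 : ‖z‖ - ‖x‖ ≤ ‖x + z‖ := by
    rw [add_comm]
    simpa using norm_sub_norm_le z (-x)
  linarith

theorem hasCompactSupport_of_two_le (h2 : ∀ y, 2 ≤ ‖y‖ → F y = 0) : HasCompactSupport F :=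
  HasCompactSupport.intro (isCompact_closedBall 0 2) fun y hy => h2 y (by
    simp only [Metric.mem_closedBall, dist_zero_right, not_le] at hy; exact hy.le)

/-- For `‖x‖ ≤ 8` the ball of radius ten contains every `z` with `‖x + z‖ ≤ 2`, so truncating the
integral loses nothing and the fundamental solution applies to a translate of `F`. -/
theorem lapS_newtonPot (hF : ContDiff ℝ ∞ F) (h2 : ∀ y, 2 ≤ ‖y‖ → F y = 0) {x : Space 4}
    (hx : ‖x‖ ≤ 8) : lapS (newtonPot F) x = -newtonMass * F x := by
  have h1 := lapS_integral_param (isCompact_closedBall 0 10) (integrableOn_norm_inv 10) isOpen_univ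
    (f := fun z : Space 4 × Space 4 => F (z.1 + z.2)) isOpen_univ (subset_univ _)
    (hF.comp (contDiff_fst.add contDiff_snd)).contDiffOn (mem_univ x)
  simp only [lapS_comp_add] at h1
  have h3 := integral_norm_inv_mul_lapS (g := fun z => F (z + x))
    (hF.comp (contDiff_id.add contDiff_const))
    ((hasCompactSupport_of_two_le h2).comp_homeomorph (Homeomorph.addRight x))
  simp only [lapS_comp_add, zero_add] at h3
  rw [← h3]
  refine h1.trans ((setIntegral_eq_integral_of_forall_compl_eq_zero fun z hz => ?_).trans ?_)
  · have h4 : F =ᶠ[𝓝 (x + z)] fun _ => 0 := by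
      filter_upwards [(isOpen_lt continuous_const continuous_norm).mem_nhds
        (two_lt_norm_add hx hz)] with y hy using h2 y (le_of_lt hy)
    rw [lapS_congr h4]
    simp [lapS]
  · simp only [add_comm x]

theorem newtonPot_eq (h2 : ∀ y, 2 ≤ ‖y‖ → F y = 0) {x : Space 4} (hx : ‖x‖ ≤ 8) :
    newtonPot F x = ∫ y in Metric.closedBall 0 2, F y * ‖x - y‖⁻¹ := by
  rw [newtonPot, setIntegral_eq_integral_of_forall_compl_eq_zero fun z hz => by
      rw [h2 _ (two_lt_norm_add hx hz).le, smul_zero],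
    setIntegral_eq_integral_of_forall_compl_eq_zero fun y hy => by
      simp only [Metric.mem_closedBall, dist_zero_right, not_le] at hy
      rw [h2 y hy.le, zero_mul],
    ← integral_add_left_eq_self (fun y => F y * ‖x - y‖⁻¹) x]
  refine integral_congr_ae (ae_of_all _ fun z => ?_)
  simp [mul_comm]

end Potential

/-! ### Integration along bounded rays -/

section Rays

open MeasureTheory

variable {d : ℕ}

/-- The integral of `(Ψ(s x) - Ψ(0)) / s` over `0 ≤ s ≤ 4`. -/
def rayIntegral (Ψ : Space d → ℝ) (x : Space d) : ℝ :=
  ∫ s in Icc (0 : ℝ) 4, (Ψ (s • x) - Ψ 0) * s⁻¹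

variable {Ψ : Space d → ℝ}

/-- Differentiation produces a factor `s` that cancels `s⁻¹`; the mean value inequality shows that
the integrand itself is bounded near `s = 0`. -/
theorem hasFDerivAt_rayIntegral (hΨ : ContDiff ℝ ∞ Ψ) (x : Space d) :
    HasFDerivAt (rayIntegral Ψ) (∫ s in Icc (0 : ℝ) 4, fderiv ℝ Ψ (s • x)) x := by
  have hd : Differentiable ℝ Ψ := hΨ.differentiable (by simp)
  have hc : Continuous (fderiv ℝ Ψ) := hΨ.continuous_fderiv (by simp)
  obtain ⟨C, hC⟩ := (isCompact_closedBall (0 : Space d) (4 * (‖x‖ + 1))).exists_bound_of_continuousOn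
    hc.continuousOn
  have hmem : ∀ s ∈ Icc (0 : ℝ) 4, ∀ z ∈ Metric.ball x 1,
      s • z ∈ Metric.closedBall (0 : Space d) (4 * (‖x‖ + 1)) := by
    intro s hs z hz
    rw [mem_closedBall_zero_iff, norm_smul, Real.norm_of_nonneg hs.1]
    have : ‖z‖ ≤ ‖x‖ + 1 := by
      have h1 := norm_sub_norm_le z x
      rw [Metric.mem_ball, dist_eq_norm] at hz
      linarith
    exact mul_le_mul hs.2 this (norm_nonneg _) (by norm_num)
  have hm : ∀ z : Space d, AEStronglyMeasurable (fun s : ℝ => (Ψ (s • z) - Ψ 0) * s⁻¹)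
      (volume.restrict (Icc (0 : ℝ) 4)) := fun z => by
    have h1 : Continuous fun s : ℝ => Ψ (s • z) - Ψ 0 := by
      have := hΨ.continuous
      fun_prop
    exact (h1.measurable.mul measurable_inv).aestronglyMeasurable
  refine hasFDerivAt_integral_of_dominated_of_fderiv_le (s := Metric.ball x 1) (bound := fun _ => C)
    (F := fun x s => (Ψ (s • x) - Ψ 0) * s⁻¹) (F' := fun x s => fderiv ℝ Ψ (s • x))
    (Metric.ball_mem_nhds x one_pos) (Eventually.of_forall hm) ?_ ?_ ?_ (by simp) ?_
  · refine Integrable.mono' (integrable_const (C * ‖x‖)) (hm x) ?_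
    filter_upwards [ae_restrict_mem measurableSet_Icc] with s hs
    have h1 := (convex_closedBall (0 : Space d) (4 * (‖x‖ + 1))).norm_image_sub_le_of_norm_fderiv_le
      (fun z _ => hd z) hC (Metric.mem_closedBall_self (by positivity))
      (hmem s hs x (Metric.mem_ball_self one_pos))
    rw [sub_zero, norm_smul] at h1
    rw [norm_mul, norm_inv]
    rcases eq_or_ne s 0 with rfl | h0
    · simpa using mul_nonneg ((norm_nonneg _).trans (hC 0 (Metric.mem_closedBall_self (by positivity))))
        (norm_nonneg x)
    · have : 0 < ‖s‖ := norm_pos_iff.2 h0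
      rw [mul_inv_le_iff₀ this]
      linarith
  · have h1 : Continuous fun s : ℝ => fderiv ℝ Ψ (s • x) := by fun_prop
    exact h1.aestronglyMeasurable
  · filter_upwards [ae_restrict_mem measurableSet_Icc] with s hs z hz using hC _ (hmem s hs z hz)
  · filter_upwards [ae_restrict_of_ae (Measure.ae_ne volume (0 : ℝ))] with s hs z _
    have h1 := (((hd (s • z)).hasFDerivAt.comp z
      ((hasFDerivAt_id z).const_smul s)).sub_const (Ψ 0)).mul_const s⁻¹
    refine h1.congr_fderiv ?_
    ext v
    simp [hs]

theorem contDiffOn_slope (hΨ : ContDiff ℝ ∞ Ψ) : ContDiffOn ℝ ∞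
    (fun z : Space d × ℝ => fderiv ℝ Ψ (z.2 • z.1)) univ :=
  ((hΨ.fderiv_right (m := ∞) (by simp)).comp (contDiff_snd.smul contDiff_fst)).contDiffOn

theorem contDiff_rayIntegral (hΨ : ContDiff ℝ ∞ Ψ) : ContDiff ℝ ∞ (rayIntegral Ψ) := by
  rw [contDiff_infty_iff_fderiv]
  refine ⟨fun x => (hasFDerivAt_rayIntegral hΨ x).differentiableAt, ?_⟩
  have h1 := contDiffOn_integral_param (μ := volume) (w := fun _ => (1 : ℝ))
    (isCompact_Icc (a := (0 : ℝ)) (b := 4))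
    (by simp) isOpen_univ isOpen_univ (subset_univ _) (contDiffOn_slope hΨ)
  rw [← contDiffOn_univ]
  refine h1.congr fun x _ => ?_
  simp only [one_smul]
  exact (hasFDerivAt_rayIntegral hΨ x).fderiv

/-- The integrand of the radial derivative is `d/ds Ψ(s x)`. -/
theorem fderiv_rayIntegral_self (hΨ : ContDiff ℝ ∞ Ψ) (x : Space d) :
    fderiv ℝ (rayIntegral Ψ) x x = Ψ ((4 : ℝ) • x) - Ψ 0 := by
  have hc : Continuous fun s : ℝ => fderiv ℝ Ψ (s • x) := by
    have := hΨ.continuous_fderiv (by simp)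
    fun_prop
  rw [(hasFDerivAt_rayIntegral hΨ x).fderiv, ContinuousLinearMap.integral_apply
    hc.integrableOn_Icc, integral_Icc_eq_integral_Ioc,
    ← intervalIntegral.integral_of_le (by norm_num : (0 : ℝ) ≤ 4)]
  have h1 : ∀ s : ℝ, HasDerivAt (fun s : ℝ => Ψ (s • x)) (fderiv ℝ Ψ (s • x) x) s := fun s => by
    have := (hΨ.differentiable (by simp) (s • x)).hasFDerivAt.comp_hasDerivAt s
      ((hasDerivAt_id s).smul_const x)
    exact HasDerivAt.congr_deriv (f := fun s : ℝ => Ψ (s • x)) this (by simp)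
  rw [intervalIntegral.integral_eq_sub_of_hasDerivAt (fun s _ => h1 s)
    ((hc.clm_apply continuous_const).intervalIntegrable _ _), zero_smul]

theorem hasFDerivAt_fstDeriv {E X G : Type} [NormedAddCommGroup E] [NormedSpace ℝ E]
    [NormedAddCommGroup X] [NormedSpace ℝ X] [NormedAddCommGroup G] [NormedSpace ℝ G]
    {g : E × X → G} {W : Set (E × X)} (hW : IsOpen W) (hg : ContDiffOn ℝ ∞ g W) {z : E × X}
    (hz : z ∈ W) : HasFDerivAt (fun x => g (x, z.2)) (fstDeriv g z) z.1 :=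
  (ContDiffOn.differentiableAt_top hW hg hz).hasFDerivAt.comp z.1 (hasFDerivAt_prodMk_left z.1 z.2)

theorem hasFDerivAt_integral_smul {G : Type} [NormedAddCommGroup G] [NormedSpace ℝ G]
    [CompleteSpace G] {Φ : Space d → G} (hΦ : ContDiff ℝ ∞ Φ) (x : Space d) :
    ∃ D : Space d →L[ℝ] G, HasFDerivAt (fun x => ∫ s in Icc (0 : ℝ) 4, Φ (s • x)) D x ∧
      ∀ v, D v = ∫ s in Icc (0 : ℝ) 4, s • fderiv ℝ Φ (s • x) v := by
  have hs : ContDiffOn ℝ ∞ (fun z : Space d × ℝ => Φ (z.2 • z.1)) univ :=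
    (hΦ.comp (contDiff_snd.smul contDiff_fst)).contDiffOn
  have h1 := hasFDerivAt_integral_param (μ := volume) (w := fun _ => (1 : ℝ))
    (isCompact_Icc (a := (0 : ℝ)) (b := 4))
    (by simp) isOpen_univ isOpen_univ (subset_univ _) hs (mem_univ x)
  have h2 : ∀ s : ℝ, fstDeriv (fun z : Space d × ℝ => Φ (z.2 • z.1)) (x, s)
      = s • fderiv ℝ Φ (s • x) := fun s => by
    have e2 := ((hΦ.differentiable (by simp)) (s • x)).hasFDerivAt.comp x
      ((hasFDerivAt_id x).const_smul s)
    refine ((hasFDerivAt_fstDeriv isOpen_univ hs (mem_univ (x, s))).unique e2).trans ?_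
    ext v
    simp
  simp only [h2, one_smul] at h1
  refine ⟨_, h1, fun v => ?_⟩
  have hc : Continuous fun s : ℝ => s • fderiv ℝ Φ (s • x) := by
    have := hΦ.continuous_fderiv (by simp)
    fun_prop
  rw [ContinuousLinearMap.integral_apply hc.integrableOn_Icc]
  rfl

theorem lapS_rayIntegral (hΨ : ContDiff ℝ ∞ Ψ) (x : Space d) :
    lapS (rayIntegral Ψ) x = ∫ s in Icc (0 : ℝ) 4, s * lapS Ψ (s • x) := by
  have h0 : fderiv ℝ (rayIntegral Ψ) = fun x => ∫ s in Icc (0 : ℝ) 4, fderiv ℝ Ψ (s • x) :=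
    funext fun x => (hasFDerivAt_rayIntegral hΨ x).fderiv
  have hΨ' : ContDiff ℝ ∞ (fderiv ℝ Ψ) := hΨ.fderiv_right (by simp)
  obtain ⟨D, hD, hDv⟩ := hasFDerivAt_integral_smul hΨ' x
  have hc : ∀ v, Continuous fun s : ℝ => s • fderiv ℝ (fderiv ℝ Ψ) (s • x) v := fun v => by
    have := hΨ'.continuous_fderiv (by simp)
    fun_prop
  unfold lapS
  rw [h0, hD.fderiv]
  simp only [hDv, ContinuousLinearMap.integral_apply (hc _).integrableOn_Icc]
  rw [← integral_finsetSum _ fun i _ => ((hc _).clm_apply continuous_const).integrableOn_Icc]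
  simp only [smul_apply, smul_eq_mul, Finset.mul_sum]

end Rays

/-! ### Integration along unbounded rays -/

section Exterior

open MeasureTheory

variable {F : Space 4 → ℝ}

/-- The contribution of large distances along the rays, after inversion. -/
def extIntegral (F : Space 4 → ℝ) (x : Space 4) : ℝ :=
  ∫ z in Metric.closedBall (0 : Space 4) 2 ×ˢ Icc (0 : ℝ) 4⁻¹, F z.1 • ‖x - z.2 • z.1‖⁻¹

/-- `‖τ y‖ ≤ 1/2 < ‖x‖`: after the inversion `τ = 1/s` the kernel is never singular. -/
theorem sub_smul_ne_zero {x y : Space 4} {τ : ℝ} (hx : 1 / 2 < ‖x‖)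
    (hy : y ∈ Metric.closedBall (0 : Space 4) 2) (hτ : τ ∈ Icc (0 : ℝ) 4⁻¹) : x - τ • y ≠ 0 := by
  intro h
  rw [sub_eq_zero] at h
  rw [mem_closedBall_zero_iff] at hy
  rw [h, norm_smul, Real.norm_of_nonneg hτ.1] at hx
  nlinarith [hτ.1, hτ.2, norm_nonneg y]

theorem isOpen_half_lt : IsOpen {x : Space 4 | 1 / 2 < ‖x‖} := isOpen_lt (by fun_prop) (by fun_prop)

theorem isOpen_sub_smul : IsOpen {q : Space 4 × (Space 4 × ℝ) | q.1 - q.2.2 • q.2.1 ≠ 0} :=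
  isOpen_ne_fun (by fun_prop) (by fun_prop)

theorem contDiffOn_sub_smul : ContDiffOn ℝ ∞
    (fun q : Space 4 × (Space 4 × ℝ) => ‖q.1 - q.2.2 • q.2.1‖⁻¹) {q | q.1 - q.2.2 • q.2.1 ≠ 0} :=
  (ContDiffOn.norm ℝ (by fun_prop) fun q hq => hq).inv fun q hq => norm_ne_zero_iff.2 hq

theorem isCompact_ext : IsCompact (Metric.closedBall (0 : Space 4) 2 ×ˢ Icc (0 : ℝ) 4⁻¹) :=
  (isCompact_closedBall 0 2).prod isCompact_Icc

theorem integrableOn_ext (hF : Continuous F) : IntegrableOn (fun z : Space 4 × ℝ => F z.1)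
    (Metric.closedBall (0 : Space 4) 2 ×ˢ Icc (0 : ℝ) 4⁻¹) :=
  ContinuousOn.integrableOn_compact isCompact_ext (by fun_prop)

theorem ext_subset : {x : Space 4 | 1 / 2 < ‖x‖} ×ˢ
    (Metric.closedBall (0 : Space 4) 2 ×ˢ Icc (0 : ℝ) 4⁻¹) ⊆ {q | q.1 - q.2.2 • q.2.1 ≠ 0} :=
  fun _ hq => sub_smul_ne_zero hq.1 hq.2.1 hq.2.2

theorem contDiffOn_extIntegral (hF : Continuous F) :
    ContDiffOn ℝ ∞ (extIntegral F) {x | 1 / 2 < ‖x‖} :=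
  contDiffOn_integral_param isCompact_ext (integrableOn_ext hF) isOpen_half_lt isOpen_sub_smul
    ext_subset contDiffOn_sub_smul

/-- The kernel is harmonic in `x` away from its pole, which lies outside the range of integration.
-/
theorem lapS_extIntegral (hF : Continuous F) {x : Space 4} (hx : 1 / 2 < ‖x‖) :
    lapS (extIntegral F) x = 0 := by
  refine (lapS_integral_param isCompact_ext (integrableOn_ext hF) isOpen_half_lt isOpen_sub_smul
    ext_subset contDiffOn_sub_smul hx).trans ?_
  refine setIntegral_eq_zero_of_forall_eq_zero fun z hz => ?_
  simp only [sub_eq_add_neg]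
  rw [lapS_comp_add (fun x => ‖x‖⁻¹), lapS_norm_inv, mul_zero]
  rw [← sub_eq_add_neg]
  exact sub_smul_ne_zero hx hz.1 hz.2

theorem differentiableAt_norm_inv {z : Space 4} (hz : z ≠ 0) :
    DifferentiableAt ℝ (fun z : Space 4 => ‖z‖⁻¹) z :=
  ((contDiffAt_norm ℝ hz (n := 1)).inv (norm_ne_zero_iff.2 hz)).differentiableAt (by simp)

/-- Euler's identity for a function homogeneous of degree `-1`. -/
theorem fderiv_norm_inv_self {z : Space 4} (hz : z ≠ 0) :
    fderiv ℝ (fun z : Space 4 => ‖z‖⁻¹) z z = -‖z‖⁻¹ := by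
  have h1 : HasDerivAt (fun s : ℝ => ‖s • z‖⁻¹) (fderiv ℝ (fun z : Space 4 => ‖z‖⁻¹) z z) 1 := by
    have hz1 : DifferentiableAt ℝ (fun z : Space 4 => ‖z‖⁻¹) ((1 : ℝ) • z) := by
      rw [one_smul]; exact differentiableAt_norm_inv hz
    have := hz1.hasFDerivAt.comp_hasDerivAt 1 ((hasDerivAt_id (1 : ℝ)).smul_const z)
    exact HasDerivAt.congr_deriv (f := fun s : ℝ => ‖s • z‖⁻¹) this (by simp)
  have h2 : HasDerivAt (fun s : ℝ => s⁻¹ * ‖z‖⁻¹) (-((1 : ℝ) ^ 2)⁻¹ * ‖z‖⁻¹) 1 :=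
    (hasDerivAt_inv one_ne_zero).mul_const _
  have h3 : (fun s : ℝ => ‖s • z‖⁻¹) =ᶠ[𝓝 1] fun s => s⁻¹ * ‖z‖⁻¹ := by
    filter_upwards [lt_mem_nhds (zero_lt_one' ℝ)] with s hs
    rw [norm_smul, Real.norm_of_nonneg hs.le, mul_inv]
  rw [(h1.congr_of_eventuallyEq h3.symm).unique h2]
  simp

/-- By Euler's identity the radial derivative of the kernel is the `τ`-derivative of `-τ ‖x - τ
y‖⁻¹`. Its value at `τ = 1/4` is `-‖4x - y‖⁻¹`, the Newton kernel at `4x`. -/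
theorem fderiv_extIntegral_self (hF : Continuous F) (h2 : ∀ y, 2 ≤ ‖y‖ → F y = 0) {x : Space 4}
    (hx : 1 / 2 < ‖x‖) (hx2 : ‖x‖ < 2) :
    fderiv ℝ (extIntegral F) x x = -newtonPot F ((4 : ℝ) • x) := by
  have h1 := hasFDerivAt_integral_param isCompact_ext (integrableOn_ext hF) isOpen_half_lt
    isOpen_sub_smul ext_subset contDiffOn_sub_smul hx
  have hint := (integrableOn_ext hF).smul_continuousOn (continuousOn_slice
    (contDiffOn_sub_smul.fstDeriv isOpen_sub_smul).continuousOn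
    fun z hz => sub_smul_ne_zero hx hz.1 hz.2) isCompact_ext
  rw [HasFDerivAt.fderiv (f := extIntegral F) h1, ContinuousLinearMap.integral_apply hint]
  have hint' := hint.apply_continuousLinearMap x
  rw [Measure.volume_eq_prod] at hint' ⊢
  rw [setIntegral_prod _ hint', newtonPot_eq h2 (by
    rw [norm_smul, Real.norm_of_nonneg (by norm_num)]; linarith), ← integral_neg]
  refine setIntegral_congr_fun Metric.isClosed_closedBall.measurableSet fun y hy => ?_
  simp only [smul_apply, smul_eq_mul]
  rw [integral_const_mul, ← mul_neg]
  congr 1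
  have hD : ∀ τ ∈ Icc (0 : ℝ) 4⁻¹, fstDeriv (fun q : Space 4 × (Space 4 × ℝ) =>
      ‖q.1 - q.2.2 • q.2.1‖⁻¹) (x, (y, τ)) = fderiv ℝ (fun z : Space 4 => ‖z‖⁻¹) (x - τ • y) := by
    intro τ hτ
    have hz := sub_smul_ne_zero hx hy hτ
    have hz' : (x, (y, τ)) ∈ {q : Space 4 × (Space 4 × ℝ) | q.1 - q.2.2 • q.2.1 ≠ 0} := hz
    have e1 := hasFDerivAt_fstDeriv isOpen_sub_smul contDiffOn_sub_smul hz'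
    have e2 := (differentiableAt_norm_inv hz).hasFDerivAt.comp x
      ((hasFDerivAt_id x).sub_const (τ • y))
    exact (e1.unique e2).trans (by ext v; simp)
  have hder : ∀ τ ∈ Icc (0 : ℝ) 4⁻¹, HasDerivAt (fun τ : ℝ => -(τ * ‖x - τ • y‖⁻¹))
      (fstDeriv (fun q : Space 4 × (Space 4 × ℝ) => ‖q.1 - q.2.2 • q.2.1‖⁻¹) (x, (y, τ)) x) τ := by
    intro τ hτ
    have hz := sub_smul_ne_zero hx hy hτ
    have e1 := (differentiableAt_norm_inv hz).hasFDerivAt.comp_hasDerivAt τ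
      (((hasDerivAt_id τ).smul_const y).const_sub x)
    have e2 := ((hasDerivAt_id τ).mul e1).neg
    refine HasDerivAt.congr_deriv (f := fun τ : ℝ => -(τ * ‖x - τ • y‖⁻¹)) e2 ?_
    rw [hD τ hτ]
    have e3 := fderiv_norm_inv_self hz
    rw [map_sub, map_smul] at e3
    simp only [id, one_smul, map_neg, Function.comp_apply, smul_eq_mul] at e3 ⊢
    linarith
  have hcont : ContinuousOn (fun τ : ℝ => fstDeriv (fun q : Space 4 × (Space 4 × ℝ) =>
      ‖q.1 - q.2.2 • q.2.1‖⁻¹) (x, (y, τ)) x) (Icc 0 4⁻¹) := by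
    have h3 : ContinuousOn (fun τ : ℝ => fstDeriv (fun q : Space 4 × (Space 4 × ℝ) =>
      ‖q.1 - q.2.2 • q.2.1‖⁻¹) (x, (y, τ))) (Icc 0 4⁻¹) :=
      (contDiffOn_sub_smul.fstDeriv isOpen_sub_smul).continuousOn.comp (by fun_prop)
        fun τ hτ => sub_smul_ne_zero hx hy hτ
    exact h3.clm_apply continuousOn_const
  have h4 : (0 : ℝ) ≤ 4⁻¹ := by norm_num
  rw [integral_Icc_eq_integral_Ioc, ← intervalIntegral.integral_of_le h4,
    intervalIntegral.integral_eq_sub_of_hasDerivAt (fun τ hτ => hder τ (by rwa [uIcc_of_le h4] at hτ))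
      (by rw [← uIcc_of_le h4] at hcont; exact hcont.intervalIntegrable)]
  have h5 : ‖(4 : ℝ) • x - y‖ = 4 * ‖x - (4 : ℝ)⁻¹ • y‖ := by
    rw [show (4 : ℝ) • x - y = (4 : ℝ) • (x - (4 : ℝ)⁻¹ • y) by rw [smul_sub, smul_inv_smul₀ (by norm_num)],
      norm_smul, Real.norm_of_nonneg (by norm_num)]
  rw [h5, mul_inv]
  simp

end Exterior

end

section

/-! ### The Poisson equation on the two-sphere -/

section Poisson

open MeasureTheory

theorem fderiv_log_norm_self {x : Space 4} (hx : x ≠ 0) :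
    fderiv ℝ (fun x : Space 4 => Real.log ‖x‖) x x = 1 := by
  have h0 := norm_ne_zero_iff.2 hx
  have hd : DifferentiableAt ℝ (fun x : Space 4 => Real.log ‖x‖) ((1 : ℝ) • x) := by
    rw [one_smul]
    exact ((contDiffAt_norm ℝ hx (n := 1)).differentiableAt (by simp)).log h0
  have h1 := hd.hasFDerivAt.comp_hasDerivAt 1 ((hasDerivAt_id (1 : ℝ)).smul_const x)
  have h2 : HasDerivAt (fun s : ℝ => Real.log s + Real.log ‖x‖) 1 1 := by
    simpa using (Real.hasDerivAt_log one_ne_zero).add_const (Real.log ‖x‖)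
  have h3 : ((fun x : Space 4 => Real.log ‖x‖) ∘ fun s : ℝ => id s • x)
      =ᶠ[𝓝 1] fun s => Real.log s + Real.log ‖x‖ := by
    filter_upwards [lt_mem_nhds (zero_lt_one' ℝ)] with s hs
    simp only [Function.comp_apply, id, norm_smul, Real.norm_of_nonneg hs.le]
    exact Real.log_mul hs.ne' h0
  have h4 := h1.unique (h2.congr_of_eventuallyEq h3)
  simpa using h4

/-- The annulus `1/2 < |x| < 2`. -/
def annulus : Set (Space 4) := {x | 1 / 2 < ‖x‖ ∧ ‖x‖ < 2}

theorem isOpen_annulus : IsOpen annulus :=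
  isOpen_half_lt.inter (isOpen_lt continuous_norm continuous_const)

theorem ne_zero_of_mem_annulus {x : Space 4} (hx : x ∈ annulus) : x ≠ 0 :=
  norm_pos_iff.1 (by linarith [hx.1])

theorem mem_annulus_of_norm_eq_one {x : Space 4} (hx : ‖x‖ = 1) : x ∈ annulus := by
  constructor <;> rw [hx] <;> norm_num

/-- A function on the annulus whose radial derivative vanishes only depends on the direction. -/
theorem eq_dir_of_fderiv_self_eq_zero {h : Space 4 → ℝ} (hh : ContDiffOn ℝ ∞ h annulus)
    (h0 : ∀ x ∈ annulus, fderiv ℝ h x x = 0) {x : Space 4} (hx : x ∈ annulus) : h (dir x) = h x := by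
  have hx0 := ne_zero_of_mem_annulus hx
  have hmem : ∀ s ∈ Ioo (1 / 2 : ℝ) 2, s • dir x ∈ annulus := fun s hs => by
    have h1 : ‖s • dir x‖ = s := by
      rw [norm_smul, norm_dir hx0, mul_one, Real.norm_of_nonneg (by linarith [hs.1])]
    rw [annulus, mem_ofPred_eq, h1]
    exact hs
  have hder : ∀ s ∈ Ioo (1 / 2 : ℝ) 2, HasDerivAt (fun s : ℝ => h (s • dir x)) 0 s := fun s hs => by
    have h1 := (ContDiffOn.differentiableAt_top isOpen_annulus hh
      (hmem s hs)).hasFDerivAt.comp_hasDerivAt s ((hasDerivAt_id s).smul_const (dir x))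
    refine HasDerivAt.congr_deriv (f := fun s : ℝ => h (s • dir x)) h1 ?_
    have h2 := h0 _ (hmem s hs)
    rw [map_smul, smul_eq_mul] at h2
    have h3 : s ≠ 0 := by linarith [hs.1]
    simpa using (mul_eq_zero.1 h2).resolve_left h3
  have h1 := isOpen_Ioo.is_const_of_deriv_eq_zero (convex_Ioo (1 / 2 : ℝ) 2).isPreconnected
    (fun s hs => (hder s hs).differentiableAt.differentiableWithinAt)
    (fun s hs => (hder s hs).deriv) (x := 1) (y := ‖x‖) (by norm_num) hx
  simpa [norm_smul_dir] using h1

theorem exists_radial_bump : ∃ β : ℝ → ℝ, ContDiff ℝ ∞ β ∧ (∀ r, 0 ≤ β r) ∧ (∀ r, r ≤ 1 → β r = 0) ∧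
    (∀ r, 2 ≤ r → β r = 0) ∧ 0 < ∫ s in Icc (0 : ℝ) 4, β s := by
  let b : ContDiffBump (3 / 2 : ℝ) := ⟨1 / 4, 1 / 2, by norm_num, by norm_num⟩
  refine ⟨b, b.contDiff, fun r => b.nonneg, fun r hr => ?_, fun r hr => ?_, ?_⟩
  · refine b.zero_of_le_dist ?_
    rw [Real.dist_eq, abs_of_nonpos (by linarith)]
    show (1 / 2 : ℝ) ≤ _
    linarith
  · refine b.zero_of_le_dist ?_
    rw [Real.dist_eq, abs_of_nonneg (by linarith)]
    show (1 / 2 : ℝ) ≤ _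
    linarith
  · have hc : Continuous b := b.continuous
    rw [integral_Icc_eq_integral_Ioc, ← intervalIntegral.integral_of_le (by norm_num)]
    refine intervalIntegral.integral_pos (by norm_num) hc.continuousOn (fun _ _ => b.nonneg)
      ⟨3 / 2, ⟨by norm_num, by norm_num⟩, ?_⟩
    rw [b.one_of_mem_closedBall (Metric.mem_closedBall_self (by norm_num))]
    norm_num

theorem Hom.eq_of_uD_eq_zero {d : ℕ} {a : ℝ} {f : ℝ × Space d → ℝ} (hf : Hom a f)
    (hu : ∀ p : ℝ × Space d, p.2 ≠ 0 → Lorenz.uD f p = 0) (u v : ℝ) {y : Space d} (hy : y ≠ 0) :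
    f (u, y) = f (v, y) :=
  is_const_of_deriv_eq_zero (f := fun u => f (u, y))
    (fun w => (hf.hasDerivAt_u w hy).differentiableAt)
    (fun w => (hf.hasDerivAt_u w hy).deriv.trans (hu (w, y) hy)) u v

/-- The Poisson equation on the two-sphere, in homogeneous form. -/
theorem exists_poisson {f : ℝ × Space 4 → ℝ} (hf : Hom 2 f)
    (hu : ∀ p : ℝ × Space 4, p.2 ≠ 0 → uD f p = 0) :
    ∃ (c : ℝ) (lam : ℝ × Space 4 → ℝ), Hom 0 lam ∧ (∀ p : ℝ × Space 4, p.2 ≠ 0 → uD lam p = 0) ∧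
      ∀ p : ℝ × Space 4, p.2 ≠ 0 → lapY lam p = f p - c * (‖p.2‖ ^ 2)⁻¹ := by
  obtain ⟨β, hβ, hβ0, hβ1, hβ2, hm⟩ := exists_radial_bump
  set m := ∫ s in Icc (0 : ℝ) 4, β s with hm_def
  -- The factor `‖y‖` is chosen so that `s F(s x) = f(0, x) β(s)` for unit `x`: the powers are `s ·
  -- s⁻² · s`. The cutoff `β` removes the origin and bounds the support.
  let F : Space 4 → ℝ := fun y => f (0, y) * (‖y‖ * β ‖y‖)
  have hF1 : ∀ y, ‖y‖ ≤ 1 → F y = 0 := fun y hy => by simp [F, hβ1 _ hy]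
  have hF2 : ∀ y, 2 ≤ ‖y‖ → F y = 0 := fun y hy => by simp [F, hβ2 _ hy]
  have hF : ContDiff ℝ ∞ F := by
    rw [contDiff_iff_contDiffAt]
    intro y
    rcases eq_or_ne y 0 with rfl | hy
    · refine (contDiffAt_const (c := (0 : ℝ))).congr_of_eventuallyEq ?_
      filter_upwards [Metric.ball_mem_nhds (0 : Space 4) one_pos] with z hz
      exact hF1 z (by rw [mem_ball_zero_iff] at hz; exact hz.le)
    · have h1 : ContDiffAt ℝ ∞ (fun y : Space 4 => f (0, y)) y :=
        (hf.contDiffAt (p := (0, y)) hy).comp y (contDiffAt_const.prodMk contDiffAt_id)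
      have h2 := contDiffAt_norm ℝ hy (n := ∞)
      exact h1.mul (h2.mul (hβ.contDiffAt.comp y h2))
  set Ψ := newtonPot F with hΨ_def
  have hΨ : ContDiff ℝ ∞ Ψ := contDiff_newtonPot hF
  have hlog : ContDiffOn ℝ ∞ (fun x : Space 4 => Ψ 0 * Real.log ‖x‖) annulus := fun x hx =>
    (contDiffAt_const.mul ((contDiffAt_norm ℝ (ne_zero_of_mem_annulus hx)).log
      (norm_ne_zero_iff.2 (ne_zero_of_mem_annulus hx)))).contDiffWithinAt
  have hray := (contDiff_rayIntegral hΨ).contDiffOn (s := annulus)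
  have hext : ContDiffOn ℝ ∞ (extIntegral F) annulus :=
    (contDiffOn_extIntegral hF.continuous).mono fun x hx => hx.1
  -- A regularisation of the scale invariant integral `∫ Ψ(s x) ds/s` over `s > 0`. The part `s > 4`
  -- is rewritten by `τ = 1/s`, and the logarithm makes up for subtracting `Ψ 0` near `s = 0`. The
  -- three radial derivatives `Ψ(4x) - Ψ(0)`, `-Ψ(4x)` and `Ψ(0)` add to zero.
  set h : Space 4 → ℝ := fun x => rayIntegral Ψ x + extIntegral F x + Ψ 0 * Real.log ‖x‖ with hh_def
  have hh : ContDiffOn ℝ ∞ h annulus := (hray.add hext).add hlog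
  have hEuler : ∀ x ∈ annulus, fderiv ℝ h x x = 0 := by
    intro x hx
    have hx0 := ne_zero_of_mem_annulus hx
    have d1 := ContDiffOn.differentiableAt_top isOpen_annulus hray hx
    have d2 := ContDiffOn.differentiableAt_top isOpen_annulus hext hx
    have d3 := ((contDiffAt_norm ℝ hx0 (n := 1)).differentiableAt (by simp)).log
      (norm_ne_zero_iff.2 hx0)
    have e := ((d1.hasFDerivAt.add d2.hasFDerivAt).add (d3.hasFDerivAt.const_mul (Ψ 0)))
    rw [HasFDerivAt.fderiv (f := h) e]
    simp only [add_apply, smul_apply, smul_eq_mul]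
    rw [fderiv_rayIntegral_self hΨ, fderiv_extIntegral_self hF.continuous hF2 hx.1 hx.2,
      fderiv_log_norm_self hx0]
    ring
  -- On the ray `ΔΨ` returns `-newtonMass * F`, whose integral is a multiple of `f`; the exterior
  -- part is harmonic, and the logarithm leaves the constant `Ψ 0`.
  have hlap : ∀ x : Space 4, ‖x‖ = 1 → lapS h x = -(newtonMass * m) * f (0, x) + Ψ 0 := by
    intro x hx
    have hxa := mem_annulus_of_norm_eq_one hx
    have hx0 := ne_zero_of_mem_annulus hxa
    have hnhds := isOpen_annulus.mem_nhds hxa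
    have c3 : ContDiffAt ℝ ∞ (fun x : Space 4 => Real.log ‖x‖) x :=
      (contDiffAt_norm ℝ hx0).log (norm_ne_zero_iff.2 hx0)
    rw [hh_def, lapS_add (h := fun x => rayIntegral Ψ x + extIntegral F x)
        ((hray.contDiffAt hnhds).add (hext.contDiffAt hnhds)) (hlog.contDiffAt hnhds),
      lapS_add (hray.contDiffAt hnhds) (hext.contDiffAt hnhds), lapS_const_mul c3,
      lapS_rayIntegral hΨ, lapS_extIntegral hF.continuous hxa.1, lapS_log_norm hx0, hx]
    have e1 : ∫ s in Icc (0 : ℝ) 4, s * lapS Ψ (s • x)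
        = ∫ s in Icc (0 : ℝ) 4, -(newtonMass * f (0, x)) * β s := by
      refine setIntegral_congr_fun measurableSet_Icc fun s hs => ?_
      have hn : ‖s • x‖ = s := by rw [norm_smul, hx, mul_one, Real.norm_of_nonneg hs.1]
      rw [hΨ_def, lapS_newtonPot hF hF2 (by rw [hn]; linarith [hs.2])]
      show s * (-newtonMass * (f (0, s • x) * (‖s • x‖ * β ‖s • x‖))) = _
      rw [hn]
      rcases hs.1.eq_or_lt with rfl | hs0
      · simp [hβ1 0 zero_le_one]
      · rw [hf.hom 0 x s hs0 hx0, Real.rpow_neg hs0.le, Real.rpow_two, smul_eq_mul]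
        field_simp
    rw [e1, integral_const_mul, ← hm_def]
    ring
  have hκm : newtonMass * m ≠ 0 := (mul_pos newtonMass_pos hm).ne'
  -- `h` depends only on the direction within the annulus; this extends it to all nonzero vectors as
  -- a function of degree zero.
  let g : Space 4 → ℝ := fun y => -(newtonMass * m)⁻¹ * h (dir y)
  have hg : ∀ y : Space 4, y ≠ 0 → ContDiffAt ℝ ∞ g y := fun y hy =>
    contDiffAt_const.mul ((hh.contDiffAt (isOpen_annulus.mem_nhds
      (mem_annulus_of_norm_eq_one (norm_dir hy)))).comp y (contDiffAt_dir hy))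
  have hlam : Hom 0 fun p : ℝ × Space 4 => g p.2 :=
    ⟨fun p hp => ((hg p.2 hp).comp p contDiffAt_snd).contDiffWithinAt, fun u y s hs _ => by
      simp [g, dir_smul hs]⟩
  have hr : Hom 2 fun p : ℝ × Space 4 => (Ψ 0 * (newtonMass * m)⁻¹) * (‖p.2‖ ^ 2)⁻¹ := by
    have h1 := ((Hom.norm_inv (d := 4)).mul Hom.norm_inv).const_smul (Ψ 0 * (newtonMass * m)⁻¹)
    rw [one_add_one_eq_two] at h1
    exact h1.congr fun p _ => by rw [smul_eq_mul, sq, mul_inv ‖p.2‖]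
  refine ⟨Ψ 0 * (newtonMass * m)⁻¹, _, hlam, fun p hp => ?_, fun p hp => ?_⟩
  · exact (hlam.hasDerivAt_u p.1 hp).unique (hasDerivAt_const p.1 (g p.2))
  · have hunit : ∀ x : Space 4, ‖x‖ = 1 → lapY (fun p : ℝ × Space 4 => g p.2) (p.1, x)
        = f (p.1, x) - (Ψ 0 * (newtonMass * m)⁻¹) * (‖x‖ ^ 2)⁻¹ := by
      intro x hx
      have hxa := mem_annulus_of_norm_eq_one hx
      have hx0 := ne_zero_of_mem_annulus hxa
      have e1 : g =ᶠ[𝓝 x] fun y => -(newtonMass * m)⁻¹ * h y := by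
        filter_upwards [isOpen_annulus.mem_nhds hxa] with y hy
        show -(newtonMass * m)⁻¹ * h (dir y) = _
        rw [eq_dir_of_fderiv_self_eq_zero hh hEuler hy]
      rw [lapY_comp_snd (p := (p.1, x)) (hg x hx0), lapS_congr e1,
        lapS_const_mul (hh.contDiffAt (isOpen_annulus.mem_nhds hxa)), hlap x hx, hx,
        hf.eq_of_uD_eq_zero hu p.1 0 hx0]
      have hκ := newtonMass_pos.ne'
      field_simp
      ring
    -- Both sides are homogeneous of degree `-2`, so the identity on the unit sphere is enough.
    have hD := norm_dir hp
    have hs := norm_pos_iff.2 hp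
    have h1 := hlam.lapY.hom p.1 (dir p.2) ‖p.2‖ hs (ne_zero_of_norm_eq_one hD)
    have h2 := (hf.sub hr).hom p.1 (dir p.2) ‖p.2‖ hs (ne_zero_of_norm_eq_one hD)
    rw [norm_smul_dir, hunit _ hD] at h1
    rw [norm_smul_dir] at h2
    rw [zero_add] at h1
    exact h1.trans h2.symm

end Poisson

end

section

/-! ### Gauge transformations and reduction to the scalar wave equation -/

section Gauge

variable {d : ℕ}

theorem fderiv_clm_comp {E G H : Type} [NormedAddCommGroup E] [NormedSpace ℝ E]
    [NormedAddCommGroup G] [NormedSpace ℝ G] [NormedAddCommGroup H] [NormedSpace ℝ H]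
    (L : G →L[ℝ] H) {f : E → G} {x : E} (hf : DifferentiableAt ℝ f x) :
    fderiv ℝ (fun y => L (f y)) x = L.comp (fderiv ℝ f x) :=
  (L.hasFDerivAt.comp x hf.hasFDerivAt).fderiv

theorem contDiffOn_clm_comp {E G H : Type} [NormedAddCommGroup E] [NormedSpace ℝ E]
    [NormedAddCommGroup G] [NormedSpace ℝ G] [NormedAddCommGroup H] [NormedSpace ℝ H]
    (L : G →L[ℝ] H) {f : E → G} {s : Set E} (hf : ContDiffOn ℝ ∞ f s) :
    ContDiffOn ℝ ∞ (fun y => L (f y)) s := L.contDiff.comp_contDiffOn hf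

/-- The wave operator commutes with the differential. -/
theorem box_fderiv {χ : Spacetime d → ℝ} {x : Spacetime d} (hχ : ContDiffAt ℝ ∞ χ x) :
    box (fderiv ℝ χ) x = fderiv ℝ (box χ) x := by
  have h1 : ContDiffAt ℝ ∞ (fderiv ℝ χ) x := contDiffAt_top_fderiv hχ
  have h2 : ContDiffAt ℝ ∞ (fderiv ℝ (fderiv ℝ χ)) x := contDiffAt_top_fderiv h1
  have hb : box χ =ᶠ[𝓝 x] fun y => etaTrace d ℝ (fderiv ℝ (fderiv ℝ χ) y) := by
    -- Smoothness at a point spreads to a neighbourhood only for each finite order; three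
    -- derivatives are sufficient here.
    obtain ⟨u, hu, hu'⟩ := (contDiffAt_infty.1 hχ 3).contDiffOn le_rfl (by simp)
    obtain ⟨w, hw, hwo, hxw⟩ := mem_nhds_iff.1 hu
    filter_upwards [hwo.mem_nhds hxw] with y hy
    have hy3 : ContDiffAt ℝ 3 χ y := (hu'.mono hw).contDiffAt (hwo.mem_nhds hy)
    have hd : DifferentiableAt ℝ (fderiv ℝ χ) y :=
      (hy3.fderiv_right (m := 2) (by norm_num)).differentiableAt (by simp)
    have h : ∀ v : Spacetime d, pderiv v (pderiv v χ) y = fderiv ℝ (fderiv ℝ χ) y v v := by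
      intro v
      show fderiv ℝ (fun x => fderiv ℝ χ x v) y v = _
      rw [fderiv_clm_apply hd (by fun_prop)]
      simp
    rw [etaTrace_apply, box]
    simp [h]
  have hd2 : DifferentiableAt ℝ (fderiv ℝ (fderiv ℝ χ)) x := h2.differentiableAt (by simp)
  have hsymm : ∀ a b c : Spacetime d, fderiv ℝ (fderiv ℝ (fderiv ℝ χ)) x a b c
      = fderiv ℝ (fderiv ℝ (fderiv ℝ χ)) x a c b := by
    intro a b c
    have e : ∀ b c : Spacetime d, fderiv ℝ (fun y => fderiv ℝ (fderiv ℝ χ) y b c) x a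
        = fderiv ℝ (fderiv ℝ (fderiv ℝ χ)) x a b c := fun b c => by
      rw [((hd2.hasFDerivAt.clm_apply (hasFDerivAt_const b x)).clm_apply
        (hasFDerivAt_const c x)).fderiv]
      simp
    rw [← e, ← e]
    have : (fun y => fderiv ℝ (fderiv ℝ χ) y b c) =ᶠ[𝓝 x] fun y => fderiv ℝ (fderiv ℝ χ) y c b := by
      filter_upwards [(hχ.top_to_nat 2).eventually (by simp)] with y hy
      exact hy.isSymmSndFDerivAt (by simp) b c
    rw [this.fderiv_eq]
  have hsymm' : ∀ a b c : Spacetime d, fderiv ℝ (fderiv ℝ (fderiv ℝ χ)) x a b c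
      = fderiv ℝ (fderiv ℝ (fderiv ℝ χ)) x b a c := fun a b c => by
    have := ((h1.top_to_nat 2).isSymmSndFDerivAt (by simp)) a b
    exact congrArg (fun A => A c) this
  rw [hb.fderiv_eq, box_eq h1]
  have e : fderiv ℝ (fun y => etaTrace d ℝ (fderiv ℝ (fderiv ℝ χ) y)) x
      = (etaTrace d ℝ).comp (fderiv ℝ (fderiv ℝ (fderiv ℝ χ)) x) :=
    fderiv_clm_comp (E := Spacetime d) (G := Spacetime d →L[ℝ] Spacetime d →L[ℝ] ℝ) (H := ℝ)
      (etaTrace d ℝ) (f := fderiv ℝ (fderiv ℝ χ)) hd2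
  refine Eq.trans ?_ e.symm
  refine ContinuousLinearMap.ext fun v => ?_
  rw [etaTrace_apply, ContinuousLinearMap.comp_apply, etaTrace_apply]
  have h3 : ∀ a : Spacetime d, fderiv ℝ (fderiv ℝ (fderiv ℝ χ)) x a a v
      = fderiv ℝ (fderiv ℝ (fderiv ℝ χ)) x v a a := fun a => by rw [hsymm, hsymm']
  simp [sum_apply, h3]

variable {U : Set (Spacetime d)} {A : Spacetime d → Covector d} {χ : Spacetime d → ℝ}

theorem contDiffOn_gaugeTransform (hU : IsOpen U) (hA : ContDiffOn ℝ ∞ A U)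
    (hχ : ContDiffOn ℝ ∞ χ U) : ContDiffOn ℝ ∞ (gaugeTransform A χ) U :=
  hA.sub (hχ.fderiv_of_isOpen hU (by simp))

theorem divergence_sub {A' : Spacetime d → Covector d} {x : Spacetime d}
    (hA : DifferentiableAt ℝ A x) (hA' : DifferentiableAt ℝ A' x) :
    divergence (fun x => A x - A' x) x = divergence A x - divergence A' x := by
  simp only [divergence_eq]
  rw [fderiv_fun_sub hA hA', eq_sub_iff_add_eq, ← map_add]
  exact congrArg _ (ContinuousLinearMap.ext fun v => ContinuousLinearMap.ext fun w =>
    sub_add_cancel (_ : ℝ) _)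

theorem divergence_fderiv {x : Spacetime d} (hχ : ContDiffAt ℝ ∞ χ x) :
    divergence (fderiv ℝ χ) x = box χ x := by
  rw [box_eq hχ, divergence_eq]

theorem divergence_gaugeTransform {x : Spacetime d} (hA : ContDiffAt ℝ ∞ A x)
    (hχ : ContDiffAt ℝ ∞ χ x) :
    divergence (gaugeTransform A χ) x = divergence A x - box χ x := by
  rw [← divergence_fderiv hχ]
  exact divergence_sub (hA.differentiableAt (by simp))
    ((contDiffAt_top_fderiv hχ).differentiableAt (by simp))

theorem box_sub {F : Type} [NormedAddCommGroup F] [NormedSpace ℝ F] {f g : Spacetime d → F}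
    {x : Spacetime d} (hf : ContDiffAt ℝ ∞ f x) (hg : ContDiffAt ℝ ∞ g x) :
    box (fun x => f x - g x) x = box f x - box g x := by
  rw [box_eq hf, box_eq hg, box_eq (hf.sub hg), eq_sub_iff_add_eq, ← map_add]
  have h1 : fderiv ℝ (fun x => f x - g x) =ᶠ[𝓝 x] fun x => fderiv ℝ f x - fderiv ℝ g x := by
    filter_upwards [(hf.top_to_nat 1).eventually (by simp), (hg.top_to_nat 1).eventually (by simp)]
      with y h1 h2
    exact fderiv_fun_sub (h1.differentiableAt (by simp)) (h2.differentiableAt (by simp))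
  rw [h1.fderiv_eq, fderiv_fun_sub ((contDiffAt_top_fderiv hf).differentiableAt (by simp))
    ((contDiffAt_top_fderiv hg).differentiableAt (by simp))]
  exact congrArg _ (ContinuousLinearMap.ext fun v => ContinuousLinearMap.ext fun w =>
    sub_add_cancel (_ : F) _)

theorem contDiffOn_divergence (hU : IsOpen U) (hA : ContDiffOn ℝ ∞ A U) :
    ContDiffOn ℝ ∞ (divergence A) U := by
  rw [divergence_eq]
  exact (etaTrace d ℝ).contDiff.comp_contDiffOn (hA.fderiv_of_isOpen (m := ∞) hU (by simp))

theorem contDiffOn_box {F : Type} [NormedAddCommGroup F] [NormedSpace ℝ F] {f : Spacetime d → F}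
    (hU : IsOpen U) (hf : ContDiffOn ℝ ∞ f U) : ContDiffOn ℝ ∞ (box f) U :=
  ContDiffOn.congr (f := fun x => etaTrace d F (fderiv ℝ (fderiv ℝ f) x))
    (contDiffOn_clm_comp (etaTrace d F) ((hf.fderiv_of_isOpen (m := ∞) hU
      (by simp)).fderiv_of_isOpen (m := ∞) hU (by simp))) fun x hx =>
        box_eq (hf.contDiffAt (hU.mem_nhds hx))

/-- Gauge invariance of Maxwell's equations. -/
theorem maxwell_gaugeTransform (hU : IsOpen U) (hA : ContDiffOn ℝ ∞ A U)
    (hχ : ContDiffOn ℝ ∞ χ U) {x : Spacetime d} (hx : x ∈ U) :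
    box (gaugeTransform A χ) x - fderiv ℝ (divergence (gaugeTransform A χ)) x
      = box A x - fderiv ℝ (divergence A) x := by
  have hAx := hA.contDiffAt (hU.mem_nhds hx)
  have hχx := hχ.contDiffAt (hU.mem_nhds hx)
  have h1 : divergence (gaugeTransform A χ) =ᶠ[𝓝 x] fun y => divergence A y - box χ y := by
    filter_upwards [hU.mem_nhds hx] with y hy
    exact divergence_gaugeTransform (hA.contDiffAt (hU.mem_nhds hy))
      (hχ.contDiffAt (hU.mem_nhds hy))
  rw [h1.fderiv_eq, fderiv_fun_sub
    (ContDiffOn.differentiableAt_top hU (contDiffOn_divergence hU hA) hx)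
    (ContDiffOn.differentiableAt_top hU (contDiffOn_box hU hχ) hx), ← box_fderiv hχx]
  rw [show gaugeTransform A χ = fun x => A x - fderiv ℝ χ x from rfl,
    box_sub hAx (contDiffAt_top_fderiv hχx)]
  abel

/-- Maxwell's equations express the current through derivatives of the smooth potential, so its
smoothness need not be assumed. -/
theorem contDiffOn_current {j : Spacetime d → Covector d} (hU : IsOpen U)
    (hA : ContDiffOn ℝ ∞ A U) (hM : IsMaxwellOn U A j) : ContDiffOn ℝ ∞ j U := by
  have h1 : ContDiffOn ℝ ∞ (fun x => box A x - fderiv ℝ (divergence A) x) U :=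
    (contDiffOn_box hU hA).sub ((contDiffOn_divergence hU hA).fderiv_of_isOpen hU (by simp))
  refine (h1.const_smul (-(4 * Real.pi))⁻¹).congr fun x hx => ?_
  have h2 : -(4 * Real.pi) ≠ 0 := neg_ne_zero.2 (by positivity)
  rw [hM.1 x hx, inv_smul_smul₀ h2]

/-- The coefficients of an expansion as homogeneous functions. -/
def homCoef (c : ℕ → ℝ → Space d → Covector d) (k : ℕ) (p : ℝ × Space d) : Covector d :=
  ‖p.2‖ ^ (-((k : ℝ) / 2)) • c k p.1 (dir p.2)

theorem homCoef_eq_zero {c : ℕ → ℝ → Space d → Covector d} {I : Set ℕ} (hc : SupportedOn c I)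
    {k : ℕ} (hk : k ∉ I) {p : ℝ × Space d} (hp : p.2 ≠ 0) : homCoef c k p = 0 := by
  rw [homCoef, hc k hk _ _ (norm_dir hp), smul_zero]

/-- The expansion coefficients of a potential in the ansatz satisfy Maxwell's equations. -/
theorem exists_maxwellCoef (hd : 4 ≤ d) {j : Spacetime d → Covector d} (hU : IsNhdScri U)
    (hA : ContDiffOn ℝ ∞ A U) (hM : IsMaxwellOn U A j) (hχ : ContDiffOn ℝ ∞ χ U)
    (hans : SatisfiesAnsatz (gaugeTransform A χ)) {jc : ℕ → ℝ → Space d → Covector d}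
    (hj : HasExpansion j jc) (hjO : SupportedOn jc (currentOrders d))
    (hjE : ∀ θ : Space d, ‖θ‖ = 1 → Tendsto (fun u : ℝ => jc (2 * (d - 2)) u θ) atBot (𝓝 0)) :
    ∃ b s, Exp (gaugeTransform A χ) b ∧ Exp (divergence (gaugeTransform A χ)) s ∧
      MaxwellCoef b (homCoef jc) s := by
  obtain ⟨bc, hbc, hbO⟩ := hans
  have hB : Exp (gaugeTransform A χ) (homCoef bc) :=
    hbc.exp ⟨U, hU, contDiffOn_gaugeTransform hU.1 hA hχ⟩
  have hJ : Exp j (homCoef jc) := hj.exp ⟨U, hU, contDiffOn_current hU.1 hA hM⟩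
  refine ⟨_, _, hB, hB.divergence', hB.hom, hB.divergence'.hom, fun k p _ => rfl, fun k p hp =>
    Exp.maxwell (by omega) hB hJ hB.divergence' hU (fun x hx => ?_) k hp,
    fun k hk p hp => homCoef_eq_zero hbO hk hp, fun k hk p hp => homCoef_eq_zero hjO hk hp,
    fun p hp => hJ.null_current_eq_zero hU hM.2 (fun k hk q hq => homCoef_eq_zero hjO ?_ hq)
      (fun y hy => ?_) hp⟩
  · rw [maxwell_gaugeTransform hU.1 hA hχ hx, hM.1 x hx]
  · rintro ⟨i, hi⟩
    omega
  · simpa [homCoef] using (hjE (dir y) (norm_dir hy)).const_smul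
      (‖y‖ ^ (-(((2 * (d - 2) : ℕ) : ℝ) / 2)))

/-- A solution of the wave equation for the gauge function gives the Lorenz gauge. -/
theorem lorenzWithinAnsatz_of_box_eq (hU : IsNhdScri U) (hA : ContDiffOn ℝ ∞ A U)
    (hχ : ContDiffOn ℝ ∞ χ U) {b c : ℕ → ℝ × Space d → Covector d}
    (hB : Exp (gaugeTransform A χ) b)
    (hb : ∀ k ∉ potentialOrders d, ∀ p : ℝ × Space d, p.2 ≠ 0 → b k p = 0)
    {ψ : Spacetime d → ℝ} (hψ : SmoothNear ψ) {V : Set (Spacetime d)} (hV : IsNhdScri V)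
    (hbox : ∀ x ∈ V, box ψ x = divergence (gaugeTransform A χ) x) (hdψ : Exp (fderiv ℝ ψ) c)
    (hc : ∀ k ∉ potentialOrders d, ∀ p : ℝ × Space d, p.2 ≠ 0 → c k p = 0) :
    LorenzWithinAnsatz U A := by
  obtain ⟨W, hW, hψW⟩ := hψ
  have hN : IsNhdScri (U ∩ (V ∩ W)) := hU.inter (hV.inter hW)
  have heq : EqOn (gaugeTransform (gaugeTransform A χ) ψ) (gaugeTransform A fun x => χ x + ψ x)
      (U ∩ (V ∩ W)) := fun x hx => by
    simp only [gaugeTransform]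
    rw [fderiv_fun_add (ContDiffOn.differentiableAt_top hU.1 hχ hx.1)
      (ContDiffOn.differentiableAt_top hW.1 hψW hx.2.2), sub_sub]
  -- The two gauge transformations compose additively, and the result is divergence free because
  -- `□ψ` cancels the divergence.
  refine ⟨_, hN, inter_subset_left, fun x => χ x + ψ x, (hχ.mono inter_subset_left).add
    (hψW.mono fun x hx => hx.2.2), fun x hx => ?_, ?_⟩
  · have h1 : gaugeTransform A (fun x => χ x + ψ x)
        =ᶠ[𝓝 x] gaugeTransform (gaugeTransform A χ) ψ := by
      filter_upwards [hN.1.mem_nhds hx] with y hy using (heq hy).symm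
    have h2 := divergence_gaugeTransform
      ((contDiffOn_gaugeTransform hU.1 hA hχ).contDiffAt (hU.1.mem_nhds hx.1))
      (hψW.contDiffAt (hW.1.mem_nhds hx.2.2))
    rw [hbox x hx.2.1, sub_self] at h2
    rw [divergence_eq] at h2 ⊢
    simp only [h1.fderiv_eq]
    exact h2
  · have h1 := ((hB.sub hdψ).congr hN heq).hasExpansion
    refine ⟨_, h1, fun k hk u θ hθ => ?_⟩
    have hθ0 := ne_zero_of_norm_eq_one hθ
    simp only [hb k hk (u, θ) hθ0, hc k hk (u, θ) hθ0, sub_zero]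

end Gauge

end

section

/-! ### The logarithmic gauge function in four dimensions -/

section Logarithm

/-- A homogeneous lift is its own expansion with one term; truncations either contain it or leave a
remainder of its own order. -/
theorem Hom.exp_lift {d : ℕ} {F : Type} [NormedAddCommGroup F] [NormedSpace ℝ F] {n : ℕ}
    {g : ℝ × Space d → F} (hg : Hom ((n : ℝ) / 2) g) :
    Exp (lift g) fun k => if k = n then g else fun _ => 0 := by
  refine ⟨hg.smoothNear_lift, fun k => ?_, fun K => ?_⟩
  · split_ifs with h
    · rw [h]; exact hg
    · exact Hom.zero _
  · have h1 : ∀ x : Spacetime d, ∑ k ∈ Finset.range K, lift (if k = n then g else fun _ => 0) x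
        = if n < K then lift g x else 0 := fun x => by
      have h2 : ∀ k, lift (if k = n then g else fun _ => (0 : F)) x = if k = n then lift g x else 0 :=
        fun k => by split_ifs <;> rfl
      simp only [h2, Finset.sum_ite_eq', Finset.mem_range]
    simp only [h1]
    split_ifs with h
    · simpa using Sym.zero (d := d) (F := F) _
    · simp only [sub_zero]
      exact hg.sym.mono (by
        have : (K : ℝ) ≤ n := by exact_mod_cast not_lt.1 h
        linarith)

theorem hasFDerivAt_log_norm {d : ℕ} {y : Space d} (hy : y ≠ 0) :
    HasFDerivAt (fun y : Space d => Real.log ‖y‖) (‖y‖⁻¹ • innerSL ℝ (dir y)) y := by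
  have h0 := norm_ne_zero_iff.2 hy
  have h1 : (fun z : Space d => Real.log ‖z‖) = fun z => (2 : ℝ)⁻¹ * Real.log (‖z‖ ^ 2) := by
    funext z; rw [Real.log_pow]; push_cast; ring
  rw [h1]
  refine ((((hasStrictFDerivAt_norm_sq y).hasFDerivAt).log (pow_ne_zero 2 h0)).const_mul
    (2 : ℝ)⁻¹).congr_fderiv ?_
  ext v
  simp only [smul_apply, innerSL_apply_apply, dir, inner_smul_left, smul_eq_mul, nsmul_eq_mul,
    RCLike.conj_to_real]
  push_cast
  field_simp

/-- The differential of `log |x|`. -/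
def dlog {d : ℕ} (p : ℝ × Space d) : Covector d :=
  ‖p.2‖⁻¹ • (innerSL ℝ (dir p.2)).comp (ContinuousLinearMap.snd ℝ ℝ (Space d))

theorem hom_dlog {d : ℕ} : Hom (((2 : ℕ) : ℝ) / 2) (dlog : ℝ × Space d → Covector d) := by
  have h1 := Hom.norm_inv.smul (Hom.dir.clm (((ContinuousLinearMap.compL ℝ (Spacetime d)
    (Space d) ℝ).flip (ContinuousLinearMap.snd ℝ ℝ (Space d))).comp
      (innerSL ℝ : Space d →L[ℝ] Space d →L[ℝ] ℝ)))
  convert h1 using 1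
  · norm_num
  · rfl

theorem fderiv_log_norm_snd {d : ℕ} (c : ℝ) {x : Spacetime d} (hx : x.2 ≠ 0) :
    fderiv ℝ (fun x : Spacetime d => c * Real.log ‖x.2‖) x = c • lift dlog x := by
  have h1 := ((hasFDerivAt_log_norm hx).comp x hasFDerivAt_snd).const_mul c
  refine (HasFDerivAt.fderiv (f := fun x : Spacetime d => c * Real.log ‖x.2‖) h1).trans ?_
  ext v <;> simp [lift, dlog]

theorem exp_fderiv_log {d : ℕ} (c : ℝ) :
    Exp (fderiv ℝ fun x : Spacetime d => c * Real.log ‖x.2‖)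
      fun k p => c • (if k = 2 then dlog else fun _ => 0) p :=
  (hom_dlog.exp_lift.const_smul c).congr (isNhdScri_lt_norm 0) fun _ hx =>
    (fderiv_log_norm_snd c (norm_pos_iff.1 hx)).symm

theorem contDiffOn_log_snd {d : ℕ} (c : ℝ) :
    ContDiffOn ℝ ∞ (fun x : Spacetime d => c * Real.log ‖x.2‖) {x | 0 < ‖x.2‖} := fun x hx => by
  have hx0 : x.2 ≠ 0 := norm_pos_iff.1 hx
  exact (contDiffAt_const.mul (((contDiffAt_norm ℝ hx0).comp x contDiffAt_snd).log
    (norm_ne_zero_iff.2 hx0))).contDiffWithinAt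

/-- A static function, so the wave operator reduces to the spatial Laplacian. -/
theorem box_log_norm_snd (c : ℝ) {x : Spacetime 4} (hx : x.2 ≠ 0) :
    box (fun x : Spacetime 4 => c * Real.log ‖x.2‖) x = c * (‖x.2‖ ^ 2)⁻¹ := by
  have h1 : pderiv (timeVec 4) (fun x : Spacetime 4 => c * Real.log ‖x.2‖) =ᶠ[𝓝 x] fun _ => 0 := by
    have ho : IsOpen {x : Spacetime 4 | x.2 ≠ 0} := isOpen_snd_ne_zero
    filter_upwards [ho.mem_nhds hx] with z hz
    rw [pderiv, fderiv_log_norm_snd c hz]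
    simp [lift, dlog, timeVec]
  have h2 : pderiv (timeVec 4) (pderiv (timeVec 4) fun x : Spacetime 4 => c * Real.log ‖x.2‖) x
      = 0 := by
    rw [pderiv, h1.fderiv_eq]
    simp
  have hs : ContDiffAt ℝ ∞ (fun y : Space 4 => Real.log ‖y‖) x.2 :=
    (contDiffAt_norm ℝ hx).log (norm_ne_zero_iff.2 hx)
  have h3 := lapY_comp_snd (p := x) (contDiffAt_const (c := c) |>.mul hs)
  rw [box, h2, neg_zero, zero_add]
  refine Eq.trans h3 ?_
  rw [lapS_const_mul hs, lapS_log_norm hx]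

end Logarithm

/-! ### The two cases of the theorem -/

section Main

theorem four_mem_potentialOrders : 4 ∈ potentialOrders 4 := Or.inl ⟨1, rfl⟩

theorem two_mem_potentialOrders : 2 ∈ potentialOrders 4 := Or.inl ⟨0, rfl⟩

variable {d : ℕ} {U : Set (Spacetime d)} {A j : Spacetime d → Covector d}
  {jc : ℕ → ℝ → Space d → Covector d}

theorem lorenzWithinAnsatz_of_four_lt (hd : 4 < d) (hU : IsNhdScri U)
    (hA : ContDiffOn ℝ ∞ A U) (hM : IsMaxwellOn U A j)
    (hans : ∃ χ : Spacetime d → ℝ, ContDiffOn ℝ ∞ χ U ∧ SatisfiesAnsatz (gaugeTransform A χ))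
    (hj : HasExpansion j jc) (hjO : SupportedOn jc (currentOrders d))
    (hjE : ∀ θ : Space d, ‖θ‖ = 1 → Tendsto (fun u : ℝ => jc (2 * (d - 2)) u θ) atBot (𝓝 0)) :
    LorenzWithinAnsatz U A := by
  obtain ⟨χ, hχ, hans⟩ := hans
  obtain ⟨b, s, hB, hS, hc⟩ := exists_maxwellCoef hd.le hU hA hM hχ hans hj hjO hjE
  have hr := hc.hom_radial hd.le
  -- The place where `d > 4` makes the constraint solvable explicitly: the Laplacian of the radial
  -- function is a nonzero multiple of the source.
  have h0 : (2 - (d : ℝ) / 2) ≠ 0 := by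
    have : (4 : ℝ) < d := by exact_mod_cast hd
    linarith
  have hu : ∀ p : ℝ × Space d, p.2 ≠ 0 →
      uD (fun p => (2 - (d : ℝ) / 2)⁻¹ • MaxwellCoef.radial b p) p = 0 := fun p hp => by
    have := uD_clm (hr.differentiableAt hp) ((2 - (d : ℝ) / 2)⁻¹ • ContinuousLinearMap.id ℝ ℝ)
    refine this.trans ?_
    rw [hc.uD_radial hd.le hp, map_zero]
  have hlap : ∀ p : ℝ × Space d, p.2 ≠ 0 →
      lapY (fun p => (2 - (d : ℝ) / 2)⁻¹ • MaxwellCoef.radial b p) p = s d p := fun p hp => by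
    refine (hr.lapY_clm ((2 - (d : ℝ) / 2)⁻¹ • ContinuousLinearMap.id ℝ ℝ) hp).trans ?_
    rw [hc.lapY_radial hd hp]
    simp [h0]
  obtain ⟨ψ, hψ, ⟨V, hV, hbox⟩, c, hdψ, hc0⟩ := exists_box_eq hd.le hS (hr.const_smul _) hu hlap
    (fun k hk p hp => hc.s_eq_zero hk hp) (fun p hp => hc.s_first hd.le hp)
    (fun ho p hp => hc.s_second hd.le ho hp)
  exact lorenzWithinAnsatz_of_box_eq hU hA hχ hB hc.supp hψ hV hbox hdψ hc0

variable {U : Set (Spacetime 4)} {A j : Spacetime 4 → Covector 4}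
  {jc : ℕ → ℝ → Space 4 → Covector 4}

/-- Without flux `s 4` is independent of `u`. The sphere equation is solved up to a multiple of
`‖y‖⁻²`, and that multiple is the source produced by a logarithm. -/
theorem lorenzWithinAnsatz_of_no_flux (hU : IsNhdScri U)
    (hA : ContDiffOn ℝ ∞ A U) (hM : IsMaxwellOn U A j)
    (hans : ∃ χ : Spacetime 4 → ℝ, ContDiffOn ℝ ∞ χ U ∧ SatisfiesAnsatz (gaugeTransform A χ))
    (hj : HasExpansion j jc) (hjO : SupportedOn jc (currentOrders 4))
    (hjE : ∀ θ : Space 4, ‖θ‖ = 1 → Tendsto (fun u : ℝ => jc (2 * (4 - 2)) u θ) atBot (𝓝 0))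
    (hflux : ∀ (u : ℝ) (θ : Space 4), ‖θ‖ = 1 → jc 4 u θ (timeVec 4) = 0) :
    LorenzWithinAnsatz U A := by
  obtain ⟨χ, hχ, hans⟩ := hans
  obtain ⟨b, s, hB, hS, hc⟩ := exists_maxwellCoef le_rfl hU hA hM hχ hans hj hjO hjE
  have hs4 : Hom 2 (s 4) := by
    have := hc.homS 4
    norm_num at this
    exact this
  have hu : ∀ p : ℝ × Space 4, p.2 ≠ 0 → uD (s 4) p = 0 := fun p hp =>
    hc.uD_s le_rfl hp (by
      rw [homCoef, smul_apply, hflux _ _ (norm_dir hp), smul_zero])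
  obtain ⟨a, lam, hlam, hlamu, hlap⟩ := exists_poisson hs4 hu
  have hr : Hom (((4 : ℕ) : ℝ) / 2) fun p : ℝ × Space 4 => a * (‖p.2‖ ^ 2)⁻¹ := by
    have h1 := ((Hom.norm_inv (d := 4)).mul Hom.norm_inv).const_smul a
    convert h1 using 1
    · norm_num
    · funext p
      rw [smul_eq_mul, sq, mul_inv ‖p.2‖]
  -- The source without the part that the logarithm will account for; only the index `4` changes.
  have hS' := hS.sub hr.exp_lift
  have hlam' : Hom (((4 - 4 : ℕ) : ℝ) / 2) lam := by simpa using hlam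
  obtain ⟨ψ, hψ, ⟨V, hV, hbox⟩, c, hdψ, hc0⟩ := exists_box_eq le_rfl hS' hlam' hlamu
    (fun p hp => by simpa using hlap p hp)
    (fun k hk p hp => by
      have : k ≠ 4 := fun h => hk (h ▸ four_mem_potentialOrders)
      simp [this, hc.s_eq_zero hk hp])
    (fun p hp => by simpa using hc.s_first le_rfl hp)
    (fun ho => absurd ho (by decide))
  have hlog : SmoothNear fun x : Spacetime 4 => a * Real.log ‖x.2‖ :=
    ⟨_, isNhdScri_lt_norm 0, contDiffOn_log_snd a⟩
  obtain ⟨V', hV', hadd⟩ := box_add_near hψ hlog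
  obtain ⟨W, hW, hψW⟩ := hψ
  refine lorenzWithinAnsatz_of_box_eq hU hA hχ hB hc.supp
    (SmoothNear.add ⟨W, hW, hψW⟩ hlog)
    (hV.inter (hV'.inter (isNhdScri_lt_norm 0))) (fun x hx => ?_)
    ((hdψ.add (exp_fderiv_log a)).congr (hW.inter (isNhdScri_lt_norm 0)) fun x hx => ?_)
    fun k hk p hp => ?_
  · have hx0 : x.2 ≠ 0 := norm_pos_iff.1 hx.2.2
    rw [hadd x hx.2.1, hbox x hx.1, box_log_norm_snd a hx0]
    simp [lift]
  · exact (fderiv_fun_add (ContDiffOn.differentiableAt_top hW.1 hψW hx.1)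
      (ContDiffOn.differentiableAt_top (isNhdScri_lt_norm 0).1 (contDiffOn_log_snd a) hx.2)).symm
  · have : k ≠ 2 := fun h => hk (h ▸ two_mem_potentialOrders)
    simp [this, hc0 k hk p hp]

/-- In the Lorenz gauge every divergence coefficient vanishes, and at index `4` the time component
of Maxwell's equations equates the current with `∂_u s 4`, up to the factor `4π`. -/
theorem no_flux_of_lorenzWithinAnsatz
    (hA : ContDiffOn ℝ ∞ A U) (hM : IsMaxwellOn U A j)
    (hj : HasExpansion j jc) (hjO : SupportedOn jc (currentOrders 4))
    (hjE : ∀ θ : Space 4, ‖θ‖ = 1 → Tendsto (fun u : ℝ => jc (2 * (4 - 2)) u θ) atBot (𝓝 0))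
    (hL : LorenzWithinAnsatz U A) (u : ℝ) {θ : Space 4} (hθ : ‖θ‖ = 1) :
    jc 4 u θ (timeVec 4) = 0 := by
  obtain ⟨V, hV, hVU, φ, hφ, hdiv, hans⟩ := hL
  obtain ⟨b, s, -, hS, hc⟩ := exists_maxwellCoef le_rfl hV (hA.mono hVU)
    ⟨fun x hx => hM.1 x (hVU hx), fun x hx => hM.2 x (hVU hx)⟩ hφ hans hj hjO hjE
  have hz : Exp (divergence (gaugeTransform A φ)) fun _ _ => 0 :=
    (Exp.of_sym fun κ => Sym.zero κ).congr hV fun x hx => (hdiv x hx).symm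
  have hθ0 := ne_zero_of_norm_eq_one hθ
  have hs : uD (s 4) (u, θ) = 0 := by
    rw [uD_congr (g := fun _ => 0) (fun p hp => hS.unique hz 4 hp) hθ0, uD_zero]
  -- For `d = 4` the factor `(0 + 2) - (d - 2)` of `∂_u b 2` is zero, and `b 0` lies below the
  -- ansatz.
  have h1 := hc.maxwell_time 0 (p := (u, θ)) hθ0
  rw [zero_add, hs, hc.lapY_eq_zero (not_mem_potentialOrders_of_lt le_rfl (by norm_num)) hθ0] at h1
  have h2 : homCoef jc 4 (u, θ) (timeVec 4) = 0 := by
    have hπ : -(4 * Real.pi) ≠ 0 := neg_ne_zero.2 (by positivity)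
    refine (mul_eq_zero.1 (Eq.trans h1.symm ?_)).resolve_left hπ
    push_cast
    ring
  simpa [homCoef, hθ, dir_eq_self hθ] using h2

end Main

end

end Lorenz

end

theorem mainTheorem4 (d : ℕ) (hd : 4 ≤ d)
    (U : Set (Lorenz.Spacetime d)) (hU : Lorenz.IsNhdScri U)
    (A j : Lorenz.Spacetime d → Lorenz.Covector d)
    (hA : ContDiffOn ℝ ∞ A U)
    (hMaxwell : Lorenz.IsMaxwellOn U A j)
    (hAnsatz : ∃ χ : Lorenz.Spacetime d → ℝ, ContDiffOn ℝ ∞ χ U ∧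
      Lorenz.SatisfiesAnsatz (Lorenz.gaugeTransform A χ))
    (jc : ℕ → ℝ → Lorenz.Space d → Lorenz.Covector d)
    (hj : Lorenz.HasExpansion j jc)
    (hjOrders : Lorenz.SupportedOn jc (Lorenz.currentOrders d))
    (hjEarly : ∀ θ : Lorenz.Space d, ‖θ‖ = 1 →
      Filter.Tendsto (fun u : ℝ => jc (2 * (d - 2)) u θ) Filter.atBot (nhds 0)) :
    (4 < d → Lorenz.LorenzWithinAnsatz U A) ∧
    (d = 4 → (Lorenz.LorenzWithinAnsatz U A ↔
      ∀ (u : ℝ) (θ : Lorenz.Space d), ‖θ‖ = 1 →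
        jc (2 * 2) u θ (Lorenz.timeVec d) = 0)) := by
  refine ⟨fun h => Lorenz.lorenzWithinAnsatz_of_four_lt h hU hA hMaxwell hAnsatz hj hjOrders
    hjEarly, ?_⟩
  rintro rfl
  exact ⟨fun hL u θ hθ => Lorenz.no_flux_of_lorenzWithinAnsatz hA hMaxwell hj hjOrders hjEarly hL u
    hθ, fun h => Lorenz.lorenzWithinAnsatz_of_no_flux hU hA hMaxwell hAnsatz hj hjOrders hjEarly h⟩
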